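/- Notation. For complex $e_0,e_1,e_\infty$ let $H(e_0,e_1,e_\infty)$ be the hypergeometric differential equation with local exponent differences $e_0,e_1,e_\infty$ at $X=0,1,\infty$: $$Y''+\Big(\frac{1-e_0}{X}+\frac{1-e_1}{X-1}\Big)Y'+\frac{(1-e_0-e_1)^2-e_\infty^2}{4X(X-1)}\,Y=0 .$$ Let $D$ be an algebraic curve over $\mathbf C$ with function field $\mathbf C(D)$, and let $\varphi\in\mathbf C(D)$ be non-constant, viewed as a finite covering $D\to\mathbf P^1_X$ of degree $[\mathbf C(D):\mathbf C(\varphi)]$. It is a *Darboux covering* for a linear differential equation $E$ over $\mathbf C(X)$ (and $D$ is a *Darboux curve*) if the pull-back of $E$ along $X=\varphi$ has a non-zero solution $Y$ (in a differential field extending $\mathbf C(D)$ with derivation $d/dX$) such that $Y'=uY$ with $u\in\mathbf C(D)$, and the algebraic degree of $u$ over $\mathbf C(X)=\mathbf C(\varphi)$ equals the degree of $\varphi$. Consider the curves $$E_3:\ \xi^2=x(1+33x-9x^2),\quad E_4:\ \xi^2=x(1+5x-5x^2),\quad E_5:\ \xi^2=x(1+x)(1+16x),\quad E_6:\ \xi^2=x(1+x-x^2)$$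 and on them the rational functions $$\varphi_3=\frac{144\,\xi\,(1+33x-9x^2)^2(1-9\xi+54x)}{(1+21\xi-117x+9x\xi-234x^2)^3},$$ $$\varphi_4=\frac{432\,x\,(1-\frac75\xi-9x-x^2)^5(1+50x-125\xi^2+450x\xi-500x^2)}{(5\xi+57x)(1+\frac{18}5\xi-16x+x^2)^5(1+50x-125\xi^2-450x\xi-500x^2)},$$ $$\varphi_5=-\frac{54\,(\xi+5x)^3(1-2\xi+6x)^5}{(1-16x^2)(\xi-5x)^2(1-2\xi-14x)^5},\qquad \varphi_6=\frac{16\,\xi\,(1+x-x^2)^2(1-\xi)^2}{(1+\xi+2x)(1+\xi-2x)^5}.$$ **Claim 1.** $E_3,E_4,E_5,E_6$ are elliptic curves. $\varphi_3$ is a Darboux covering for $H(\frac25,\frac13,\frac13)$ and for $H(\frac15,\frac13,\frac23)$; $\varphi_4$ for $H(\frac15,\frac23,\frac15)$ and for $H(\frac25,\frac13,\frac35)$; $\varphi_5$ for $H(\frac15,\frac13,\frac35)$; $\varphi_6$ for $H(\frac15,\frac15,\frac45)$ and for $H(\frac25,\frac25,\frac25)$. (These are the icosahedral Schwarz types $(1/3,1/3,2/5)$,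 $(1/3,2/3,1/5)$, $(2/3,1/5,1/5)$, $(1/3,2/5,3/5)$, $(1/3,1/5,3/5)$, $(1/5,1/5,4/5)$, $(2/5,2/5,2/5)$.) **Claim 2.** The following identities hold at all complex points $(x,\xi)\neq(0,0)$ of the respective curve in some neighbourhood of $(0,0)$, where ${}_2F_1$ is the sum of the hypergeometric series and the fractional powers of factors with value $1$ at $(0,0)$ are principal. On $E_5$, where some factors vanish at $(0,0)$, all powers are principal at the points with $\operatorname{Re}\xi>0$; moreover on the whole punctured neighbourhood the identities hold, with principal powers, after $\xi\pm5x$, $\xi-3x$, $x$ are replaced by $(\xi\pm5x)/\xi$, $(\xi-3x)/\xi$, $x/\xi^2$ respectively (the total exponent of $\xi$ divided out is zero). On $E_3$ put $A=1-9\xi+54x$, $B=1+21\xi-117x+9x\xi-234x^2$, $\bar B=1-21\xi-117x-9x\xi-234x^2$. Type $(1/3,1/3,2/5)$: $${}_2F_1(\tfrac3{10},-\tfrac1{30};\tfrac35;\varphi_3)=\frac{A^{1/30}}{B^{1/10}},\qquad {}_2F_1(\tfrac3{10},\tfrac{29}{30};\tfrac35;\varphi_3)=\frac{B^{9/10}(1+9x)^2(1+198x-99x^2)}{A^{29/30}\,\bar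 B^{2}},$$ $${}_2F_1(\tfrac7{10},\tfrac{11}{30};\tfrac75;\varphi_3)=\frac{B^{11/10}}{A^{11/30}(1+33x-9x^2)},\qquad {}_2F_1(-\tfrac3{10},\tfrac{11}{30};\tfrac25;\varphi_3)=\frac{A^{19/30}(1-15\xi-72x-54x^2)}{B^{9/10}(1+9x)}.$$ Type $(1/3,2/3,1/5)$: $${}_2F_1(-\tfrac1{10},\tfrac{17}{30};\tfrac45;\varphi_3)=\frac{A^{13/30}}{B^{3/10}},\qquad {}_2F_1(\tfrac9{10},\tfrac{17}{30};\tfrac95;\varphi_3)=\frac{B^{17/10}(1+\frac37x)}{A^{17/30}(1+33x-9x^2)^2},$$ $${}_2F_1(\tfrac1{10},\tfrac{23}{30};\tfrac65;\varphi_3)=\frac{B^{3/10}A^{7/30}(\xi+5x)}{\xi(1+9x)},\qquad {}_2F_1(\tfrac1{10},-\tfrac7{30};\tfrac15;\varphi_3)=\frac{A^{7/30}(1-21x)}{B^{7/10}}.$$ On $E_4$ put $S=1+50x-125\xi^2-450x\xi-500x^2$, $T=1+3\xi-20x$, $G=1-\frac35\xi-\frac{34}5x$, $K=1-\frac{95}4\xi+\frac{83}4x+\frac{21}4\xi^2+\frac{475}4x\xi+10x^2$,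 $U=1-\frac75\xi-9x-x^2$, $V=1+\frac{18}5\xi-16x+x^2$. Type $(2/3,1/5,1/5)$: $${}_2F_1(\tfrac16,-\tfrac1{30};\tfrac45;\varphi_4)=\frac{G^{1/6}}{T^{1/6}S^{1/30}},\qquad {}_2F_1(\tfrac16,\tfrac{29}{30};\tfrac45;\varphi_4)=\frac{T^{5/6}G^{1/6}(1-\frac{35}4\xi-\frac{101}4x)}{S^{1/30}K},$$ $${}_2F_1(\tfrac16,\tfrac{11}{30};\tfrac65;\varphi_4)=\frac{S^{11/30}\,T^{5/6}G^{1/6}(1+\frac{21}4\xi+\frac{41}4x)}{(1-9x)(1-\frac74\xi-\frac{15}2x)(1+5\xi+10x)},$$ $${}_2F_1(\tfrac16,\tfrac{11}{30};\tfrac15;\varphi_4)=\frac{S^{11/30}\,T^{5/6}G^{1/6}(1+\frac{21}4\xi+\frac{41}4x)}{K\,(1+5\xi+10x)}.$$ Type $(1/3,2/5,3/5)$: $${}_2F_1(-\tfrac16,\tfrac{13}{30};\tfrac35;\varphi_4)=\frac{S^{13/30}(1-3\xi+2x)}{T^{5/6}G^{1/6}(1+5\xi+10x)},$$ $${}_2F_1(\tfrac56,\tfrac{13}{30};\tfrac35;\varphi_4)=\frac{S^{13/30}\,T^{13/6}(1-\frac74\xi+\frac{25}2x-\frac{245}4x^2)(1-\frac7{20}\xi-\frac{79}{20}x)}{G^{1/6}K^2(1-5x)^2},$$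 $${}_2F_1(\tfrac56,\tfrac7{30};\tfrac75;\varphi_4)=\frac{S^{7/30}\,V^{7/6}(1+\frac1{25}x)^{5/6}(1+5\xi+10x)}{U^2(1-5x)^{7/6}},$$ $${}_2F_1(-\tfrac16,\tfrac7{30};\tfrac25;\varphi_4)=\frac{S^{7/30}(1-\frac{27}5\xi+\frac{58}5x-2x^2)}{V^{5/6}(1+\frac1{25}x)^{1/6}(1-5x)^{7/6}}.$$ On $E_5$, type $(1/3,1/5,3/5)$: $${}_2F_1(-\tfrac1{15},\tfrac8{15};\tfrac45;\varphi_5)=\frac{(1+4x)^{8/15}(\xi+5x)^{1/6}x^{1/15}}{(1-2\xi-14x)^{1/3}(\xi-3x)^{3/10}},$$ $${}_2F_1(\tfrac{14}{15},\tfrac8{15};\tfrac95;\varphi_5)=\frac{(1-2\xi-14x)^{8/3}(1+\frac23\xi+\frac23x-\frac{16}3x^2)(1+4x)^{8/15}(\xi-5x)^2x^{1/15}}{(1-2\xi+6x)^4(\xi+5x)^{11/6}(\xi-3x)^{3/10}},$$ $${}_2F_1(\tfrac2{15},\tfrac{11}{15};\tfrac65;\varphi_5)=\frac{(1-\xi+x)(1-2\xi-14x)^{2/3}(\xi+5x)^{1/6}(\xi-3x)^{13/10}}{(1+\xi+x)(1-2\xi+6x)(1+4x)^{13/15}x^{11/15}},$$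 $${}_2F_1(\tfrac2{15},-\tfrac4{15};\tfrac15;\varphi_5)=\frac{(1+3\xi+x)(1+4x)^{2/15}(\xi+5x)^{7/6}(\xi-3x)^{3/10}}{(1+\xi+x)(1-2\xi-14x)^{4/3}x^{11/15}}.$$ On $E_6$, type $(1/5,1/5,4/5)$: $${}_2F_1(\tfrac7{10},-\tfrac1{10};\tfrac45;\varphi_6)=\frac{(1-\xi+2x)^{1/15}(1-\xi)^{3/5}}{(1+\xi+2x)^{7/30}(1+\xi-2x)^{1/2}},$$ $${}_2F_1(\tfrac7{10},\tfrac9{10};\tfrac95;\varphi_6)=\frac{(1-\xi+2x)^{1/15}(1+\xi+2x)^{23/30}(1+\xi-2x)^{7/2}}{(1-\xi)^{7/5}(1+x-x^2)^2},$$ $${}_2F_1(\tfrac1{10},\tfrac9{10};\tfrac65;\varphi_6)=\frac{(\xi+2x+x^2)(1+\xi)^{1/10}(1-\xi)^{3/10}}{\xi(1-\xi+2x)^{1/30}(1+\xi+2x)^{2/15}(1+\xi-2x)^{1/2}},$$ $${}_2F_1(\tfrac1{10},-\tfrac1{10};\tfrac15;\varphi_6)=\frac{(1+\xi)^{1/10}(1-\xi)^{3/10}}{(1-\xi+2x)^{1/30}(1+\xi+2x)^{2/15}(1+\xi-2x)^{1/2}}.$$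 Type $(2/5,2/5,2/5)$: $${}_2F_1(\tfrac3{10},-\tfrac1{10};\tfrac35;\varphi_6)=\frac{(1-\xi+2x)^{2/15}(1+\xi+2x)^{1/30}(1-\xi)^{1/5}}{(1+\xi-2x)^{1/2}},$$ $${}_2F_1(\tfrac3{10},\tfrac9{10};\tfrac85;\varphi_6)=\frac{(1-\xi+2x)^{2/15}(1+\xi+2x)^{1/30}(1-\xi)^{1/5}(1+\xi-2x)^{3/2}(1+\frac12\xi+\frac12x)}{(1+x-x^2)(1-\xi+x-x^2)},$$ $${}_2F_1(\tfrac3{10},\tfrac7{10};\tfrac75;\varphi_6)=\frac{(1+\xi+2x)^{7/30}(1+\xi)^{1/5}(1+\xi-2x)^{3/2}}{(1-\xi+2x)^{1/15}(1-\xi)^{2/5}(1+x-x^2)},$$ $${}_2F_1(\tfrac3{10},-\tfrac3{10};\tfrac25;\varphi_6)=\frac{(1+\xi+2x)^{7/30}(1+\xi)^{1/5}(1-3\xi+4x-2x^2)}{(1-\xi+2x)^{1/15}(1-\xi)^{2/5}(1+\xi-2x)^{3/2}}.$$ -/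

import Mathlib

open Filter Topology Polynomial
open scoped IntermediateField

noncomputable section

/-! ### The curves `ξ² = x (1 + b x + a x²)` and their function fields -/

/-- For `a ≠ 0`, the projective curve `ξ² = x (1 + b x + a x²)` in Weierstrass form: with
`X = a x`, `Y = a ξ` its equation is `Y² = X³ + b X² + a X`. -/
def darbouxCurve (a b : ℂ) : WeierstrassCurve ℂ := ⟨0, b, 0, a, 0⟩

/-- The field of rational functions on the curve `ξ² = x (1 + b x + a x²)`. -/
abbrev DarbouxField (a b : ℂ) : Type := (darbouxCurve a b).toAffine.FunctionField

/-- The coordinate function `x = X / a`. -/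
def coordX (a b : ℂ) : DarbouxField a b :=
  algebraMap _ (DarbouxField a b)
      (WeierstrassCurve.Affine.CoordinateRing.mk (darbouxCurve a b).toAffine (C X))
    / algebraMap ℂ (DarbouxField a b) a

/-- The coordinate function `ξ = Y / a`. -/
def coordXi (a b : ℂ) : DarbouxField a b :=
  algebraMap _ (DarbouxField a b)
      (WeierstrassCurve.Affine.CoordinateRing.mk (darbouxCurve a b).toAffine X)
    / algebraMap ℂ (DarbouxField a b) a

/-- The coordinate functions satisfy the equation of the curve. -/
theorem coordXi_sq (a b : ℂ) (ha : a ≠ 0) :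
    coordXi a b ^ 2 = coordX a b * (1 + algebraMap ℂ (DarbouxField a b) b * coordX a b
      + algebraMap ℂ (DarbouxField a b) a * coordX a b ^ 2) := by
  have h0 : WeierstrassCurve.Affine.CoordinateRing.mk (darbouxCurve a b).toAffine
      (X ^ 2 - C (X ^ 3 + C b * X ^ 2 + C a * X)) = 0 := by
    have : (X ^ 2 - C (X ^ 3 + C b * X ^ 2 + C a * X) : ℂ[X][X])
        = (darbouxCurve a b).toAffine.polynomial := by
      simp [WeierstrassCurve.Affine.polynomial, darbouxCurve]
    rw [this]
    exact AdjoinRoot.mk_self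
  have hC (r : ℂ) : algebraMap _ (DarbouxField a b)
      (WeierstrassCurve.Affine.CoordinateRing.mk (darbouxCurve a b).toAffine (C (C r)))
        = algebraMap ℂ (DarbouxField a b) r := rfl
  have h1 := congrArg (algebraMap _ (DarbouxField a b)) h0
  simp only [map_sub, map_pow, map_add, map_mul, map_zero, hC] at h1
  have ha' : algebraMap ℂ (DarbouxField a b) a ≠ 0 := by simpa using ha
  unfold coordXi coordX
  field_simp
  linear_combination h1

/-! ### Darboux coverings -/

/-- The second order linear homogeneous differential equation `Y'' + p Y' + q Y = 0` with
coefficients `p, q ∈ ℂ(X)`. -/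
structure LinearODE where
  /-- the coefficient of `Y'` -/
  p : RatFunc ℂ
  /-- the coefficient of `Y` -/
  q : RatFunc ℂ

/-- The hypergeometric differential equation `H(e₀, e₁, e_∞)` with local exponent differences
`e₀, e₁, e_∞` at `X = 0, 1, ∞`:
`Y'' + ((1 - e₀) / X + (1 - e₁) / (X - 1)) Y'
  + ((1 - e₀ - e₁)² - e_∞²) / (4 X (X - 1)) Y = 0`. -/
def hypergeometricODE (e₀ e₁ e : ℂ) : LinearODE where
  p := RatFunc.C (1 - e₀) / RatFunc.X + RatFunc.C (1 - e₁) / (RatFunc.X - 1)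
  q := RatFunc.C ((1 - e₀ - e₁) ^ 2 - e ^ 2) / (4 * RatFunc.X * (RatFunc.X - 1))

/-- Let `K` be the function field of an algebraic curve over `ℂ`, and let `φ ∈ K`, considered as
a map from the curve to the projective line with coordinate `X = φ`. `IsDarbouxCovering E K φ`
says that `φ` is a finite covering, of degree `[K : ℂ(φ)]`, and that the pull-back of the equation
`E` along `φ` has a nonzero solution `Y`, in some differential field `L` extending `K`, with
`Y' = u Y` for some `u ∈ K` whose algebraic degree over `ℂ(X) = ℂ(φ)` is the degree of `φ`.
The derivation is `d/dX`, that is, it sends `φ` to `1`. -/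
def IsDarbouxCovering (E : LinearODE) (K : Type) [Field K] [Algebra ℂ K] (φ : K) : Prop :=
  Transcendental ℂ φ ∧ FiniteDimensional ℂ⟮φ⟯ K ∧
  ∃ u : K, (minpoly ℂ⟮φ⟯ u).natDegree = Module.finrank ℂ⟮φ⟯ K ∧
    ∃ (L : Type) (_ : Field L) (_ : Algebra ℂ L) (_ : Algebra K L) (_ : IsScalarTower ℂ K L)
      (D : Derivation ℂ L L) (Y : L),
      D (algebraMap K L φ) = 1 ∧ Y ≠ 0 ∧ D Y = algebraMap K L u * Y ∧
      D (D Y) + RatFunc.eval (algebraMap ℂ L) (algebraMap K L φ) E.p * D Y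
        + RatFunc.eval (algebraMap ℂ L) (algebraMap K L φ) E.q * Y = 0

/-! ### The coverings, as rational expressions in `x` and `ξ` over any field -/

section Coverings

variable {F : Type*} [Field F]

/-- The covering of the curve `ξ² = x (1 + 33 x - 9 x²)`. -/
def phi3 (x ξ : F) : F :=
  144 * ξ * (1 + 33 * x - 9 * x ^ 2) ^ 2 * (1 - 9 * ξ + 54 * x)
    / (1 + 21 * ξ - 117 * x + 9 * x * ξ - 234 * x ^ 2) ^ 3

/-- The covering of the curve `ξ² = x (1 + 5 x - 5 x²)`. -/
def phi4 (x ξ : F) : F :=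
  432 * x * (1 - 7 / 5 * ξ - 9 * x - x ^ 2) ^ 5
      * (1 + 50 * x - 125 * ξ ^ 2 + 450 * x * ξ - 500 * x ^ 2)
    / ((5 * ξ + 57 * x) * (1 + 18 / 5 * ξ - 16 * x + x ^ 2) ^ 5
      * (1 + 50 * x - 125 * ξ ^ 2 - 450 * x * ξ - 500 * x ^ 2))

/-- The covering of the curve `ξ² = x (1 + x) (1 + 16 x)`. -/
def phi5 (x ξ : F) : F :=
  -(54 * (ξ + 5 * x) ^ 3 * (1 - 2 * ξ + 6 * x) ^ 5
    / ((1 - 16 * x ^ 2) * (ξ - 5 * x) ^ 2 * (1 - 2 * ξ - 14 * x) ^ 5))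

/-- The covering of the curve `ξ² = x (1 + x - x²)`. -/
def phi6 (x ξ : F) : F :=
  16 * ξ * (1 + x - x ^ 2) ^ 2 * (1 - ξ) ^ 2 / ((1 + ξ + 2 * x) * (1 + ξ - 2 * x) ^ 5)

end Coverings

/-! ### Identities near the point `(0, 0)` of a curve -/

/-- `NearOrigin f P` says that `P x ξ` holds at all points `(x, ξ) ≠ (0, 0)` of the complex
curve `ξ² = f x` in some neighbourhood of `(0, 0)`. -/
def NearOrigin (f : ℂ → ℂ) (P : ℂ → ℂ → Prop) : Prop :=
  ∀ᶠ z : ℂ × ℂ in 𝓝[{z : ℂ × ℂ | z.2 ^ 2 = f z.1 ∧ z ≠ 0}] 0, P z.1 z.2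

end

/-! ### Extending derivations to fraction fields -/

theorem exists_derivation_of_dualNumber {k A K : Type*} [Field k] [CommRing A] [IsDomain A]
    [Algebra k A] [Field K] [Algebra A K] [Algebra k K] [IsScalarTower k A K]
    [IsFractionRing A K] (g : A →+* DualNumber K)
    (hg : ∀ a, (g a).fst = algebraMap A K a) (hk : ∀ r : k, (g (algebraMap k A r)).snd = 0) :
    ∃ D : Derivation k K K, ∀ a, D (algebraMap A K a) = (g a).snd := by
  have hu : ∀ y : nonZeroDivisors A, IsUnit (g y) := fun y => by
    rw [TrivSqZeroExt.isUnit_iff_isUnit_fst, hg]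
    exact IsLocalization.map_units K y
  let G : K →+* DualNumber K := IsLocalization.lift hu
  have hG : ∀ a, G (algebraMap A K a) = g a := fun a => IsLocalization.lift_eq hu a
  have hfst : ∀ y, (G y).fst = y := by
    have : (TrivSqZeroExt.fstHom K K K).toRingHom.comp G = RingHom.id K := by
      refine IsLocalization.ringHom_ext (nonZeroDivisors A) ?_
      ext a
      simp [hG, hg]
    exact fun y => congrArg (fun f : K →+* K => f y) this
  have hconst : ∀ r : k, G (algebraMap k K r) = TrivSqZeroExt.inl (algebraMap k K r) := fun r => by
    ext
    · rw [hfst, TrivSqZeroExt.fst_inl]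
    · rw [IsScalarTower.algebraMap_apply k A K, hG, hk, TrivSqZeroExt.snd_inl]
  let l : K →ₗ[k] K :=
    { toFun := fun y => (G y).snd
      map_add' := fun y z => by simp
      map_smul' := fun r y => by
        simp [Algebra.smul_def, hconst] }
  refine ⟨Derivation.mk' l fun y z => ?_, fun a => ?_⟩
  · simp [l, hfst, mul_comm]
  · simp [l, hG]

theorem exists_derivation_ratFunc {K : Type} [Field K] [Algebra ℂ K] (D : Derivation ℂ K K)
    (u : K) :
    ∃ D' : Derivation ℂ (RatFunc K) (RatFunc K),
      (∀ y, D' (algebraMap K (RatFunc K) y) = algebraMap K (RatFunc K) (D y)) ∧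
      D' RatFunc.X = algebraMap K (RatFunc K) u * RatFunc.X := by
  let i : K →+* RatFunc K := algebraMap K (RatFunc K)
  let j : K →+* DualNumber (RatFunc K) :=
    { toFun := fun y => TrivSqZeroExt.inl (i y) + TrivSqZeroExt.inr (i (D y))
      map_one' := by simp
      map_zero' := by simp
      map_add' := fun y z => by ext <;> simp
      map_mul' := fun y z => by
        ext <;> simp [i]
        ring }
  let g : K[X] →+* DualNumber (RatFunc K) :=
    eval₂RingHom j (TrivSqZeroExt.inl RatFunc.X + TrivSqZeroExt.inr (i u * RatFunc.X))
  obtain ⟨D', hD'⟩ := exists_derivation_of_dualNumber (k := ℂ) (K := RatFunc K) g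
    (by
      have : (TrivSqZeroExt.fstHom (RatFunc K) (RatFunc K) (RatFunc K)).toRingHom.comp g
          = algebraMap K[X] (RatFunc K) := by
        ext y
        · simp [g, j, i]
        · simp [g]
      exact fun y => congrArg (fun f : K[X] →+* RatFunc K => f y) this)
    (by
      intro r
      have : algebraMap ℂ K[X] r = C (algebraMap ℂ K r) := rfl
      simp [this, g, j])
  refine ⟨D', fun y => ?_, ?_⟩
  · have := hD' (C y)
    simpa [g, j, i] using this
  · have := hD' X
    simpa [g, i] using this

/-! ### Function fields of the curves `ξ² = x (1 + b x + a x²)` -/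

/-- `K` is the function field of the curve `ξ² = x (1 + b x + a x²)` over `ℂ`, and `D` is the
derivation `2 ξ d/dx`. -/
structure IsCurveField (a b : ℂ) {K : Type} [Field K] [Algebra ℂ K] (x ξ : K)
    (D : Derivation ℂ K K) : Prop where
  sq : ξ ^ 2 = x * (1 + algebraMap ℂ K b * x + algebraMap ℂ K a * x ^ 2)
  indep : ∀ P Q : ℂ[X], aeval x P + aeval x Q * ξ = 0 → P = 0 ∧ Q = 0
  gen : ∀ M : IntermediateField ℂ K, x ∈ M → ξ ∈ M → M = ⊤
  deriv_x : D x = 2 * ξ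
  deriv_xi : D ξ = 1 + 2 * algebraMap ℂ K b * x + 3 * algebraMap ℂ K a * x ^ 2

theorem exists_isCurveField (a b : ℂ) (ha : a ≠ 0) :
    ∃ D : Derivation ℂ (DarbouxField a b) (DarbouxField a b),
      IsCurveField a b (coordX a b) (coordXi a b) D := by
  set K := DarbouxField a b
  set R := (darbouxCurve a b).toAffine.CoordinateRing
  let m := WeierstrassCurve.Affine.CoordinateRing.mk (darbouxCurve a b).toAffine
  have hinj : Function.Injective (algebraMap R K) := IsFractionRing.injective R K
  have ha' : algebraMap ℂ K a ≠ 0 := by simpa using ha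
  let x₁ : K := algebraMap R K (m (C X))
  let y₁ : K := algebraMap R K (m X)
  have hC (r : ℂ) : algebraMap R K (m (C (C r))) = algebraMap ℂ K r := rfl
  have hpoly : (darbouxCurve a b).toAffine.polynomial
      = X ^ 2 - C (X ^ 3 + C b * X ^ 2 + C a * X) := by
    simp [WeierstrassCurve.Affine.polynomial, darbouxCurve]
  have heq : y₁ ^ 2 = x₁ ^ 3 + algebraMap ℂ K b * x₁ ^ 2 + algebraMap ℂ K a * x₁ := by
    have h0 : m (X ^ 2 - C (X ^ 3 + C b * X ^ 2 + C a * X)) = 0 := by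
      rw [← hpoly]
      exact AdjoinRoot.mk_self
    have h1 := congrArg (algebraMap R K) h0
    simp only [map_sub, map_pow, map_add, map_mul, map_zero, hC] at h1
    linear_combination h1
  have hx : coordX a b = x₁ / algebraMap ℂ K a := rfl
  have hξ : coordXi a b = y₁ / algebraMap ℂ K a := rfl
  -- the derivation
  let i : ℂ →+* DualNumber K := (TrivSqZeroExt.inlHom K K).comp (algebraMap ℂ K)
  let X₁ : DualNumber K := TrivSqZeroExt.inl x₁ + TrivSqZeroExt.inr (2 * y₁)
  let Y₁ : DualNumber K := TrivSqZeroExt.inl y₁ + TrivSqZeroExt.inr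
    (3 * x₁ ^ 2 + 2 * algebraMap ℂ K b * x₁ + algebraMap ℂ K a)
  let g : R →+* DualNumber K := AdjoinRoot.lift (eval₂RingHom i X₁) Y₁ (by
    refine (congrArg (eval₂ (eval₂RingHom i X₁) Y₁) hpoly).trans ?_
    simp only [eval₂_sub, eval₂_pow, eval₂_X, eval₂_C, coe_eval₂RingHom, eval₂_add, eval₂_mul]
    ext
    · simp [i, X₁, Y₁]
      linear_combination heq
    · simp [i, X₁, Y₁, pow_succ]
      ring)
  have gm (q : ℂ[X][X]) : g (m q) = eval₂ (eval₂RingHom i X₁) Y₁ q := AdjoinRoot.lift_mk _ _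
  obtain ⟨D, hD⟩ := exists_derivation_of_dualNumber (k := ℂ) (K := K) g
    (by
      have : (TrivSqZeroExt.fstHom K K K).toRingHom.comp g = algebraMap R K := by
        refine AdjoinRoot.ringHom_ext (Polynomial.ringHom_ext (fun r => ?_) ?_) ?_
        · have := gm (C (C r))
          simp only [eval₂_C, coe_eval₂RingHom, i] at this
          change (g (m (C (C r)))).fst = _
          rw [this]
          simp
          rfl
        · change (g (m (C X))).fst = _
          rw [gm]
          simp [X₁]
          rfl
        · change (g (m X)).fst = _
          rw [gm]
          simp only [eval₂_X, Y₁]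
          exact add_zero _
      exact fun y => congrArg (fun f : R →+* K => f y) this)
    (by
      intro r
      change (g (m (C (C r)))).snd = 0
      rw [gm]
      simp [i])
  have hDx : D x₁ = 2 * y₁ := by
    rw [hD, gm]
    simp [X₁]
  have hDy : D y₁ = 3 * x₁ ^ 2 + 2 * algebraMap ℂ K b * x₁ + algebraMap ℂ K a := by
    rw [hD, gm]
    simp [Y₁]
  have hDdiv (z : K) : D (z / algebraMap ℂ K a) = D z / algebraMap ℂ K a := by
    have : z / algebraMap ℂ K a = a⁻¹ • z := by
      rw [Algebra.smul_def, map_inv₀, div_eq_inv_mul]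
    rw [this, D.map_smul, Algebra.smul_def, map_inv₀, div_eq_inv_mul]
  suffices h : IsCurveField (K := K) a b (coordX a b) (coordXi a b) D from ⟨D, h⟩
  refine ⟨coordXi_sq a b ha, fun P Q h => ?_, fun M hxM hξM => ?_, ?_, ?_⟩
  · have key : ∀ P : ℂ[X], aeval x₁ P = algebraMap R K (m (C P)) := fun P => by
      induction P using Polynomial.induction_on' with
      | add p q hp hq => simp only [map_add, hp, hq]
      | monomial n r =>
        rw [← C_mul_X_pow_eq_monomial]
        simp only [map_mul, map_pow, aeval_C, aeval_X, hC, x₁]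
    have hscale : ∀ P : ℂ[X], aeval (coordX a b) P = aeval x₁ (P.comp (C a⁻¹ * X)) := fun P => by
      rw [aeval_comp, hx]
      congr 1
      simp [div_eq_inv_mul]
    have hcomp : ∀ P : ℂ[X], P.comp (C a⁻¹ * X) = 0 → P = 0 := fun P hP => by
      have := congrArg (fun q : ℂ[X] => q.comp (C a * X)) hP
      simpa [comp_assoc, ← mul_assoc, ← C_mul, ha] using this
    have h2 : algebraMap R K (P.comp (C a⁻¹ * X) • (1 : R)
        + (C a⁻¹ * Q.comp (C a⁻¹ * X)) • m X) = 0 := by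
      rw [← h, WeierstrassCurve.Affine.CoordinateRing.smul,
        WeierstrassCurve.Affine.CoordinateRing.smul, mul_one, hscale, hscale, key, key, hξ]
      simp only [map_add, map_mul, hC, map_inv₀, m]
      change _ + _ * y₁ = _
      rw [div_eq_inv_mul]
      ring
    rw [map_eq_zero_iff _ hinj] at h2
    obtain ⟨h3, h4⟩ := WeierstrassCurve.Affine.CoordinateRing.smul_basis_eq_zero h2
    refine ⟨hcomp _ h3, hcomp _ ?_⟩
    simpa [ha] using h4
  · have hxM' : x₁ ∈ M := by
      have := M.mul_mem hxM (M.algebraMap_mem a)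
      rwa [hx, div_mul_cancel₀ _ ha'] at this
    have hyM' : y₁ ∈ M := by
      have := M.mul_mem hξM (M.algebraMap_mem a)
      rwa [hξ, div_mul_cancel₀ _ ha'] at this
    have hR : ∀ q : ℂ[X][X], algebraMap R K (m q) ∈ M := fun q => by
      induction q using Polynomial.induction_on' with
      | add p q hp hq => simpa only [map_add] using M.add_mem hp hq
      | monomial n r =>
        rw [← C_mul_X_pow_eq_monomial]
        simp only [map_mul, map_pow]
        refine M.mul_mem ?_ (M.pow_mem hyM' n)
        induction r using Polynomial.induction_on' with
        | add p q hp hq => simpa only [map_add] using M.add_mem hp hq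
        | monomial k s =>
          rw [← C_mul_X_pow_eq_monomial]
          simp only [map_mul, map_pow, hC]
          exact M.mul_mem (M.algebraMap_mem s) (M.pow_mem hxM' k)
    refine eq_top_iff.mpr fun z _ => ?_
    obtain ⟨p, q, -, rfl⟩ := IsFractionRing.div_surjective (A := R) z
    obtain ⟨p, rfl⟩ := AdjoinRoot.mk_surjective p
    obtain ⟨q, rfl⟩ := AdjoinRoot.mk_surjective q
    exact M.div_mem (hR p) (hR q)
  · rw [hx, hξ, hDdiv, hDx]
    ring
  · rw [hx, hξ, hDdiv, hDy, div_eq_iff ha']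
    have h1 : x₁ = x₁ / algebraMap ℂ K a * algebraMap ℂ K a := (div_mul_cancel₀ _ ha').symm
    change _ = (1 + 2 * algebraMap ℂ K b * (x₁ / algebraMap ℂ K a)
      + 3 * algebraMap ℂ K a * (x₁ / algebraMap ℂ K a) ^ 2) * algebraMap ℂ K a
    generalize x₁ / algebraMap ℂ K a = z at h1 ⊢
    rw [h1]
    ring

section

open IntermediateField.algebraAdjoinAdjoin

theorem IntermediateField.aeval_mem_of_mem {F K : Type*} [Field F] [Field K] [Algebra F K]
    {M : IntermediateField F K} {x : K} (hx : x ∈ M) (q : F[X]) : aeval x q ∈ M :=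
  Algebra.adjoin_le (S := M.toSubalgebra) (by simpa using hx) (aeval_mem_adjoin_singleton F x)

namespace IsCurveField

variable {a b : ℂ} {K : Type} [Field K] [Algebra ℂ K] {x ξ : K} {D : Derivation ℂ K K}

theorem sq_aeval (h : IsCurveField a b x ξ D) :
    ξ ^ 2 = aeval x (X * (1 + C b * X + C a * X ^ 2) : ℂ[X]) := by
  simp [h.sq]

theorem transcendental_x (h : IsCurveField a b x ξ D) : Transcendental ℂ x := by
  rw [transcendental_iff]
  intro P hP
  exact (h.indep P 0 (by simp [hP])).1

theorem aeval_ne_zero (h : IsCurveField a b x ξ D) {P : ℂ[X]} (hP : P ≠ 0) : aeval x P ≠ 0 :=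
  fun h0 => hP ((transcendental_iff.mp h.transcendental_x) P h0)

theorem ne_zero_of_eval (h : IsCurveField a b x ξ D) (P Q : ℂ[X]) {y : K}
    (hy : y = aeval x P + aeval x Q * ξ) (hP : P.eval 0 ≠ 0) : y ≠ 0 := by
  rintro rfl
  obtain ⟨rfl, -⟩ := h.indep P Q hy.symm
  simp at hP

theorem transcendental_of_eq (h : IsCurveField a b x ξ D) {α β p : ℂ[X]} (hβ : β ≠ 0) {ψ : K}
    (hψ : aeval x p * ψ = aeval x α + aeval x β * ξ) : Transcendental ℂ ψ := by
  intro halg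
  obtain ⟨c, rfl⟩ : ψ ∈ (algebraMap ℂ K).range :=
    minpoly.mem_range_of_degree_eq_one ℂ ψ (IsAlgClosed.degree_eq_one_of_irreducible ℂ
      (minpoly.irreducible halg.isIntegral))
  refine hβ (h.indep (α - p * C c) β ?_).2
  simp only [map_sub, map_mul, aeval_C]
  linear_combination -hψ

/-- A rational function `ψ = (α + β ξ) / p`, where the norm of `α + β ξ` is `p r` with `r` prime
to `p`, has degree `max (deg p) (deg r)`. -/
theorem finrank_adjoin (h : IsCurveField a b x ξ D) {α β p r : ℂ[X]} (hβ : β ≠ 0)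
    (hp : p ≠ 0) (hα : α.natDegree ≤ max p.natDegree r.natDegree)
    (hcop : IsCoprime p r)
    (hpr : α ^ 2 - β ^ 2 * (X * (1 + C b * X + C a * X ^ 2)) = p * r) {ψ : K}
    (hψ : aeval x p * ψ = aeval x α + aeval x β * ξ) :
    Module.finrank ℂ⟮ψ⟯ K = max p.natDegree r.natDegree := by
  have htr : Transcendental ℂ ψ := h.transcendental_of_eq hβ hψ
  have hp' : aeval x p ≠ 0 := h.aeval_ne_zero hp
  have hβ' : aeval x β ≠ 0 := h.aeval_ne_zero hβ
  have hr : r ≠ 0 := by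
    rintro rfl
    have h0 : (aeval x α + aeval x β * ξ) * (aeval x α + aeval x (-β) * ξ) = 0 := by
      have := congrArg (aeval x) hpr
      simp only [mul_zero, map_zero, map_sub, map_mul (aeval x) (β ^ 2), ← h.sq_aeval] at this
      simp only [map_pow] at this
      simp only [map_neg]
      linear_combination this
    rcases mul_eq_zero.mp h0 with h1 | h1
    · exact hβ (h.indep _ _ h1).2
    · exact hβ (neg_eq_zero.mp (h.indep _ _ h1).2)
  -- the quadratic equation of `ψ`
  let G : ℂ[X][X] := C p * X ^ 2 - C (2 * α) * X + C r
  have hroot : aeval x p * ψ ^ 2 - 2 * aeval x α * ψ + aeval x r = 0 := by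
    have h1 := congrArg (aeval x) hpr
    simp only [map_sub, map_mul (aeval x) (β ^ 2), ← h.sq_aeval, map_mul (aeval x) p] at h1
    simp only [map_pow] at h1
    apply mul_left_cancel₀ hp'
    linear_combination (aeval x p * ψ - aeval x α + aeval x β * ξ) * hψ - h1
  have hGroot : aevalAeval x ψ G = 0 := by
    rw [← hroot]
    simp [G]
  have hmin : ∀ A : ℂ[X][X], aevalAeval x ψ A = 0 → A.natDegree < 2 → A = 0 := fun A hA hd => by
    rw [A.as_sum_range' 2 hd, Finset.sum_range_succ, Finset.sum_range_one] at hA ⊢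
    simp only [← C_mul_X_pow_eq_monomial, pow_zero, mul_one, pow_one, map_add, map_mul,
      aevalAeval_C, aevalAeval_Y] at hA ⊢
    have h1 := h.indep (p * A.coeff 0 + A.coeff 1 * α) (A.coeff 1 * β) (by
      simp only [map_add, map_mul]
      linear_combination aeval x p * hA - aeval x (A.coeff 1) * hψ)
    have h2 : A.coeff 1 = 0 := (mul_eq_zero.mp h1.2).resolve_right hβ
    have h3 : A.coeff 0 = 0 := by
      have := h1.1
      rw [h2, zero_mul, add_zero] at this
      exact (mul_eq_zero.mp this).resolve_left hp
    simp [h2, h3]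
  have hGdeg : G.natDegree = 2 := by
    simp only [G]
    compute_degree!
  have hGne : G ≠ 0 := fun h0 => by simp [h0] at hGdeg
  have hfac : ∀ A B : ℂ[X][X], G = A * B → aevalAeval x ψ A = 0 → IsUnit B := fun A B hAB hA => by
    have hA0 : A ≠ 0 := by
      rintro rfl
      exact hGne (by simpa using hAB)
    have hB0 : B ≠ 0 := by
      rintro rfl
      exact hGne (by simpa using hAB)
    have hdA : 2 ≤ A.natDegree := by
      by_contra hlt
      exact hA0 (hmin A hA (by omega))
    have hdeg := natDegree_mul hA0 hB0
    rw [← hAB, hGdeg] at hdeg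
    obtain ⟨c, rfl⟩ : ∃ c, B = C c := ⟨_, eq_C_of_natDegree_eq_zero (by omega)⟩
    have hc : ∀ n, c ∣ G.coeff n := fun n => ⟨A.coeff n, by rw [hAB, coeff_mul_C, mul_comm]⟩
    have h2 : c ∣ p := by simpa [G, coeff_X, coeff_C] using hc 2
    have h0 : c ∣ r := by simpa [G, coeff_X, coeff_C] using hc 0
    exact (hcop.isUnit_of_dvd' h2 h0).map C
  have hGirr : Irreducible G := by
    refine ⟨fun hu => ?_, fun A B hAB => ?_⟩
    · rw [Polynomial.natDegree_eq_zero_of_isUnit hu] at hGdeg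
      omega
    · have h1 : aevalAeval x ψ A * aevalAeval x ψ B = 0 := by rw [← map_mul, ← hAB, hGroot]
      rcases mul_eq_zero.mp h1 with h2 | h2
      · exact .inr (hfac A B hAB h2)
      · exact .inl (hfac B A (by rw [hAB, mul_comm]) h2)
  -- exchange the variables and pass to the field `ℂ(ψ)`
  let S : ℂ[X][X] := Bivariate.swap G
  have hSirr : Irreducible S := (MulEquiv.irreducible_iff _).mpr hGirr
  have hS : S = p.map C * C (X ^ 2) - (2 * α).map C * C X + r.map C := by
    simp only [S, G, map_add, map_sub, map_mul (Bivariate.swap (R := ℂ)), map_pow,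
      Bivariate.swap_C, Bivariate.swap_Y]
  have hScoeff : ∀ n,
      S.coeff n = C (p.coeff n) * X ^ 2 - C ((2 * α).coeff n) * X + C (r.coeff n) := fun n => by
    rw [hS, coeff_add, coeff_sub, coeff_mul_C, coeff_mul_C, coeff_map, coeff_map, coeff_map]
  have hSdeg : S.natDegree = max p.natDegree r.natDegree := by
    apply le_antisymm
    · rw [natDegree_le_iff_coeff_eq_zero]
      intro n hn
      rw [hScoeff, coeff_eq_zero_of_natDegree_lt (lt_of_le_of_lt (le_max_left _ _) hn),
        coeff_eq_zero_of_natDegree_lt (lt_of_le_of_lt (le_max_right _ _) hn),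
        coeff_eq_zero_of_natDegree_lt (lt_of_le_of_lt ?_ hn)]
      · simp
      · refine le_trans (natDegree_mul_le.trans ?_) hα
        simp
    · refine max_le (le_natDegree_of_ne_zero fun h0 => ?_) (le_natDegree_of_ne_zero fun h0 => ?_)
      · have := congrArg (fun q : ℂ[X] => q.coeff 2) ((hScoeff _).symm.trans h0)
        simp at this
        exact hp this
      · have := congrArg (fun q : ℂ[X] => q.coeff 0) ((hScoeff _).symm.trans h0)
        simp at this
        exact hr this
  have hcase : S.natDegree ≠ 0 := fun h0 => by
    rw [hSdeg, Nat.max_eq_zero_iff] at h0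
    have h1 : β ^ 2 * (X * (1 + C b * X + C a * X ^ 2)) = α ^ 2 - p * r := by rw [← hpr]; ring
    have hf : (1 + C b * X + C a * X ^ 2 : ℂ[X]) ≠ 0 := fun h2 => by
      simpa using congrArg (fun q : ℂ[X] => q.eval 0) h2
    have h2 : (α ^ 2 - p * r).natDegree ≤ 0 := by
      refine (natDegree_sub_le _ _).trans
        (max_le (natDegree_pow_le.trans ?_) (natDegree_mul_le.trans ?_))
      · simp only [h0.1, h0.2, max_self, nonpos_iff_eq_zero] at hα
        simp [hα]
      · simp [h0.1, h0.2]
    rw [← h1, natDegree_mul (pow_ne_zero 2 hβ) (mul_ne_zero X_ne_zero hf), natDegree_X_mul hf] at h2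
    omega
  let e := Polynomial.algEquivOfTranscendental ℂ ψ htr
  have : UniqueFactorizationMonoid (Algebra.adjoin ℂ {ψ}) := htr.uniqueFactorizationMonoid_adjoin
  let S₁ : (Algebra.adjoin ℂ {ψ})[X] := S.mapEquiv e.toRingEquiv
  have hS₁irr : Irreducible S₁ := (MulEquiv.irreducible_iff _).mpr hSirr
  have hS₁deg : S₁.natDegree = S.natDegree := natDegree_map_eq_of_injective e.injective S
  let S₂ : ℂ⟮ψ⟯[X] := S₁.map (algebraMap (Algebra.adjoin ℂ {ψ}) ℂ⟮ψ⟯)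
  have hS₂irr : Irreducible S₂ :=
    (IsPrimitive.irreducible_iff_irreducible_map_fraction_map
      (hS₁irr.isPrimitive (by rwa [hS₁deg]))).mp hS₁irr
  have hS₂deg : S₂.natDegree = S.natDegree := by
    rw [← hS₁deg]
    exact natDegree_map_eq_of_injective (FaithfulSMul.algebraMap_injective _ _) S₁
  have hS₂root : aeval x S₂ = 0 := by
    have hcomp : ((algebraMap ℂ⟮ψ⟯ K).comp (algebraMap (Algebra.adjoin ℂ {ψ}) ℂ⟮ψ⟯)).comp
        (e.toRingEquiv : ℂ[X] →+* Algebra.adjoin ℂ {ψ}) = (aeval ψ : ℂ[X] →ₐ[ℂ] K) := by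
      ext
      · simp [e]
      · simp [e]
    have hS₂ : aeval x S₂ = eval₂ ((aeval ψ : ℂ[X] →ₐ[ℂ] K) : ℂ[X] →+* K) x S := by
      rw [← hcomp, ← eval₂_map, ← eval₂_map]
      rfl
    have hC : ((aeval ψ : ℂ[X] →ₐ[ℂ] K) : ℂ[X] →+* K).comp C = algebraMap ℂ K := by
      ext
      simp
    rw [hS₂, hS]
    simp only [eval₂_add, eval₂_sub, eval₂_mul, eval₂_map, hC, eval₂_C]
    rw [← hroot]
    simp [aeval_def]
  have htop : ℂ⟮ψ⟯⟮x⟯ = ⊤ := by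
    rw [← IntermediateField.restrictScalars_eq_top_iff (K := ℂ)]
    have hx : x ∈ IntermediateField.restrictScalars ℂ ℂ⟮ψ⟯⟮x⟯ :=
      IntermediateField.mem_adjoin_simple_self ℂ⟮ψ⟯ x
    have hmem : ∀ q : ℂ[X], aeval x q ∈ IntermediateField.restrictScalars ℂ ℂ⟮ψ⟯⟮x⟯ := fun q =>
      IntermediateField.aeval_mem_of_mem hx q
    refine h.gen _ hx ?_
    have hξ : ξ = (aeval x p * ψ - aeval x α) / aeval x β := by
      rw [eq_div_iff hβ']
      linear_combination -hψ
    rw [hξ]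
    refine div_mem (sub_mem (mul_mem (hmem p) ?_) (hmem α)) (hmem β)
    exact IntermediateField.algebraMap_mem ℂ⟮ψ⟯⟮x⟯ (IntermediateField.AdjoinSimple.gen ℂ ψ)
  have hint : IsIntegral ℂ⟮ψ⟯ x :=
    isAlgebraic_iff_isIntegral.mp ⟨S₂, hS₂irr.ne_zero, hS₂root⟩
  rw [← hSdeg, ← hS₂deg, ← IntermediateField.finrank_top', ← htop,
    IntermediateField.adjoin.finrank hint, ← minpoly.eq_of_irreducible hS₂irr hS₂root,
    natDegree_mul_C (by simpa using hS₂irr.ne_zero)]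

end IsCurveField

end

section

open IntermediateField.algebraAdjoinAdjoin

theorem RatFunc.eval_hypergeometricODE {L : Type} [Field L] [Algebra ℂ L] {φ : L}
    (hφ : Transcendental ℂ φ) (e₀ e₁ e : ℂ) :
    RatFunc.eval (algebraMap ℂ L) φ (hypergeometricODE e₀ e₁ e).p
      = algebraMap ℂ L (1 - e₀) / φ + algebraMap ℂ L (1 - e₁) / (φ - 1) ∧
    RatFunc.eval (algebraMap ℂ L) φ (hypergeometricODE e₀ e₁ e).q
      = algebraMap ℂ L ((1 - e₀ - e₁) ^ 2 - e ^ 2) / (4 * φ * (φ - 1)) := by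
  have hne : ∀ y : RatFunc ℂ, Polynomial.eval₂ (algebraMap ℂ L) φ y.denom ≠ 0 := fun y h0 =>
    y.denom_ne_zero (transcendental_iff.mp hφ _ h0)
  let g : RatFunc ℂ →+* L :=
    { toFun := RatFunc.eval (algebraMap ℂ L) φ
      map_one' := RatFunc.eval_one _ _
      map_zero' := RatFunc.eval_zero _ _
      map_add' := fun y z => RatFunc.eval_add _ _ (hne y) (hne z)
      map_mul' := fun y z => RatFunc.eval_mul _ _ (hne y) (hne z) }
  have hC : ∀ c, g (RatFunc.C c) = algebraMap ℂ L c := fun c => RatFunc.eval_C _ _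
  have hX : g RatFunc.X = φ := RatFunc.eval_X _ _
  change g _ = _ ∧ g _ = _
  constructor <;>
    simp only [hypergeometricODE, map_add, map_div₀, map_mul, map_sub g, map_one, map_ofNat, hC, hX]

theorem IntermediateField.eq_top_of_coprime_finrank {K : Type} [Field K] [Algebra ℂ K]
    {M : IntermediateField ℂ K} {ψ₁ ψ₂ : K} (h₁ : ψ₁ ∈ M) (h₂ : ψ₂ ∈ M)
    (h : Nat.Coprime (Module.finrank ℂ⟮ψ₁⟯ K) (Module.finrank ℂ⟮ψ₂⟯ K)) : M = ⊤ := by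
  rw [← IntermediateField.finrank_eq_one_iff_eq_top]
  exact Nat.eq_one_of_dvd_coprimes h
    (IntermediateField.finrank_dvd_of_le_left (IntermediateField.adjoin_simple_le_iff.mpr h₁))
    (IntermediateField.finrank_dvd_of_le_left (IntermediateField.adjoin_simple_le_iff.mpr h₂))

namespace IsCurveField

variable {a b : ℂ} {K : Type} [Field K] [Algebra ℂ K] {x ξ : K} {D : Derivation ℂ K K}

theorem finiteDimensional_of_isIntegral (h : IsCurveField a b x ξ D)
    {F : IntermediateField ℂ K} (hx : IsIntegral F x) : FiniteDimensional F K := by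
  have hξ : IsIntegral F ξ := by
    refine IsIntegral.of_pow (n := 2) two_pos ?_
    have hc : ∀ c, IsIntegral F (algebraMap ℂ K c) := fun c =>
      isIntegral_algebraMap (x := algebraMap ℂ F c)
    rw [h.sq]
    exact hx.mul ((isIntegral_one.add ((hc b).mul hx)).add ((hc a).mul (hx.pow 2)))
  have htop : IntermediateField.adjoin F {x, ξ} = ⊤ := by
    rw [← IntermediateField.restrictScalars_eq_top_iff (K := ℂ)]
    exact h.gen _ (IntermediateField.subset_adjoin F _ (by simp))
      (IntermediateField.subset_adjoin F _ (by simp))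
  have := IntermediateField.finiteDimensional_adjoin_pair hx hξ
  rw [htop] at this
  exact IntermediateField.topEquiv.toLinearEquiv.finiteDimensional

theorem finiteDimensional (h : IsCurveField a b x ξ D) {φ : K} (hφ : Transcendental ℂ φ) :
    FiniteDimensional ℂ⟮φ⟯ K := by
  have h0 : FiniteDimensional ℂ⟮x⟯ K :=
    h.finiteDimensional_of_isIntegral
      (isIntegral_algebraMap (x := IntermediateField.AdjoinSimple.gen ℂ x))
  have h1 : Algebra.IsAlgebraic (Algebra.adjoin ℂ {x}) K :=
    (IsFractionRing.comap_isAlgebraic_iff (K := ℂ⟮x⟯)).mpr inferInstance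
  have h2 : Algebra.trdeg ℂ K ≤ 1 := by
    have := Algebra.IsAlgebraic.trdeg_le_cardinalMk ℂ ({x} : Set K)
    simpa using this
  have h3 : IsTranscendenceBasis ℂ (fun _ : Unit => φ) :=
    AlgebraicIndependent.isTranscendenceBasis_of_trdeg_le_of_finite
      (algebraicIndependent_unique_type_iff.mpr hφ) (by simpa using h2)
  have h4 : Algebra.IsAlgebraic (Algebra.adjoin ℂ {φ}) K := by
    have := h3.isAlgebraic
    rwa [Set.range_const] at this
  have h5 : Algebra.IsAlgebraic ℂ⟮φ⟯ K :=
    (IsFractionRing.comap_isAlgebraic_iff (A := Algebra.adjoin ℂ {φ})).mp h4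
  exact h.finiteDimensional_of_isIntegral (h5.isAlgebraic x).isIntegral

theorem transcendental_of_deriv_ne_zero {φ : K} (hφ : D φ ≠ 0) : Transcendental ℂ φ := by
  intro halg
  obtain ⟨c, rfl⟩ : φ ∈ (algebraMap ℂ K).range :=
    minpoly.mem_range_of_degree_eq_one ℂ φ (IsAlgClosed.degree_eq_one_of_irreducible ℂ
      (minpoly.irreducible halg.isIntegral))
  exact hφ (D.map_algebraMap c)

/-- A solution `u` of the Riccati equation associated with a hypergeometric equation gives a
Darboux covering if it generates the function field over `ℂ(φ)`. -/
theorem isDarbouxCovering (h : IsCurveField a b x ξ D) {e₀ e₁ e : ℂ} {φ u : K} (hφ : D φ ≠ 0)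
    (hu : D u / D φ + u ^ 2
      + (algebraMap ℂ K (1 - e₀) / φ + algebraMap ℂ K (1 - e₁) / (φ - 1)) * u
      + algebraMap ℂ K ((1 - e₀ - e₁) ^ 2 - e ^ 2) / (4 * φ * (φ - 1)) = 0)
    (htop : ∀ M : IntermediateField ℂ K, φ ∈ M → u ∈ M → M = ⊤) :
    IsDarbouxCovering (hypergeometricODE e₀ e₁ e) K φ := by
  have htr := transcendental_of_deriv_ne_zero hφ
  have hfin := h.finiteDimensional htr
  refine ⟨htr, hfin, u, ?_, ?_⟩
  · have hF : ℂ⟮φ⟯⟮u⟯ = ⊤ := by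
      rw [← IntermediateField.restrictScalars_eq_top_iff (K := ℂ)]
      exact htop _ (IntermediateField.algebraMap_mem ℂ⟮φ⟯⟮u⟯ (IntermediateField.AdjoinSimple.gen ℂ φ))
        (IntermediateField.mem_adjoin_simple_self ℂ⟮φ⟯ u)
    rw [← IntermediateField.adjoin.finrank (IsIntegral.of_finite ℂ⟮φ⟯ u), hF,
      IntermediateField.finrank_top']
  · obtain ⟨D', hD', hX⟩ := exists_derivation_ratFunc D (D φ * u)
    let i : K →+* RatFunc K := algebraMap K (RatFunc K)
    have hi : i (D φ) ≠ 0 := by simpa [i] using hφ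
    have htr' : Transcendental ℂ (i φ) :=
      (transcendental_algebraMap_iff (FaithfulSMul.algebraMap_injective K (RatFunc K))).mpr htr
    obtain ⟨hp, hq⟩ := RatFunc.eval_hypergeometricODE htr' e₀ e₁ e
    have hY : (i (D φ))⁻¹ * D' RatFunc.X = i u * RatFunc.X := by
      rw [hX]
      change (i (D φ))⁻¹ * (i (D φ * u) * RatFunc.X) = _
      rw [map_mul, mul_assoc, inv_mul_cancel_left₀ hi]
    refine ⟨RatFunc K, inferInstance, inferInstance, inferInstance, inferInstance,
      (i (D φ))⁻¹ • D', RatFunc.X, ?_, RatFunc.X_ne_zero, hY, ?_⟩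
    · rw [Derivation.smul_apply, hD', smul_eq_mul, inv_mul_cancel₀ hi]
    · rw [hp, hq]
      simp only [Derivation.smul_apply, smul_eq_mul, hY, Derivation.leibniz]
      have h1 := congrArg i hu
      simp only [map_add, map_mul, map_div₀, map_pow, map_sub i, map_zero, map_one, map_ofNat] at h1
      have h2 : ∀ c, i (algebraMap ℂ K c) = algebraMap ℂ (RatFunc K) c :=
        fun c => (IsScalarTower.algebraMap_apply ℂ K (RatFunc K) c).symm
      simp only [h2] at h1
      have h3 : (i (D φ))⁻¹ * D' (i u) = i (D u) / i (D φ) := by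
        rw [div_eq_inv_mul]
        exact congrArg _ (hD' u)
      change i u * (i u * RatFunc.X) + RatFunc.X * ((i (D φ))⁻¹ * D' (i u)) + _ + _ = 0
      rw [h3]
      linear_combination RatFunc.X * h1

end IsCurveField

end

/-! ### Power series at the origin -/

/-- Near `0` the function `f` is the sum of the power series with coefficients `c`. -/
def HasPowerSeries (f : ℂ → ℂ) (c : ℕ → ℂ) : Prop :=
  ∀ᶠ z in 𝓝 (0 : ℂ), HasSum (fun n => z ^ n * c n) (f z)

namespace HasPowerSeries

variable {f g : ℂ → ℂ} {c d : ℕ → ℂ}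

theorem iff_hasFPowerSeriesAt {p : FormalMultilinearSeries ℂ ℂ ℂ} :
    HasPowerSeries f p.coeff ↔ HasFPowerSeriesAt f p 0 := by
  simp [hasFPowerSeriesAt_iff, HasPowerSeries]

theorem exists_of_analyticAt (hf : AnalyticAt ℂ f 0) :
    ∃ c, HasPowerSeries f c ∧ HasPowerSeries (deriv f) (fun n => (n + 1) * c (n + 1)) := by
  obtain ⟨p, hp⟩ := hf
  refine ⟨p.coeff, iff_hasFPowerSeriesAt.mpr hp, ?_⟩
  obtain ⟨r, hr⟩ := hp
  have h1 := hasFPowerSeriesAt_iff.mp hr.fderiv.hasFPowerSeriesAt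
  refine h1.mono fun z hz => ?_
  have h2 := (ContinuousLinearMap.apply ℂ ℂ (1 : ℂ)).hasSum hz
  have h3 : ∀ n, p.derivSeries.coeff n 1 = (n + 1) * p.coeff (n + 1) := fun n => by
    rw [p.derivSeries_coeff_one n, nsmul_eq_mul]
    push_cast
    rfl
  simpa [h3] using h2

theorem unique (hc : HasPowerSeries f c) (hd : HasPowerSeries f d) : c = d := by
  have key : ∀ e : ℕ → ℂ, (FormalMultilinearSeries.ofScalars ℂ e).coeff = e := fun e => by
    ext n
    simp
  have h1 : HasFPowerSeriesAt f (FormalMultilinearSeries.ofScalars ℂ c) 0 := by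
    rw [← iff_hasFPowerSeriesAt, key]
    exact hc
  have h2 : HasFPowerSeriesAt f (FormalMultilinearSeries.ofScalars ℂ d) 0 := by
    rw [← iff_hasFPowerSeriesAt, key]
    exact hd
  rw [← key c, h1.eq_formalMultilinearSeries h2, key]

theorem add (hc : HasPowerSeries f c) (hd : HasPowerSeries g d) :
    HasPowerSeries (fun z => f z + g z) (fun n => c n + d n) := by
  filter_upwards [hc, hd] with z h1 h2
  simpa only [mul_add] using h1.add h2

theorem sub (hc : HasPowerSeries f c) (hd : HasPowerSeries g d) :
    HasPowerSeries (fun z => f z - g z) (fun n => c n - d n) := by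
  filter_upwards [hc, hd] with z h1 h2
  simpa only [mul_sub] using h1.sub h2

theorem const_mul (r : ℂ) (hc : HasPowerSeries f c) :
    HasPowerSeries (fun z => r * f z) (fun n => r * c n) := by
  filter_upwards [hc] with z h1
  simpa only [mul_left_comm] using h1.mul_left r

theorem id_mul (hc : HasPowerSeries f c) :
    HasPowerSeries (fun z => z * f z) (fun n => Nat.casesOn n 0 c) := by
  filter_upwards [hc] with z h1
  rw [← hasSum_nat_add_iff' 1]
  simpa [pow_succ', mul_assoc] using h1.mul_left z

theorem congr (hc : HasPowerSeries f c) (h : ∀ᶠ z in 𝓝 0, f z = g z) : HasPowerSeries g c := by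
  filter_upwards [hc, h] with z h1 h2
  rwa [← h2]

theorem coeff_zero (hc : HasPowerSeries f c) : c 0 = f 0 := by
  have h1 : HasSum (fun n => (0 : ℂ) ^ n * c n) (f 0) := hc.self_of_nhds
  have h2 := hasSum_single (f := fun n => (0 : ℂ) ^ n * c n) 0 fun n hn => by simp [hn]
  simpa using h2.unique h1

theorem eq_ordinaryHypergeometric {a b c : ℂ}
    (hf : HasPowerSeries f (ordinaryHypergeometricCoefficient a b c)) :
    ∀ᶠ z in 𝓝 0, f z = ₂F₁ a b c z := by
  filter_upwards [hf] with z hz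
  rw [ordinaryHypergeometric_eq_tsum, ← hz.tsum_eq]
  simp only [smul_eq_mul, mul_comm]

end HasPowerSeries

/-- A system `X (1 - X) F' = (A + B X) F` of two differential equations has at most one power
series solution with given constant term if no eigenvalue of `A` is a positive integer. -/
theorem recurrence_unique {A B : Fin 2 → Fin 2 → ℂ} {f g : Fin 2 → ℕ → ℂ}
    (h0 : ∀ i, f i 0 = g i 0)
    (hf : ∀ i (n : ℕ), (n + 1) * f i (n + 1) - n * f i n
      = ∑ j, (A i j * f j (n + 1) + B i j * f j n))
    (hg : ∀ i (n : ℕ), (n + 1) * g i (n + 1) - n * g i n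
      = ∑ j, (A i j * g j (n + 1) + B i j * g j n))
    (hdet : ∀ n : ℕ, (n + 1 - A 0 0) * (n + 1 - A 1 1) - A 0 1 * A 1 0 ≠ 0) : f = g := by
  suffices h : ∀ n i, f i n = g i n from funext fun i => funext fun n => h n i
  intro n
  induction n with
  | zero => exact h0
  | succ n ih =>
    have e0 := hf 0 n
    have e1 := hf 1 n
    have k0 := hg 0 n
    have k1 := hg 1 n
    simp only [Fin.sum_univ_two, ih 0, ih 1] at e0 e1 k0 k1
    have h1 : f 0 (n + 1) = g 0 (n + 1) := by
      apply mul_left_cancel₀ (hdet n)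
      linear_combination (n + 1 - A 1 1) * (e0 - k0) + A 0 1 * (e1 - k1)
    have h2 : f 1 (n + 1) = g 1 (n + 1) := by
      apply mul_left_cancel₀ (hdet n)
      linear_combination (n + 1 - A 0 0) * (e1 - k1) + A 1 0 * (e0 - k0)
    intro i
    fin_cases i
    · exact h1
    · exact h2

theorem system_unique {A B : Fin 2 → Fin 2 → ℂ} {F : Fin 2 → ℂ → ℂ} {g : Fin 2 → ℕ → ℂ}
    (hF : ∀ i, AnalyticAt ℂ (F i) 0)
    (hode : ∀ᶠ z in 𝓝 (0 : ℂ), ∀ i, z * (1 - z) * deriv (F i) z = ∑ j, (A i j + B i j * z) * F j z)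
    (h0 : ∀ i, F i 0 = g i 0)
    (hg : ∀ i (n : ℕ), (n + 1) * g i (n + 1) - n * g i n
      = ∑ j, (A i j * g j (n + 1) + B i j * g j n))
    (hdet : ∀ n : ℕ, (n + 1 - A 0 0) * (n + 1 - A 1 1) - A 0 1 * A 1 0 ≠ 0) (i : Fin 2) :
    HasPowerSeries (F i) (g i) := by
  choose f hf hf' using fun i => HasPowerSeries.exists_of_analyticAt (hF i)
  have hfg : f = g := by
    refine recurrence_unique (fun i => (hf i).coeff_zero.trans (h0 i)) (fun i n => ?_) hg hdet
    have h1 := ((hf' i).id_mul.sub (hf' i).id_mul.id_mul)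
    have h2 := (((hf 0).const_mul (A i 0)).add ((hf 0).id_mul.const_mul (B i 0))).add
      (((hf 1).const_mul (A i 1)).add ((hf 1).id_mul.const_mul (B i 1)))
    have h3 := h1.unique (h2.congr (by
      filter_upwards [hode] with z hz
      have := hz i
      rw [Fin.sum_univ_two] at this
      linear_combination -this))
    have h4 := congrFun h3 (n + 1)
    rw [Fin.sum_univ_two]
    cases n with
    | zero => simpa using h4
    | succ n =>
      push_cast
      simpa using h4
  rw [← hfg]
  exact hf i

/-! ### Contiguous hypergeometric functions -/

section Contiguous

variable {a b c : ℂ}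

local notation "h" => ordinaryHypergeometricCoefficient

theorem ordinaryHypergeometricCoefficient_zero : h a b c 0 = 1 := by
  simp [ordinaryHypergeometricCoefficient]

theorem ascPochhammer_eval_ne_zero_of_re_pos (hc : 0 < c.re) (n : ℕ) :
    (ascPochhammer ℂ n).eval c ≠ 0 := by
  rw [Ne, ascPochhammer_eval_eq_zero_iff]
  rintro ⟨k, -, hk⟩
  have := congrArg Complex.re hk
  simp at this
  have h2 : (0 : ℝ) ≤ k := k.cast_nonneg
  linarith

theorem add_natCast_ne_zero_of_re_pos (hc : 0 < c.re) (n : ℕ) : c + n ≠ 0 := fun h0 => by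
  have := congrArg Complex.re h0
  simp at this
  have h2 : (0 : ℝ) ≤ n := n.cast_nonneg
  linarith

theorem ordinaryHypergeometricCoefficient_succ (hc : 0 < c.re) (n : ℕ) :
    (n + 1) * (c + n) * h a b c (n + 1) = (a + n) * (b + n) * h a b c n := by
  have h1 := ascPochhammer_eval_ne_zero_of_re_pos hc n
  have h2 := add_natCast_ne_zero_of_re_pos hc n
  have h3 : (n + 1 : ℂ) ≠ 0 := by exact_mod_cast n.succ_ne_zero
  have h4 : (n.factorial : ℂ) ≠ 0 := by exact_mod_cast n.factorial_ne_zero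
  simp only [ordinaryHypergeometricCoefficient, ascPochhammer_succ_eval, Nat.factorial_succ,
    Nat.cast_mul, Nat.cast_add, Nat.cast_one]
  field_simp

theorem ascPochhammer_eval_add_one (z : ℂ) (n : ℕ) :
    z * (ascPochhammer ℂ n).eval (z + 1) = (z + n) * (ascPochhammer ℂ n).eval z := by
  have h1 := congrArg (Polynomial.eval z) (ascPochhammer_succ_left ℂ n)
  rw [ascPochhammer_succ_eval] at h1
  simp only [eval_mul, eval_X, eval_comp, eval_add, eval_one] at h1
  linear_combination -h1

theorem ordinaryHypergeometricCoefficient_add_one (n : ℕ) :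
    b * h a (b + 1) c n = (b + n) * h a b c n := by
  simp only [ordinaryHypergeometricCoefficient]
  linear_combination ((n.factorial : ℂ)⁻¹ * (ascPochhammer ℂ n).eval a
    * ((ascPochhammer ℂ n).eval c)⁻¹) * ascPochhammer_eval_add_one b n

theorem ordinaryHypergeometricCoefficient_add_one' (hc : 0 < c.re) (n : ℕ) :
    (c + n) * h a b (c + 1) n = c * h a b c n := by
  have h1 := ascPochhammer_eval_ne_zero_of_re_pos hc n
  have h2 := ascPochhammer_eval_ne_zero_of_re_pos (c := c + 1)
    (by simpa using hc.trans (lt_add_one _)) n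
  have h4 : (n.factorial : ℂ) ≠ 0 := by exact_mod_cast n.factorial_ne_zero
  simp only [ordinaryHypergeometricCoefficient]
  field_simp
  linear_combination (-(ascPochhammer ℂ n).eval a * (ascPochhammer ℂ n).eval b) *
    ascPochhammer_eval_add_one c n

/-- The coefficients of `X (1 - X) F' = (A + B X) F` and the initial values for the pair of
contiguous series `F = (₂F₁(a, b; c), ₂F₁(a, b + 1; c))`. -/
theorem contiguous_b (hc : 0 < c.re) (i : Fin 2) (n : ℕ) :
    (n + 1) * (![h a b c, h a (b + 1) c] : Fin 2 → ℕ → ℂ) i (n + 1)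
        - n * (![h a b c, h a (b + 1) c] : Fin 2 → ℕ → ℂ) i n
      = ∑ j, ((![![-b, b], ![c - b - 1, b + 1 - c]] : Fin 2 → Fin 2 → ℂ) i j
          * (![h a b c, h a (b + 1) c] : Fin 2 → ℕ → ℂ) j (n + 1)
        + (![![b, -b], ![0, a]] : Fin 2 → Fin 2 → ℂ) i j
          * (![h a b c, h a (b + 1) c] : Fin 2 → ℕ → ℂ) j n) := by
  have h1 := ordinaryHypergeometricCoefficient_add_one (a := a) (b := b) (c := c) n
  have h2 := ordinaryHypergeometricCoefficient_add_one (a := a) (b := b) (c := c) (n + 1)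
  have h3 := ordinaryHypergeometricCoefficient_succ (a := a) (b := b) hc n
  have h4 := ordinaryHypergeometricCoefficient_succ (a := a) (b := b + 1) hc n
  have h5 := add_natCast_ne_zero_of_re_pos hc n
  have h6 : (n + 1 : ℂ) ≠ 0 := by exact_mod_cast n.succ_ne_zero
  push_cast at h2
  generalize h a b c = f at *
  generalize h a (b + 1) c = g at *
  fin_cases i
  · simp [Fin.sum_univ_two]
    linear_combination h1 - h2
  · simp [Fin.sum_univ_two]
    apply mul_left_cancel₀ (mul_ne_zero h6 h5)
    linear_combination (n + c - b) * h4 - (c - b - 1) * h3 + (c - b - 1) * (a + n) * h1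

/-- As `contiguous_b`, for the pair `(₂F₁(a, b; c), ₂F₁(a, b + 1; c + 1))`. -/
theorem contiguous_bc (hc : 0 < c.re) (i : Fin 2) (n : ℕ) :
    (n + 1) * (![h a b c, h a (b + 1) (c + 1)] : Fin 2 → ℕ → ℂ) i (n + 1)
        - n * (![h a b c, h a (b + 1) (c + 1)] : Fin 2 → ℕ → ℂ) i n
      = ∑ j, ((![![0, 0], ![c, -c]] : Fin 2 → Fin 2 → ℂ) i j
          * (![h a b c, h a (b + 1) (c + 1)] : Fin 2 → ℕ → ℂ) j (n + 1)
        + (![![b, -b * (c - a) / c], ![0, a]] : Fin 2 → Fin 2 → ℂ) i j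
          * (![h a b c, h a (b + 1) (c + 1)] : Fin 2 → ℕ → ℂ) j n) := by
  have h1 := ordinaryHypergeometricCoefficient_add_one (a := a) (b := b) (c := c) n
  have h2 := ordinaryHypergeometricCoefficient_add_one' (a := a) (b := b + 1) hc n
  have h3 := ordinaryHypergeometricCoefficient_succ (a := a) (b := b) hc n
  have h4 := ordinaryHypergeometricCoefficient_succ (a := a) (b := b + 1) (c := c + 1)
    (by simpa using hc.trans (lt_add_one _)) n
  have h5 := add_natCast_ne_zero_of_re_pos hc n
  have h6 : (n + 1 : ℂ) ≠ 0 := by exact_mod_cast n.succ_ne_zero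
  have h7 : c ≠ 0 := by
    rintro rfl
    simp at hc
  have hk : -b * (c - a) / c * c = -b * (c - a) := div_mul_cancel₀ _ h7
  generalize -b * (c - a) / c = k at *
  generalize h a b c = f at *
  generalize h a (b + 1) c = g at *
  generalize h a (b + 1) (c + 1) = g' at *
  fin_cases i
  · simp [Fin.sum_univ_two]
    apply mul_left_cancel₀ (mul_ne_zero h7 h5)
    linear_combination c * h3 + b * (c - a) * h2 + c * (c - a) * h1 - (c + n) * g' n * hk
  · simp [Fin.sum_univ_two]
    apply mul_left_cancel₀ (mul_ne_zero h6 h5)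
    linear_combination (c + n) * h4 - c * h3 + (a + n) * (b * h2 + c * h1)

/-- As `contiguous_b`, for the pair `(₂F₁(a, b; c), ₂F₁(a, b; c + 1))`. -/
theorem contiguous_c (hc : 0 < c.re) (i : Fin 2) (n : ℕ) :
    (n + 1) * (![h a b c, h a b (c + 1)] : Fin 2 → ℕ → ℂ) i (n + 1)
        - n * (![h a b c, h a b (c + 1)] : Fin 2 → ℕ → ℂ) i n
      = ∑ j, ((![![0, 0], ![c, -c]] : Fin 2 → Fin 2 → ℂ) i j
          * (![h a b c, h a b (c + 1)] : Fin 2 → ℕ → ℂ) j (n + 1)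
        + (![![a + b - c, (c - a) * (c - b) / c], ![-c, c]] : Fin 2 → Fin 2 → ℂ) i j
          * (![h a b c, h a b (c + 1)] : Fin 2 → ℕ → ℂ) j n) := by
  have h2 := ordinaryHypergeometricCoefficient_add_one' (a := a) (b := b) hc n
  have h2' := ordinaryHypergeometricCoefficient_add_one' (a := a) (b := b) hc (n + 1)
  have h3 := ordinaryHypergeometricCoefficient_succ (a := a) (b := b) hc n
  have h5 := add_natCast_ne_zero_of_re_pos hc n
  have h7 : c ≠ 0 := by
    rintro rfl
    simp at hc
  push_cast at h2'
  have hk : (c - a) * (c - b) / c * c = (c - a) * (c - b) := div_mul_cancel₀ _ h7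
  generalize (c - a) * (c - b) / c = k at *
  generalize h a b c = f at *
  generalize h a b (c + 1) = g at *
  fin_cases i
  · simp [Fin.sum_univ_two]
    apply mul_left_cancel₀ (mul_ne_zero h7 h5)
    linear_combination c * h3 - (c - a) * (c - b) * h2 - (c + n) * g n * hk
  · simp [Fin.sum_univ_two]
    linear_combination h2' - h2

end Contiguous

/-! ### Logarithmic derivatives near the origin -/

/-- On a punctured neighbourhood of `0` the function `f` is differentiable with logarithmic
derivative `κ v`, and it tends to `1` at `0`. -/
structure NearUnit (κ f v : ℂ → ℂ) : Prop where
  tendsto : Tendsto f (𝓝[≠] 0) (𝓝 1)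
  hasDerivAt : ∀ᶠ t in 𝓝[≠] 0, HasDerivAt f (κ t * (f t * v t)) t

namespace NearUnit

variable {κ f g v w : ℂ → ℂ}

theorem eventually_ne_zero (hf : NearUnit κ f v) : ∀ᶠ t in 𝓝[≠] 0, f t ≠ 0 :=
  hf.tendsto.eventually_ne one_ne_zero

theorem mul (hf : NearUnit κ f v) (hg : NearUnit κ g w) :
    NearUnit κ (fun t => f t * g t) (fun t => v t + w t) := by
  refine ⟨by simpa using hf.tendsto.mul hg.tendsto, ?_⟩
  filter_upwards [hf.hasDerivAt, hg.hasDerivAt] with t h1 h2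
  exact (h1.mul h2).congr_deriv (by ring)

theorem div (hf : NearUnit κ f v) (hg : NearUnit κ g w) :
    NearUnit κ (fun t => f t / g t) (fun t => v t - w t) := by
  refine ⟨?_, ?_⟩
  · have h1 := hf.tendsto.div hg.tendsto one_ne_zero
    rw [div_one] at h1
    exact h1
  filter_upwards [hf.hasDerivAt, hg.hasDerivAt, hg.eventually_ne_zero] with t h1 h2 h3
  exact (h1.div h2 h3).congr_deriv (by field_simp)

theorem pow (hf : NearUnit κ f v) (n : ℕ) :
    NearUnit κ (fun t => f t ^ n) (fun t => n * v t) := by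
  refine ⟨by simpa using hf.tendsto.pow n, ?_⟩
  filter_upwards [hf.hasDerivAt] with t h1
  refine (h1.pow n).congr_deriv ?_
  cases n with
  | zero => simp
  | succ n =>
    simp only [Nat.add_sub_cancel]
    ring

theorem cpow (hf : NearUnit κ f v) (e : ℂ) :
    NearUnit κ (fun t => f t ^ e) (fun t => e * v t) := by
  have hs : ∀ᶠ t in 𝓝[≠] 0, f t ∈ Complex.slitPlane :=
    hf.tendsto.eventually_mem (Complex.isOpen_slitPlane.mem_nhds (by simp))
  refine ⟨?_, ?_⟩
  · have h1 : ContinuousAt (fun z : ℂ => z ^ e) 1 :=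
      continuousAt_id.cpow continuousAt_const (by simp)
    have h2 := h1.tendsto.comp hf.tendsto
    rw [Complex.one_cpow] at h2
    exact h2
  · filter_upwards [hf.hasDerivAt, hs, hf.eventually_ne_zero] with t h1 h2 h3
    refine (h1.cpow_const h2).congr_deriv ?_
    rw [Complex.cpow_sub _ _ h3, Complex.cpow_one]
    field_simp

end NearUnit

/-- A function tending to `0` at `0` with logarithmic derivative `κ θ`, with a simple zero. -/
structure NearZero (κ φ θ : ℂ → ℂ) : Prop where
  tendsto : ∃ r ≠ 0, Tendsto (fun t => φ t / t) (𝓝[≠] 0) (𝓝 r)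
  hasDerivAt : ∀ᶠ t in 𝓝[≠] 0, HasDerivAt φ (κ t * (φ t * θ t)) t

theorem NearZero.tendsto_zero {κ φ θ : ℂ → ℂ} (h : NearZero κ φ θ) :
    Tendsto φ (𝓝[≠] 0) (𝓝 0) := by
  obtain ⟨r, -, hr⟩ := h.tendsto
  have h1 := hr.mul (tendsto_id.mono_left nhdsWithin_le_nhds : Tendsto id (𝓝[≠] (0 : ℂ)) (𝓝 0))
  rw [mul_zero] at h1
  refine h1.congr' ?_
  filter_upwards [self_mem_nhdsWithin] with t ht
  exact div_mul_cancel₀ _ ht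

theorem NearZero.eventually_ne_zero {κ φ θ : ℂ → ℂ} (h : NearZero κ φ θ) :
    ∀ᶠ t in 𝓝[≠] 0, φ t ≠ 0 := by
  obtain ⟨r, hr0, hr⟩ := h.tendsto
  filter_upwards [hr.eventually_ne hr0] with t ht h0
  simp [h0] at ht

theorem update_analyticAt {f f' : ℂ → ℂ} {y : ℂ} (h : Tendsto f (𝓝[≠] 0) (𝓝 y))
    (h' : ∀ᶠ t in 𝓝[≠] 0, HasDerivAt f (f' t) t) : AnalyticAt ℂ (Function.update f 0 y) 0 := by
  apply Complex.analyticAt_of_differentiable_on_punctured_nhds_of_continuousAt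
  · filter_upwards [h', self_mem_nhdsWithin] with t h1 h2
    refine h1.differentiableAt.congr_of_eventuallyEq ?_
    filter_upwards [isOpen_ne.mem_nhds h2] with s hs
    exact Function.update_of_ne hs _ _
  · rwa [continuousAt_update_same]

/-- Solutions, near the simple zero `0` of `φ`, of the pull-back of a system satisfied by two
power series. -/
theorem NearUnit.hasPowerSeries_comp {κ φ θ : ℂ → ℂ} {A B : Fin 2 → Fin 2 → ℂ}
    {R v : Fin 2 → ℂ → ℂ} {g : Fin 2 → ℕ → ℂ} (hR : ∀ i, NearUnit κ (R i) (v i))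
    (hφ : NearZero κ φ θ)
    (hode : ∀ᶠ t in 𝓝[≠] 0, ∀ i,
      (1 - φ t) * (R i t * v i t) = θ t * ∑ j, (A i j + B i j * φ t) * R j t)
    (hA : ∀ i, ∑ j, A i j = 0) (h0 : ∀ i, g i 0 = 1)
    (hg : ∀ i (n : ℕ), (n + 1) * g i (n + 1) - n * g i n
      = ∑ j, (A i j * g j (n + 1) + B i j * g j n))
    (hdet : ∀ n : ℕ, (n + 1 - A 0 0) * (n + 1 - A 1 1) - A 0 1 * A 1 0 ≠ 0) :
    ∃ F : Fin 2 → ℂ → ℂ, (∀ i, HasPowerSeries (F i) (g i)) ∧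
      ∀ᶠ t in 𝓝[≠] 0, ∀ i, R i t = F i (φ t) := by
  obtain ⟨r, hr0, hr⟩ := hφ.tendsto
  let φ₁ := Function.update φ 0 0
  have hφ₁ : AnalyticAt ℂ φ₁ 0 := update_analyticAt hφ.tendsto_zero hφ.hasDerivAt
  have hφ₁0 : φ₁ 0 = 0 := Function.update_self ..
  have hφ₁t : ∀ t, t ≠ 0 → φ₁ t = φ t := fun t ht => Function.update_of_ne ht _ _
  have hφ₁' : deriv φ₁ 0 ≠ 0 := by
    have h1 := hasDerivAt_iff_tendsto_slope.mp hφ₁.differentiableAt.hasDerivAt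
    have h2 : Tendsto (slope φ₁ 0) (𝓝[≠] 0) (𝓝 r) := by
      refine hr.congr' ?_
      filter_upwards [self_mem_nhdsWithin] with t ht
      rw [slope_def_field, hφ₁0, hφ₁t t ht, sub_zero, sub_zero]
    rwa [tendsto_nhds_unique h1 h2]
  let ψ := hφ₁.hasStrictDerivAt.localInverse φ₁ _ 0 hφ₁'
  have hψ : AnalyticAt ℂ ψ 0 := by
    have := hφ₁.analyticAt_localInverse hφ₁'
    rwa [hφ₁0] at this
  have hψl : ∀ᶠ t in 𝓝 0, ψ (φ₁ t) = t := HasStrictDerivAt.eventually_left_inverse ..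
  have hψr : ∀ᶠ z in 𝓝 0, φ₁ (ψ z) = z := by
    have := hφ₁.hasStrictDerivAt.eventually_right_inverse (hf' := hφ₁')
    rwa [hφ₁0] at this
  have hψ0 : ψ 0 = 0 := by
    have := hψl.self_of_nhds
    rwa [hφ₁0] at this
  have hψt : Tendsto ψ (𝓝 0) (𝓝 0) := by
    have := hψ.continuousAt.tendsto
    rwa [hψ0] at this
  let G : Fin 2 → ℂ → ℂ := fun i => Function.update (R i) 0 1
  have hG : ∀ i, AnalyticAt ℂ (G i) 0 := fun i =>
    update_analyticAt (hR i).tendsto (hR i).hasDerivAt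
  have hGt : ∀ i t, t ≠ 0 → G i t = R i t := fun i t ht => Function.update_of_ne ht _ _
  have hG0 : ∀ i, G i 0 = 1 := fun i => Function.update_self ..
  have hev : ∀ᶠ t in 𝓝 0, t ≠ 0 → φ t ≠ 0 ∧ (∀ i,
      (1 - φ t) * (R i t * v i t) = θ t * ∑ j, (A i j + B i j * φ t) * R j t) ∧
      HasDerivAt φ (κ t * (φ t * θ t)) t ∧
      ∀ i, HasDerivAt (R i) (κ t * (R i t * v i t)) t := by
    have h1 : ∀ᶠ t in 𝓝[≠] 0, ∀ i, HasDerivAt (R i) (κ t * (R i t * v i t)) t :=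
      eventually_all.mpr fun i => (hR i).hasDerivAt
    have := (hφ.eventually_ne_zero.and (hode.and (hφ.hasDerivAt.and h1)))
    rw [eventually_nhdsWithin_iff] at this
    exact this
  refine ⟨fun i z => G i (ψ z), fun i => ?_, ?_⟩
  · refine system_unique (F := fun i z => G i (ψ z)) (A := A) (B := B) (g := g) (fun i => ?_) ?_
      (fun i => ?_) hg hdet i
    · exact AnalyticAt.fun_comp (by rw [hψ0]; exact hG i) hψ
    · filter_upwards [hψt.eventually hev, hψr, hψr.eventually_nhds, hψ.eventually_analyticAt]
        with z h1 h2 h2' h3 i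
      by_cases hz : ψ z = 0
      · have hz0 : z = 0 := by rw [← h2, hz, hφ₁0]
        have h4 := hA i
        rw [Fin.sum_univ_two] at h4 ⊢
        rw [hz0, hψ0, hG0, hG0]
        linear_combination -h4
      · obtain ⟨hne, h4, h5, h6⟩ := h1 hz
        have hn : ∀ᶠ s in 𝓝 (ψ z), s ≠ 0 := isOpen_ne.mem_nhds hz
        have h7 : HasDerivAt φ₁ (κ (ψ z) * (φ (ψ z) * θ (ψ z))) (ψ z) :=
          h5.congr_of_eventuallyEq (hn.mono fun s hs => hφ₁t s hs)
        have h8 : HasDerivAt (G i) (κ (ψ z) * (R i (ψ z) * v i (ψ z))) (ψ z) :=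
          (h6 i).congr_of_eventuallyEq (hn.mono fun s hs => hGt i s hs)
        have h9 := h3.differentiableAt.hasDerivAt
        have h10 : κ (ψ z) * (φ (ψ z) * θ (ψ z)) * deriv ψ z = 1 := by
          have h11 := (h7.comp z h9).congr_of_eventuallyEq
            (h2'.mono fun s hs => hs.symm : (fun s => s) =ᶠ[𝓝 z] φ₁ ∘ ψ)
          exact h11.unique (hasDerivAt_id z)
        have h12 := (h8.comp z h9).deriv
        change deriv (fun s => G i (ψ s)) z = _ at h12
        have h13 : φ (ψ z) = z := by rw [← hφ₁t _ hz, h2]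
        rw [h12]
        simp only [hGt _ _ hz]
        have h4' := h4 i
        rw [h13] at h4' h10
        linear_combination (κ (ψ z) * deriv ψ z * z) * h4'
          + (∑ j, (A i j + B i j * z) * R j (ψ z)) * h10
    · rw [hψ0, hG0, h0]
  · have : ∀ᶠ t in 𝓝[≠] 0, ψ (φ₁ t) = t := hψl.filter_mono nhdsWithin_le_nhds
    filter_upwards [this, self_mem_nhdsWithin] with t h1 ht i
    rw [← hφ₁t t ht, h1, hGt i t ht]

/-! ### Evaluation of pairs of contiguous hypergeometric functions -/

theorem ordinaryHypergeometric_comm (a b c z : ℂ) : ₂F₁ a b c z = ₂F₁ b a c z := by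
  simp only [ordinaryHypergeometric, ordinaryHypergeometricSeries_symm a b c]

section Pairs

variable {κ R v w l φ θ ρ : ℂ → ℂ} {a b c : ℂ}

theorem NearUnit.eventually_eq_ordinaryHypergeometric {A B : Fin 2 → Fin 2 → ℂ}
    {a₁ b₁ c₁ a₂ b₂ c₂ : ℂ}
    (hR : NearUnit κ R v) (hw : NearUnit κ w l) (hφ : NearZero κ φ θ)
    (hode₁ : ∀ᶠ t in 𝓝[≠] 0, (1 - φ t) * v t
      = θ t * ((A 0 0 + B 0 0 * φ t) + (A 0 1 + B 0 1 * φ t) * w t))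
    (hode₂ : ∀ᶠ t in 𝓝[≠] 0, (1 - φ t) * ((v t + l t) * w t)
      = θ t * ((A 1 0 + B 1 0 * φ t) + (A 1 1 + B 1 1 * φ t) * w t))
    (hA₁ : A 0 0 + A 0 1 = 0) (hA₂ : A 1 0 + A 1 1 = 0)
    (hg : ∀ i (n : ℕ),
      (n + 1) * ![ordinaryHypergeometricCoefficient a₁ b₁ c₁,
          ordinaryHypergeometricCoefficient a₂ b₂ c₂] i (n + 1)
        - n * ![ordinaryHypergeometricCoefficient a₁ b₁ c₁,
          ordinaryHypergeometricCoefficient a₂ b₂ c₂] i n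
      = ∑ j, (A i j * ![ordinaryHypergeometricCoefficient a₁ b₁ c₁,
          ordinaryHypergeometricCoefficient a₂ b₂ c₂] j (n + 1)
        + B i j * ![ordinaryHypergeometricCoefficient a₁ b₁ c₁,
          ordinaryHypergeometricCoefficient a₂ b₂ c₂] j n))
    (hdet : ∀ n : ℕ, (n + 1 - A 0 0) * (n + 1 - A 1 1) - A 0 1 * A 1 0 ≠ 0) :
    ∀ᶠ t in 𝓝[≠] 0, ₂F₁ a₁ b₁ c₁ (φ t) = R t ∧ ₂F₁ a₂ b₂ c₂ (φ t) = R t * w t := by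
  obtain ⟨F, hF, hRF⟩ := NearUnit.hasPowerSeries_comp
    (R := ![R, fun t => R t * w t]) (v := ![v, fun t => v t + l t]) (A := A) (B := B)
    (g := ![ordinaryHypergeometricCoefficient a₁ b₁ c₁,
      ordinaryHypergeometricCoefficient a₂ b₂ c₂])
    (Fin.forall_fin_two.mpr ⟨hR, hR.mul hw⟩) hφ
    (by
      filter_upwards [hode₁, hode₂] with t h1 h2
      refine Fin.forall_fin_two.mpr ⟨?_, ?_⟩
      · simp only [Fin.sum_univ_two, Matrix.cons_val_zero, Matrix.cons_val_one]
        linear_combination R t * h1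
      · simp only [Fin.sum_univ_two, Matrix.cons_val_zero, Matrix.cons_val_one]
        linear_combination R t * h2)
    (Fin.forall_fin_two.mpr ⟨by rw [Fin.sum_univ_two, hA₁], by rw [Fin.sum_univ_two, hA₂]⟩)
    (Fin.forall_fin_two.mpr ⟨ordinaryHypergeometricCoefficient_zero,
      ordinaryHypergeometricCoefficient_zero⟩) hg hdet
  have h1 := (hF 0).eq_ordinaryHypergeometric
  have h2 := (hF 1).eq_ordinaryHypergeometric
  filter_upwards [hRF, hφ.tendsto_zero.eventually h1, hφ.tendsto_zero.eventually h2]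
    with t h3 h4 h5
  have h6 := h3 0
  have h7 := h3 1
  simp only [Matrix.cons_val_zero, Matrix.cons_val_one] at h6 h7
  exact ⟨by rw [h6, h4], by rw [h7, h5]⟩

/-- Criterion for the pair `(₂F₁(a, b; c), ₂F₁(a, b + 1; c))`; here `ρ = θ φ / (1 - φ)`. -/
theorem NearUnit.eventually_eq_contiguous_b (hc : 0 < c.re)
    (hR : NearUnit κ R v) (hw : NearUnit κ w l) (hφ : NearZero κ φ θ)
    (hode : ∀ᶠ t in 𝓝[≠] 0, ρ t * (1 - φ t) = θ t * φ t ∧ v t = b * θ t * (w t - 1) ∧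
      (l t + v t) * w t = (θ t + ρ t) * (c - b - 1) * (1 - w t) + a * ρ t * w t) :
    ∀ᶠ t in 𝓝[≠] 0, ₂F₁ a b c (φ t) = R t ∧ ₂F₁ a (b + 1) c (φ t) = R t * w t := by
  refine NearUnit.eventually_eq_ordinaryHypergeometric hR hw hφ ?_ ?_ ?_ ?_
    (contiguous_b (a := a) (b := b) hc) fun n => ?_
  · filter_upwards [hode] with t ⟨h1, h2, h3⟩
    simp
    linear_combination (1 - φ t) * h2
  · filter_upwards [hode] with t ⟨h1, h2, h3⟩
    simp
    linear_combination (1 - φ t) * h3 + ((c - b - 1) * (1 - w t) + a * w t) * h1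
  · simp
  · simp
    ring
  · have h1 := mul_ne_zero (n.cast_add_one_ne_zero (R := ℂ)) (add_natCast_ne_zero_of_re_pos hc n)
    convert h1 using 1
    simp only [Matrix.cons_val]
    ring

/-- Criterion for the pair `(₂F₁(a, b; c), ₂F₁(a, b + 1; c + 1))`; here `ρ = θ φ / (1 - φ)`. -/
theorem NearUnit.eventually_eq_contiguous_bc (hc : 0 < c.re)
    (hR : NearUnit κ R v) (hw : NearUnit κ w l) (hφ : NearZero κ φ θ)
    (hode : ∀ᶠ t in 𝓝[≠] 0, ρ t * (1 - φ t) = θ t * φ t ∧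
      v t = ρ t * (b - b * (c - a) / c * w t) ∧
      (l t + v t) * w t = (θ t + ρ t) * c * (1 - w t) + a * ρ t * w t) :
    ∀ᶠ t in 𝓝[≠] 0, ₂F₁ a b c (φ t) = R t ∧ ₂F₁ a (b + 1) (c + 1) (φ t) = R t * w t := by
  refine NearUnit.eventually_eq_ordinaryHypergeometric hR hw hφ ?_ ?_ ?_ ?_
    (contiguous_bc (a := a) (b := b) hc) fun n => ?_
  · filter_upwards [hode] with t ⟨h1, h2, h3⟩
    simp
    linear_combination (1 - φ t) * h2 + (b - b * (c - a) / c * w t) * h1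
  · filter_upwards [hode] with t ⟨h1, h2, h3⟩
    simp
    linear_combination (1 - φ t) * h3 + (c * (1 - w t) + a * w t) * h1
  · simp
  · simp
  · have h1 := mul_ne_zero (n.cast_add_one_ne_zero (R := ℂ)) (add_natCast_ne_zero_of_re_pos
      (c := c + 1) (by simpa using hc.trans (lt_add_one _)) n)
    convert h1 using 1
    simp only [Matrix.cons_val]
    ring

/-- Criterion for the pair `(₂F₁(a, b; c), ₂F₁(a, b; c + 1))`; here `ρ = θ φ / (1 - φ)`. -/
theorem NearUnit.eventually_eq_contiguous_c (hc : 0 < c.re)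
    (hR : NearUnit κ R v) (hw : NearUnit κ w l) (hφ : NearZero κ φ θ)
    (hode : ∀ᶠ t in 𝓝[≠] 0, ρ t * (1 - φ t) = θ t * φ t ∧
      v t = ρ t * (a + b - c + (c - a) * (c - b) / c * w t) ∧
      (l t + v t) * w t = θ t * c * (1 - w t)) :
    ∀ᶠ t in 𝓝[≠] 0, ₂F₁ a b c (φ t) = R t ∧ ₂F₁ a b (c + 1) (φ t) = R t * w t := by
  refine NearUnit.eventually_eq_ordinaryHypergeometric hR hw hφ ?_ ?_ ?_ ?_
    (contiguous_c (a := a) (b := b) hc) fun n => ?_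
  · filter_upwards [hode] with t ⟨h1, h2, h3⟩
    simp
    linear_combination (1 - φ t) * h2 + (a + b - c + (c - a) * (c - b) / c * w t) * h1
  · filter_upwards [hode] with t ⟨h1, h2, h3⟩
    simp
    linear_combination (1 - φ t) * h3
  · simp
  · simp
  · have h1 := mul_ne_zero (n.cast_add_one_ne_zero (R := ℂ)) (add_natCast_ne_zero_of_re_pos
      (c := c + 1) (by simpa using hc.trans (lt_add_one _)) n)
    convert h1 using 1
    simp only [Matrix.cons_val]
    ring

end Pairs

theorem eventually_nhds_of_punctured {P : ℂ → Prop} (h : ∀ᶠ t in 𝓝[≠] 0, P t) :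
    ∀ᶠ t in 𝓝[≠] 0, ∀ᶠ s in 𝓝 t, P s := by
  filter_upwards [eventually_eventually_nhdsWithin.mpr h, self_mem_nhdsWithin] with t h1 h2
  rwa [isOpen_compl_singleton.nhdsWithin_eq h2] at h1

/-! ### A local parameter of the curve at the origin -/

/-- Near the origin the curve `ξ² = x (1 + b x + a x²)` is parametrized by `t = ξ`, and `κ` is
the derivation `d/dt` divided by the one that sends `x` to `2 ξ`. -/
structure IsLocalParametrization (a b : ℂ) (x κ : ℂ → ℂ) : Prop where
  sq : ∀ᶠ t in 𝓝[≠] 0, t ^ 2 = x t * (1 + b * x t + a * x t ^ 2)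
  tendsto_div_sq : Tendsto (fun t => x t / t ^ 2) (𝓝[≠] 0) (𝓝 1)
  hasDerivAt : ∀ᶠ t in 𝓝[≠] 0, HasDerivAt x (κ t * (2 * t)) t
  kappa : ∀ᶠ t in 𝓝[≠] 0, κ t * (1 + 2 * b * x t + 3 * a * x t ^ 2) = 1
  eventually_eq : ∀ᶠ z : ℂ × ℂ in 𝓝 0, z.2 ^ 2 = z.1 * (1 + b * z.1 + a * z.1 ^ 2) →
    z.1 = x z.2
  map_zero : x 0 = 0

theorem exists_isLocalParametrization (a b : ℂ) : ∃ x κ, IsLocalParametrization a b x κ := by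
  let f : ℂ → ℂ := fun x => x * (1 + b * x + a * x ^ 2)
  have hf' : ∀ x, HasStrictDerivAt f (1 + 2 * b * x + 3 * a * x ^ 2) x := fun x => by
    refine ((hasStrictDerivAt_id x).mul ((((hasStrictDerivAt_id x).const_mul b).const_add 1).add
      (((hasStrictDerivAt_id x).pow 2).const_mul a))).congr_deriv ?_
    simp only [id, Pi.add_apply, Pi.pow_apply]
    push_cast
    ring
  have h1 : HasStrictDerivAt f 1 0 := by simpa using hf' 0
  have hf0 : f 0 = 0 := by simp [f]
  let g := h1.localInverse f 1 0 one_ne_zero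
  have hgl : ∀ᶠ x in 𝓝 0, g (f x) = x := HasStrictDerivAt.eventually_left_inverse ..
  have hgr : ∀ᶠ y in 𝓝 0, f (g y) = y := by
    have := h1.eventually_right_inverse (hf' := one_ne_zero)
    rwa [hf0] at this
  have hg0 : g 0 = 0 := by
    have := hgl.self_of_nhds
    rwa [hf0] at this
  have hgd : HasStrictDerivAt g 1 0 := by
    have := h1.to_localInverse (hf' := one_ne_zero)
    rw [hf0, inv_one] at this
    exact this
  have hgan : AnalyticAt ℂ g 0 := by
    have hfan : AnalyticAt ℂ f 0 := by fun_prop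
    have h2 : deriv f 0 ≠ 0 := by
      rw [h1.hasDerivAt.deriv]
      exact one_ne_zero
    have h3 := hfan.analyticAt_localInverse h2
    rw [hf0] at h3
    refine h3.congr ?_
    have h4 : Tendsto (hfan.hasStrictDerivAt.localInverse f _ 0 h2) (𝓝 0) (𝓝 0) := by
      have h5 := h3.continuousAt.tendsto
      have h6 := (hfan.hasStrictDerivAt.eventually_left_inverse h2).self_of_nhds
      rw [hf0] at h6
      rwa [h6] at h5
    have h5 := hfan.hasStrictDerivAt.eventually_right_inverse h2
    rw [hf0] at h5
    filter_upwards [h4.eventually hgl, h5] with y h6 h7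
    rw [h7] at h6
    exact h6.symm
  have hsq : Tendsto (fun t : ℂ => t ^ 2) (𝓝 0) (𝓝 0) := by
    simpa using (continuous_pow 2).tendsto (0 : ℂ)
  have hg : Tendsto g (𝓝 0) (𝓝 0) := by
    have := hgan.continuousAt.tendsto
    rwa [hg0] at this
  have hkey : ∀ᶠ y in 𝓝 0, HasDerivAt g (deriv g y) y ∧
      deriv g y * (1 + 2 * b * g y + 3 * a * g y ^ 2) = 1 := by
    filter_upwards [hgan.eventually_analyticAt, hgr.eventually_nhds] with y h2 h3
    have h4 := h2.differentiableAt.hasDerivAt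
    refine ⟨h4, ?_⟩
    have h5 := ((hf' (g y)).hasDerivAt.comp y h4).congr_of_eventuallyEq
      (h3.mono fun s hs => hs.symm : (fun s => s) =ᶠ[𝓝 y] f ∘ g)
    rw [mul_comm]
    exact h5.unique (hasDerivAt_id y)
  have hle : 𝓝[≠] (0 : ℂ) ≤ 𝓝 0 := nhdsWithin_le_nhds
  refine ⟨fun t => g (t ^ 2), fun t => deriv g (t ^ 2), ?_, ?_, ?_, ?_, ?_, ?_⟩
  · filter_upwards [(hsq.eventually hgr).filter_mono hle] with t ht
    exact ht.symm
  · have h2 : Tendsto (fun t : ℂ => t ^ 2) (𝓝[≠] 0) (𝓝[≠] 0) := by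
      refine tendsto_nhdsWithin_iff.mpr ⟨hsq.mono_left hle, ?_⟩
      filter_upwards [self_mem_nhdsWithin] with t ht
      exact pow_ne_zero 2 ht
    refine ((hasDerivAt_iff_tendsto_slope.mp hgd.hasDerivAt).comp h2).congr fun t => ?_
    simp [slope_def_field, hg0]
  · filter_upwards [(hsq.eventually hkey).filter_mono hle] with t ht
    refine (ht.1.comp t (hasDerivAt_pow 2 t)).congr_deriv ?_
    simp
  · filter_upwards [(hsq.eventually hkey).filter_mono hle] with t ht
    exact ht.2
  · have h2 : Tendsto (fun z : ℂ × ℂ => z.1) (𝓝 0) (𝓝 0) := continuous_fst.tendsto' _ _ rfl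
    filter_upwards [h2.eventually hgl] with z hz h3
    rw [h3]
    exact hz.symm
  · simp [hg0]

namespace IsLocalParametrization

variable {a b : ℂ} {x κ : ℂ → ℂ}

theorem nearOrigin (h : IsLocalParametrization a b x κ) {f : ℂ → ℂ}
    (hf : ∀ x, f x = x * (1 + b * x + a * x ^ 2)) {P : ℂ → ℂ → Prop}
    (hP : ∀ᶠ t in 𝓝[≠] 0, P (x t) t) : NearOrigin f P := by
  unfold NearOrigin
  rw [eventually_nhdsWithin_iff] at hP ⊢
  have h2 : Tendsto (fun z : ℂ × ℂ => z.2) (𝓝 0) (𝓝 0) := continuous_snd.tendsto' _ _ rfl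
  filter_upwards [h.eventually_eq, h2.eventually hP] with z h3 h4 ⟨h5, h6⟩
  rw [hf] at h5
  have h7 := h3 h5
  rw [h7]
  refine h4 fun h0 : z.2 = 0 => h6 ?_
  rw [h0, h.map_zero] at h7
  exact Prod.ext h7 h0

theorem tendsto_div (h : IsLocalParametrization a b x κ) :
    Tendsto (fun t => x t / t) (𝓝[≠] 0) (𝓝 0) := by
  have h1 := h.tendsto_div_sq.mul
    (tendsto_id.mono_left nhdsWithin_le_nhds : Tendsto id (𝓝[≠] (0 : ℂ)) (𝓝 0))
  rw [mul_zero] at h1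
  refine h1.congr' ?_
  filter_upwards [self_mem_nhdsWithin] with t (ht : t ≠ 0)
  simp only [id]
  field_simp

theorem tendsto (h : IsLocalParametrization a b x κ) : Tendsto x (𝓝[≠] 0) (𝓝 0) := by
  have h1 := h.tendsto_div.mul
    (tendsto_id.mono_left nhdsWithin_le_nhds : Tendsto id (𝓝[≠] (0 : ℂ)) (𝓝 0))
  rw [mul_zero] at h1
  refine h1.congr' ?_
  filter_upwards [self_mem_nhdsWithin] with t (ht : t ≠ 0)
  exact div_mul_cancel₀ _ ht

theorem eventually_ne_zero (h : IsLocalParametrization a b x κ) : ∀ᶠ t in 𝓝[≠] 0, x t ≠ 0 := by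
  filter_upwards [h.tendsto_div_sq.eventually_ne one_ne_zero] with t ht h0
  simp [h0] at ht

theorem eventually_ne (h : IsLocalParametrization a b x κ) {p : ℂ → ℂ} (hp : ContinuousAt p 0)
    (h0 : p 0 ≠ 0) : ∀ᶠ t in 𝓝[≠] 0, p (x t) ≠ 0 :=
  h.tendsto.eventually (hp.eventually_ne h0)

theorem nearUnit (h : IsLocalParametrization a b x κ) {f v : ℂ → ℂ} (c₁ c₂ c₃ c₄ c₅ : ℂ)
    (hf : ∀ t, f t = 1 + c₁ * t + c₂ * x t + c₃ * (x t * t) + c₄ * x t ^ 2 + c₅ * t ^ 2)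
    (hv : ∀ᶠ t in 𝓝[≠] 0, f t * v t = 2 * t * (c₂ + c₃ * t + 2 * c₄ * x t)
      + (1 + 2 * b * x t + 3 * a * x t ^ 2) * (c₁ + c₃ * x t + 2 * c₅ * t)) :
    NearUnit κ f v := by
  have ht : Tendsto id (𝓝[≠] (0 : ℂ)) (𝓝 0) := tendsto_id.mono_left nhdsWithin_le_nhds
  obtain rfl := funext hf
  refine ⟨?_, ?_⟩
  · have h1 := (((((tendsto_const_nhds (x := (1 : ℂ))).add (ht.const_mul c₁)).add
      (h.tendsto.const_mul c₂)).add ((h.tendsto.mul ht).const_mul c₃)).add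
      ((h.tendsto.pow 2).const_mul c₄)).add ((ht.pow 2).const_mul c₅)
    simpa using h1
  · filter_upwards [hv, h.hasDerivAt, h.kappa] with t h1 h2 h3
    rw [h1]
    have h4 := hasDerivAt_id t
    refine ((((((hasDerivAt_const t (1 : ℂ)).add (h4.const_mul c₁)).add
      (h2.const_mul c₂)).add ((h2.mul h4).const_mul c₃)).add
      ((h2.pow 2).const_mul c₄)).add ((h4.pow 2).const_mul c₅)).congr_deriv ?_
    simp only [id]
    push_cast
    linear_combination (-(c₁ + c₃ * x t + 2 * c₅ * t)) * h3

theorem nearUnit_div (h : IsLocalParametrization a b x κ) {f v : ℂ → ℂ} (c d : ℂ)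
    (hf : ∀ᶠ t in 𝓝[≠] 0, f t * t = t + c * x t + d * x t ^ 2)
    (hv : ∀ᶠ t in 𝓝[≠] 0, f t * v t * t ^ 2 = 2 * t ^ 2 * (c + 2 * d * x t)
      - (c * x t + d * x t ^ 2) * (1 + 2 * b * x t + 3 * a * x t ^ 2)) :
    NearUnit κ f v := by
  have hf2 : ∀ᶠ t in 𝓝[≠] 0, f t = 1 + (c * x t + d * x t ^ 2) / t := by
    filter_upwards [hf, self_mem_nhdsWithin] with t h1 (h2 : t ≠ 0)
    field_simp
    linear_combination h1
  refine ⟨?_, ?_⟩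
  · have h1 := (tendsto_const_nhds (x := (1 : ℂ))).add ((h.tendsto_div.const_mul c).add
      ((h.tendsto.mul h.tendsto_div).const_mul d))
    simp only [mul_zero, add_zero] at h1
    refine h1.congr' ?_
    filter_upwards [hf2] with t h2
    rw [h2]
    ring
  · have hf3 : ∀ᶠ t in 𝓝[≠] 0, f =ᶠ[𝓝 t] fun t => 1 + (c * x t + d * x t ^ 2) / t :=
      eventually_nhds_of_punctured hf2
    filter_upwards [hv, hf3, h.hasDerivAt, h.kappa, self_mem_nhdsWithin]
      with t h1 h0 h2 h3 (h5 : t ≠ 0)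
    have h4 := hasDerivAt_id t
    refine HasDerivAt.congr_of_eventuallyEq ?_ h0
    refine (((((h2.const_mul c).add ((h2.pow 2).const_mul d)).div h4 h5)).const_add 1).congr_deriv ?_
    simp only [id]
    push_cast
    field_simp
    simp only [Pi.add_apply, Pi.pow_apply]
    linear_combination (-κ t) * h1 + (c * x t + d * x t ^ 2) * h3

theorem nearUnit_div_sq (h : IsLocalParametrization a b x κ) {v : ℂ → ℂ}
    (hv : ∀ᶠ t in 𝓝[≠] 0, x t * v t * t = 2 * t ^ 2
      - 2 * x t * (1 + 2 * b * x t + 3 * a * x t ^ 2)) :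
    NearUnit κ (fun t => x t / t ^ 2) v := by
  refine ⟨h.tendsto_div_sq, ?_⟩
  filter_upwards [hv, h.hasDerivAt, h.kappa, self_mem_nhdsWithin] with t h1 h2 h3 (h5 : t ≠ 0)
  refine (h2.div ((hasDerivAt_id t).pow 2) (pow_ne_zero 2 h5)).congr_deriv ?_
  simp only [id, Pi.pow_apply]
  push_cast
  field_simp
  linear_combination (-κ t) * h1 + (2 * x t) * h3

theorem nearZero (h : IsLocalParametrization a b x κ) {f v φ θ : ℂ → ℂ} {r : ℂ} (hr : r ≠ 0)
    (hf : NearUnit κ f v) (hφ : ∀ᶠ t in 𝓝[≠] 0, φ t = r * t * f t)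
    (hθ : ∀ᶠ t in 𝓝[≠] 0, θ t * t = v t * t + (1 + 2 * b * x t + 3 * a * x t ^ 2)) :
    NearZero κ φ θ := by
  refine ⟨⟨r, hr, ?_⟩, ?_⟩
  · have h1 := hf.tendsto.const_mul r
    rw [mul_one] at h1
    refine h1.congr' ?_
    filter_upwards [hφ, self_mem_nhdsWithin] with t h2 (h5 : t ≠ 0)
    rw [h2]
    field_simp
  · have hf3 : ∀ᶠ t in 𝓝[≠] 0, φ =ᶠ[𝓝 t] fun t => r * t * f t :=
      eventually_nhds_of_punctured hφ
    filter_upwards [hθ, hf3, hf.hasDerivAt, h.kappa] with t h1 h0 h2 h3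
    refine HasDerivAt.congr_of_eventuallyEq ?_ h0
    refine (((hasDerivAt_id t).const_mul r).mul h2).congr_deriv ?_
    rw [h0.self_of_nhds]
    simp only [id]
    linear_combination (-κ t * r * f t) * h1 + (-r * f t) * h3

end IsLocalParametrization

theorem NearUnit.congr {κ f g v w : ℂ → ℂ} (hf : NearUnit κ f v)
    (h : ∀ᶠ t in 𝓝[≠] 0, f t = g t ∧ v t = w t) : NearUnit κ g w := by
  refine ⟨hf.tendsto.congr' (h.mono fun t ht => ht.1), ?_⟩
  have hf3 : ∀ᶠ t in 𝓝[≠] 0, g =ᶠ[𝓝 t] f :=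
    (eventually_nhds_of_punctured h).mono fun t ht =>
      ht.mono fun s hs => hs.1.symm
  filter_upwards [h, hf3, hf.hasDerivAt] with t h1 h2 h3
  rw [← h1.1, ← h1.2]
  exact h3.congr_of_eventuallyEq h2

section Cpow

variable {z e e' : ℂ}

theorem exists_cpow_eq (hz : z ≠ 0) (e : ℂ) : ∃ y, y ≠ 0 ∧ z ^ e = y :=
  ⟨z ^ e, by simp [Complex.cpow_eq_zero_iff, hz], rfl⟩

theorem exists_cpow_eq_div (hz : z ≠ 0) (n : ℕ) (h : e' = n - e) :
    ∃ y, y ≠ 0 ∧ z ^ e = y ∧ z ^ e' = z ^ n / y :=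
  ⟨z ^ e, by simp [Complex.cpow_eq_zero_iff, hz], rfl, by
    rw [h, Complex.cpow_sub _ _ hz, Complex.cpow_natCast]⟩

theorem exists_cpow_eq_mul (hz : z ≠ 0) (n : ℕ) (h : e' = n + e) :
    ∃ y, y ≠ 0 ∧ z ^ e = y ∧ z ^ e' = z ^ n * y :=
  ⟨z ^ e, by simp [Complex.cpow_eq_zero_iff, hz], rfl, by
    rw [h, Complex.cpow_add _ _ hz, Complex.cpow_natCast]⟩

end Cpow

/-! ### Normal forms `(a + b ξ) / d` of functions on a curve `ξ² = g` -/

/-- The element `y` equals `(a + b ξ) / d`. -/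
structure IsRep {F : Type*} [Field F] (ξ d y a b : F) : Prop where
  ne_zero : d ≠ 0
  eq : d * y = a + b * ξ

namespace IsRep

variable {F : Type*} [Field F] {ξ g : F} {d y a b d₁ y₁ a₁ b₁ d₂ y₂ a₂ b₂ d₃ y₃ a₃ b₃ : F}

theorem of_div {n : F} (hd : d ≠ 0) (hn : n = a + b * ξ := by ring) : IsRep ξ d (n / d) a b :=
  ⟨hd, by rw [mul_div_cancel₀ _ hd, hn]⟩

theorem mul (hξ : ξ ^ 2 = g) (h₁ : IsRep ξ d₁ y₁ a₁ b₁) (h₂ : IsRep ξ d₂ y₂ a₂ b₂) (hd : d ≠ 0 := by exact one_ne_zero)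
    (e₀ : d * (a₁ * a₂ + b₁ * b₂ * g) = a * (d₁ * d₂) := by ring)
    (e₁ : d * (a₁ * b₂ + b₁ * a₂) = b * (d₁ * d₂) := by ring) : IsRep ξ d (y₁ * y₂) a b := by
  refine ⟨hd, mul_left_cancel₀ (mul_ne_zero h₁.1 h₂.1) ?_⟩
  linear_combination d * (d₂ * y₂) * h₁.2 + d * (a₁ + b₁ * ξ) * h₂.2 + e₀ + ξ * e₁
    + d * b₁ * b₂ * hξ

theorem sq (hξ : ξ ^ 2 = g) (h : IsRep ξ d₁ y₁ a₁ b₁) (hd : d ≠ 0 := by exact one_ne_zero)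
    (e₀ : d * (a₁ ^ 2 + b₁ ^ 2 * g) = a * d₁ ^ 2 := by ring) (e₁ : d * (2 * a₁ * b₁) = b * d₁ ^ 2 := by ring) :
    IsRep ξ d (y₁ ^ 2) a b := by
  rw [pow_two]
  exact h.mul hξ h hd (by linear_combination e₀) (by linear_combination e₁)

theorem pow_succ {n : ℕ} (hξ : ξ ^ 2 = g) (h₁ : IsRep ξ d₁ (y ^ n) a₁ b₁)
    (h₂ : IsRep ξ d₂ y a₂ b₂) (hd : d ≠ 0 := by exact one_ne_zero)
    (e₀ : d * (a₁ * a₂ + b₁ * b₂ * g) = a * (d₁ * d₂) := by ring)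
    (e₁ : d * (a₁ * b₂ + b₁ * a₂) = b * (d₁ * d₂) := by ring) : IsRep ξ d (y ^ (n + 1)) a b := by
  rw [_root_.pow_succ]
  exact h₁.mul hξ h₂ hd e₀ e₁

theorem one_sub (h : IsRep ξ d y a b) : IsRep ξ d (1 - y) (d - a) (-b) :=
  ⟨h.1, by linear_combination -h.2⟩

theorem sub_one (h : IsRep ξ d y a b) : IsRep ξ d (y - 1) (a - d) b :=
  ⟨h.1, by linear_combination h.2⟩

theorem ne_zero_of_norm {n : F} (hξ : ξ ^ 2 = g) (h : IsRep ξ d y a b)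
    (e : a ^ 2 - b ^ 2 * g = n) (hn : n ≠ 0) : y ≠ 0 := by
  rintro rfl
  apply hn
  have := h.eq
  linear_combination -(a - b * ξ) * this + b ^ 2 * hξ - e

theorem div (hξ : ξ ^ 2 = g) (h₁ : IsRep ξ d₁ y₁ a₁ b₁) (h₂ : IsRep ξ d₂ y₂ a₂ b₂)
    (hy : y₂ ≠ 0) (hd : d ≠ 0)
    (e₀ : (a * a₂ + b * b₂ * g) * d₁ = d * a₁ * d₂ := by ring)
    (e₁ : (a * b₂ + b * a₂) * d₁ = d * b₁ * d₂ := by ring) : IsRep ξ d (y₁ / y₂) a b := by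
  refine ⟨hd, ?_⟩
  rw [mul_div_assoc', div_eq_iff hy]
  refine mul_left_cancel₀ (mul_ne_zero h₁.1 h₂.1) ?_
  linear_combination d * d₂ * h₁.2 - (a + b * ξ) * d₁ * h₂.2 - e₀ - ξ * e₁ - b * b₂ * d₁ * hξ

theorem eq_mul_add (hξ : ξ ^ 2 = g) (h : IsRep ξ d y a b) (h₁ : IsRep ξ d₁ y₁ a₁ b₁)
    (h₂ : IsRep ξ d₂ y₂ a₂ b₂) (p q : F)
    (e₀ : d₁ * d₂ * a = d * (a₁ * (p * d₂ + q * a₂) + q * b₁ * b₂ * g) := by ring)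
    (e₁ : d₁ * d₂ * b = d * (b₁ * (p * d₂ + q * a₂) + q * a₁ * b₂) := by ring) :
    y = y₁ * (p + q * y₂) := by
  refine mul_left_cancel₀ (mul_ne_zero h.1 (mul_ne_zero h₁.1 h₂.1)) ?_
  linear_combination d₁ * d₂ * h.2 - d * d₂ * (p + q * y₂) * h₁.2
    - d * (a₁ + b₁ * ξ) * q * h₂.2 + e₀ + ξ * e₁ - d * q * b₁ * b₂ * hξ

theorem mul_eq_mul_one_sub (hξ : ξ ^ 2 = g) (h : IsRep ξ d y a b) (h₁ : IsRep ξ d₁ y₁ a₁ b₁)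
    (h₂ : IsRep ξ d₂ y₂ a₂ b₂) (p : F)
    (e₀ : (a * a₂ + b * b₂ * g) * d₁ = p * d * (a₁ * (d₂ - a₂) - b₁ * b₂ * g) := by ring)
    (e₁ : (a * b₂ + b * a₂) * d₁ = p * d * (b₁ * (d₂ - a₂) - a₁ * b₂) := by ring) :
    y * y₂ = p * y₁ * (1 - y₂) := by
  refine mul_left_cancel₀ (mul_ne_zero h.1 (mul_ne_zero h₁.1 h₂.1)) ?_
  linear_combination d₁ * d₂ * y₂ * h.2 + d₁ * (a + b * ξ) * h₂.2
    - p * d * d₂ * (1 - y₂) * h₁.2 + p * d * (a₁ + b₁ * ξ) * h₂.2 + e₀ + ξ * e₁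
    + (b * b₂ * d₁ + p * d * b₁ * b₂) * hξ

theorem mul_one_sub_eq (hξ : ξ ^ 2 = g) (h : IsRep ξ d y a b) (h₁ : IsRep ξ d₁ y₁ a₁ b₁)
    (h₂ : IsRep ξ d₂ y₂ a₂ b₂)
    (e₀ : (a * (d₂ - a₂) - b * b₂ * g) * d₁ = d * (a₁ * a₂ + b₁ * b₂ * g) := by ring)
    (e₁ : (b * (d₂ - a₂) - a * b₂) * d₁ = d * (a₁ * b₂ + b₁ * a₂) := by ring) :
    y * (1 - y₂) = y₁ * y₂ := by
  refine mul_left_cancel₀ (mul_ne_zero h.1 (mul_ne_zero h₁.1 h₂.1)) ?_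
  linear_combination d₁ * d₂ * (1 - y₂) * h.2 - d₁ * (a + b * ξ) * h₂.2
    - d * d₂ * y₂ * h₁.2 - d * (a₁ + b₁ * ξ) * h₂.2 + e₀ + ξ * e₁
    - (b * b₂ * d₁ + d * b₁ * b₂) * hξ

theorem of_eq (h : y = a + b * ξ := by ring) : IsRep ξ 1 y a b :=
  ⟨one_ne_zero, by rw [one_mul, h]⟩

theorem mul_eq (hξ : ξ ^ 2 = g) (h : IsRep ξ d y a b) (q : F) {f m : F}
    (e : f * (a + b * ξ) - d * m = q * (ξ ^ 2 - g) := by ring) : f * y = m := by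
  refine mul_left_cancel₀ h.1 ?_
  linear_combination f * h.2 + e + q * hξ

end IsRep

/-! ### Darboux coverings from contiguous hypergeometric functions -/

namespace IsCurveField

variable {K : Type} [Field K] [Algebra ℂ K] {a b : ℂ} {x ξ : K} {D : Derivation ℂ K K}

theorem isDarbouxCovering_of_contiguous_b (h : IsCurveField a b x ξ D) {α β γ e₀ e₁ e : ℂ}
    {α' β' γ' φ w θ ρ l ψ₁ ψ₂ : K} (he₀ : e₀ = 1 - γ) (he₁ : e₁ = γ - α - β) (he : e = α - β)
    (hα : algebraMap ℂ K α = α') (hβ : algebraMap ℂ K β = β') (hγ : algebraMap ℂ K γ = γ')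
    (hβ0 : β ≠ 0) (hφ : D φ = φ * θ) (hw : D w = w * l) (hρ : ρ * (1 - φ) = θ * φ)
    (hl : (l + β' * θ * (w - 1)) * w = (θ + ρ) * (γ' - β' - 1) * (1 - w) + α' * ρ * w)
    (hφ0 : φ ≠ 0) (hθ0 : θ ≠ 0)
    (hψ : ∀ M : IntermediateField ℂ K, φ ∈ M → w ∈ M → ψ₁ ∈ M ∧ ψ₂ ∈ M)
    (hcop : Nat.Coprime (Module.finrank ℂ⟮ψ₁⟯ K) (Module.finrank ℂ⟮ψ₂⟯ K)) :
    IsDarbouxCovering (hypergeometricODE e₀ e₁ e) K φ := by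
  have hβ1 : β' ≠ 0 := by
    rw [← hβ]
    simpa using hβ0
  have hφ1 : 1 - φ ≠ 0 := fun h0 => by
    rw [h0, mul_zero] at hρ
    exact mul_ne_zero hθ0 hφ0 hρ.symm
  have hφ2 : φ - 1 ≠ 0 := fun h0 => hφ1 (by linear_combination -h0)
  have hC : ∀ z : ℂ, D (algebraMap ℂ K z) = 0 := fun z => D.map_algebraMap z
  refine h.isDarbouxCovering (φ := φ) (u := β' * (w - 1) / φ)
    (by rw [hφ]; exact mul_ne_zero hφ0 hθ0) ?_ fun M h1 h2 => ?_
  · have h1 : D (β' * (w - 1) / φ) = β' * (w * l - (w - 1) * θ) / φ := by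
      rw [Derivation.leibniz_div, Derivation.leibniz, ← hβ, hC, map_sub, D.map_one_eq_zero, hw, hφ]
      simp only [smul_eq_mul]
      field_simp
      ring
    have h4 : (4 : K) ≠ 0 := by
      have : CharZero K := charZero_of_injective_algebraMap (algebraMap ℂ K).injective
      norm_num
    rw [h1, hφ, he₀, he₁, he]
    simp only [map_sub, map_pow, map_one, hα, hβ, hγ]
    have hl' : (1 - φ) * (l + β' * θ * (w - 1)) * w
        = θ * (γ' - β' - 1) * (1 - w) + α' * θ * φ * w := by
      linear_combination (1 - φ) * hl + ((γ' - β' - 1) * (1 - w) + α' * w) * hρ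
    field_simp
    linear_combination (-4 * β') * hl'
  · refine IntermediateField.eq_top_of_coprime_finrank (hψ M h1 ?_).1 (hψ M h1 ?_).2 hcop
    all_goals
    have h3 : w = 1 + algebraMap ℂ K β⁻¹ * (φ * (β' * (w - 1) / φ)) := by
      rw [map_inv₀, hβ]
      field_simp
      ring
    rw [h3]
    exact add_mem (one_mem M) (mul_mem (M.algebraMap_mem _) (mul_mem h1 h2))

theorem isDarbouxCovering_of_contiguous_bc (h : IsCurveField a b x ξ D) {α β γ e₀ e₁ e : ℂ}
    {α' β' γ' φ w θ ρ l ψ₁ ψ₂ : K} (he₀ : e₀ = 1 - γ) (he₁ : e₁ = γ - α - β) (he : e = α - β)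
    (hα : algebraMap ℂ K α = α') (hβ : algebraMap ℂ K β = β') (hγ : algebraMap ℂ K γ = γ')
    (hβ0 : β ≠ 0) (hγ0 : γ ≠ 0) (hγα : γ - α ≠ 0)
    (hφ : D φ = φ * θ) (hw : D w = w * l) (hρ : ρ * (1 - φ) = θ * φ)
    (hl : (l + ρ * (β' - β' * (γ' - α') / γ' * w)) * w
      = (θ + ρ) * γ' * (1 - w) + α' * ρ * w)
    (hφ0 : φ ≠ 0) (hθ0 : θ ≠ 0)
    (hψ : ∀ M : IntermediateField ℂ K, φ ∈ M → w ∈ M → ψ₁ ∈ M ∧ ψ₂ ∈ M)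
    (hcop : Nat.Coprime (Module.finrank ℂ⟮ψ₁⟯ K) (Module.finrank ℂ⟮ψ₂⟯ K)) :
    IsDarbouxCovering (hypergeometricODE e₀ e₁ e) K φ := by
  have hβ1 : β' ≠ 0 := by
    rw [← hβ]
    simpa using hβ0
  have hγ1 : γ' ≠ 0 := by
    rw [← hγ]
    simpa using hγ0
  have hγα1 : γ' - α' ≠ 0 := by
    rw [← hγ, ← hα, ← map_sub]
    exact (_root_.map_ne_zero _).mpr hγα
  have hφ1 : 1 - φ ≠ 0 := fun h0 => by
    rw [h0, mul_zero] at hρ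
    exact mul_ne_zero hθ0 hφ0 hρ.symm
  have hφ2 : φ - 1 ≠ 0 := fun h0 => hφ1 (by linear_combination -h0)
  have hC : ∀ z : ℂ, D (algebraMap ℂ K z) = 0 := fun z => D.map_algebraMap z
  obtain ⟨k, hk⟩ : ∃ k : ℂ, k = β * (γ - α) / γ := ⟨_, rfl⟩
  have hk0 : k ≠ 0 := by
    rw [hk]
    exact div_ne_zero (mul_ne_zero hβ0 hγα) hγ0
  obtain ⟨k', hk'⟩ : ∃ k' : K, k' = β' * (γ' - α') / γ' := ⟨_, rfl⟩
  have hkk : algebraMap ℂ K k = k' := by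
    rw [hk, hk', map_div₀, map_mul, map_sub, hα, hβ, hγ]
  have hkγ : k' * γ' = β' * (γ' - α') := by
    rw [hk']
    field_simp
  have hk1 : k' ≠ 0 := by
    rw [← hkk]
    simpa using hk0
  rw [← hk'] at hl
  refine h.isDarbouxCovering (φ := φ) (u := (β' - k' * w) / (1 - φ))
    (by rw [hφ]; exact mul_ne_zero hφ0 hθ0) ?_ fun M h1 h2 => ?_
  · have h1 : D ((β' - k' * w) / (1 - φ))
        = (-(k' * w * l) * (1 - φ) + (β' - k' * w) * (φ * θ)) / (1 - φ) ^ 2 := by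
      rw [Derivation.leibniz_div, map_sub, map_sub, Derivation.leibniz, ← hβ, ← hkk, hC, hC,
        D.map_one_eq_zero, hw, hφ]
      simp only [smul_eq_mul]
      field_simp
      ring
    have h4 : (4 : K) ≠ 0 := by
      have : CharZero K := charZero_of_injective_algebraMap (algebraMap ℂ K).injective
      norm_num
    rw [h1, hφ, he₀, he₁, he]
    simp only [map_sub, map_pow, map_one, hα, hβ, hγ]
    have hl' : ((1 - φ) * l + θ * φ * (β' - k' * w)) * w
        = θ * γ' * (1 - w) + α' * θ * φ * w := by
      linear_combination (1 - φ) * hl + (γ' * (1 - w) + α' * w - (β' - k' * w) * w) * hρ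
    have hφ3 : φ - 1 = -(1 - φ) := by ring
    rw [hφ3]
    field_simp
    linear_combination (-4 * k') * hl' - 4 * θ * hkγ
  · refine IntermediateField.eq_top_of_coprime_finrank (hψ M h1 ?_).1 (hψ M h1 ?_).2 hcop
    all_goals
    have h3 : w = algebraMap ℂ K k⁻¹
        * (algebraMap ℂ K β - (1 - φ) * ((β' - k' * w) / (1 - φ))) := by
      rw [map_inv₀, hkk, hβ]
      field_simp
      ring
    rw [h3]
    exact mul_mem (M.algebraMap_mem _) (sub_mem (M.algebraMap_mem _)
      (mul_mem (sub_mem (one_mem M) h1) h2))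

end IsCurveField

/-! ### The curve `ξ² = x (1 + 33 x - 9 x²)` -/

namespace E3

set_option linter.unusedSectionVars false
set_option linter.unusedVariables false

/-- A point of the curve, over any field, outside a finite set of points. -/
structure IsPoint {F : Type*} [Field F] (x ξ : F) : Prop where
  sq : ξ ^ 2 = x * (1 + 33 * x - 9 * x ^ 2)
  ne₀ : x ≠ 0
  ne₁ : 1 - 21 * x ≠ 0
  ne₂ : 1 - x ≠ 0
  ne₃ : 1 + 9 * x ≠ 0
  ne₄ : 7 + 3 * x ≠ 0
  ne₅ : 1 + 33 * x - 9 * x ^ 2 ≠ 0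
  ne₆ : 1 + 198 * x - 99 * x ^ 2 ≠ 0
  ne₇ : 1 - 378 * x + 1053 * x ^ 2 + 324 * x ^ 3 ≠ 0
  ne₈ : 1 - 684 * x + 4446 * x ^ 2 + 6156 * x ^ 3 + 81 * x ^ 4 ≠ 0

variable {F : Type*} [Field F]

/-- The logarithmic derivative of `1 - 9 * ξ + 54 * x`. -/
def dlogA (x ξ : F) : F := (-9 + 54 * x + 27 * ξ) / (1 + 9 * x)

/-- The logarithmic derivative of `1 + 21 * ξ - 117 * x + 9 * x * ξ - 234 * x ^ 2`. -/
def dlogB (x ξ : F) : F := (21 + 3870 * x + 14310 * x ^ 2 + 278640 * x ^ 3 - 15795 * x ^ 4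
    + 18954 * x ^ 5 - 675 * ξ - 3420 * x * ξ + 138510 * x ^ 2 * ξ + 221940 * x ^ 3 * ξ
    + 3645 * x ^ 4 * ξ) / ((1 + 9 * x) * (1 - 684 * x + 4446 * x ^ 2 + 6156 * x ^ 3 + 81 * x ^ 4))

/-- The logarithmic derivative of `1 - 21 * ξ - 117 * x - 9 * x * ξ - 234 * x ^ 2`. -/
def dlogBBar (x ξ : F) : F := (-21 - 3870 * x - 14310 * x ^ 2 - 278640 * x ^ 3 + 15795 * x ^ 4
    - 18954 * x ^ 5 - 675 * ξ - 3420 * x * ξ + 138510 * x ^ 2 * ξ + 221940 * x ^ 3 * ξ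
    + 3645 * x ^ 4 * ξ) / ((1 + 9 * x) * (1 - 684 * x + 4446 * x ^ 2 + 6156 * x ^ 3 + 81 * x ^ 4))

/-- The logarithmic derivative of `1 + 9 * x`. -/
def dlogC (x ξ : F) : F := (18 * ξ) / (1 + 9 * x)

/-- The logarithmic derivative of `1 + 198 * x - 99 * x ^ 2`. -/
def dlogP (x ξ : F) : F := (396 * ξ - 396 * x * ξ) / (1 + 198 * x - 99 * x ^ 2)

/-- The logarithmic derivative of `1 + 33 * x - 9 * x ^ 2`. -/
def dlogF (x ξ : F) : F := (66 * ξ - 36 * x * ξ) / (1 + 33 * x - 9 * x ^ 2)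

/-- The logarithmic derivative of `1 - 15 * ξ - 72 * x - 54 * x ^ 2`. -/
def dlogQ (x ξ : F) : F := (-15 - 2070 * x - 2025 * x ^ 2 - 63180 * x ^ 3 + 7290 * x ^ 4 - 369 * ξ
    - 4698 * x * ξ + 29403 * x ^ 2 * ξ + 11664 * x ^ 3 * ξ) / ((1 + 9 * x) * (1 - 378 * x
    + 1053 * x ^ 2 + 324 * x ^ 3))

/-- The logarithmic derivative of `1 + 3 / 7 * x`. -/
def dlogR (x ξ : F) : F := (6 * ξ) / (7 + 3 * x)

/-- The logarithmic derivative of `1 - 21 * x`. -/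
def dlogL (x ξ : F) : F := (-42 * ξ) / (1 - 21 * x)

/-- The logarithmic derivative of `ξ`. -/
def dlogXi (x ξ : F) : F := (ξ + 66 * x * ξ - 27 * x ^ 2 * ξ) / (x * (1 + 33 * x - 9 * x ^ 2))

/-- The logarithmic derivative of `ξ + 5 * x`. -/
def dlogM (x ξ : F) : F :=
  (5 * x + 45 * x ^ 3 + ξ + 16 * x * ξ - 27 * x ^ 2 * ξ) / (x * (1 - x) * (1 + 9 * x))

/-- The logarithmic derivative `θ` of the covering `φ`. -/
def theta (x ξ : F) : F := (-72 * x - 7128 * x ^ 2 - 233280 * x ^ 3 - 2459160 * x ^ 4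
    + 2099520 * x ^ 5 - 577368 * x ^ 6 + 52488 * x ^ 7 + ξ + 1566 * x * ξ - 90045 * x ^ 2 * ξ
    - 810405 * x ^ 4 * ξ - 126846 * x ^ 5 * ξ + 729 * x ^ 6 * ξ) / (x * (1 + 33 * x
    - 9 * x ^ 2) * (1 - 684 * x + 4446 * x ^ 2 + 6156 * x ^ 3 + 81 * x ^ 4))

/-- The function `ρ = θ φ / (1 - φ)`. -/
def rho (x ξ : F) : F :=
    (144 + 9504 * x + 154224 * x ^ 2 - 85536 * x ^ 3 + 11664 * x ^ 4) / (1 - 684 * x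
    + 4446 * x ^ 2 + 6156 * x ^ 3 + 81 * x ^ 4)

/-- The quotient of the hypergeometric functions with parameters
`(3/10, -1/30; 3/5)` and `(3/10, 29/30; 3/5)`. -/
def ratioA (x ξ : F) : F := (1 + 21 * ξ - 117 * x + 9 * x * ξ - 234 * x ^ 2) * (1 + 9 * x) ^ 2 * (1
    + 198 * x - 99 * x ^ 2) / ((1 - 9 * ξ + 54 * x) * (1 - 21 * ξ - 117 * x - 9 * x * ξ
    - 234 * x ^ 2) ^ 2)

/-- The quotient of the hypergeometric functions with parameters
`(11/30, -3/10; 2/5)` and `(11/30, 7/10; 7/5)`. -/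
def ratioB (x ξ : F) : F := (1 + 21 * ξ - 117 * x + 9 * x * ξ - 234 * x ^ 2) ^ 2 * (1
    + 9 * x) / ((1 - 9 * ξ + 54 * x) * (1 + 33 * x - 9 * x ^ 2) * (1 - 15 * ξ - 72 * x
    - 54 * x ^ 2))

/-- The quotient of the hypergeometric functions with parameters
`(17/30, -1/10; 4/5)` and `(17/30, 9/10; 9/5)`. -/
def ratioC (x ξ : F) : F := (1 + 21 * ξ - 117 * x + 9 * x * ξ - 234 * x ^ 2) ^ 2 * (1
    + 3 / 7 * x) / ((1 - 9 * ξ + 54 * x) * (1 + 33 * x - 9 * x ^ 2) ^ 2)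

/-- The quotient of the hypergeometric functions with parameters
`(1/10, -7/30; 1/5)` and `(1/10, 23/30; 6/5)`. -/
def ratioD (x ξ : F) : F :=
    (1 + 21 * ξ - 117 * x + 9 * x * ξ - 234 * x ^ 2) * (ξ + 5 * x) / (ξ * (1 + 9 * x) * (1
    - 21 * x))

variable [CharZero F] {x ξ : F}

theorem rep_dlogA (h : IsPoint x ξ) : IsRep ξ (1 + 9 * x) (dlogA x ξ) (-9 + 54 * x) 27 :=
  .of_div h.ne₃

theorem mul_dlogA (h : IsPoint x ξ) : (1 - 9 * ξ + 54 * x) * dlogA x ξ = 2 * ξ * 54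
    + (1 + 66 * x - 27 * x ^ 2) * (-9) := (rep_dlogA h).mul_eq h.sq (-243)

theorem rep_dlogB (h : IsPoint x ξ) :
    IsRep ξ ((1 + 9 * x) * (1 - 684 * x + 4446 * x ^ 2 + 6156 * x ^ 3 + 81 * x ^ 4)) (dlogB x ξ)
    (21 + 3870 * x + 14310 * x ^ 2 + 278640 * x ^ 3 - 15795 * x ^ 4 + 18954 * x ^ 5)
    (-675 - 3420 * x + 138510 * x ^ 2 + 221940 * x ^ 3 + 3645 * x ^ 4) :=
  .of_div (mul_ne_zero h.ne₃ h.ne₈)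

theorem mul_dlogB (h : IsPoint x ξ) : (1 + 21 * ξ - 117 * x + 9 * x * ξ - 234 * x ^ 2) * dlogB x
    ξ = 2 * ξ * (-117 - 468 * x + 9 * ξ) + (1 + 66 * x - 27 * x ^ 2) * (21 + 9 * x) :=
    (rep_dlogB h).mul_eq h.sq (-14193 - 65745 * x + 2908710 * x ^ 2 + 5076270 * x ^ 3
    + 1075275 * x ^ 4 + 19683 * x ^ 5)

theorem rep_dlogBBar (h : IsPoint x ξ) :
    IsRep ξ ((1 + 9 * x) * (1 - 684 * x + 4446 * x ^ 2 + 6156 * x ^ 3 + 81 * x ^ 4)) (dlogBBar x ξ)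
    (-21 - 3870 * x - 14310 * x ^ 2 - 278640 * x ^ 3 + 15795 * x ^ 4 - 18954 * x ^ 5)
    (-675 - 3420 * x + 138510 * x ^ 2 + 221940 * x ^ 3 + 3645 * x ^ 4) :=
  .of_div (mul_ne_zero h.ne₃ h.ne₈)

theorem mul_dlogBBar (h : IsPoint x ξ) :
    (1 - 21 * ξ - 117 * x - 9 * x * ξ - 234 * x ^ 2) * dlogBBar x ξ = 2 * ξ * (-117 - 468 * x
    - 9 * ξ) + (1 + 66 * x - 27 * x ^ 2) * (-21 - 9 * x) :=
    (rep_dlogBBar h).mul_eq h.sq (14193 + 65745 * x - 2908710 * x ^ 2 - 5076270 * x ^ 3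
    - 1075275 * x ^ 4 - 19683 * x ^ 5)

theorem rep_dlogC (h : IsPoint x ξ) : IsRep ξ (1 + 9 * x) (dlogC x ξ) 0 18 := .of_div h.ne₃

theorem mul_dlogC (h : IsPoint x ξ) : (1 + 9 * x) * dlogC x ξ = 2 * ξ * 9 :=
  (rep_dlogC h).mul_eq h.sq 0

theorem rep_dlogP (h : IsPoint x ξ) : IsRep ξ (1 + 198 * x - 99 * x ^ 2) (dlogP x ξ) 0
    (396 - 396 * x) := .of_div h.ne₆

theorem mul_dlogP (h : IsPoint x ξ) : (1 + 198 * x - 99 * x ^ 2) * dlogP x ξ = 2 * ξ * (198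
    - 198 * x) := (rep_dlogP h).mul_eq h.sq 0

theorem rep_dlogF (h : IsPoint x ξ) : IsRep ξ (1 + 33 * x - 9 * x ^ 2) (dlogF x ξ) 0
    (66 - 36 * x) := .of_div h.ne₅

theorem mul_dlogF (h : IsPoint x ξ) : (1 + 33 * x - 9 * x ^ 2) * dlogF x ξ = 2 * ξ * (33
    - 18 * x) := (rep_dlogF h).mul_eq h.sq 0

theorem rep_dlogQ (h : IsPoint x ξ) :
    IsRep ξ ((1 + 9 * x) * (1 - 378 * x + 1053 * x ^ 2 + 324 * x ^ 3)) (dlogQ x ξ)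
    (-15 - 2070 * x - 2025 * x ^ 2 - 63180 * x ^ 3 + 7290 * x ^ 4) (-369 - 4698 * x + 29403 * x ^ 2
    + 11664 * x ^ 3) := .of_div (mul_ne_zero h.ne₃ h.ne₇)

theorem mul_dlogQ (h : IsPoint x ξ) : (1 - 15 * ξ - 72 * x - 54 * x ^ 2) * dlogQ x ξ = 2 * ξ * (-72
    - 108 * x) + (1 + 66 * x - 27 * x ^ 2) * (-15) :=
  (rep_dlogQ h).mul_eq h.sq (5535 + 70470 * x - 441045 * x ^ 2 - 174960 * x ^ 3)

theorem rep_dlogR (h : IsPoint x ξ) : IsRep ξ (7 + 3 * x) (dlogR x ξ) 0 6 := .of_div h.ne₄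

theorem mul_dlogR (h : IsPoint x ξ) : (1 + 3 / 7 * x) * dlogR x ξ = 2 * ξ * (3 / 7) :=
  (rep_dlogR h).mul_eq h.sq 0

theorem rep_dlogL (h : IsPoint x ξ) : IsRep ξ (1 - 21 * x) (dlogL x ξ) 0 (-42) := .of_div h.ne₁

theorem mul_dlogL (h : IsPoint x ξ) : (1 - 21 * x) * dlogL x ξ = 2 * ξ * (-21) :=
  (rep_dlogL h).mul_eq h.sq 0

theorem rep_dlogXi (h : IsPoint x ξ) : IsRep ξ (x * (1 + 33 * x - 9 * x ^ 2)) (dlogXi x ξ) 0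
    (1 + 66 * x - 27 * x ^ 2) := .of_div (mul_ne_zero h.ne₀ h.ne₅)

theorem mul_dlogXi (h : IsPoint x ξ) : ξ * dlogXi x ξ = (1 + 66 * x - 27 * x ^ 2) :=
  (rep_dlogXi h).mul_eq h.sq (1 + 66 * x - 27 * x ^ 2)

theorem rep_dlogM (h : IsPoint x ξ) : IsRep ξ (x * (1 - x) * (1 + 9 * x)) (dlogM x ξ)
    (5 * x + 45 * x ^ 3) (1 + 16 * x - 27 * x ^ 2) :=
  .of_div (mul_ne_zero (mul_ne_zero h.ne₀ h.ne₂) h.ne₃)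

theorem mul_dlogM (h : IsPoint x ξ) : (ξ + 5 * x) * dlogM x ξ = 2 * ξ * 5
    + (1 + 66 * x - 27 * x ^ 2) := (rep_dlogM h).mul_eq h.sq (1 + 16 * x - 27 * x ^ 2)

theorem rep_theta (h : IsPoint x ξ) :
    IsRep ξ (x * (1 + 33 * x - 9 * x ^ 2) * (1 - 684 * x + 4446 * x ^ 2 + 6156 * x ^ 3
    + 81 * x ^ 4)) (theta x ξ) (-72 * x - 7128 * x ^ 2 - 233280 * x ^ 3 - 2459160 * x ^ 4
    + 2099520 * x ^ 5 - 577368 * x ^ 6 + 52488 * x ^ 7) (1 + 1566 * x - 90045 * x ^ 2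
    - 810405 * x ^ 4 - 126846 * x ^ 5 + 729 * x ^ 6) :=
  .of_div (mul_ne_zero (mul_ne_zero h.ne₀ h.ne₅) h.ne₈)

theorem rep_rho (h : IsPoint x ξ) :
    IsRep ξ (1 - 684 * x + 4446 * x ^ 2 + 6156 * x ^ 3 + 81 * x ^ 4) (rho x ξ)
    (144 + 9504 * x + 154224 * x ^ 2 - 85536 * x ^ 3 + 11664 * x ^ 4) 0 := .of_div h.ne₈

theorem theta_eq (h : IsPoint x ξ) : theta x ξ = dlogXi x ξ + 2 * dlogF x ξ + dlogA x ξ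
    - 3 * dlogB x ξ := by
  refine mul_left_cancel₀ ((mul_ne_zero (mul_ne_zero (mul_ne_zero h.ne₀ h.ne₃) h.ne₅)
    h.ne₈) : (x * (1 + 9 * x) * (1 + 33 * x - 9 * x ^ 2) * (1 - 684 * x + 4446 * x ^ 2
    + 6156 * x ^ 3 + 81 * x ^ 4) : F) ≠ 0) ?_
  linear_combination (1 + 9 * x) * (rep_theta h).eq
    - ((1 - 675 * x - 1710 * x ^ 2 + 46170 * x ^ 3 + 55485 * x ^ 4 + 729 * x ^ 5) * (rep_dlogXi
    h).eq + (2 * x - 1350 * x ^ 2 - 3420 * x ^ 3 + 92340 * x ^ 4 + 110970 * x ^ 5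
    + 1458 * x ^ 6) * (rep_dlogF h).eq + (x - 651 * x ^ 2 - 18135 * x ^ 3 + 159030 * x ^ 4
    + 163215 * x ^ 5 - 52731 * x ^ 6 - 729 * x ^ 7) * (rep_dlogA h).eq
    + (-3 * x - 99 * x ^ 2 + 27 * x ^ 3) * (rep_dlogB h).eq)

theorem theta_ne_zero (h : IsPoint x ξ) : theta x ξ ≠ 0 :=
  (rep_theta h).ne_zero_of_norm h.sq (n :=
    (-1) * x * (1 + 33 * x - 9 * x ^ 2) * (1 - 684 * x + 4446 * x ^ 2 + 6156 * x ^ 3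
    + 81 * x ^ 4) ^ 3) (by ring) (mul_ne_zero (mul_ne_zero (mul_ne_zero (by norm_num) h.ne₀) h.ne₅)
    (pow_ne_zero 3 h.ne₈))

theorem rep_tau (h : IsPoint x ξ) :
    IsRep ξ (x * (1 + 33 * x - 9 * x ^ 2) * (1 - 684 * x + 4446 * x ^ 2 + 6156 * x ^ 3
    + 81 * x ^ 4)) (theta x ξ + rho x ξ) (72 * x + 7128 * x ^ 2 + 233280 * x ^ 3 + 2459160 * x ^ 4
    - 2099520 * x ^ 5 + 577368 * x ^ 6 - 52488 * x ^ 7) (1 + 1566 * x - 90045 * x ^ 2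
    - 810405 * x ^ 4 - 126846 * x ^ 5 + 729 * x ^ 6) := by
  refine ⟨(mul_ne_zero (mul_ne_zero h.ne₀ h.ne₅) h.ne₈), mul_left_cancel₀
    (one_ne_zero : (1 : F) ≠ 0) ?_⟩
  linear_combination (rep_theta h).eq + (x + 33 * x ^ 2 - 9 * x ^ 3) * (rep_rho h).eq

theorem rep_A (h : IsPoint x ξ) : IsRep ξ 1 (1 - 9 * ξ + 54 * x) (1 + 54 * x) (-9) := .of_eq

theorem rep_B (h : IsPoint x ξ) : IsRep ξ 1 (1 + 21 * ξ - 117 * x + 9 * x * ξ - 234 * x ^ 2)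
    (1 - 117 * x - 234 * x ^ 2) (21 + 9 * x) := .of_eq

theorem rep_B_sq (h : IsPoint x ξ) :
    IsRep ξ 1 ((1 + 21 * ξ - 117 * x + 9 * x * ξ - 234 * x ^ 2) ^ 2) (1 + 207 * x + 28152 * x ^ 2
    + 63342 * x ^ 3 + 54027 * x ^ 4 - 729 * x ^ 5) (42 - 4896 * x - 11934 * x ^ 2
    - 4212 * x ^ 3) := (rep_B h).sq h.sq

theorem rep_C (h : IsPoint x ξ) : IsRep ξ 1 (1 + 9 * x) (1 + 9 * x) 0 := .of_eq

theorem rep_F (h : IsPoint x ξ) : IsRep ξ 1 (1 + 33 * x - 9 * x ^ 2) (1 + 33 * x - 9 * x ^ 2)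
    0 := .of_eq

theorem rep_F_sq (h : IsPoint x ξ) : IsRep ξ 1 ((1 + 33 * x - 9 * x ^ 2) ^ 2)
    (1 + 66 * x + 1071 * x ^ 2 - 594 * x ^ 3 + 81 * x ^ 4) 0 := (rep_F h).sq h.sq

theorem rep_Xi (h : IsPoint x ξ) : IsRep ξ 1 ξ 0 1 := .of_eq

theorem rep_phi (h : IsPoint x ξ) :
    IsRep ξ ((1 - 684 * x + 4446 * x ^ 2 + 6156 * x ^ 3 + 81 * x ^ 4) ^ 3) (phi3 x ξ)
    (-10368 * x - 1710720 * x ^ 2 - 112440960 * x ^ 3 - 3664362240 * x ^ 4 - 58438039680 * x ^ 5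
    - 339520097664 * x ^ 6 + 525942357120 * x ^ 7 - 296813341440 * x ^ 8 + 81969459840 * x ^ 9
    - 11224033920 * x ^ 10 + 612220032 * x ^ 11) (144 + 235008 * x + 2071008 * x ^ 2
    - 614358432 * x ^ 3 - 14137736112 * x ^ 4 - 127239625008 * x ^ 6 + 49763032992 * x ^ 7
    + 1509764832 * x ^ 8 - 1541887488 * x ^ 9 + 8503056 * x ^ 10) ∧ phi3 x ξ ≠ 0 := by
  have nc : IsRep ξ 1 (144 : F) 144 0 := .of_eq
  have nm1 : IsRep ξ 1 (144 * ξ) 0 144 := nc.mul h.sq (rep_Xi h)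
  have nm2 : IsRep ξ 1 (144 * ξ * (1 + 33 * x - 9 * x ^ 2) ^ 2) 0
      (144 + 9504 * x + 154224 * x ^ 2 - 85536 * x ^ 3 + 11664 * x ^ 4) :=
      nm1.mul h.sq (rep_F_sq h)
  have nm3 : IsRep ξ 1 (144 * ξ * (1 + 33 * x - 9 * x ^ 2) ^ 2 * (1 - 9 * ξ + 54 * x))
      (-1296 * x - 128304 * x ^ 2 - 4199040 * x ^ 3 - 44264880 * x ^ 4 + 37791360 * x ^ 5
      - 10392624 * x ^ 6 + 944784 * x ^ 7) (144 + 17280 * x + 667440 * x ^ 2 + 8242560 * x ^ 3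
      - 4607280 * x ^ 4 + 629856 * x ^ 5) := nm2.mul h.sq (rep_A h)
  have rB3 : IsRep ξ 1 ((1 + 21 * ξ - 117 * x + 9 * x * ξ - 234 * x ^ 2) ^ 3)
      (1 + 972 * x - 69633 * x ^ 2 - 6961950 * x ^ 3 - 22942845 * x ^ 4 - 24993036 * x ^ 5
      - 12045267 * x ^ 6 + 511758 * x ^ 7) (63 - 5454 * x + 1144125 * x ^ 2 + 4121280 * x ^ 3
      + 4990005 * x ^ 4 + 1456542 * x ^ 5 - 6561 * x ^ 6) := (rep_B_sq h).pow_succ h.sq (rep_B h)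
  have hr := rB3.ne_zero_of_norm h.sq (n :=
      (1 + 9 * x) ^ 3 * (1 - 684 * x + 4446 * x ^ 2 + 6156 * x ^ 3 + 81 * x ^ 4) ^ 3) (by ring)
      (mul_ne_zero (pow_ne_zero 3 h.ne₃) (pow_ne_zero 3 h.ne₈))
  have hn := nm3.ne_zero_of_norm h.sq (n :=
      (-20736) * x * (1 + 9 * x) ^ 3 * (1 + 33 * x - 9 * x ^ 2) ^ 5) (by ring)
      (mul_ne_zero (mul_ne_zero (mul_ne_zero (by norm_num) h.ne₀) (pow_ne_zero 3 h.ne₃))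
      (pow_ne_zero 5 h.ne₅))
  unfold phi3
  exact ⟨nm3.div h.sq rB3 hr (pow_ne_zero 3 h.ne₈), div_ne_zero hn hr⟩

theorem rho_mul (h : IsPoint x ξ) :
    rho x ξ * (1 - phi3 x ξ) = theta x ξ * phi3 x ξ :=
  (rep_rho h).mul_one_sub_eq h.sq (rep_theta h) (rep_phi h).1

theorem rep_ratioA (h : IsPoint x ξ) :
    IsRep ξ ((1 - 684 * x + 4446 * x ^ 2 + 6156 * x ^ 3 + 81 * x ^ 4) ^ 2) (ratioA x ξ)
    (1 + 1764 * x + 219924 * x ^ 2 - 17983944 * x ^ 3 + 8104050 * x ^ 4 - 160587036 * x ^ 5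
    + 55115316 * x ^ 6 + 12702096 * x ^ 7 - 72171 * x ^ 8) (72 + 19008 * x + 1010880 * x ^ 2
    + 14754960 * x ^ 3 - 16096320 * x ^ 4 + 5388768 * x ^ 5 - 577368 * x ^ 6) := by
  have nC2 : IsRep ξ 1 ((1 + 9 * x) ^ 2) (1 + 18 * x + 81 * x ^ 2) 0 := (rep_C h).sq h.sq
  have nm1 : IsRep ξ 1 ((1 + 21 * ξ - 117 * x + 9 * x * ξ - 234 * x ^ 2) * (1 + 9 * x) ^ 2)
      (1 - 99 * x - 2259 * x ^ 2 - 13689 * x ^ 3 - 18954 * x ^ 4) (21 + 387 * x + 1863 * x ^ 2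
      + 729 * x ^ 3) := (rep_B h).mul h.sq nC2
  have nP : IsRep ξ 1 (1 + 198 * x - 99 * x ^ 2) (1 + 198 * x - 99 * x ^ 2) 0 := .of_eq
  have nm2 : IsRep ξ 1 ((1 + 21 * ξ - 117 * x + 9 * x * ξ - 234 * x ^ 2) * (1 + 9 * x) ^ 2 * (1
      + 198 * x - 99 * x ^ 2)) (1 + 99 * x - 21960 * x ^ 2 - 451170 * x ^ 3 - 2505735 * x ^ 4
      - 2397681 * x ^ 5 + 1876446 * x ^ 6) (21 + 4545 * x + 76410 * x ^ 2 + 331290 * x ^ 3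
      - 40095 * x ^ 4 - 72171 * x ^ 5) := nm1.mul h.sq nP
  have rBBar : IsRep ξ 1 (1 - 21 * ξ - 117 * x - 9 * x * ξ - 234 * x ^ 2)
      (1 - 117 * x - 234 * x ^ 2) (-21 - 9 * x) := .of_eq
  have rBBar2 : IsRep ξ 1 ((1 - 21 * ξ - 117 * x - 9 * x * ξ - 234 * x ^ 2) ^ 2)
      (1 + 207 * x + 28152 * x ^ 2 + 63342 * x ^ 3 + 54027 * x ^ 4 - 729 * x ^ 5)
      (-42 + 4896 * x + 11934 * x ^ 2 + 4212 * x ^ 3) := rBBar.sq h.sq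
  have rm1 :
      IsRep ξ 1 ((1 - 9 * ξ + 54 * x) * (1 - 21 * ξ - 117 * x - 9 * x * ξ - 234 * x ^ 2) ^ 2)
      (1 + 639 * x + 7740 * x ^ 2 + 18630 * x ^ 3 + 288765 * x ^ 4 + 2632419 * x ^ 5
      + 301806 * x ^ 6) (-51 + 765 * x + 22950 * x ^ 2 + 78570 * x ^ 3 - 258795 * x ^ 4
      + 6561 * x ^ 5) := (rep_A h).mul h.sq rBBar2
  have hr := rm1.ne_zero_of_norm h.sq (n :=
      (1 + 9 * x) ^ 5 * (1 - 684 * x + 4446 * x ^ 2 + 6156 * x ^ 3 + 81 * x ^ 4) ^ 2) (by ring)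
      (mul_ne_zero (pow_ne_zero 5 h.ne₃) (pow_ne_zero 2 h.ne₈))
  exact nm2.div h.sq rm1 hr (pow_ne_zero 2 h.ne₈)

theorem contiguousA (h : IsPoint x ξ) {v l : F} (hv : v = 1 / 30 * dlogA x ξ - 1 / 10 * dlogB x ξ)
    (hl : l = dlogB x ξ + 2 * dlogC x ξ + dlogP x ξ - dlogA x ξ - 2 * dlogBBar x ξ) :
    v = (-1 / 30) * theta x ξ * (ratioA x ξ - 1)
      ∧ (l + v) * ratioA x ξ = (theta x ξ + rho x ξ) * ((3 / 5) - (-1 / 30) - 1) * (1 - ratioA x ξ)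
      + (3 / 10) * rho x ξ * ratioA x ξ := by
  have h1 : IsRep ξ (5 * (1 - 684 * x + 4446 * x ^ 2 + 6156 * x ^ 3 + 81 * x ^ 4)) v
      (-12 - 792 * x - 12852 * x ^ 2 + 7128 * x ^ 3 - 972 * x ^ 4) (342 - 4446 * x - 9234 * x ^ 2
      - 162 * x ^ 3) := by
    refine ⟨(mul_ne_zero (by norm_num) h.ne₈), mul_left_cancel₀
      ((mul_ne_zero (by norm_num) h.ne₃) : (6 * (1 + 9 * x) : F) ≠ 0) ?_⟩
    rw [hv]
    linear_combination (1 - 684 * x + 4446 * x ^ 2 + 6156 * x ^ 3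
      + 81 * x ^ 4) * (rep_dlogA h).eq + (-3) * (rep_dlogB h).eq
  have h2 : IsRep ξ (5 * (1 + 198 * x - 99 * x ^ 2) * (1 - 684 * x + 4446 * x ^ 2 + 6156 * x ^ 3
      + 81 * x ^ 4)) (l + v - (3 / 10) * rho x ξ) (132 + 34848 * x + 1853280 * x ^ 2
      + 27050760 * x ^ 3 - 29509920 * x ^ 4 + 9879408 * x ^ 5 - 1058508 * x ^ 6)
      (5742 - 660330 * x - 11885940 * x ^ 3 - 2325510 * x ^ 4 + 16038 * x ^ 5) := by
    refine ⟨(mul_ne_zero (mul_ne_zero (by norm_num) h.ne₆) h.ne₈), mul_left_cancel₀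
      ((mul_ne_zero (by norm_num) h.ne₃) : (6 * (1 + 9 * x) : F) ≠ 0) ?_⟩
    rw [hv, hl]
    linear_combination (-29 + 14094 * x + 3801465 * x ^ 2 - 27671220 * x ^ 3
      - 22585635 * x ^ 4 + 17208774 * x ^ 5 + 232551 * x ^ 6) * (rep_dlogA h).eq
      + (27 + 5346 * x - 2673 * x ^ 2) * (rep_dlogB h).eq + (60 - 29160 * x - 7865100 * x ^ 2
      + 57250800 * x ^ 3 + 46728900 * x ^ 4 - 35604360 * x ^ 5 - 481140 * x ^ 6) * (rep_dlogC h).eq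
      + (30 - 20250 * x - 51300 * x ^ 2 + 1385100 * x ^ 3 + 1664550 * x ^ 4
      + 21870 * x ^ 5) * (rep_dlogP h).eq + (-60 - 11880 * x + 5940 * x ^ 2) * (rep_dlogBBar h).eq
      + (-9 - 1863 * x - 15147 * x ^ 2 + 8019 * x ^ 3) * (rep_rho h).eq
  have h3 := h1.eq_mul_add h.sq (rep_theta h) (rep_ratioA h) (1 / 30) (-1 / 30)
  have h4 := h2.mul_eq_mul_one_sub h.sq (rep_tau h) (rep_ratioA h) (-11 / 30)
  exact ⟨by linear_combination h3, by linear_combination h4⟩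

theorem rep_ratioB (h : IsPoint x ξ) :
    IsRep ξ ((1 + 33 * x - 9 * x ^ 2) * (1 - 378 * x + 1053 * x ^ 2 + 324 * x ^ 3)) (ratioB x ξ)
    (1 + 1305 * x - 60030 * x ^ 2 - 270135 * x ^ 4 - 21141 * x ^ 5) (66 + 3366 * x + 38556 * x ^ 2
    - 12474 * x ^ 3 + 486 * x ^ 4) := by
  have nm1 : IsRep ξ 1 ((1 + 21 * ξ - 117 * x + 9 * x * ξ - 234 * x ^ 2) ^ 2 * (1 + 9 * x))
      (1 + 216 * x + 30015 * x ^ 2 + 316710 * x ^ 3 + 624105 * x ^ 4 + 485514 * x ^ 5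
      - 6561 * x ^ 6) (42 - 4518 * x - 55998 * x ^ 2 - 111618 * x ^ 3 - 37908 * x ^ 4) :=
      (rep_B_sq h).mul h.sq (rep_C h)
  have rm1 : IsRep ξ 1 ((1 - 9 * ξ + 54 * x) * (1 + 33 * x - 9 * x ^ 2)) (1 + 87 * x + 1773 * x ^ 2
      - 486 * x ^ 3) (-9 - 297 * x + 81 * x ^ 2) := (rep_A h).mul h.sq (rep_F h)
  have rQ : IsRep ξ 1 (1 - 15 * ξ - 72 * x - 54 * x ^ 2) (1 - 72 * x - 54 * x ^ 2) (-15) := .of_eq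
  have rm2 : IsRep ξ 1 ((1 - 9 * ξ + 54 * x) * (1 + 33 * x - 9 * x ^ 2) * (1 - 15 * ξ - 72 * x
      - 54 * x ^ 2)) (1 + 150 * x + 4365 * x ^ 2 + 11745 * x ^ 3 - 140940 * x ^ 4 + 37179 * x ^ 5)
      (-24 - 954 * x - 4644 * x ^ 2 + 17496 * x ^ 3 - 4374 * x ^ 4) := rm1.mul h.sq rQ
  have hr := rm2.ne_zero_of_norm h.sq (n :=
      (1 + 9 * x) ^ 4 * (1 + 33 * x - 9 * x ^ 2) ^ 2 * (1 - 378 * x + 1053 * x ^ 2 + 324 * x ^ 3))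
      (by ring) (mul_ne_zero (mul_ne_zero (pow_ne_zero 4 h.ne₃) (pow_ne_zero 2 h.ne₅)) h.ne₇)
  exact nm1.div h.sq rm2 hr (mul_ne_zero h.ne₅ h.ne₇)

theorem contiguousB (h : IsPoint x ξ) {v l : F} (hv : v = 19 / 30 * dlogA x ξ + dlogQ x ξ
    - 9 / 10 * dlogB x ξ - dlogC x ξ) (hl : l = 2 * dlogB x ξ + dlogC x ξ - dlogA x ξ - dlogF x ξ
    - dlogQ x ξ) :
    v = rho x ξ * ((-3 / 10) - (-3 / 10) * ((2 / 5) - (11 / 30)) / (2 / 5) * ratioB x ξ)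
      ∧ (l + v) * ratioB x ξ = (theta x ξ + rho x ξ) * (2 / 5) * (1 - ratioB x ξ)
      + (11 / 30) * rho x ξ * ratioB x ξ := by
  have h1 : IsRep ξ (5 * (1 - 378 * x + 1053 * x ^ 2 + 324 * x ^ 3) * (1 - 684 * x + 4446 * x ^ 2
      + 6156 * x ^ 3 + 81 * x ^ 4)) v (-198 + 91476 * x + 4624452 * x ^ 2 + 36622530 * x ^ 3
      - 291869730 * x ^ 4 - 94075992 * x ^ 5 + 54351324 * x ^ 6 - 2243862 * x ^ 7)
      (1188 + 99792 * x + 2682720 * x ^ 2 + 22132440 * x ^ 3 - 13646880 * x ^ 4 + 2309472 * x ^ 5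
      - 78732 * x ^ 6) := by
    refine ⟨(mul_ne_zero (mul_ne_zero (by norm_num) h.ne₇) h.ne₈), mul_left_cancel₀
      ((mul_ne_zero (by norm_num) h.ne₃) : (6 * (1 + 9 * x) : F) ≠ 0) ?_⟩
    rw [hv]
    linear_combination (19 - 20178 * x + 5016969 * x ^ 2 - 45492840 * x ^ 3
      + 40529565 * x ^ 4 + 149950926 * x ^ 5 + 39516903 * x ^ 6 + 498636 * x ^ 7) * (rep_dlogA
      h).eq + (30 - 20520 * x + 133380 * x ^ 2 + 184680 * x ^ 3 + 2430 * x ^ 4) * (rep_dlogQ h).eq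
      + (-27 + 10206 * x - 28431 * x ^ 2 - 8748 * x ^ 3) * (rep_dlogB h).eq
      + (-30 + 31860 * x - 7921530 * x ^ 2 + 71830800 * x ^ 3 - 63994050 * x ^ 4
      - 236764620 * x ^ 5 - 62395110 * x ^ 6 - 787320 * x ^ 7) * (rep_dlogC h).eq
  have h2 : IsRep ξ (5 * (1 + 33 * x - 9 * x ^ 2) * (1 - 684 * x + 4446 * x ^ 2 + 6156 * x ^ 3
      + 81 * x ^ 4)) (l + v - (11 / 30) * rho x ξ) (-132 - 13068 * x - 427680 * x ^ 2
      - 4508460 * x ^ 3 + 3849120 * x ^ 4 - 1058508 * x ^ 5 + 96228 * x ^ 6) (-4092 + 150660 * x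
      + 159030 * x ^ 2 + 1682370 * x ^ 3 + 225990 * x ^ 4 - 1458 * x ^ 5) := by
    refine ⟨(mul_ne_zero (mul_ne_zero (by norm_num) h.ne₅) h.ne₈), mul_left_cancel₀
      ((mul_ne_zero (by norm_num) h.ne₃) : (6 * (1 + 9 * x) : F) ≠ 0) ?_⟩
    rw [hv, hl]
    linear_combination (-11 + 7161 * x + 199485 * x ^ 2 - 1749330 * x ^ 3
      - 1795365 * x ^ 4 + 580041 * x ^ 5 + 8019 * x ^ 6) * (rep_dlogA h).eq
      + (33 + 1089 * x - 297 * x ^ 2) * (rep_dlogB h).eq + (-30 + 20250 * x + 51300 * x ^ 2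
      - 1385100 * x ^ 3 - 1664550 * x ^ 4 - 21870 * x ^ 5) * (rep_dlogF h).eq
      + (-11 - 462 * x - 3168 * x ^ 2 + 891 * x ^ 3) * (rep_rho h).eq
  have h3 := h1.eq_mul_add h.sq (rep_rho h) (rep_ratioB h) (-3 / 10) (1 / 40)
  have h4 := h2.mul_eq_mul_one_sub h.sq (rep_tau h) (rep_ratioB h) (2 / 5)
  exact ⟨by linear_combination h3, by linear_combination h4⟩

theorem rep_ratioC (h : IsPoint x ξ) : IsRep ξ (7 * (1 + 9 * x) * (1 + 33 * x - 9 * x ^ 2) ^ 2)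
    (ratioC x ξ) (7 + 4350 * x - 22770 * x ^ 2 + 211140 * x ^ 3 + 121095 * x ^ 4 + 11178 * x ^ 5)
    (357 - 11628 * x + 17442 * x ^ 2 + 9072 * x ^ 3 - 243 * x ^ 4) := by
  have nR : IsRep ξ 1 (1 + 3 / 7 * x) (1 + 3 / 7 * x) 0 := .of_eq
  have nm1 : IsRep ξ 1 ((1 + 21 * ξ - 117 * x + 9 * x * ξ - 234 * x ^ 2) ^ 2 * (1 + 3 / 7 * x))
      (1 + 1452 / 7 * x + 197685 / 7 * x ^ 2 + 527850 / 7 * x ^ 3 + 568215 / 7 * x ^ 4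
      + 156978 / 7 * x ^ 5 - 2187 / 7 * x ^ 6) (42 - 4878 * x - 98226 / 7 * x ^ 2
      - 65286 / 7 * x ^ 3 - 12636 / 7 * x ^ 4) := (rep_B_sq h).mul h.sq nR
  have rm1 : IsRep ξ 1 ((1 - 9 * ξ + 54 * x) * (1 + 33 * x - 9 * x ^ 2) ^ 2)
      (1 + 120 * x + 4635 * x ^ 2 + 57240 * x ^ 3 - 31995 * x ^ 4 + 4374 * x ^ 5)
      (-9 - 594 * x - 9639 * x ^ 2 + 5346 * x ^ 3 - 729 * x ^ 4) := (rep_A h).mul h.sq (rep_F_sq h)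
  have hr := rm1.ne_zero_of_norm h.sq (n := (1 + 9 * x) ^ 3 * (1 + 33 * x - 9 * x ^ 2) ^ 4)
      (by ring) (mul_ne_zero (pow_ne_zero 3 h.ne₃) (pow_ne_zero 4 h.ne₅))
  exact nm1.div h.sq rm1 hr (mul_ne_zero (mul_ne_zero (by norm_num) h.ne₃) (pow_ne_zero 2 h.ne₅))

theorem contiguousC (h : IsPoint x ξ) {v l : F} (hv : v = 13 / 30 * dlogA x ξ - 3 / 10 * dlogB x ξ)
    (hl : l = 2 * dlogB x ξ + dlogR x ξ - dlogA x ξ - 2 * dlogF x ξ) :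
    v = rho x ξ * ((-1 / 10) - (-1 / 10) * ((4 / 5) - (17 / 30)) / (4 / 5) * ratioC x ξ)
      ∧ (l + v) * ratioC x ξ = (theta x ξ + rho x ξ) * (4 / 5) * (1 - ratioC x ξ)
      + (17 / 30) * rho x ξ * ratioC x ξ := by
  have h1 : IsRep ξ (5 * (1 + 9 * x) * (1 - 684 * x + 4446 * x ^ 2 + 6156 * x ^ 3 + 81 * x ^ 4)) v
      (-51 + 7650 * x - 188190 * x ^ 2 - 17820 * x ^ 3 + 742365 * x ^ 4 - 18954 * x ^ 5)
      (1071 - 34884 * x + 52326 * x ^ 2 + 27216 * x ^ 3 - 729 * x ^ 4) := by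
    refine ⟨(mul_ne_zero (mul_ne_zero (by norm_num) h.ne₃) h.ne₈), mul_left_cancel₀
      ((by norm_num) : (6 : F) ≠ 0) ?_⟩
    rw [hv]
    linear_combination (13 - 8892 * x + 57798 * x ^ 2 + 80028 * x ^ 3
      + 1053 * x ^ 4) * (rep_dlogA h).eq + (-9) * (rep_dlogB h).eq
  have h2 : IsRep ξ (5 * (7 + 3 * x) * (1 + 33 * x - 9 * x ^ 2) * (1 - 684 * x + 4446 * x ^ 2
      + 6156 * x ^ 3 + 81 * x ^ 4)) (l + v - (17 / 30) * rho x ξ) (-1428 - 141984 * x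
      - 4687308 * x ^ 2 - 50756220 * x ^ 3 + 20737620 * x ^ 4 + 6394788 * x ^ 5 - 3866616 * x ^ 6
      + 446148 * x ^ 7) (-45288 + 2309688 * x - 2877120 * x ^ 2 + 17622360 * x ^ 3
      + 16903080 * x ^ 4 + 971028 * x ^ 5 - 8748 * x ^ 6) := by
    refine ⟨(mul_ne_zero (mul_ne_zero (mul_ne_zero (by norm_num) h.ne₄) h.ne₅) h.ne₈),
      mul_left_cancel₀ ((mul_ne_zero (by norm_num) h.ne₃) : (6 * (1 + 9 * x) : F) ≠ 0) ?_⟩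
    rw [hv, hl]
    linear_combination (-119 + 77418 * x + 2191266 * x ^ 2 - 17999685 * x ^ 3
      - 27533115 * x ^ 4 - 2048976 * x ^ 5 + 2776032 * x ^ 6 + 37179 * x ^ 7) * (rep_dlogA h).eq
      + (357 + 11934 * x + 1836 * x ^ 2 - 1377 * x ^ 3) * (rep_dlogB h).eq
      + (30 - 19260 * x - 719820 * x ^ 2 - 125550 * x ^ 3 + 47834550 * x ^ 4 + 42486120 * x ^ 5
      - 14259240 * x ^ 6 - 196830 * x ^ 7) * (rep_dlogR h).eq + (-420 + 283320 * x + 839700 * x ^ 2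
      - 19083600 * x ^ 3 - 31614300 * x ^ 4 - 10293480 * x ^ 5 - 131220 * x ^ 6) * (rep_dlogF h).eq
      + (-119 - 5049 * x - 36414 * x ^ 2 - 5049 * x ^ 3 + 4131 * x ^ 4) * (rep_rho h).eq
  have h3 := h1.eq_mul_add h.sq (rep_rho h) (rep_ratioC h) (-1 / 10) (7 / 240)
  have h4 := h2.mul_eq_mul_one_sub h.sq (rep_tau h) (rep_ratioC h) (4 / 5)
  exact ⟨by linear_combination h3, by linear_combination h4⟩

theorem rep_ratioD (h : IsPoint x ξ) : IsRep ξ ((1 - 21 * x) * (1 + 33 * x - 9 * x ^ 2))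
    (ratioD x ξ) (1 + 12 * x - 702 * x ^ 2 + 189 * x ^ 3) (26 - 117 * x - 9 * x ^ 2) := by
  have nM : IsRep ξ 1 (ξ + 5 * x) (5 * x) 1 := .of_eq
  have nm1 : IsRep ξ 1 ((1 + 21 * ξ - 117 * x + 9 * x * ξ - 234 * x ^ 2) * (ξ + 5 * x))
      (26 * x + 117 * x ^ 2 - 1062 * x ^ 3 - 81 * x ^ 4) (1 - 12 * x - 189 * x ^ 2) :=
      (rep_B h).mul h.sq nM
  have rm1 : IsRep ξ 1 (ξ * (1 + 9 * x)) 0 (1 + 9 * x) := (rep_Xi h).mul h.sq (rep_C h)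
  have rL : IsRep ξ 1 (1 - 21 * x) (1 - 21 * x) 0 := .of_eq
  have rm2 : IsRep ξ 1 (ξ * (1 + 9 * x) * (1 - 21 * x)) 0 (1 - 12 * x - 189 * x ^ 2) :=
      rm1.mul h.sq rL
  have hr := rm2.ne_zero_of_norm h.sq (n :=
      (-1) * x * (1 - 21 * x) ^ 2 * (1 + 9 * x) ^ 2 * (1 + 33 * x - 9 * x ^ 2)) (by ring)
      (mul_ne_zero (mul_ne_zero (mul_ne_zero (mul_ne_zero (by norm_num) h.ne₀)
      (pow_ne_zero 2 h.ne₁)) (pow_ne_zero 2 h.ne₃)) h.ne₅)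
  exact nm1.div h.sq rm2 hr (mul_ne_zero h.ne₁ h.ne₅)

theorem contiguousD (h : IsPoint x ξ) {v l : F} (hv : v = 7 / 30 * dlogA x ξ + dlogL x ξ
    - 7 / 10 * dlogB x ξ) (hl : l = dlogB x ξ + dlogM x ξ - dlogXi x ξ - dlogC x ξ - dlogL x ξ) :
    v = rho x ξ * ((-7 / 30) - (-7 / 30) * ((1 / 5) - (1 / 10)) / (1 / 5) * ratioD x ξ)
      ∧ (l + v) * ratioD x ξ = (theta x ξ + rho x ξ) * (1 / 5) * (1 - ratioD x ξ)
      + (1 / 10) * rho x ξ * ratioD x ξ := by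
  have h1 : IsRep ξ (5 * (1 - 21 * x) * (1 - 684 * x + 4446 * x ^ 2 + 6156 * x ^ 3 + 81 * x ^ 4)) v
      (-84 - 3780 * x + 26460 * x ^ 2 + 1939140 * x ^ 3 - 1054620 * x ^ 4 + 142884 * x ^ 5)
      (2184 + 62244 * x - 344736 * x ^ 2 + 63504 * x ^ 3 + 6804 * x ^ 4) := by
    refine ⟨(mul_ne_zero (mul_ne_zero (by norm_num) h.ne₁) h.ne₈), mul_left_cancel₀
      ((mul_ne_zero (by norm_num) h.ne₃) : (6 * (1 + 9 * x) : F) ≠ 0) ?_⟩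
    rw [hv]
    linear_combination (7 - 4935 * x + 131670 * x ^ 2 - 610470 * x ^ 3 - 904365 * x ^ 4
      - 11907 * x ^ 5) * (rep_dlogA h).eq + (30 - 20250 * x - 51300 * x ^ 2 + 1385100 * x ^ 3
      + 1664550 * x ^ 4 + 21870 * x ^ 5) * (rep_dlogL h).eq + (-21 + 441 * x) * (rep_dlogB h).eq
  have h2 : IsRep ξ (5 * (1 - x) * (1 + 33 * x - 9 * x ^ 2) * (1 - 684 * x + 4446 * x ^ 2
      + 6156 * x ^ 3 + 81 * x ^ 4)) (l + v - (1 / 10) * rho x ξ) (-26 - 10023 * x - 304191 * x ^ 2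
      + 205335 * x ^ 3 + 6296940 * x ^ 4 + 582471 * x ^ 5 - 483327 * x ^ 6 - 37179 * x ^ 7)
      (-1196 + 96876 * x - 319815 * x ^ 2 - 298080 * x ^ 3 - 687690 * x ^ 4 - 40824 * x ^ 5
      + 729 * x ^ 6) := by
    refine ⟨(mul_ne_zero (mul_ne_zero (mul_ne_zero (by norm_num) h.ne₂) h.ne₅) h.ne₈),
      mul_left_cancel₀ ((mul_ne_zero (mul_ne_zero (by norm_num) h.ne₀) h.ne₃) : (6 * x * (1
      + 9 * x) : F) ≠ 0) ?_⟩
    rw [hv, hl]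
    linear_combination (7 * x - 4564 * x ^ 2 - 122388 * x ^ 3 + 1240155 * x ^ 4
      + 29295 * x ^ 5 - 1511622 * x ^ 6 + 364014 * x ^ 7 + 5103 * x ^ 8) * (rep_dlogA h).eq
      + (9 * x + 288 * x ^ 2 - 378 * x ^ 3 + 81 * x ^ 4) * (rep_dlogB h).eq
      + (30 - 19530 * x - 544050 * x ^ 2 + 4770900 * x ^ 3 + 4896450 * x ^ 4 - 1581930 * x ^ 5
      - 21870 * x ^ 6) * (rep_dlogM h).eq + (-30 + 20280 * x + 31050 * x ^ 2 - 1436400 * x ^ 3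
      - 279450 * x ^ 4 + 1642680 * x ^ 5 + 21870 * x ^ 6) * (rep_dlogXi h).eq
      + (-30 * x + 19560 * x ^ 2 + 524520 * x ^ 3 - 5314950 * x ^ 4 - 125550 * x ^ 5
      + 6478380 * x ^ 6 - 1560060 * x ^ 7 - 21870 * x ^ 8) * (rep_dlogC h).eq
      + (-3 * x - 123 * x ^ 2 - 738 * x ^ 3 + 1107 * x ^ 4 - 243 * x ^ 5) * (rep_rho h).eq
  have h3 := h1.eq_mul_add h.sq (rep_rho h) (rep_ratioD h) (-7 / 30) (7 / 60)
  have h4 := h2.mul_eq_mul_one_sub h.sq (rep_tau h) (rep_ratioD h) (1 / 5)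
  exact ⟨by linear_combination h3, by linear_combination h4⟩

end E3

namespace E3

section Local

variable {x κ : ℂ → ℂ}

theorem eventually_isPoint (hx : IsLocalParametrization (-9) 33 x κ) :
    ∀ᶠ t in 𝓝[≠] 0, IsPoint (x t) t := by
  filter_upwards [hx.sq, hx.eventually_ne_zero,
    hx.eventually_ne (p := fun x => 1 - 21 * x) (by fun_prop) (by norm_num),
    hx.eventually_ne (p := fun x => 1 - x) (by fun_prop) (by norm_num),
    hx.eventually_ne (p := fun x => 1 + 9 * x) (by fun_prop) (by norm_num),
    hx.eventually_ne (p := fun x => 7 + 3 * x) (by fun_prop) (by norm_num),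
    hx.eventually_ne (p := fun x => 1 + 33 * x - 9 * x ^ 2) (by fun_prop) (by norm_num),
    hx.eventually_ne (p := fun x => 1 + 198 * x - 99 * x ^ 2) (by fun_prop) (by norm_num),
    hx.eventually_ne (p := fun x => 1 - 378 * x + 1053 * x ^ 2 + 324 * x ^ 3) (by fun_prop)
      (by norm_num),
    hx.eventually_ne (p := fun x => 1 - 684 * x + 4446 * x ^ 2 + 6156 * x ^ 3 + 81 * x ^ 4) (by fun_prop)
      (by norm_num)]
    with t h0 h1 h2 h3 h4 h5 h6 h7 h8 h9
  exact ⟨by linear_combination h0, h1, h2, h3, h4, h5, h6, h7, h8, h9⟩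

theorem nearUnit_A (hx : IsLocalParametrization (-9) 33 x κ) :
    NearUnit κ (fun t => 1 - 9 * t + 54 * x t) (fun t => dlogA (x t) t) :=
  hx.nearUnit (-9) 54 0 0 0 (fun t => by ring)
    ((eventually_isPoint hx).mono fun t h => by linear_combination mul_dlogA h)

theorem nearUnit_B (hx : IsLocalParametrization (-9) 33 x κ) :
    NearUnit κ (fun t => 1 + 21 * t - 117 * x t + 9 * x t * t - 234 * x t ^ 2)
    (fun t => dlogB (x t) t) :=
  hx.nearUnit 21 (-117) 9 (-234) 0 (fun t => by ring)
    ((eventually_isPoint hx).mono fun t h => by linear_combination mul_dlogB h)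

theorem nearUnit_BBar (hx : IsLocalParametrization (-9) 33 x κ) :
    NearUnit κ (fun t => 1 - 21 * t - 117 * x t - 9 * x t * t - 234 * x t ^ 2)
    (fun t => dlogBBar (x t) t) :=
  hx.nearUnit (-21) (-117) (-9) (-234) 0 (fun t => by ring)
    ((eventually_isPoint hx).mono fun t h => by linear_combination mul_dlogBBar h)

theorem nearUnit_C (hx : IsLocalParametrization (-9) 33 x κ) : NearUnit κ (fun t => 1 + 9 * x t)
    (fun t => dlogC (x t) t) :=
  hx.nearUnit 0 9 0 0 0 (fun t => by ring)
    ((eventually_isPoint hx).mono fun t h => by linear_combination mul_dlogC h)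

theorem nearUnit_P (hx : IsLocalParametrization (-9) 33 x κ) :
    NearUnit κ (fun t => 1 + 198 * x t - 99 * x t ^ 2) (fun t => dlogP (x t) t) :=
  hx.nearUnit 0 198 0 (-99) 0 (fun t => by ring)
    ((eventually_isPoint hx).mono fun t h => by linear_combination mul_dlogP h)

theorem nearUnit_F (hx : IsLocalParametrization (-9) 33 x κ) :
    NearUnit κ (fun t => 1 + 33 * x t - 9 * x t ^ 2) (fun t => dlogF (x t) t) :=
  hx.nearUnit 0 33 0 (-9) 0 (fun t => by ring)
    ((eventually_isPoint hx).mono fun t h => by linear_combination mul_dlogF h)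

theorem nearUnit_Q (hx : IsLocalParametrization (-9) 33 x κ) :
    NearUnit κ (fun t => 1 - 15 * t - 72 * x t - 54 * x t ^ 2) (fun t => dlogQ (x t) t) :=
  hx.nearUnit (-15) (-72) 0 (-54) 0 (fun t => by ring)
    ((eventually_isPoint hx).mono fun t h => by linear_combination mul_dlogQ h)

theorem nearUnit_R (hx : IsLocalParametrization (-9) 33 x κ) :
    NearUnit κ (fun t => 1 + 3 / 7 * x t) (fun t => dlogR (x t) t) :=
  hx.nearUnit 0 (3 / 7) 0 0 0 (fun t => by ring)
    ((eventually_isPoint hx).mono fun t h => by linear_combination mul_dlogR h)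

theorem nearUnit_L (hx : IsLocalParametrization (-9) 33 x κ) : NearUnit κ (fun t => 1 - 21 * x t)
    (fun t => dlogL (x t) t) :=
  hx.nearUnit 0 (-21) 0 0 0 (fun t => by ring)
    ((eventually_isPoint hx).mono fun t h => by linear_combination mul_dlogL h)

theorem nearUnit_M (hx : IsLocalParametrization (-9) 33 x κ) :
    NearUnit κ (fun t => (t + 5 * x t) / t) (fun t => dlogM (x t) t - dlogXi (x t) t) := by
  refine hx.nearUnit_div 5 0 ?_ ?_
  · filter_upwards [self_mem_nhdsWithin] with t (ht : t ≠ 0)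
    field_simp
    ring
  · filter_upwards [eventually_isPoint hx, self_mem_nhdsWithin] with t h (ht : t ≠ 0)
    have h1 := mul_dlogM h
    have h2 := mul_dlogXi h
    field_simp
    linear_combination t * h1 - (t + 5 * x t) * h2

theorem nearZero_phi (hx : IsLocalParametrization (-9) 33 x κ) :
    NearZero κ (fun t => phi3 (x t) t) (fun t => theta (x t) t) := by
  have hF := nearUnit_F hx
  have hA := nearUnit_A hx
  have hB := nearUnit_B hx
  refine hx.nearZero (r := 144) (by norm_num) (((hF.pow 2).mul hA).div (hB.pow 3)) ?_ ?_
  · filter_upwards [self_mem_nhdsWithin] with t (ht : t ≠ 0)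
    unfold phi3
    rw [← mul_div_assoc]
    congr 1
    ring
  · filter_upwards [eventually_isPoint hx] with t h
    rw [theta_eq h]
    push_cast
    linear_combination mul_dlogXi h

theorem eventually_eqA (hx : IsLocalParametrization (-9) 33 x κ) : ∀ᶠ t in 𝓝[≠] 0, ₂F₁ (3 / 10 : ℂ)
    (-1 / 30) (3 / 5) (phi3 (x t) t) = (1 - 9 * t + 54 * x t) ^ (1 / 30 : ℂ) / (1 + 21 * t
    - 117 * x t + 9 * x t * t - 234 * x t ^ 2) ^ (1 / 10 : ℂ) ∧ ₂F₁ (3 / 10 : ℂ) (29 / 30) (3 / 5)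
    (phi3 (x t) t) = ₂F₁ (3 / 10 : ℂ) (-1 / 30) (3 / 5) (phi3 (x t) t) * ratioA (x t) t := by
  have hA := nearUnit_A hx
  have hB := nearUnit_B hx
  have hC := nearUnit_C hx
  have hP := nearUnit_P hx
  have hBBar := nearUnit_BBar hx
  have hr := ((hA.cpow (1 / 30)).div (hB.cpow (1 / 10)))
  have hw : NearUnit κ (fun t => ratioA (x t) t) (fun t => dlogB (x t) t + 2 * dlogC (x t) t
      + dlogP (x t) t - dlogA (x t) t - 2 * dlogBBar (x t) t) := by
    refine (((hB.mul (hC.pow 2)).mul hP).div (hA.mul (hBBar.pow 2))).congr ?_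
    filter_upwards [self_mem_nhdsWithin] with t (ht : t ≠ 0)
    refine ⟨by simp only [ratioA], by push_cast; ring⟩
  have h1 := NearUnit.eventually_eq_contiguous_b (a := 3 / 10) (b := -1 / 30) (c := 3 / 5)
    (by norm_num) hr hw (nearZero_phi hx) ((eventually_isPoint hx).mono fun t h =>
      ⟨rho_mul h, contiguousA h (by ring) rfl⟩)
  filter_upwards [h1] with t ht
  refine ⟨ht.1, ?_⟩
  rw [ht.1, ← ht.2]
  norm_num

theorem eventually_eqB (hx : IsLocalParametrization (-9) 33 x κ) : ∀ᶠ t in 𝓝[≠] 0,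
    ₂F₁ (11 / 30 : ℂ) (-3 / 10) (2 / 5) (phi3 (x t) t) =
    (1 - 9 * t + 54 * x t) ^ (19 / 30 : ℂ) * (1 - 15 * t - 72 * x t - 54 * x t ^ 2) / ((1 + 21 * t
    - 117 * x t + 9 * x t * t - 234 * x t ^ 2) ^ (9 / 10 : ℂ) * (1 + 9 * x t))
    ∧ ₂F₁ (11 / 30 : ℂ) (7 / 10) (7 / 5) (phi3 (x t) t) = ₂F₁ (11 / 30 : ℂ) (-3 / 10) (2 / 5)
    (phi3 (x t) t) * ratioB (x t) t := by
  have hA := nearUnit_A hx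
  have hQ := nearUnit_Q hx
  have hB := nearUnit_B hx
  have hC := nearUnit_C hx
  have hF := nearUnit_F hx
  have hr := (((hA.cpow (19 / 30)).mul hQ).div ((hB.cpow (9 / 10)).mul hC))
  have hw : NearUnit κ (fun t => ratioB (x t) t) (fun t => 2 * dlogB (x t) t + dlogC (x t) t
      - dlogA (x t) t - dlogF (x t) t - dlogQ (x t) t) := by
    refine (((hB.pow 2).mul hC).div ((hA.mul hF).mul hQ)).congr ?_
    filter_upwards [self_mem_nhdsWithin] with t (ht : t ≠ 0)
    refine ⟨by simp only [ratioB], by push_cast; ring⟩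
  have h1 := NearUnit.eventually_eq_contiguous_bc (a := 11 / 30) (b := -3 / 10) (c := 2 / 5)
    (by norm_num) hr hw (nearZero_phi hx) ((eventually_isPoint hx).mono fun t h =>
      ⟨rho_mul h, contiguousB h (by ring) rfl⟩)
  filter_upwards [h1] with t ht
  refine ⟨ht.1, ?_⟩
  rw [ht.1, ← ht.2]
  norm_num

theorem eventually_eqC (hx : IsLocalParametrization (-9) 33 x κ) : ∀ᶠ t in 𝓝[≠] 0,
    ₂F₁ (17 / 30 : ℂ) (-1 / 10) (4 / 5) (phi3 (x t) t) =
    (1 - 9 * t + 54 * x t) ^ (13 / 30 : ℂ) / (1 + 21 * t - 117 * x t + 9 * x t * t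
    - 234 * x t ^ 2) ^ (3 / 10 : ℂ) ∧ ₂F₁ (17 / 30 : ℂ) (9 / 10) (9 / 5) (phi3 (x t) t) = ₂F₁
    (17 / 30 : ℂ) (-1 / 10) (4 / 5) (phi3 (x t) t) * ratioC (x t) t := by
  have hA := nearUnit_A hx
  have hB := nearUnit_B hx
  have hR := nearUnit_R hx
  have hF := nearUnit_F hx
  have hr := ((hA.cpow (13 / 30)).div (hB.cpow (3 / 10)))
  have hw : NearUnit κ (fun t => ratioC (x t) t) (fun t => 2 * dlogB (x t) t + dlogR (x t) t
      - dlogA (x t) t - 2 * dlogF (x t) t) := by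
    refine (((hB.pow 2).mul hR).div (hA.mul (hF.pow 2))).congr ?_
    filter_upwards [self_mem_nhdsWithin] with t (ht : t ≠ 0)
    refine ⟨by simp only [ratioC], by push_cast; ring⟩
  have h1 := NearUnit.eventually_eq_contiguous_bc (a := 17 / 30) (b := -1 / 10) (c := 4 / 5)
    (by norm_num) hr hw (nearZero_phi hx) ((eventually_isPoint hx).mono fun t h =>
      ⟨rho_mul h, contiguousC h (by ring) rfl⟩)
  filter_upwards [h1] with t ht
  refine ⟨ht.1, ?_⟩
  rw [ht.1, ← ht.2]
  norm_num

theorem eventually_eqD (hx : IsLocalParametrization (-9) 33 x κ) : ∀ᶠ t in 𝓝[≠] 0, ₂F₁ (1 / 10 : ℂ)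
    (-7 / 30) (1 / 5) (phi3 (x t) t) = (1 - 9 * t + 54 * x t) ^ (7 / 30 : ℂ) * (1 - 21 * x t) / (1
    + 21 * t - 117 * x t + 9 * x t * t - 234 * x t ^ 2) ^ (7 / 10 : ℂ)
    ∧ ₂F₁ (1 / 10 : ℂ) (23 / 30) (6 / 5) (phi3 (x t) t) = ₂F₁ (1 / 10 : ℂ) (-7 / 30) (1 / 5)
    (phi3 (x t) t) * ratioD (x t) t := by
  have hA := nearUnit_A hx
  have hL := nearUnit_L hx
  have hB := nearUnit_B hx
  have hM := nearUnit_M hx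
  have hC := nearUnit_C hx
  have hr := (((hA.cpow (7 / 30)).mul hL).div (hB.cpow (7 / 10)))
  have hw : NearUnit κ (fun t => ratioD (x t) t) (fun t => dlogB (x t) t + dlogM (x t) t - dlogXi
      (x t) t - dlogC (x t) t - dlogL (x t) t) := by
    refine ((hB.mul hM).div (hC.mul hL)).congr ?_
    filter_upwards [self_mem_nhdsWithin] with t (ht : t ≠ 0)
    refine ⟨by simp only [ratioD]; field_simp, by ring⟩
  have h1 := NearUnit.eventually_eq_contiguous_bc (a := 1 / 10) (b := -7 / 30) (c := 1 / 5)
    (by norm_num) hr hw (nearZero_phi hx) ((eventually_isPoint hx).mono fun t h =>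
      ⟨rho_mul h, contiguousD h (by ring) rfl⟩)
  filter_upwards [h1] with t ht
  refine ⟨ht.1, ?_⟩
  rw [ht.1, ← ht.2]
  norm_num

end Local

/-- Hypergeometric functions of the type with exponent differences `1/3, 1/3, 2/5`. -/
theorem nearOrigin_typeA : NearOrigin (fun x => x * (1 + 33 * x - 9 * x ^ 2)) (fun x ξ =>
      ₂F₁ (3 / 10 : ℂ) (-1 / 30) (3 / 5) (phi3 x ξ)
        = (1 - 9 * ξ + 54 * x) ^ (1 / 30 : ℂ)
          / (1 + 21 * ξ - 117 * x + 9 * x * ξ - 234 * x ^ 2) ^ (1 / 10 : ℂ) ∧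
      ₂F₁ (3 / 10 : ℂ) (29 / 30) (3 / 5) (phi3 x ξ)
        = (1 + 21 * ξ - 117 * x + 9 * x * ξ - 234 * x ^ 2) ^ (9 / 10 : ℂ)
            * (1 + 9 * x) ^ 2 * (1 + 198 * x - 99 * x ^ 2)
          / ((1 - 9 * ξ + 54 * x) ^ (29 / 30 : ℂ)
            * (1 - 21 * ξ - 117 * x - 9 * x * ξ - 234 * x ^ 2) ^ 2) ∧
      ₂F₁ (7 / 10 : ℂ) (11 / 30) (7 / 5) (phi3 x ξ)
        = (1 + 21 * ξ - 117 * x + 9 * x * ξ - 234 * x ^ 2) ^ (11 / 10 : ℂ)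
          / ((1 - 9 * ξ + 54 * x) ^ (11 / 30 : ℂ) * (1 + 33 * x - 9 * x ^ 2)) ∧
      ₂F₁ (-3 / 10 : ℂ) (11 / 30) (2 / 5) (phi3 x ξ)
        = (1 - 9 * ξ + 54 * x) ^ (19 / 30 : ℂ) * (1 - 15 * ξ - 72 * x - 54 * x ^ 2)
          / ((1 + 21 * ξ - 117 * x + 9 * x * ξ - 234 * x ^ 2) ^ (9 / 10 : ℂ)
            * (1 + 9 * x))) := by
  obtain ⟨x, κ, hx⟩ := exists_isLocalParametrization (-9) 33
  refine hx.nearOrigin (fun y => by ring) ?_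
  filter_upwards [self_mem_nhdsWithin, eventually_eqA hx, eventually_eqB hx,
    (nearUnit_A hx).eventually_ne_zero, (nearUnit_B hx).eventually_ne_zero,
    (nearUnit_C hx).eventually_ne_zero, (nearUnit_P hx).eventually_ne_zero,
    (nearUnit_BBar hx).eventually_ne_zero, (nearUnit_Q hx).eventually_ne_zero,
    (nearUnit_F hx).eventually_ne_zero]
    with t (ht : t ≠ 0) eA eB hA hB hC hP hBBar hQ hF
  refine ⟨?_, ?_, ?_, ?_⟩
  · exact eA.1
  · refine eA.2.trans ?_
    obtain ⟨yA, nA, cA, dA⟩ := exists_cpow_eq_div (e := 1 / 30) (e' := 29 / 30) hA 1 (by norm_num)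
    obtain ⟨yB, nB, cB, dB⟩ := exists_cpow_eq_div (e := 1 / 10) (e' := 9 / 10) hB 1 (by norm_num)
    rw [eA.1, ratioA, cA, dA, cB, dB]
    generalize 1 + 21 * t - 117 * x t + 9 * x t * t - 234 * x t ^ 2 = zB at *
    generalize 1 - 21 * t - 117 * x t - 9 * x t * t - 234 * x t ^ 2 = zBBar at *
    generalize 1 + 198 * x t - 99 * x t ^ 2 = zP at *
    generalize 1 - 9 * t + 54 * x t = zA at *
    generalize 1 + 9 * x t = zC at *
    field_simp
  · refine (ordinaryHypergeometric_comm _ _ _ _).trans <| eB.2.trans ?_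
    obtain ⟨yA, nA, cA, dA⟩ := exists_cpow_eq_div (e := 19 / 30) (e' := 11 / 30) hA 1 (by norm_num)
    obtain ⟨yB, nB, cB, dB⟩ := exists_cpow_eq_div (e := 9 / 10) (e' := 11 / 10) hB 2 (by norm_num)
    rw [eB.1, ratioB, cA, dA, cB, dB]
    generalize 1 + 21 * t - 117 * x t + 9 * x t * t - 234 * x t ^ 2 = zB at *
    generalize 1 - 15 * t - 72 * x t - 54 * x t ^ 2 = zQ at *
    generalize 1 + 33 * x t - 9 * x t ^ 2 = zF at *
    generalize 1 - 9 * t + 54 * x t = zA at *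
    generalize 1 + 9 * x t = zC at *
    field_simp
  · exact (ordinaryHypergeometric_comm _ _ _ _).trans eB.1

/-- Hypergeometric functions of the type with exponent differences `1/3, 2/3, 1/5`. -/
theorem nearOrigin_typeB : NearOrigin (fun x => x * (1 + 33 * x - 9 * x ^ 2)) (fun x ξ =>
      ₂F₁ (-1 / 10 : ℂ) (17 / 30) (4 / 5) (phi3 x ξ)
        = (1 - 9 * ξ + 54 * x) ^ (13 / 30 : ℂ)
          / (1 + 21 * ξ - 117 * x + 9 * x * ξ - 234 * x ^ 2) ^ (3 / 10 : ℂ) ∧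
      ₂F₁ (9 / 10 : ℂ) (17 / 30) (9 / 5) (phi3 x ξ)
        = (1 + 21 * ξ - 117 * x + 9 * x * ξ - 234 * x ^ 2) ^ (17 / 10 : ℂ)
            * (1 + 3 / 7 * x)
          / ((1 - 9 * ξ + 54 * x) ^ (17 / 30 : ℂ) * (1 + 33 * x - 9 * x ^ 2) ^ 2) ∧
      ₂F₁ (1 / 10 : ℂ) (23 / 30) (6 / 5) (phi3 x ξ)
        = (1 + 21 * ξ - 117 * x + 9 * x * ξ - 234 * x ^ 2) ^ (3 / 10 : ℂ)
            * (1 - 9 * ξ + 54 * x) ^ (7 / 30 : ℂ) * (ξ + 5 * x)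
          / (ξ * (1 + 9 * x)) ∧
      ₂F₁ (1 / 10 : ℂ) (-7 / 30) (1 / 5) (phi3 x ξ)
        = (1 - 9 * ξ + 54 * x) ^ (7 / 30 : ℂ) * (1 - 21 * x)
          / (1 + 21 * ξ - 117 * x + 9 * x * ξ - 234 * x ^ 2) ^ (7 / 10 : ℂ)) := by
  obtain ⟨x, κ, hx⟩ := exists_isLocalParametrization (-9) 33
  refine hx.nearOrigin (fun y => by ring) ?_
  filter_upwards [self_mem_nhdsWithin, eventually_eqC hx, eventually_eqD hx,
    (nearUnit_A hx).eventually_ne_zero, (nearUnit_B hx).eventually_ne_zero,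
    (nearUnit_R hx).eventually_ne_zero, (nearUnit_F hx).eventually_ne_zero,
    (nearUnit_L hx).eventually_ne_zero, (nearUnit_M hx).eventually_ne_zero,
    (nearUnit_C hx).eventually_ne_zero]
    with t (ht : t ≠ 0) eC eD hA hB hR hF hL hM hC
  have hM0 : t + 5 * x t ≠ 0 := (div_ne_zero_iff.mp hM).1
  refine ⟨?_, ?_, ?_, ?_⟩
  · exact (ordinaryHypergeometric_comm _ _ _ _).trans eC.1
  · refine (ordinaryHypergeometric_comm _ _ _ _).trans <| eC.2.trans ?_
    obtain ⟨yA, nA, cA, dA⟩ := exists_cpow_eq_div (e := 13 / 30) (e' := 17 / 30) hA 1 (by norm_num)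
    obtain ⟨yB, nB, cB, dB⟩ := exists_cpow_eq_div (e := 3 / 10) (e' := 17 / 10) hB 2 (by norm_num)
    rw [eC.1, ratioC, cA, dA, cB, dB]
    generalize 1 + 21 * t - 117 * x t + 9 * x t * t - 234 * x t ^ 2 = zB at *
    generalize 1 + 33 * x t - 9 * x t ^ 2 = zF at *
    generalize 1 - 9 * t + 54 * x t = zA at *
    generalize 1 + 3 / 7 * x t = zR at *
    field_simp
  · refine eD.2.trans ?_
    obtain ⟨yA, nA, cA⟩ := exists_cpow_eq hA (7 / 30)
    obtain ⟨yB, nB, cB, dB⟩ := exists_cpow_eq_div (e := 7 / 10) (e' := 3 / 10) hB 1 (by norm_num)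
    rw [eD.1, ratioD, cA, cB, dB]
    generalize 1 + 21 * t - 117 * x t + 9 * x t * t - 234 * x t ^ 2 = zB at *
    generalize 1 - 9 * t + 54 * x t = zA at *
    generalize 1 - 21 * x t = zL at *
    generalize t + 5 * x t = zM at *
    generalize 1 + 9 * x t = zC at *
    field_simp
  · exact eD.1

end E3

/-! ### The curve `ξ² = x (1 + 5 x - 5 x²)` -/

namespace E4

set_option linter.unusedSectionVars false
set_option linter.unusedVariables false

/-- A point of the curve, over any field, outside a finite set of points. -/
structure IsPoint {F : Type*} [Field F] (x ξ : F) : Prop where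
  sq : ξ ^ 2 = x * (1 + 5 * x - 5 * x ^ 2)
  ne₀ : x ≠ 0
  ne₁ : 1 - 125 * x ≠ 0
  ne₂ : 1 - 9 * x ≠ 0
  ne₃ : 1 - 5 * x ≠ 0
  ne₄ : 1 - x ≠ 0
  ne₅ : 1 + x ≠ 0
  ne₆ : 1 + 4 * x ≠ 0
  ne₇ : 1 + 5 * x ≠ 0
  ne₈ : 16 - 49 * x ≠ 0
  ne₉ : 25 + x ≠ 0
  ne₁₀ : 1 - 40 * x - 5 * x ^ 2 ≠ 0
  ne₁₁ : 1 - 15 * x - 5 * x ^ 2 ≠ 0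
  ne₁₂ : 1 + 5 * x - 5 * x ^ 2 ≠ 0
  ne₁₃ : 1 + 30 * x + 245 * x ^ 2 ≠ 0
  ne₁₄ : 1 - 500 * x - 2490 * x ^ 2 + 2500 * x ^ 3 + 25 * x ^ 4 ≠ 0

variable {F : Type*} [Field F]

/-- The logarithmic derivative of `1 + 50 * x - 125 * ξ ^ 2 - 450 * x * ξ - 500 * x ^ 2`. -/
def dlogS (x ξ : F) : F :=
  (-1350 * x - 2250 * x ^ 2 - 150 * ξ + 3750 * x * ξ) / ((1 - 125 * x) * (1 - 5 * x))

/-- The logarithmic derivative of `1 + 50 * x - 125 * ξ ^ 2 + 450 * x * ξ - 500 * x ^ 2`. -/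
def dlogSBar (x ξ : F) : F :=
  (1350 * x + 2250 * x ^ 2 - 150 * ξ + 3750 * x * ξ) / ((1 - 125 * x) * (1 - 5 * x))

/-- The logarithmic derivative of `1 + 3 * ξ - 20 * x`. -/
def dlogT (x ξ : F) : F := (3 + 90 * x - 45 * x ^ 2 + 300 * x ^ 3 - 49 * ξ + 710 * x * ξ
    + 135 * x ^ 2 * ξ) / ((1 - 9 * x) * (1 - 40 * x - 5 * x ^ 2))

/-- The logarithmic derivative of `1 - 3 / 5 * ξ - 34 / 5 * x`. -/
def dlogG (x ξ : F) : F := (-15 - 252 * x + 225 * x ^ 2 - 510 * x ^ 3 - 349 * ξ + 2222 * x * ξ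
    + 135 * x ^ 2 * ξ) / ((1 - 9 * x) * (1 - 5 * x) * (25 + x))

/-- The logarithmic derivative of `1 - 95 / 4 * ξ + 83 / 4 * x + 21 / 4 * ξ ^ 2 + 475 / 4 * x * ξ + 10 * x ^ 2`. -/
def dlogK (x ξ : F) : F := (-380 + 11780 * x + 134425 * x ^ 2 + 514900 * x ^ 3 - 859750 * x ^ 4
    + 304000 * x ^ 5 - 249375 * x ^ 6 - 8193 * ξ + 114202 * x * ξ + 900210 * x ^ 2 * ξ
    - 6320760 * x ^ 3 * ξ + 5488375 * x ^ 4 * ξ + 66150 * x ^ 5 * ξ) / ((1 - 9 * x) * (16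
    - 49 * x) * (1 - 500 * x - 2490 * x ^ 2 + 2500 * x ^ 3 + 25 * x ^ 4))

/-- The logarithmic derivative of `1 - 7 / 5 * ξ - 9 * x - x ^ 2`. -/
def dlogU (x ξ : F) : F := (-35 - 665 * x + 420 * x ^ 2 - 1925 * x ^ 3 + 175 * x ^ 4 - 499 * ξ
    + 3460 * x * ξ + 2085 * x ^ 2 * ξ + 100 * x ^ 3 * ξ) / ((1 - 5 * x) * (25 + x) * (1 - 15 * x
    - 5 * x ^ 2))

/-- The logarithmic derivative of `1 + 18 / 5 * ξ - 16 * x + x ^ 2`. -/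
def dlogV (x ξ : F) : F := (90 + 2340 * x - 1620 * x ^ 2 + 6300 * x ^ 3 + 450 * x ^ 4 - 1124 * ξ
    + 9660 * x * ξ + 2460 * x ^ 2 * ξ + 100 * x ^ 3 * ξ) / ((1 - 5 * x) * (25 + x) * (1 - 40 * x
    - 5 * x ^ 2))

/-- The logarithmic derivative of `1 - 35 / 4 * ξ - 101 / 4 * x`. -/
def dlogA (x ξ : F) : F := (-140 - 4935 * x + 2100 * x ^ 2 - 17675 * x ^ 3 - 2033 * ξ
    + 8152 * x * ξ + 18375 * x ^ 2 * ξ) / ((1 - 125 * x) * (1 + x) * (16 - 49 * x))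

/-- The logarithmic derivative of `1 + 21 / 4 * ξ + 41 / 4 * x`. -/
def dlogB (x ξ : F) : F := (84 - 21 * x - 1260 * x ^ 2 - 4305 * x ^ 3 - 113 * ξ - 1048 * x * ξ
    + 6615 * x ^ 2 * ξ) / ((1 - 9 * x) * (1 + 5 * x) * (16 - 49 * x))

/-- The logarithmic derivative of `1 - 9 * x`. -/
def dlogC (x ξ : F) : F := (-18 * ξ) / (1 - 9 * x)

/-- The logarithmic derivative of `1 - 7 / 4 * ξ - 15 / 2 * x`. -/
def dlogL (x ξ : F) : F := (-28 - 490 * x + 420 * x ^ 2 - 1050 * x ^ 3 - 289 * ξ + 1310 * x * ξ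
    + 735 * x ^ 2 * ξ) / ((16 - 49 * x) * (1 - 15 * x - 5 * x ^ 2))

/-- The logarithmic derivative of `1 + 5 * ξ + 10 * x`. -/
def dlogM (x ξ : F) : F :=
  (5 + 25 * x + 50 * x ^ 2 - 5 * ξ - 75 * x * ξ) / ((1 - 5 * x) * (1 + 5 * x))

/-- The logarithmic derivative of `1 - 3 * ξ + 2 * x`. -/
def dlogN (x ξ : F) : F := (-3 - 24 * x + 45 * x ^ 2 + 30 * x ^ 3 - 5 * ξ - 82 * x * ξ
    + 135 * x ^ 2 * ξ) / ((1 - 9 * x) * (1 - x) * (1 + 5 * x))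

/-- The logarithmic derivative of `1 - 7 / 4 * ξ + 25 / 2 * x - 245 / 4 * x ^ 2`. -/
def dlogP (x ξ : F) : F := (-28 + 70 * x - 4725 * x ^ 2 - 15400 * x ^ 3 + 8575 * x ^ 4 + 351 * ξ
    + 590 * x * ξ - 72765 * x ^ 2 * ξ + 240100 * x ^ 3 * ξ) / ((1 - 5 * x) * (16 - 49 * x) * (1
    + 30 * x + 245 * x ^ 2))

/-- The logarithmic derivative of `1 - 7 / 20 * ξ - 79 / 20 * x`. -/
def dlogQ (x ξ : F) : F := (-140 - 1953 * x + 2100 * x ^ 2 - 2765 * x ^ 3 - 3209 * ξ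
    + 11992 * x * ξ + 735 * x ^ 2 * ξ) / ((1 - 5 * x) * (16 - 49 * x) * (25 + x))

/-- The logarithmic derivative of `1 - 5 * x`. -/
def dlogR (x ξ : F) : F := (-10 * ξ) / (1 - 5 * x)

/-- The logarithmic derivative of `1 + 1 / 25 * x`. -/
def dlogW (x ξ : F) : F := (2 * ξ) / (25 + x)

/-- The logarithmic derivative of `1 - 27 / 5 * ξ + 58 / 5 * x - 2 * x ^ 2`. -/
def dlogH (x ξ : F) : F := (-135 - 459 * x - 1080 * x ^ 2 - 270 * x ^ 3 - 149 * ξ - 1507 * x * ξ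
    - 80 * x ^ 2 * ξ) / ((1 - 5 * x) * (1 + 4 * x) * (25 + x))

/-- The logarithmic derivative of `5 * ξ + 57 * x`. -/
def dlogZ (x ξ : F) : F :=
    (285 * x + 1425 * x ^ 3 + 25 * ξ - 6248 * x * ξ - 375 * x ^ 2 * ξ) / (x * (1 - 125 * x) * (25
    + x))

/-- The logarithmic derivative of `x`. -/
def dlogX (x ξ : F) : F := (2 * ξ) / x

/-- The logarithmic derivative of `ξ`. -/
def dlogXi (x ξ : F) : F := (ξ + 10 * x * ξ - 15 * x ^ 2 * ξ) / (x * (1 + 5 * x - 5 * x ^ 2))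

/-- The logarithmic derivative `θ` of the covering `φ`. -/
def theta (x ξ : F) : F := (-910 * x + 156900 * x ^ 2 - 2579550 * x ^ 3 - 18956000 * x ^ 4
    + 12897750 * x ^ 5 + 3922500 * x ^ 6 + 113750 * x ^ 7 + 25 * ξ + 1750 * x * ξ
    - 375625 * x ^ 2 * ξ - 1878125 * x ^ 4 * ξ - 43750 * x ^ 5 * ξ + 3125 * x ^ 6 * ξ) / (x * (1
    - 125 * x) * (25 + x) * (1 - 40 * x - 5 * x ^ 2) * (1 - 15 * x - 5 * x ^ 2))

/-- The function `ρ = θ φ / (1 - φ)`. -/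
def rho (x ξ : F) : F := (2160 - 583200 * x + 44938800 * x ^ 2 + 463212000 * x ^ 3
    + 1067256000 * x ^ 4 - 2316060000 * x ^ 5 + 1123470000 * x ^ 6 + 72900000 * x ^ 7
    + 1350000 * x ^ 8 + 29376 * ξ - 1002240 * x * ξ - 228804480 * x ^ 2 * ξ
    - 1144022400 * x ^ 4 * ξ + 25056000 * x ^ 5 * ξ + 3672000 * x ^ 6 * ξ) / ((1 - 125 * x) * (25
    + x) * (1 - 40 * x - 5 * x ^ 2) * (1 - 500 * x - 2490 * x ^ 2 + 2500 * x ^ 3 + 25 * x ^ 4))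

/-- The quotient of the hypergeometric functions with parameters
`(1/6, -1/30; 4/5)` and `(1/6, 29/30; 4/5)`. -/
def ratioA (x ξ : F) : F :=
    (1 + 3 * ξ - 20 * x) * (1 - 35 / 4 * ξ - 101 / 4 * x) / (1 - 95 / 4 * ξ + 83 / 4 * x
    + 21 / 4 * ξ ^ 2 + 475 / 4 * x * ξ + 10 * x ^ 2)

/-- The quotient of the hypergeometric functions with parameters
`(1/6, 11/30; 1/5)` and `(1/6, 11/30; 6/5)`. -/
def ratioB (x ξ : F) : F :=
    (1 - 95 / 4 * ξ + 83 / 4 * x + 21 / 4 * ξ ^ 2 + 475 / 4 * x * ξ + 10 * x ^ 2) / ((1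
    - 9 * x) * (1 - 7 / 4 * ξ - 15 / 2 * x))

/-- The quotient of the hypergeometric functions with parameters
`(13/30, -1/6; 3/5)` and `(13/30, 5/6; 3/5)`. -/
def ratioC (x ξ : F) : F :=
    (1 + 3 * ξ - 20 * x) ^ 3 * (1 - 7 / 4 * ξ + 25 / 2 * x - 245 / 4 * x ^ 2) * (1 - 7 / 20 * ξ
    - 79 / 20 * x) * (1 + 5 * ξ + 10 * x) / ((1 - 3 * ξ + 2 * x) * (1 - 95 / 4 * ξ + 83 / 4 * x
    + 21 / 4 * ξ ^ 2 + 475 / 4 * x * ξ + 10 * x ^ 2) ^ 2 * (1 - 5 * x) ^ 2)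

/-- The quotient of the hypergeometric functions with parameters
`(7/30, -1/6; 2/5)` and `(7/30, 5/6; 7/5)`. -/
def ratioD (x ξ : F) : F := (1 + 18 / 5 * ξ - 16 * x + x ^ 2) ^ 2 * (1 + 1 / 25 * x) * (1 + 5 * ξ
    + 10 * x) / ((1 - 7 / 5 * ξ - 9 * x - x ^ 2) ^ 2 * (1 - 27 / 5 * ξ + 58 / 5 * x - 2 * x ^ 2))

variable [CharZero F] {x ξ : F}

theorem rep_dlogS (h : IsPoint x ξ) : IsRep ξ ((1 - 125 * x) * (1 - 5 * x)) (dlogS x ξ)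
    (-1350 * x - 2250 * x ^ 2) (-150 + 3750 * x) := .of_div (mul_ne_zero h.ne₁ h.ne₃)

theorem mul_dlogS (h : IsPoint x ξ) :
    (1 + 50 * x - 125 * ξ ^ 2 - 450 * x * ξ - 500 * x ^ 2) * dlogS x ξ = 2 * ξ * (50 - 1000 * x
    - 450 * ξ) + (1 + 10 * x - 15 * x ^ 2) * (-450 * x - 250 * ξ) :=
  (rep_dlogS h).mul_eq h.sq (900 + 119250 * x - 843750 * x ^ 2 + 18750 * ξ - 468750 * x * ξ)

theorem rep_dlogSBar (h : IsPoint x ξ) : IsRep ξ ((1 - 125 * x) * (1 - 5 * x)) (dlogSBar x ξ)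
    (1350 * x + 2250 * x ^ 2) (-150 + 3750 * x) := .of_div (mul_ne_zero h.ne₁ h.ne₃)

theorem mul_dlogSBar (h : IsPoint x ξ) :
    (1 + 50 * x - 125 * ξ ^ 2 + 450 * x * ξ - 500 * x ^ 2) * dlogSBar x ξ = 2 * ξ * (50 - 1000 * x
    + 450 * ξ) + (1 + 10 * x - 15 * x ^ 2) * (450 * x - 250 * ξ) :=
  (rep_dlogSBar h).mul_eq h.sq (-900 - 119250 * x + 843750 * x ^ 2 + 18750 * ξ - 468750 * x * ξ)

theorem rep_dlogT (h : IsPoint x ξ) : IsRep ξ ((1 - 9 * x) * (1 - 40 * x - 5 * x ^ 2)) (dlogT x ξ)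
    (3 + 90 * x - 45 * x ^ 2 + 300 * x ^ 3) (-49 + 710 * x + 135 * x ^ 2) :=
  .of_div (mul_ne_zero h.ne₂ h.ne₁₀)

theorem mul_dlogT (h : IsPoint x ξ) : (1 + 3 * ξ - 20 * x) * dlogT x ξ = 2 * ξ * (-20)
    + (1 + 10 * x - 15 * x ^ 2) * 3 := (rep_dlogT h).mul_eq h.sq (-147 + 2130 * x + 405 * x ^ 2)

theorem rep_dlogG (h : IsPoint x ξ) : IsRep ξ ((1 - 9 * x) * (1 - 5 * x) * (25 + x)) (dlogG x ξ)
    (-15 - 252 * x + 225 * x ^ 2 - 510 * x ^ 3) (-349 + 2222 * x + 135 * x ^ 2) :=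
  .of_div (mul_ne_zero (mul_ne_zero h.ne₂ h.ne₃) h.ne₉)

theorem mul_dlogG (h : IsPoint x ξ) : (1 - 3 / 5 * ξ - 34 / 5 * x) * dlogG x ξ = 2 * ξ * (-34 / 5)
    + (1 + 10 * x - 15 * x ^ 2) * (-3 / 5) :=
  (rep_dlogG h).mul_eq h.sq (1047 / 5 - 6666 / 5 * x - 81 * x ^ 2)

theorem rep_dlogK (h : IsPoint x ξ) :
    IsRep ξ ((1 - 9 * x) * (16 - 49 * x) * (1 - 500 * x - 2490 * x ^ 2 + 2500 * x ^ 3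
    + 25 * x ^ 4)) (dlogK x ξ) (-380 + 11780 * x + 134425 * x ^ 2 + 514900 * x ^ 3 - 859750 * x ^ 4
    + 304000 * x ^ 5 - 249375 * x ^ 6) (-8193 + 114202 * x + 900210 * x ^ 2 - 6320760 * x ^ 3
    + 5488375 * x ^ 4 + 66150 * x ^ 5) := .of_div (mul_ne_zero (mul_ne_zero h.ne₂ h.ne₈) h.ne₁₄)

theorem mul_dlogK (h : IsPoint x ξ) : (1 - 95 / 4 * ξ + 83 / 4 * x + 21 / 4 * ξ ^ 2
    + 475 / 4 * x * ξ + 10 * x ^ 2) * dlogK x ξ = 2 * ξ * (83 / 4 + 20 * x + 475 / 4 * ξ)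
    + (1 + 10 * x - 15 * x ^ 2) * (-95 / 4 + 475 / 4 * x + 21 / 2 * ξ) :=
    (rep_dlogK h).mul_eq h.sq (755155 / 4 - 6710135 / 4 * x - 82697025 / 4 * x ^ 2
    + 376909175 / 2 * x ^ 3 - 2040630875 / 4 * x ^ 4 + 1564286625 / 4 * x ^ 5
    + 15710625 / 4 * x ^ 6 - 172053 / 4 * ξ + 1199121 / 2 * x * ξ + 9452205 / 2 * x ^ 2 * ξ
    - 33183990 * x ^ 3 * ξ + 115255875 / 4 * x ^ 4 * ξ + 694575 / 2 * x ^ 5 * ξ)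

theorem rep_dlogU (h : IsPoint x ξ) : IsRep ξ ((1 - 5 * x) * (25 + x) * (1 - 15 * x - 5 * x ^ 2))
    (dlogU x ξ) (-35 - 665 * x + 420 * x ^ 2 - 1925 * x ^ 3 + 175 * x ^ 4)
    (-499 + 3460 * x + 2085 * x ^ 2 + 100 * x ^ 3) :=
  .of_div (mul_ne_zero (mul_ne_zero h.ne₃ h.ne₉) h.ne₁₁)

theorem mul_dlogU (h : IsPoint x ξ) : (1 - 7 / 5 * ξ - 9 * x - x ^ 2) * dlogU x ξ = 2 * ξ * (-9
    - 2 * x) + (1 + 10 * x - 15 * x ^ 2) * (-7 / 5) :=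
  (rep_dlogU h).mul_eq h.sq (3493 / 5 - 4844 * x - 2919 * x ^ 2 - 140 * x ^ 3)

theorem rep_dlogV (h : IsPoint x ξ) : IsRep ξ ((1 - 5 * x) * (25 + x) * (1 - 40 * x - 5 * x ^ 2))
    (dlogV x ξ) (90 + 2340 * x - 1620 * x ^ 2 + 6300 * x ^ 3 + 450 * x ^ 4)
    (-1124 + 9660 * x + 2460 * x ^ 2 + 100 * x ^ 3) :=
  .of_div (mul_ne_zero (mul_ne_zero h.ne₃ h.ne₉) h.ne₁₀)

theorem mul_dlogV (h : IsPoint x ξ) : (1 + 18 / 5 * ξ - 16 * x + x ^ 2) * dlogV x ξ = 2 * ξ * (-16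
    + 2 * x) + (1 + 10 * x - 15 * x ^ 2) * (18 / 5) :=
  (rep_dlogV h).mul_eq h.sq (-20232 / 5 + 34776 * x + 8856 * x ^ 2 + 360 * x ^ 3)

theorem rep_dlogA (h : IsPoint x ξ) : IsRep ξ ((1 - 125 * x) * (1 + x) * (16 - 49 * x)) (dlogA x ξ)
    (-140 - 4935 * x + 2100 * x ^ 2 - 17675 * x ^ 3) (-2033 + 8152 * x + 18375 * x ^ 2) :=
  .of_div (mul_ne_zero (mul_ne_zero h.ne₁ h.ne₅) h.ne₈)

theorem mul_dlogA (h : IsPoint x ξ) : (1 - 35 / 4 * ξ - 101 / 4 * x) * dlogA x ξ =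
    2 * ξ * (-101 / 4) + (1 + 10 * x - 15 * x ^ 2) * (-35 / 4) :=
  (rep_dlogA h).mul_eq h.sq (71155 / 4 - 71330 * x - 643125 / 4 * x ^ 2)

theorem rep_dlogB (h : IsPoint x ξ) : IsRep ξ ((1 - 9 * x) * (1 + 5 * x) * (16 - 49 * x))
    (dlogB x ξ) (84 - 21 * x - 1260 * x ^ 2 - 4305 * x ^ 3) (-113 - 1048 * x + 6615 * x ^ 2) :=
  .of_div (mul_ne_zero (mul_ne_zero h.ne₂ h.ne₇) h.ne₈)

theorem mul_dlogB (h : IsPoint x ξ) : (1 + 21 / 4 * ξ + 41 / 4 * x) * dlogB x ξ = 2 * ξ * (41 / 4)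
    + (1 + 10 * x - 15 * x ^ 2) * (21 / 4) :=
  (rep_dlogB h).mul_eq h.sq (-2373 / 4 - 5502 * x + 138915 / 4 * x ^ 2)

theorem rep_dlogC (h : IsPoint x ξ) : IsRep ξ (1 - 9 * x) (dlogC x ξ) 0 (-18) := .of_div h.ne₂

theorem mul_dlogC (h : IsPoint x ξ) : (1 - 9 * x) * dlogC x ξ = 2 * ξ * (-9) :=
  (rep_dlogC h).mul_eq h.sq 0

theorem rep_dlogL (h : IsPoint x ξ) : IsRep ξ ((16 - 49 * x) * (1 - 15 * x - 5 * x ^ 2))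
    (dlogL x ξ) (-28 - 490 * x + 420 * x ^ 2 - 1050 * x ^ 3) (-289 + 1310 * x + 735 * x ^ 2) :=
  .of_div (mul_ne_zero h.ne₈ h.ne₁₁)

theorem mul_dlogL (h : IsPoint x ξ) : (1 - 7 / 4 * ξ - 15 / 2 * x) * dlogL x ξ = 2 * ξ * (-15 / 2)
    + (1 + 10 * x - 15 * x ^ 2) * (-7 / 4) :=
  (rep_dlogL h).mul_eq h.sq (2023 / 4 - 4585 / 2 * x - 5145 / 4 * x ^ 2)

theorem rep_dlogM (h : IsPoint x ξ) : IsRep ξ ((1 - 5 * x) * (1 + 5 * x)) (dlogM x ξ)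
    (5 + 25 * x + 50 * x ^ 2) (-5 - 75 * x) := .of_div (mul_ne_zero h.ne₃ h.ne₇)

theorem mul_dlogM (h : IsPoint x ξ) : (1 + 5 * ξ + 10 * x) * dlogM x ξ = 2 * ξ * 10
    + (1 + 10 * x - 15 * x ^ 2) * 5 := (rep_dlogM h).mul_eq h.sq (-25 - 375 * x)

theorem rep_dlogN (h : IsPoint x ξ) : IsRep ξ ((1 - 9 * x) * (1 - x) * (1 + 5 * x)) (dlogN x ξ)
    (-3 - 24 * x + 45 * x ^ 2 + 30 * x ^ 3) (-5 - 82 * x + 135 * x ^ 2) :=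
  .of_div (mul_ne_zero (mul_ne_zero h.ne₂ h.ne₄) h.ne₇)

theorem mul_dlogN (h : IsPoint x ξ) : (1 - 3 * ξ + 2 * x) * dlogN x ξ = 2 * ξ * 2
    + (1 + 10 * x - 15 * x ^ 2) * (-3) := (rep_dlogN h).mul_eq h.sq (15 + 246 * x - 405 * x ^ 2)

theorem rep_dlogP (h : IsPoint x ξ) :
    IsRep ξ ((1 - 5 * x) * (16 - 49 * x) * (1 + 30 * x + 245 * x ^ 2)) (dlogP x ξ)
    (-28 + 70 * x - 4725 * x ^ 2 - 15400 * x ^ 3 + 8575 * x ^ 4) (351 + 590 * x - 72765 * x ^ 2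
    + 240100 * x ^ 3) := .of_div (mul_ne_zero (mul_ne_zero h.ne₃ h.ne₈) h.ne₁₃)

theorem mul_dlogP (h : IsPoint x ξ) : (1 - 7 / 4 * ξ + 25 / 2 * x - 245 / 4 * x ^ 2) * dlogP x ξ =
    2 * ξ * (25 / 2 - 245 / 2 * x) + (1 + 10 * x - 15 * x ^ 2) * (-7 / 4) :=
  (rep_dlogP h).mul_eq h.sq (-2457 / 4 - 2065 / 2 * x + 509355 / 4 * x ^ 2 - 420175 * x ^ 3)

theorem rep_dlogQ (h : IsPoint x ξ) : IsRep ξ ((1 - 5 * x) * (16 - 49 * x) * (25 + x)) (dlogQ x ξ)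
    (-140 - 1953 * x + 2100 * x ^ 2 - 2765 * x ^ 3) (-3209 + 11992 * x + 735 * x ^ 2) :=
  .of_div (mul_ne_zero (mul_ne_zero h.ne₃ h.ne₈) h.ne₉)

theorem mul_dlogQ (h : IsPoint x ξ) : (1 - 7 / 20 * ξ - 79 / 20 * x) * dlogQ x ξ =
    2 * ξ * (-79 / 20) + (1 + 10 * x - 15 * x ^ 2) * (-7 / 20) :=
  (rep_dlogQ h).mul_eq h.sq (22463 / 20 - 20986 / 5 * x - 1029 / 4 * x ^ 2)

theorem rep_dlogR (h : IsPoint x ξ) : IsRep ξ (1 - 5 * x) (dlogR x ξ) 0 (-10) := .of_div h.ne₃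

theorem mul_dlogR (h : IsPoint x ξ) : (1 - 5 * x) * dlogR x ξ = 2 * ξ * (-5) :=
  (rep_dlogR h).mul_eq h.sq 0

theorem rep_dlogW (h : IsPoint x ξ) : IsRep ξ (25 + x) (dlogW x ξ) 0 2 := .of_div h.ne₉

theorem mul_dlogW (h : IsPoint x ξ) : (1 + 1 / 25 * x) * dlogW x ξ = 2 * ξ * (1 / 25) :=
  (rep_dlogW h).mul_eq h.sq 0

theorem rep_dlogH (h : IsPoint x ξ) : IsRep ξ ((1 - 5 * x) * (1 + 4 * x) * (25 + x)) (dlogH x ξ)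
    (-135 - 459 * x - 1080 * x ^ 2 - 270 * x ^ 3) (-149 - 1507 * x - 80 * x ^ 2) :=
  .of_div (mul_ne_zero (mul_ne_zero h.ne₃ h.ne₆) h.ne₉)

theorem mul_dlogH (h : IsPoint x ξ) : (1 - 27 / 5 * ξ + 58 / 5 * x - 2 * x ^ 2) * dlogH x ξ =
    2 * ξ * (58 / 5 - 4 * x) + (1 + 10 * x - 15 * x ^ 2) * (-27 / 5) :=
  (rep_dlogH h).mul_eq h.sq (4023 / 5 + 40689 / 5 * x + 432 * x ^ 2)

theorem rep_dlogZ (h : IsPoint x ξ) : IsRep ξ (x * (1 - 125 * x) * (25 + x)) (dlogZ x ξ)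
    (285 * x + 1425 * x ^ 3) (25 - 6248 * x - 375 * x ^ 2) :=
  .of_div (mul_ne_zero (mul_ne_zero h.ne₀ h.ne₁) h.ne₉)

theorem mul_dlogZ (h : IsPoint x ξ) : (5 * ξ + 57 * x) * dlogZ x ξ = 2 * ξ * 57
    + (1 + 10 * x - 15 * x ^ 2) * 5 := (rep_dlogZ h).mul_eq h.sq (125 - 31240 * x - 1875 * x ^ 2)

theorem rep_dlogX (h : IsPoint x ξ) : IsRep ξ x (dlogX x ξ) 0 2 := .of_div h.ne₀

theorem mul_dlogX (h : IsPoint x ξ) : x * dlogX x ξ = 2 * ξ := (rep_dlogX h).mul_eq h.sq 0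

theorem rep_dlogXi (h : IsPoint x ξ) : IsRep ξ (x * (1 + 5 * x - 5 * x ^ 2)) (dlogXi x ξ) 0
    (1 + 10 * x - 15 * x ^ 2) := .of_div (mul_ne_zero h.ne₀ h.ne₁₂)

theorem mul_dlogXi (h : IsPoint x ξ) : ξ * dlogXi x ξ = (1 + 10 * x - 15 * x ^ 2) :=
  (rep_dlogXi h).mul_eq h.sq (1 + 10 * x - 15 * x ^ 2)

theorem rep_theta (h : IsPoint x ξ) :
    IsRep ξ (x * (1 - 125 * x) * (25 + x) * (1 - 40 * x - 5 * x ^ 2) * (1 - 15 * x - 5 * x ^ 2))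
    (theta x ξ) (-910 * x + 156900 * x ^ 2 - 2579550 * x ^ 3 - 18956000 * x ^ 4 + 12897750 * x ^ 5
    + 3922500 * x ^ 6 + 113750 * x ^ 7) (25 + 1750 * x - 375625 * x ^ 2 - 1878125 * x ^ 4
    - 43750 * x ^ 5 + 3125 * x ^ 6) :=
  .of_div (mul_ne_zero (mul_ne_zero (mul_ne_zero (mul_ne_zero h.ne₀ h.ne₁) h.ne₉) h.ne₁₀) h.ne₁₁)

theorem rep_rho (h : IsPoint x ξ) :
    IsRep ξ ((1 - 125 * x) * (25 + x) * (1 - 40 * x - 5 * x ^ 2) * (1 - 500 * x - 2490 * x ^ 2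
    + 2500 * x ^ 3 + 25 * x ^ 4)) (rho x ξ) (2160 - 583200 * x + 44938800 * x ^ 2
    + 463212000 * x ^ 3 + 1067256000 * x ^ 4 - 2316060000 * x ^ 5 + 1123470000 * x ^ 6
    + 72900000 * x ^ 7 + 1350000 * x ^ 8) (29376 - 1002240 * x - 228804480 * x ^ 2
    - 1144022400 * x ^ 4 + 25056000 * x ^ 5 + 3672000 * x ^ 6) :=
  .of_div (mul_ne_zero (mul_ne_zero (mul_ne_zero h.ne₁ h.ne₉) h.ne₁₀) h.ne₁₄)

theorem theta_eq (h : IsPoint x ξ) : theta x ξ = dlogX x ξ + 5 * dlogU x ξ + dlogSBar x ξ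
    - dlogZ x ξ - 5 * dlogV x ξ - dlogS x ξ := by
  refine mul_left_cancel₀
    ((mul_ne_zero (mul_ne_zero (mul_ne_zero (mul_ne_zero (mul_ne_zero h.ne₀ h.ne₁) h.ne₃) h.ne₉)
    h.ne₁₀) h.ne₁₁) : (x * (1 - 125 * x) * (1 - 5 * x) * (25 + x) * (1 - 40 * x - 5 * x ^ 2) * (1
    - 15 * x - 5 * x ^ 2) : F) ≠ 0) ?_
  linear_combination (1 - 5 * x) * (rep_theta h).eq
    - ((25 - 4624 * x + 208940 * x ^ 2 - 2761635 * x ^ 3 + 8214825 * x ^ 4 + 4548650 * x ^ 5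
    + 559250 * x ^ 6 + 15625 * x ^ 7) * (rep_dlogX h).eq + (5 * x - 825 * x ^ 2 + 24975 * x ^ 3
    + 3125 * x ^ 4) * (rep_dlogU h).eq + (25 * x - 1374 * x ^ 2 + 14695 * x ^ 3 + 7465 * x ^ 4
    + 900 * x ^ 5 + 25 * x ^ 6) * (rep_dlogSBar h).eq + (-1 + 60 * x - 865 * x ^ 2 + 2675 * x ^ 3
    + 1350 * x ^ 4 + 125 * x ^ 5) * (rep_dlogZ h).eq + (-5 * x + 700 * x ^ 2 - 9350 * x ^ 3
    - 3125 * x ^ 4) * (rep_dlogV h).eq + (-25 * x + 1374 * x ^ 2 - 14695 * x ^ 3 - 7465 * x ^ 4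
    - 900 * x ^ 5 - 25 * x ^ 6) * (rep_dlogS h).eq)

theorem theta_ne_zero (h : IsPoint x ξ) : theta x ξ ≠ 0 :=
  (rep_theta h).ne_zero_of_norm h.sq (n :=
    (-25) * x * (1 - 125 * x) * (25 + x) * (1 - 40 * x - 5 * x ^ 2) * (1 - 15 * x - 5 * x ^ 2) * (1
    - 500 * x - 2490 * x ^ 2 + 2500 * x ^ 3 + 25 * x ^ 4) ^ 2) (by ring)
    (mul_ne_zero (mul_ne_zero
    (mul_ne_zero (mul_ne_zero (mul_ne_zero (mul_ne_zero (by norm_num) h.ne₀) h.ne₁) h.ne₉) h.ne₁₀)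
    h.ne₁₁) (pow_ne_zero 2 h.ne₁₄))

theorem rep_tau (h : IsPoint x ξ) :
    IsRep ξ (x * (1 - 15 * x - 5 * x ^ 2) * (1 - 500 * x - 2490 * x ^ 2 + 2500 * x ^ 3
    + 25 * x ^ 4)) (theta x ξ + rho x ξ) (50 * x + 8100 * x ^ 2 + 83250 * x ^ 3 + 82000 * x ^ 4
    - 416250 * x ^ 5 + 202500 * x ^ 6 - 6250 * x ^ 7) (1 + 910 * x + 34895 * x ^ 2 + 174475 * x ^ 4
    - 22750 * x ^ 5 + 125 * x ^ 6) := by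
  refine ⟨(mul_ne_zero (mul_ne_zero h.ne₀ h.ne₁₁) h.ne₁₄), mul_left_cancel₀
    ((mul_ne_zero (mul_ne_zero h.ne₁ h.ne₉) h.ne₁₀) : ((1 - 125 * x) * (25 + x) * (1 - 40 * x
    - 5 * x ^ 2) : F) ≠ 0) ?_⟩
  linear_combination (1 - 500 * x - 2490 * x ^ 2 + 2500 * x ^ 3 + 25 * x ^ 4) * (rep_theta h).eq
    + (x - 15 * x ^ 2 - 5 * x ^ 3) * (rep_rho h).eq

theorem rep_T (h : IsPoint x ξ) : IsRep ξ 1 (1 + 3 * ξ - 20 * x) (1 - 20 * x) 3 := .of_eq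

theorem rep_K (h : IsPoint x ξ) : IsRep ξ 1 (1 - 95 / 4 * ξ + 83 / 4 * x + 21 / 4 * ξ ^ 2
    + 475 / 4 * x * ξ + 10 * x ^ 2) (1 + 26 * x + 145 / 4 * x ^ 2 - 105 / 4 * x ^ 3)
    (-95 / 4 + 475 / 4 * x) := .of_eq (by linear_combination (21 / 4) * h.sq)

theorem rep_U (h : IsPoint x ξ) : IsRep ξ 1 (1 - 7 / 5 * ξ - 9 * x - x ^ 2) (1 - 9 * x - x ^ 2)
    (-7 / 5) := .of_eq

theorem rep_U_sq (h : IsPoint x ξ) : IsRep ξ 1 ((1 - 7 / 5 * ξ - 9 * x - x ^ 2) ^ 2)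
    (1 - 401 / 25 * x + 444 / 5 * x ^ 2 + 41 / 5 * x ^ 3 + x ^ 4) (-14 / 5 + 126 / 5 * x
    + 14 / 5 * x ^ 2) := (rep_U h).sq h.sq

theorem rep_V (h : IsPoint x ξ) : IsRep ξ 1 (1 + 18 / 5 * ξ - 16 * x + x ^ 2) (1 - 16 * x + x ^ 2)
    (18 / 5) := .of_eq

theorem rep_V_sq (h : IsPoint x ξ) : IsRep ξ 1 ((1 + 18 / 5 * ξ - 16 * x + x ^ 2) ^ 2)
    (1 - 476 / 25 * x + 1614 / 5 * x ^ 2 - 484 / 5 * x ^ 3 + x ^ 4) (36 / 5 - 576 / 5 * x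
    + 36 / 5 * x ^ 2) := (rep_V h).sq h.sq

theorem rep_M (h : IsPoint x ξ) : IsRep ξ 1 (1 + 5 * ξ + 10 * x) (1 + 10 * x) 5 := .of_eq

theorem rep_phi (h : IsPoint x ξ) :
    IsRep ξ ((1 - 125 * x) * (25 + x) * (1 - 40 * x - 5 * x ^ 2) ^ 5) (phi4 x ξ)
    (-78624 * x - 1771200 * x ^ 2 + 1228521600 * x ^ 3 + 27363744000 * x ^ 4 + 52008804000 * x ^ 5
    + 147921120000 * x ^ 6 - 260044020000 * x ^ 7 + 684093600000 * x ^ 8 - 153565200000 * x ^ 9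
    - 1107000000 * x ^ 10 + 245700000 * x ^ 11) (2160 + 993600 * x - 96055200 * x ^ 2
    - 7439364000 * x ^ 3 - 35893098000 * x ^ 4 - 179465490000 * x ^ 6 + 185984100000 * x ^ 7
    - 12006900000 * x ^ 8 - 621000000 * x ^ 9 + 6750000 * x ^ 10) ∧ phi4 x ξ ≠ 0 := by
  have nc : IsRep ξ 1 (432 : F) 432 0 := .of_eq
  have nX : IsRep ξ 1 x x 0 := .of_eq
  have nm1 : IsRep ξ 1 (432 * x) (432 * x) 0 := nc.mul h.sq nX
  have nU3 : IsRep ξ 1 ((1 - 7 / 5 * ξ - 9 * x - x ^ 2) ^ 3) (1 - 528 / 25 * x + 5412 / 25 * x ^ 2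
      - 24372 / 25 * x ^ 3 - 24 / 5 * x ^ 4 + 12 / 5 * x ^ 5 - x ^ 6) (-21 / 5 + 9107 / 125 * x
      - 8638 / 25 * x ^ 2 - 1547 / 25 * x ^ 3 - 21 / 5 * x ^ 4) :=
      (rep_U_sq h).pow_succ h.sq (rep_U h)
  have nU4 : IsRep ξ 1 ((1 - 7 / 5 * ξ - 9 * x - x ^ 2) ^ 4)
      (1 - 606 / 25 * x + 208101 / 625 * x ^ 2 - 369718 / 125 * x ^ 3 + 1445988 / 125 * x ^ 4
      - 23978 / 25 * x ^ 5 - 10539 / 25 * x ^ 6 - 114 / 5 * x ^ 7 + x ^ 8)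
      (-28 / 5 + 17528 / 125 * x - 162512 / 125 * x ^ 2 + 542472 / 125 * x ^ 3 + 22624 / 25 * x ^ 4
      + 2408 / 25 * x ^ 5 + 28 / 5 * x ^ 6) := nU3.pow_succ h.sq (rep_U h)
  have nU5 : IsRep ξ 1 ((1 - 7 / 5 * ξ - 9 * x - x ^ 2) ^ 5) (1 - 127 / 5 * x + 49126 / 125 * x ^ 2
      - 641349 / 125 * x ^ 3 + 5232649 / 125 * x ^ 4 - 3571464 / 25 * x ^ 5 + 513787 / 25 * x ^ 6
      + 10383 * x ^ 7 + 6314 / 5 * x ^ 8 + 53 * x ^ 9 - x ^ 10) (-7 + 5614 / 25 * x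
      - 9445807 / 3125 * x ^ 2 + 12525786 / 625 * x ^ 3 - 33154996 / 625 * x ^ 4
      - 1380666 / 125 * x ^ 5 - 147007 / 125 * x ^ 6 - 574 / 5 * x ^ 7 - 7 * x ^ 8) :=
      nU4.pow_succ h.sq (rep_U h)
  have nm2 : IsRep ξ 1 (432 * x * (1 - 7 / 5 * ξ - 9 * x - x ^ 2) ^ 5) (432 * x - 54864 / 5 * x ^ 2
      + 21222432 / 125 * x ^ 3 - 277062768 / 125 * x ^ 4 + 2260504368 / 125 * x ^ 5
      - 1542872448 / 25 * x ^ 6 + 221955984 / 25 * x ^ 7 + 4485456 * x ^ 8 + 2727648 / 5 * x ^ 9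
      + 22896 * x ^ 10 - 432 * x ^ 11) (-3024 * x + 2425248 / 25 * x ^ 2
      - 4080588624 / 3125 * x ^ 3 + 5411139552 / 625 * x ^ 4 - 14322958272 / 625 * x ^ 5
      - 596447712 / 125 * x ^ 6 - 63507024 / 125 * x ^ 7 - 247968 / 5 * x ^ 8 - 3024 * x ^ 9) :=
      nm1.mul h.sq nU5
  have nSBar : IsRep ξ 1 (1 + 50 * x - 125 * ξ ^ 2 + 450 * x * ξ - 500 * x ^ 2)
      (1 - 75 * x - 1125 * x ^ 2 + 625 * x ^ 3) (450 * x) :=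
      .of_eq (by linear_combination (-125) * h.sq)
  have nm3 : IsRep ξ 1 (432 * x * (1 - 7 / 5 * ξ - 9 * x - x ^ 2) ^ 5 * (1 + 50 * x - 125 * ξ ^ 2
      + 450 * x * ξ - 500 * x ^ 2)) (432 * x - 216864 / 5 * x ^ 2 - 106757568 / 125 * x ^ 3
      + 4314362832 / 125 * x ^ 4 - 47008329264 / 125 * x ^ 5 + 48034597536 / 25 * x ^ 6
      - 4986761328 * x ^ 7 + 34402177872 / 5 * x ^ 8 - 41488642368 / 5 * x ^ 9
      + 10032485040 * x ^ 10 + 3218151600 * x ^ 11 + 420012000 * x ^ 12 + 21600000 * x ^ 13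
      - 270000 * x ^ 14) (-3024 * x + 12955248 / 25 * x ^ 2 - 31616538624 / 3125 * x ^ 3
      + 44979090912 / 625 * x ^ 4 - 87522712272 / 625 * x ^ 5 - 88046222832 / 125 * x ^ 6
      + 472265118576 / 125 * x ^ 7 - 24608332656 / 5 * x ^ 8 - 388503648 * x ^ 9
      - 16027200 * x ^ 10 - 17290800 * x ^ 11 - 2084400 * x ^ 12) := nm2.mul h.sq nSBar
  have rZ : IsRep ξ 1 (5 * ξ + 57 * x) (57 * x) 5 := .of_eq
  have rV3 : IsRep ξ 1 ((1 + 18 / 5 * ξ - 16 * x + x ^ 2) ^ 3)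
      (1 - 228 / 25 * x + 8583 / 25 * x ^ 2 - 186448 / 25 * x ^ 3 + 20379 / 5 * x ^ 4
      - 1212 / 5 * x ^ 5 + x ^ 6) (54 / 5 - 37368 / 125 * x + 75492 / 25 * x ^ 2
      - 14472 / 25 * x ^ 3 + 54 / 5 * x ^ 4) := (rep_V_sq h).pow_succ h.sq (rep_V h)
  have rV4 : IsRep ξ 1 ((1 + 18 / 5 * ξ - 16 * x + x ^ 2) ^ 4)
      (1 + 344 / 25 * x - 244724 / 625 * x ^ 2 - 958088 / 125 * x ^ 3 + 22674638 / 125 * x ^ 4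
      - 3441208 / 25 * x ^ 5 + 464236 / 25 * x ^ 6 - 2264 / 5 * x ^ 7 + x ^ 8)
      (72 / 5 - 63072 / 125 * x + 1131192 / 125 * x ^ 2 - 9505152 / 125 * x ^ 3
      + 674136 / 25 * x ^ 4 - 40608 / 25 * x ^ 5 + 72 / 5 * x ^ 6) := rV3.pow_succ h.sq (rep_V h)
  have rV5 : IsRep ξ 1 ((1 + 18 / 5 * ξ - 16 * x + x ^ 2) ^ 5)
      (1 + 248 / 5 * x - 270999 / 125 * x ^ 2 + 2731344 / 125 * x ^ 3 + 25233306 / 125 * x ^ 4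
      - 112055616 / 25 * x ^ 5 + 106265298 / 25 * x ^ 6 - 949776 * x ^ 7 + 276561 / 5 * x ^ 8
      - 728 * x ^ 9 + x ^ 10) (18 - 17136 / 25 * x + 49148568 / 3125 * x ^ 2
      - 155582064 / 625 * x ^ 3 + 1191065004 / 625 * x ^ 4 - 125580816 / 125 * x ^ 5
      + 14977368 / 125 * x ^ 6 - 17424 / 5 * x ^ 7 + 18 * x ^ 8) := rV4.pow_succ h.sq (rep_V h)
  have rm1 : IsRep ξ 1 ((5 * ξ + 57 * x) * (1 + 18 / 5 * ξ - 16 * x + x ^ 2) ^ 5)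
      (147 * x - 150 * x ^ 2 - 39077397 / 625 * x ^ 3 + 51395112 / 125 * x ^ 4
      + 1802304558 / 125 * x ^ 5 - 1033220772 / 5 * x ^ 6 + 850626054 / 5 * x ^ 7
      - 130215096 / 5 * x ^ 8 + 351459 / 5 * x ^ 9 + 46074 * x ^ 10 - 393 * x ^ 11)
      (5 + 1274 * x - 1247751 / 25 * x ^ 2 + 3142886376 / 3125 * x ^ 3 - 8237344998 / 625 * x ^ 4
      + 53883753228 / 625 * x ^ 5 - 4501474062 / 125 * x ^ 6 + 260099976 / 125 * x ^ 7
      + 389637 / 5 * x ^ 8 - 2614 * x ^ 9 + 5 * x ^ 10) := rZ.mul h.sq rV5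
  have rS : IsRep ξ 1 (1 + 50 * x - 125 * ξ ^ 2 - 450 * x * ξ - 500 * x ^ 2)
      (1 - 75 * x - 1125 * x ^ 2 + 625 * x ^ 3) (-450 * x) :=
      .of_eq (by linear_combination (-125) * h.sq)
  have rm2 : IsRep ξ 1 ((5 * ξ + 57 * x) * (1 + 18 / 5 * ξ - 16 * x + x ^ 2) ^ 5 * (1 + 50 * x
      - 125 * ξ ^ 2 - 450 * x * ξ - 500 * x ^ 2)) (147 * x - 13425 * x ^ 2
      - 500749272 / 625 * x ^ 3 + 3120667692 / 125 * x ^ 4 - 7089615357 / 25 * x ^ 5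
      + 44151308091 / 25 * x ^ 6 - 179357770296 / 25 * x ^ 7 + 106350578352 / 5 * x ^ 8
      - 44518477095 * x ^ 9 + 49878027525 * x ^ 10 - 11851782000 * x ^ 11 + 173344500 * x ^ 12
      + 23345625 * x ^ 13 - 234375 * x ^ 14) (5 + 899 * x - 5430876 / 25 * x ^ 2
      + 10582348876 / 3125 * x ^ 3 - 2205158863 / 625 * x ^ 4 - 170599917897 / 625 * x ^ 5
      + 308179960368 / 125 * x ^ 6 - 1191908261424 / 125 * x ^ 7 + 88423464339 / 5 * x ^ 8
      - 13134758623 * x ^ 9 + 1181396300 * x ^ 10 + 30911700 * x ^ 11 - 1462525 * x ^ 12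
      + 3125 * x ^ 13) := rm1.mul h.sq rS
  have hr := rm2.ne_zero_of_norm h.sq (n :=
      (-1 / 9765625) * x * (1 - 125 * x) ^ 2 * (1 - 5 * x) ^ 10 * (25 + x) ^ 6 * (1 - 40 * x
      - 5 * x ^ 2) ^ 5) (by ring)
      (mul_ne_zero (mul_ne_zero (mul_ne_zero (mul_ne_zero (mul_ne_zero (by norm_num) h.ne₀)
      (pow_ne_zero 2 h.ne₁)) (pow_ne_zero 10 h.ne₃)) (pow_ne_zero 6 h.ne₉)) (pow_ne_zero 5 h.ne₁₀))
  have hn := nm3.ne_zero_of_norm h.sq (n :=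
      186624 / 9765625 * x ^ 2 * (1 - 125 * x) * (1 - 5 * x) ^ 10 * (25 + x) ^ 5 * (1 - 15 * x
      - 5 * x ^ 2) ^ 5) (by ring)
      (mul_ne_zero (mul_ne_zero
      (mul_ne_zero (mul_ne_zero (mul_ne_zero (by norm_num) (pow_ne_zero 2 h.ne₀)) h.ne₁)
      (pow_ne_zero 10 h.ne₃)) (pow_ne_zero 5 h.ne₉)) (pow_ne_zero 5 h.ne₁₁))
  unfold phi4
  exact ⟨nm3.div h.sq rm2 hr (mul_ne_zero (mul_ne_zero h.ne₁ h.ne₉) (pow_ne_zero 5 h.ne₁₀)),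
    div_ne_zero hn hr⟩

theorem rho_mul (h : IsPoint x ξ) :
    rho x ξ * (1 - phi4 x ξ) = theta x ξ * phi4 x ξ :=
  (rep_rho h).mul_one_sub_eq h.sq (rep_theta h) (rep_phi h).1

theorem rep_ratioA (h : IsPoint x ξ) :
    IsRep ξ (1 - 500 * x - 2490 * x ^ 2 + 2500 * x ^ 3 + 25 * x ^ 4) (ratioA x ξ)
    (1 - 170 * x - 1170 * x ^ 2 + 1900 * x ^ 3 - 125 * x ^ 4) (18 - 1650 * x - 660 * x ^ 2) := by
  have nA : IsRep ξ 1 (1 - 35 / 4 * ξ - 101 / 4 * x) (1 - 101 / 4 * x) (-35 / 4) := .of_eq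
  have nm1 : IsRep ξ 1 ((1 + 3 * ξ - 20 * x) * (1 - 35 / 4 * ξ - 101 / 4 * x))
      (1 - 143 / 2 * x + 1495 / 4 * x ^ 2 + 525 / 4 * x ^ 3) (-23 / 4 + 397 / 4 * x) :=
      (rep_T h).mul h.sq nA
  have hr := (rep_K h).ne_zero_of_norm h.sq (n :=
      1 / 16 * (1 - 9 * x) * (16 - 49 * x) * (1 - 500 * x - 2490 * x ^ 2 + 2500 * x ^ 3
      + 25 * x ^ 4)) (by ring) (mul_ne_zero (mul_ne_zero (mul_ne_zero (by norm_num) h.ne₂) h.ne₈)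
      h.ne₁₄)
  exact nm1.div h.sq (rep_K h) hr h.ne₁₄

theorem contiguousA (h : IsPoint x ξ) {v l : F} (hv : v = 1 / 6 * dlogG x ξ - 1 / 6 * dlogT x ξ
    - 1 / 30 * dlogS x ξ) (hl : l = dlogT x ξ + dlogA x ξ - dlogK x ξ) :
    v = (-1 / 30) * theta x ξ * (ratioA x ξ - 1)
      ∧ (l + v) * ratioA x ξ = (theta x ξ + rho x ξ) * ((4 / 5) - (-1 / 30) - 1) * (1 - ratioA x ξ)
      + (1 / 6) * rho x ξ * ratioA x ξ := by
  have h1 : IsRep ξ ((1 - 125 * x) * (25 + x) * (1 - 40 * x - 5 * x ^ 2)) v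
      (-15 + 2535 * x + 18615 * x ^ 2 - 24075 * x ^ 3 - 1800 * x ^ 4)
      (271 - 24975 * x - 5895 * x ^ 2 - 125 * x ^ 3) := by
    refine ⟨(mul_ne_zero (mul_ne_zero h.ne₁ h.ne₉) h.ne₁₀), mul_left_cancel₀
      ((mul_ne_zero (mul_ne_zero (by norm_num) h.ne₂) h.ne₃) : (30 * (1 - 9 * x) * (1 - 5 * x) : F)
      ≠ 0) ?_⟩
    rw [hv]
    linear_combination (5 - 825 * x + 24975 * x ^ 2 + 3125 * x ^ 3) * (rep_dlogG h).eq
      + (-125 + 16245 * x - 77475 * x ^ 2 - 3125 * x ^ 3) * (rep_dlogT h).eq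
      + (-25 + 1224 * x - 8826 * x ^ 2 - 1480 * x ^ 3 - 45 * x ^ 4) * (rep_dlogS h).eq
  have h2 : IsRep ξ ((1 - 125 * x) * (1 + x) * (1 - 500 * x - 2490 * x ^ 2 + 2500 * x ^ 3
      + 25 * x ^ 4)) (l + v - (1 / 6) * rho x ξ) (3 + 2685 * x + 70590 * x ^ 2 + 74850 * x ^ 3
      - 977325 * x ^ 4 + 674625 * x ^ 5 - 28500 * x ^ 6) (151 + 20765 * x + 15250 * x ^ 2
      + 466450 * x ^ 3 - 90025 * x ^ 4 + 625 * x ^ 5) := by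
    refine ⟨(mul_ne_zero (mul_ne_zero h.ne₁ h.ne₅) h.ne₁₄), mul_left_cancel₀
      ((mul_ne_zero (mul_ne_zero (mul_ne_zero (mul_ne_zero (mul_ne_zero (by norm_num) h.ne₂) h.ne₃)
      h.ne₈) h.ne₉) h.ne₁₀) : (30 * (1 - 9 * x) * (1 - 5 * x) * (16 - 49 * x) * (25 + x) * (1
      - 40 * x - 5 * x ^ 2) : F) ≠ 0) ?_⟩
    rw [hv, hl]
    linear_combination (80 - 53365 * x + 6909880 * x ^ 2 - 180544900 * x ^ 3
      - 730046600 * x ^ 4 + 3556450250 * x ^ 5 + 1556833000 * x ^ 6 - 2954312500 * x ^ 7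
      - 415985000 * x ^ 8 - 3828125 * x ^ 9) * (rep_dlogG h).eq
      + (10000 - 6320225 * x + 644060300 * x ^ 2 - 1120093100 * x ^ 3 - 21074156500 * x ^ 4
      + 53132070250 * x ^ 5 + 27768162500 * x ^ 6 - 47049927500 * x ^ 7 - 2401487500 * x ^ 8
      - 19140625 * x ^ 9) * (rep_dlogT h).eq + (-400 + 220409 * x - 9388883 * x ^ 2
      + 38580692 * x ^ 3 + 396845764 * x ^ 4 - 1207599250 * x ^ 5 - 719183930 * x ^ 6
      + 1021300100 * x ^ 7 + 191536900 * x ^ 8 + 7362625 * x ^ 9 + 55125 * x ^ 10) * (rep_dlogS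
      h).eq + (750 - 415470 * x + 18815880 * x ^ 2 - 122824200 * x ^ 3 - 578093100 * x ^ 4
      + 4416211500 * x ^ 5 - 2634747000 * x ^ 6 - 566805000 * x ^ 7 - 22391250 * x ^ 8
      - 168750 * x ^ 9) * (rep_dlogA h).eq + (-750 + 126720 * x - 4232430 * x ^ 2
      + 13728000 * x ^ 3 + 21162150 * x ^ 4 + 3168000 * x ^ 5 + 93750 * x ^ 6) * (rep_dlogK h).eq
      + (-80 + 1285 * x - 5665 * x ^ 2 + 3995 * x ^ 3 + 11025 * x ^ 4) * (rep_rho h).eq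
  have h3 := h1.eq_mul_add h.sq (rep_theta h) (rep_ratioA h) (1 / 30) (-1 / 30)
  have h4 := h2.mul_eq_mul_one_sub h.sq (rep_tau h) (rep_ratioA h) (-1 / 6)
  exact ⟨by linear_combination h3, by linear_combination h4⟩

theorem rep_ratioB (h : IsPoint x ξ) : IsRep ξ ((1 - 9 * x) * (1 - 15 * x - 5 * x ^ 2))
    (ratioB x ξ) (1 - 20 * x - 220 * x ^ 2 + 275 * x ^ 3) (-22 + 275 * x + 15 * x ^ 2) := by
  have rC : IsRep ξ 1 (1 - 9 * x) (1 - 9 * x) 0 := .of_eq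
  have rL : IsRep ξ 1 (1 - 7 / 4 * ξ - 15 / 2 * x) (1 - 15 / 2 * x) (-7 / 4) := .of_eq
  have rm1 : IsRep ξ 1 ((1 - 9 * x) * (1 - 7 / 4 * ξ - 15 / 2 * x))
      (1 - 33 / 2 * x + 135 / 2 * x ^ 2) (-7 / 4 + 63 / 4 * x) := rC.mul h.sq rL
  have hr := rm1.ne_zero_of_norm h.sq (n :=
      1 / 16 * (1 - 9 * x) ^ 2 * (16 - 49 * x) * (1 - 15 * x - 5 * x ^ 2)) (by ring)
      (mul_ne_zero (mul_ne_zero (mul_ne_zero (by norm_num) (pow_ne_zero 2 h.ne₂)) h.ne₈) h.ne₁₁)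
  exact (rep_K h).div h.sq rm1 hr (mul_ne_zero h.ne₂ h.ne₁₁)

theorem contiguousB (h : IsPoint x ξ) {v l : F} (hv : v = 11 / 30 * dlogS x ξ + 5 / 6 * dlogT x ξ
    + 1 / 6 * dlogG x ξ + dlogB x ξ - dlogK x ξ - dlogM x ξ) (hl : l = dlogK x ξ - dlogC x ξ
    - dlogL x ξ) :
    v = rho x ξ * ((1 / 6) + (11 / 30) - (1 / 5) + ((1 / 5) - (1 / 6)) * ((1 / 5)
      - (11 / 30)) / (1 / 5) * ratioB x ξ)
      ∧ (l + v) * ratioB x ξ = theta x ξ * (1 / 5) * (1 - ratioB x ξ) := by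
  have h1 : IsRep ξ ((1 - 125 * x) * (1 - 9 * x) * (25 + x) * (1 - 40 * x - 5 * x ^ 2) * (1
      - 500 * x - 2490 * x ^ 2 + 2500 * x ^ 3 + 25 * x ^ 4)) v (660 - 166428 * x + 14939460 * x ^ 2
      - 135023100 * x ^ 3 - 1763710200 * x ^ 4 - 3751257600 * x ^ 5 + 5671558500 * x ^ 6
      - 1606027500 * x ^ 7 - 147082500 * x ^ 8 - 3517500 * x ^ 9) (10296 - 743388 * x
      - 40181520 * x ^ 2 + 987578040 * x ^ 3 + 37775100 * x ^ 4 + 2583503700 * x ^ 5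
      + 124473000 * x ^ 6 + 2394000 * x ^ 7 + 112500 * x ^ 8) := by
    refine ⟨(mul_ne_zero (mul_ne_zero (mul_ne_zero (mul_ne_zero h.ne₁ h.ne₂) h.ne₉) h.ne₁₀)
      h.ne₁₄), mul_left_cancel₀ ((mul_ne_zero (mul_ne_zero (mul_ne_zero (by norm_num) h.ne₃) h.ne₇)
      h.ne₈) : (30 * (1 - 5 * x) * (1 + 5 * x) * (16 - 49 * x) : F) ≠ 0) ?_⟩
    rw [hv]
    linear_combination (4400 - 2406899 * x + 93562117 * x ^ 2 - 1561164 * x ^ 3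
      - 6485680300 * x ^ 4 - 2057244970 * x ^ 5 + 76386226950 * x ^ 6 - 48065411900 * x ^ 7
      - 10212999500 * x ^ 8 - 402518875 * x ^ 9 - 3031875 * x ^ 10) * (rep_dlogS h).eq
      + (10000 - 6280225 * x + 618739400 * x ^ 2 + 1481469000 * x ^ 3 - 28156091000 * x ^ 4
      - 24082621250 * x ^ 5 + 317511135000 * x ^ 6 - 225720250000 * x ^ 7 - 11930875000 * x ^ 8
      - 95703125 * x ^ 9) * (rep_dlogT h).eq + (80 - 53045 * x + 6696100 * x ^ 2
      - 152691600 * x ^ 3 - 1480079500 * x ^ 4 + 1386296750 * x ^ 5 + 17952787500 * x ^ 6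
      - 13122935000 * x ^ 7 - 2064612500 * x ^ 8 - 19140625 * x ^ 9) * (rep_dlogG h).eq
      + (750 - 502470 * x + 66227400 * x ^ 2 - 1878762600 * x ^ 3 - 2133931500 * x ^ 4
      + 57472465500 * x ^ 5 - 37408995000 * x ^ 6 - 7904385000 * x ^ 7 - 311231250 * x ^ 8
      - 2343750 * x ^ 9) * (rep_dlogB h).eq + (-750 + 123720 * x - 3722550 * x ^ 2
      - 3711600 * x ^ 3 + 93513750 * x ^ 4 + 15465000 * x ^ 5 + 468750 * x ^ 6) * (rep_dlogK h).eq
      + (-12000 + 8124270 * x - 1116324510 * x ^ 2 + 37482056520 * x ^ 3 - 170254278600 * x ^ 4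
      - 1354145313900 * x ^ 5 + 5861066983500 * x ^ 6 - 3133488243000 * x ^ 7
      - 690641025000 * x ^ 8 - 27401471250 * x ^ 9 - 206718750 * x ^ 10) * (rep_dlogM h).eq
  have h2 : IsRep ξ ((1 - 125 * x) * (25 + x) * (1 - 40 * x - 5 * x ^ 2) * (1 - 15 * x
      - 5 * x ^ 2)) (l + v) (110 - 25485 * x + 462660 * x ^ 2 + 3475225 * x ^ 3 - 2482875 * x ^ 4
      - 715500 * x ^ 5 - 20875 * x ^ 6) (-1604 + 117760 * x - 367375 * x ^ 2 + 230425 * x ^ 3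
      + 1975 * x ^ 4 - 625 * x ^ 5) := by
    refine ⟨(mul_ne_zero (mul_ne_zero (mul_ne_zero h.ne₁ h.ne₉) h.ne₁₀) h.ne₁₁), mul_left_cancel₀
      ((mul_ne_zero (mul_ne_zero (mul_ne_zero (mul_ne_zero (by norm_num) h.ne₂) h.ne₃) h.ne₇)
      h.ne₈) : (30 * (1 - 9 * x) * (1 - 5 * x) * (1 + 5 * x) * (16 - 49 * x) : F) ≠ 0) ?_⟩
    rw [hv, hl]
    linear_combination (4400 - 272899 * x + 4150102 * x ^ 2 - 8425934 * x ^ 3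
      - 127148945 * x ^ 4 + 312284665 * x ^ 5 + 175844900 * x ^ 6 + 21685400 * x ^ 7
      + 606375 * x ^ 8) * (rep_dlogS h).eq + (10000 - 1430225 * x + 22680275 * x ^ 2
      - 14343625 * x ^ 3 - 594438250 * x ^ 4 + 1251715625 * x ^ 5 + 529534375 * x ^ 6
      + 19140625 * x ^ 7) * (rep_dlogT h).eq + (80 - 14245 * x + 568075 * x ^ 2 - 4500425 * x ^ 3
      - 23281250 * x ^ 4 + 84432625 * x ^ 5 + 41594375 * x ^ 6 + 3828125 * x ^ 7) * (rep_dlogG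
      h).eq + (750 - 138720 * x + 6268200 * x ^ 2 - 82849050 * x ^ 3 + 246444750 * x ^ 4
      + 136459500 * x ^ 5 + 16777500 * x ^ 6 + 468750 * x ^ 7) * (rep_dlogB h).eq
      + (-12000 + 2304270 * x - 115873560 * x ^ 2 + 2017155120 * x ^ 3 - 12611483250 * x ^ 4
      + 18859499550 * x ^ 5 + 11683606500 * x ^ 6 + 1469950500 * x ^ 7
      + 41343750 * x ^ 8) * (rep_dlogM h).eq + (-12000 + 2196270 * x - 95807130 * x ^ 2
      + 1097284200 * x ^ 3 + 160913550 * x ^ 4 - 30121156500 * x ^ 5 + 55880279250 * x ^ 6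
      + 32904975000 * x ^ 7 + 4095956250 * x ^ 8 + 114843750 * x ^ 9) * (rep_dlogC h).eq
      + (-750 + 130470 * x - 4836030 * x ^ 2 + 29791350 * x ^ 3 + 126918150 * x ^ 4
      - 826158750 * x ^ 5 - 138716250 * x ^ 6 - 4218750 * x ^ 7) * (rep_dlogL h).eq
  have h3 := h1.eq_mul_add h.sq (rep_rho h) (rep_ratioB h) (1 / 3) (-1 / 36)
  have h4 := h2.mul_eq_mul_one_sub h.sq (rep_theta h) (rep_ratioB h) (1 / 5)
  exact ⟨by linear_combination h3, by linear_combination h4⟩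

theorem rep_ratioC (h : IsPoint x ξ) :
    IsRep ξ (5 * (1 - x) * (1 - 500 * x - 2490 * x ^ 2 + 2500 * x ^ 3 + 25 * x ^ 4) ^ 2)
    (ratioC x ξ) (5 + 7007 * x + 393040 * x ^ 2 + 5960900 * x ^ 3 + 13672450 * x ^ 4
    - 47051350 * x ^ 5 + 46114000 * x ^ 6 - 15902500 * x ^ 7 - 614375 * x ^ 8 + 4375 * x ^ 9)
    (312 + 70680 * x + 1415760 * x ^ 2 + 10269600 * x ^ 3 + 9991200 * x ^ 4 - 19560000 * x ^ 5
    + 351000 * x ^ 6 + 45000 * x ^ 7) := by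
  have nT2 : IsRep ξ 1 ((1 + 3 * ξ - 20 * x) ^ 2) (1 - 31 * x + 445 * x ^ 2 - 45 * x ^ 3)
      (6 - 120 * x) := (rep_T h).sq h.sq
  have nT3 : IsRep ξ 1 ((1 + 3 * ξ - 20 * x) ^ 3) (1 - 33 * x + 795 * x ^ 2 - 10835 * x ^ 3
      + 2700 * x ^ 4) (9 - 333 * x + 3735 * x ^ 2 - 135 * x ^ 3) := nT2.pow_succ h.sq (rep_T h)
  have nP : IsRep ξ 1 (1 - 7 / 4 * ξ + 25 / 2 * x - 245 / 4 * x ^ 2)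
      (1 + 25 / 2 * x - 245 / 4 * x ^ 2) (-7 / 4) := .of_eq
  have nm1 : IsRep ξ 1 ((1 + 3 * ξ - 20 * x) ^ 3 * (1 - 7 / 4 * ξ + 25 / 2 * x - 245 / 4 * x ^ 2))
      (1 - 145 / 4 * x + 3301 / 4 * x ^ 2 - 2420 * x ^ 3 - 216790 * x ^ 4 + 2925025 / 4 * x ^ 5
      - 666225 / 4 * x ^ 6) (29 / 4 - 651 / 4 * x - 2370 * x ^ 2 + 85910 * x ^ 3
      - 940725 / 4 * x ^ 4 + 33075 / 4 * x ^ 5) := nT3.mul h.sq nP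
  have nQ : IsRep ξ 1 (1 - 7 / 20 * ξ - 79 / 20 * x) (1 - 79 / 20 * x) (-7 / 20) := .of_eq
  have nm2 :
      IsRep ξ 1 ((1 + 3 * ξ - 20 * x) ^ 3 * (1 - 7 / 4 * ξ + 25 / 2 * x - 245 / 4 * x ^ 2) * (1
      - 7 / 20 * ξ - 79 / 20 * x)) (1 - 3419 / 80 * x + 81017 / 80 * x ^ 2 - 364219 / 80 * x ^ 3
      - 3734989 / 16 * x ^ 4 + 24246403 / 16 * x ^ 5 - 39936045 / 16 * x ^ 6 + 3709755 / 16 * x ^ 7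
      + 231525 / 16 * x ^ 8) (69 / 10 - 1787 / 10 * x - 80639 / 40 * x ^ 2 + 192237 / 2 * x ^ 3
      - 1994597 / 4 * x ^ 4 + 681295 * x ^ 5 + 205065 / 8 * x ^ 6) := nm1.mul h.sq nQ
  have nm3 :
      IsRep ξ 1 ((1 + 3 * ξ - 20 * x) ^ 3 * (1 - 7 / 4 * ξ + 25 / 2 * x - 245 / 4 * x ^ 2) * (1
      - 7 / 20 * ξ - 79 / 20 * x) * (1 + 5 * ξ + 10 * x)) (1 + 141 / 80 * x - 10853 / 80 * x ^ 2
      - 731639 / 80 * x ^ 3 + 2491143 / 16 * x ^ 4 - 13741637 / 16 * x ^ 5 + 19124485 / 16 * x ^ 6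
      + 78377655 / 16 * x ^ 7 - 224935675 / 16 * x ^ 8 - 496125 * x ^ 9) (119 / 10 - 25871 / 80 * x
      + 100847 / 80 * x ^ 2 + 851121 / 16 * x ^ 3 - 11274373 / 16 * x ^ 4 + 52348855 / 16 * x ^ 5
      - 90262895 / 16 * x ^ 6 + 22650075 / 16 * x ^ 7 + 1157625 / 16 * x ^ 8) :=
      nm2.mul h.sq (rep_M h)
  have rN : IsRep ξ 1 (1 - 3 * ξ + 2 * x) (1 + 2 * x) (-3) := .of_eq
  have rK2 : IsRep ξ 1 ((1 - 95 / 4 * ξ + 83 / 4 * x + 21 / 4 * ξ ^ 2 + 475 / 4 * x * ξ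
      + 10 * x ^ 2) ^ 2) (1 + 9857 / 16 * x - 33149 / 16 * x ^ 2 - 120715 / 8 * x ^ 3
      + 98660 * x ^ 4 - 1158575 / 16 * x ^ 5 + 11025 / 16 * x ^ 6) (-95 / 2 - 1995 / 2 * x
      + 35625 / 8 * x ^ 2 + 39425 / 4 * x ^ 3 - 49875 / 8 * x ^ 4) := (rep_K h).sq h.sq
  have rm1 : IsRep ξ 1 ((1 - 3 * ξ + 2 * x) * (1 - 95 / 4 * ξ + 83 / 4 * x + 21 / 4 * ξ ^ 2
      + 475 / 4 * x * ξ + 10 * x ^ 2) ^ 2) (1 + 12169 / 16 * x + 45845 / 16 * x ^ 2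
      - 146739 / 8 * x ^ 3 - 342775 / 8 * x ^ 4 + 1001045 / 16 * x ^ 5 + 1555625 / 16 * x ^ 6
      - 184275 / 2 * x ^ 7) (-101 / 2 - 47051 / 16 * x + 138777 / 16 * x ^ 2 + 512245 / 8 * x ^ 3
      - 2260015 / 8 * x ^ 4 + 3276225 / 16 * x ^ 5 - 33075 / 16 * x ^ 6) := rN.mul h.sq rK2
  have rR : IsRep ξ 1 (1 - 5 * x) (1 - 5 * x) 0 := .of_eq
  have rR2 : IsRep ξ 1 ((1 - 5 * x) ^ 2) (1 - 10 * x + 25 * x ^ 2) 0 := rR.sq h.sq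
  have rm2 : IsRep ξ 1 ((1 - 3 * ξ + 2 * x) * (1 - 95 / 4 * ξ + 83 / 4 * x + 21 / 4 * ξ ^ 2
      + 475 / 4 * x * ξ + 10 * x ^ 2) ^ 2 * (1 - 5 * x) ^ 2) (1 + 12009 / 16 * x
      - 75445 / 16 * x ^ 2 - 447703 / 16 * x ^ 3 + 3395355 / 16 * x ^ 4 + 519595 / 16 * x ^ 5
      - 25593575 / 16 * x ^ 6 + 7995675 / 16 * x ^ 7 + 53632625 / 16 * x ^ 8 - 4606875 / 2 * x ^ 9)
      (-101 / 2 - 38971 / 16 * x + 589087 / 16 * x ^ 2 - 1539555 / 16 * x ^ 3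
      - 11295505 / 16 * x ^ 4 + 74088775 / 16 * x ^ 5 - 145796075 / 16 * x ^ 6
      + 82236375 / 16 * x ^ 7 - 826875 / 16 * x ^ 8) := rm1.mul h.sq rR2
  have hr := rm2.ne_zero_of_norm h.sq (n :=
      1 / 256 * (1 - 9 * x) ^ 3 * (1 - 5 * x) ^ 4 * (1 - x) * (1 + 5 * x) * (16 - 49 * x) ^ 2 * (1
      - 500 * x - 2490 * x ^ 2 + 2500 * x ^ 3 + 25 * x ^ 4) ^ 2) (by ring)
      (mul_ne_zero (mul_ne_zero
      (mul_ne_zero (mul_ne_zero (mul_ne_zero (mul_ne_zero (by norm_num) (pow_ne_zero 3 h.ne₂))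
      (pow_ne_zero 4 h.ne₃)) h.ne₄) h.ne₇) (pow_ne_zero 2 h.ne₈)) (pow_ne_zero 2 h.ne₁₄))
  exact nm3.div h.sq rm2 hr (mul_ne_zero (mul_ne_zero (by norm_num) h.ne₄) (pow_ne_zero 2 h.ne₁₄))

theorem contiguousC (h : IsPoint x ξ) {v l : F} (hv : v = 13 / 30 * dlogS x ξ + dlogN x ξ
    - 5 / 6 * dlogT x ξ - 1 / 6 * dlogG x ξ - dlogM x ξ) (hl : l = 3 * dlogT x ξ + dlogP x ξ
    + dlogQ x ξ + dlogM x ξ - dlogN x ξ - 2 * dlogK x ξ - 2 * dlogR x ξ) :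
    v = (-1 / 6) * theta x ξ * (ratioC x ξ - 1)
      ∧ (l + v) * ratioC x ξ = (theta x ξ + rho x ξ) * ((3 / 5) - (-1 / 6) - 1) * (1 - ratioC x ξ)
      + (13 / 30) * rho x ξ * ratioC x ξ := by
  have h1 : IsRep ξ ((1 - 125 * x) * (1 - x) * (25 + x) * (1 - 40 * x - 5 * x ^ 2)) v
      (-260 + 22064 * x + 4780 * x ^ 2 - 222140 * x ^ 3 + 52100 * x ^ 4 + 1600 * x ^ 5)
      (-546 - 45140 * x - 97020 * x ^ 2 + 600 * x ^ 3 + 250 * x ^ 4) := by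
    refine ⟨(mul_ne_zero (mul_ne_zero (mul_ne_zero h.ne₁ h.ne₄) h.ne₉) h.ne₁₀), mul_left_cancel₀
      ((mul_ne_zero (mul_ne_zero (mul_ne_zero (by norm_num) h.ne₂) h.ne₃)
      h.ne₇) : (30 * (1 - 9 * x) * (1 - 5 * x) * (1 + 5 * x) : F) ≠ 0) ?_⟩
    rw [hv]
    linear_combination (325 - 14612 * x + 49465 * x ^ 2 + 557752 * x ^ 3 - 496145 * x ^ 4
      - 93860 * x ^ 5 - 2925 * x ^ 6) * (rep_dlogS h).eq + (750 - 127470 * x + 4359900 * x ^ 2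
      - 18087900 * x ^ 3 - 3074250 * x ^ 4 - 93750 * x ^ 5) * (rep_dlogN h).eq
      + (-625 + 78725 * x - 59350 * x ^ 2 - 1971250 * x ^ 3 + 1874375 * x ^ 4
      + 78125 * x ^ 5) * (rep_dlogT h).eq + (-5 + 805 * x - 21650 * x ^ 2 - 107150 * x ^ 3
      + 112375 * x ^ 4 + 15625 * x ^ 5) * (rep_dlogG h).eq + (-750 + 131220 * x - 4985250 * x ^ 2
      + 37907880 * x ^ 3 - 27504450 * x ^ 4 - 5379900 * x ^ 5 - 168750 * x ^ 6) * (rep_dlogM h).eq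
  have h2 : IsRep ξ (5 * (25 + x) * (1 + 30 * x + 245 * x ^ 2) * (1 - 500 * x - 2490 * x ^ 2
      + 2500 * x ^ 3 + 25 * x ^ 4)) (l + v - (13 / 30) * rho x ξ)
      (1820 + 148400 * x + 462000 * x ^ 2 - 2355500 * x ^ 3 + 9583000 * x ^ 4 + 16117500 * x ^ 5
      - 1592500 * x ^ 6 + 350000 * x ^ 7) (47502 - 64540 * x - 16864610 * x ^ 2 - 57137500 * x ^ 3
      - 11138050 * x ^ 4 + 301000 * x ^ 5 - 12250 * x ^ 6) := by
    refine ⟨(mul_ne_zero (mul_ne_zero (mul_ne_zero (by norm_num) h.ne₉) h.ne₁₃) h.ne₁₄),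
      mul_left_cancel₀ ((mul_ne_zero
      (mul_ne_zero (mul_ne_zero (mul_ne_zero (mul_ne_zero (by norm_num) h.ne₁) h.ne₂) h.ne₃) h.ne₈)
      h.ne₁₀) : (6 * (1 - 125 * x) * (1 - 9 * x) * (1 - 5 * x) * (16 - 49 * x) * (1 - 40 * x
      - 5 * x ^ 2) : F) ≠ 0) ?_⟩
    rw [hv, hl]
    linear_combination (5200 - 2714517 * x + 40084486 * x ^ 2 + 2418028223 * x ^ 3
      + 7280099320 * x ^ 4 - 269230661050 * x ^ 5 - 514409998700 * x ^ 6 + 4627818441350 * x ^ 7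
      - 2738014643000 * x ^ 8 - 589621280625 * x ^ 9 - 23295886250 * x ^ 10
      - 175573125 * x ^ 11) * (rep_dlogS h).eq + (26000 - 15678585 * x + 1203627815 * x ^ 2
      + 42094850200 * x ^ 3 + 226011492200 * x ^ 4 - 2445151621250 * x ^ 5 - 6762587367250 * x ^ 6
      + 42651302980000 * x ^ 7 - 28639121680000 * x ^ 8 - 1519047928125 * x ^ 9
      - 12192578125 * x ^ 10) * (rep_dlogT h).eq + (-80 + 51045 * x - 5379575 * x ^ 2
      - 8297500 * x ^ 3 + 4461770500 * x ^ 4 + 58116677750 * x ^ 5 + 12494398750 * x ^ 6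
      - 927575387500 * x ^ 7 + 635196662500 * x ^ 8 + 101093278125 * x ^ 9
      + 937890625 * x ^ 10) * (rep_dlogG h).eq + (750 - 505470 * x + 68222280 * x ^ 2
      - 2133697800 * x ^ 3 + 4106442900 * x ^ 4 + 97210063500 * x ^ 5 - 68610867000 * x ^ 6
      - 14277765000 * x ^ 7 - 560591250 * x ^ 8 - 4218750 * x ^ 9) * (rep_dlogP h).eq
      + (30 - 19320 * x + 2130450 * x ^ 2 - 8520000 * x ^ 3 - 1727260500 * x ^ 4
      - 12025014000 * x ^ 5 + 154631782500 * x ^ 6 + 863569200000 * x ^ 7 - 724085006250 * x ^ 8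
      - 111631575000 * x ^ 9 - 1033593750 * x ^ 10) * (rep_dlogQ h).eq
      + (-1500 + 209940 * x - 1439100 * x ^ 2 - 162957900 * x ^ 3 - 1044928500 * x ^ 4
      + 9047713500 * x ^ 5 + 1512007500 * x ^ 6 + 45937500 * x ^ 7) * (rep_dlogK h).eq
      + (-24000 + 15528540 * x - 1751072820 * x ^ 2 + 11965534740 * x ^ 3 + 1361415824100 * x ^ 4
      + 5442660351000 * x ^ 5 - 152951181381000 * x ^ 6 - 318134161287000 * x ^ 7
      + 2682532245285000 * x ^ 8 - 1576902503512500 * x ^ 9 - 340058603962500 * x ^ 10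
      - 13439124037500 * x ^ 11 - 101292187500 * x ^ 12) * (rep_dlogR h).eq
      + (-208 - 2691 * x + 37232 * x ^ 2 + 349830 * x ^ 3 - 3618160 * x ^ 4
      + 7022925 * x ^ 5) * (rep_rho h).eq
  have h3 := h1.eq_mul_add h.sq (rep_theta h) (rep_ratioC h) (1 / 6) (-1 / 6)
  have h4 := h2.mul_eq_mul_one_sub h.sq (rep_tau h) (rep_ratioC h) (-7 / 30)
  exact ⟨by linear_combination h3, by linear_combination h4⟩

theorem rep_ratioD (h : IsPoint x ξ) : IsRep ξ (5 * (1 + 4 * x) * (1 - 15 * x - 5 * x ^ 2) ^ 2)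
    (ratioD x ξ) (5 + 788 * x + 6265 * x ^ 2 + 6695 * x ^ 3 + 9800 * x ^ 4 + 325 * x ^ 5)
    (102 + 2700 * x + 3250 * x ^ 2 - 1000 * x ^ 3 - 50 * x ^ 4) := by
  have nW : IsRep ξ 1 (1 + 1 / 25 * x) (1 + 1 / 25 * x) 0 := .of_eq
  have nm1 : IsRep ξ 1 ((1 + 18 / 5 * ξ - 16 * x + x ^ 2) ^ 2 * (1 + 1 / 25 * x))
      (1 - 19 * x + 201274 / 625 * x ^ 2 - 10486 / 125 * x ^ 3 - 359 / 125 * x ^ 4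
      + 1 / 25 * x ^ 5) (36 / 5 - 14364 / 125 * x + 324 / 125 * x ^ 2 + 36 / 125 * x ^ 3) :=
      (rep_V_sq h).mul h.sq nW
  have nm2 : IsRep ξ 1 ((1 + 18 / 5 * ξ - 16 * x + x ^ 2) ^ 2 * (1 + 1 / 25 * x) * (1 + 5 * ξ
      + 10 * x)) (1 + 27 * x - 164076 / 625 * x ^ 2 + 12082 / 125 * x ^ 3 + 262161 / 125 * x ^ 4
      - 2157 / 25 * x ^ 5 - 34 / 5 * x ^ 6) (61 / 5 - 17239 / 125 * x + 57958 / 125 * x ^ 2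
      - 49154 / 125 * x ^ 3 - 287 / 25 * x ^ 4 + 1 / 5 * x ^ 5) := nm1.mul h.sq (rep_M h)
  have rH : IsRep ξ 1 (1 - 27 / 5 * ξ + 58 / 5 * x - 2 * x ^ 2) (1 + 58 / 5 * x - 2 * x ^ 2)
      (-27 / 5) := .of_eq
  have rm1 : IsRep ξ 1 ((1 - 7 / 5 * ξ - 9 * x - x ^ 2) ^ 2 * (1 - 27 / 5 * ξ + 58 / 5 * x
      - 2 * x ^ 2)) (1 + 267 / 25 * x - 19968 / 125 * x ^ 2 + 7481 / 25 * x ^ 3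
      + 13083 / 25 * x ^ 4 + 354 / 5 * x ^ 5 - 2 * x ^ 6) (-41 / 5 + 9917 / 125 * x
      - 894 / 5 * x ^ 2 - 311 / 5 * x ^ 3 - 11 * x ^ 4) := (rep_U_sq h).mul h.sq rH
  have hr := rm1.ne_zero_of_norm h.sq (n :=
      1 / 15625 * (1 - 5 * x) ^ 4 * (1 + 4 * x) * (25 + x) ^ 3 * (1 - 15 * x - 5 * x ^ 2) ^ 2)
      (by ring)
      (mul_ne_zero (mul_ne_zero (mul_ne_zero (mul_ne_zero (by norm_num) (pow_ne_zero 4 h.ne₃))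
      h.ne₆) (pow_ne_zero 3 h.ne₉)) (pow_ne_zero 2 h.ne₁₁))
  exact nm2.div h.sq rm1 hr (mul_ne_zero (mul_ne_zero (by norm_num) h.ne₆) (pow_ne_zero 2 h.ne₁₁))

theorem contiguousD (h : IsPoint x ξ) {v l : F} (hv : v = 7 / 30 * dlogS x ξ + dlogH x ξ
    - 5 / 6 * dlogV x ξ - 1 / 6 * dlogW x ξ - 7 / 6 * dlogR x ξ) (hl : l = 2 * dlogV x ξ
    + dlogW x ξ + dlogM x ξ - 2 * dlogU x ξ - dlogH x ξ) :
    v = rho x ξ * ((-1 / 6) - (-1 / 6) * ((2 / 5) - (7 / 30)) / (2 / 5) * ratioD x ξ)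
      ∧ (l + v) * ratioD x ξ = (theta x ξ + rho x ξ) * (2 / 5) * (1 - ratioD x ξ)
      + (7 / 30) * rho x ξ * ratioD x ξ := by
  have h1 : IsRep ξ ((1 - 125 * x) * (1 + 4 * x) * (25 + x) * (1 - 40 * x - 5 * x ^ 2)) v
      (-210 + 20016 * x + 45270 * x ^ 2 + 616290 * x ^ 3 - 201600 * x ^ 4 - 5850 * x ^ 5)
      (204 - 90840 * x + 173580 * x ^ 2 - 23400 * x ^ 3 - 1500 * x ^ 4) := by
    refine ⟨(mul_ne_zero (mul_ne_zero (mul_ne_zero h.ne₁ h.ne₆) h.ne₉) h.ne₁₀), mul_left_cancel₀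
      ((mul_ne_zero (by norm_num) h.ne₃) : (30 * (1 - 5 * x) : F) ≠ 0) ?_⟩
    rw [hv]
    linear_combination (175 - 6293 * x - 29127 * x ^ 2 - 4655 * x ^ 3
      - 140 * x ^ 4) * (rep_dlogS h).eq + (30 - 4950 * x + 149850 * x ^ 2
      + 18750 * x ^ 3) * (rep_dlogH h).eq + (-25 + 3025 * x + 12500 * x ^ 2) * (rep_dlogV h).eq
      + (-5 + 830 * x - 25700 * x ^ 2 + 5350 * x ^ 3 + 502625 * x ^ 4 + 62500 * x ^ 5) * (rep_dlogW
      h).eq + (-875 + 140840 * x - 3787490 * x ^ 2 - 18181100 * x ^ 3 - 2908675 * x ^ 4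
      - 87500 * x ^ 5) * (rep_dlogR h).eq
  have h2 : IsRep ξ (5 * (1 + 5 * x) * (25 + x) * (1 - 15 * x - 5 * x ^ 2) * (1 - 500 * x
      - 2490 * x ^ 2 + 2500 * x ^ 3 + 25 * x ^ 4)) (l + v - (7 / 30) * rho x ξ) (-1020 - 460500 * x
      - 5832700 * x ^ 2 - 24829500 * x ^ 3 - 20275500 * x ^ 4 + 94210000 * x ^ 5 - 39892500 * x ^ 6
      + 975000 * x ^ 7 + 50000 * x ^ 8) (-39372 - 2176980 * x - 8387790 * x ^ 2 + 5951050 * x ^ 3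
      - 34437200 * x ^ 4 + 4804500 * x ^ 5 + 87250 * x ^ 6 - 1250 * x ^ 7) := by
    refine ⟨(mul_ne_zero (mul_ne_zero (mul_ne_zero (mul_ne_zero (by norm_num) h.ne₇) h.ne₉) h.ne₁₁)
      h.ne₁₄), mul_left_cancel₀ ((mul_ne_zero (mul_ne_zero (mul_ne_zero (by norm_num) h.ne₁) h.ne₃)
      h.ne₁₀) : (6 * (1 - 125 * x) * (1 - 5 * x) * (1 - 40 * x - 5 * x ^ 2) : F) ≠ 0) ?_⟩
    rw [hv, hl]
    linear_combination (175 - 96243 * x + 3990525 * x ^ 2 - 4613350 * x ^ 3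
      - 441265300 * x ^ 4 - 1407821100 * x ^ 5 + 735721000 * x ^ 6 + 603793750 * x ^ 7
      + 83698125 * x ^ 8 + 2979375 * x ^ 9 + 21875 * x ^ 10) * (rep_dlogS h).eq
      + (35 - 22225 * x + 2316300 * x ^ 2 - 8273125 * x ^ 3 - 288230250 * x ^ 4 - 821751875 * x ^ 5
      + 601492500 * x ^ 6 + 282165625 * x ^ 7 + 2734375 * x ^ 8) * (rep_dlogV h).eq
      + (25 - 17000 * x + 2373750 * x ^ 2 - 83456875 * x ^ 3 + 382273750 * x ^ 4
      + 7566612500 * x ^ 5 - 13451000000 * x ^ 6 - 138737406250 * x ^ 7 + 60037515625 * x ^ 8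
      + 49954687500 * x ^ 9 + 5419531250 * x ^ 10 + 48828125 * x ^ 11) * (rep_dlogW h).eq
      + (-875 + 590590 * x - 80104500 * x ^ 2 + 2517144875 * x ^ 3 - 677017250 * x ^ 4
      - 268751707000 * x ^ 5 - 883566792500 * x ^ 6 + 456806656250 * x ^ 7 + 376952603125 * x ^ 8
      + 52296431250 * x ^ 9 + 1862000000 * x ^ 10 + 13671875 * x ^ 11) * (rep_dlogR h).eq
      + (750 - 509970 * x + 71210850 * x ^ 2 - 2513607000 * x ^ 3 + 13148335500 * x ^ 4
      + 164616928500 * x ^ 5 - 65741677500 * x ^ 6 - 62840175000 * x ^ 7 - 8901356250 * x ^ 8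
      - 318731250 * x ^ 9 - 2343750 * x ^ 10) * (rep_dlogM h).eq
      + (-60 + 39600 * x - 4900800 * x ^ 2 + 99510000 * x ^ 3 + 1414809000 * x ^ 4
      + 3293130000 * x ^ 5 - 3379380000 * x ^ 6 - 507150000 * x ^ 7 - 4687500 * x ^ 8) * (rep_dlogU
      h).eq + (-7 + 105 * x + 210 * x ^ 2 - 2625 * x ^ 3 - 875 * x ^ 4) * (rep_rho h).eq
  have h3 := h1.eq_mul_add h.sq (rep_rho h) (rep_ratioD h) (-1 / 6) (5 / 72)
  have h4 := h2.mul_eq_mul_one_sub h.sq (rep_tau h) (rep_ratioD h) (2 / 5)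
  exact ⟨by linear_combination h3, by linear_combination h4⟩

end E4

namespace E4

section Local

variable {x κ : ℂ → ℂ}

theorem eventually_isPoint (hx : IsLocalParametrization (-5) 5 x κ) :
    ∀ᶠ t in 𝓝[≠] 0, IsPoint (x t) t := by
  filter_upwards [hx.sq, hx.eventually_ne_zero,
    hx.eventually_ne (p := fun x => 1 - 125 * x) (by fun_prop) (by norm_num),
    hx.eventually_ne (p := fun x => 1 - 9 * x) (by fun_prop) (by norm_num),
    hx.eventually_ne (p := fun x => 1 - 5 * x) (by fun_prop) (by norm_num),
    hx.eventually_ne (p := fun x => 1 - x) (by fun_prop) (by norm_num),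
    hx.eventually_ne (p := fun x => 1 + x) (by fun_prop) (by norm_num),
    hx.eventually_ne (p := fun x => 1 + 4 * x) (by fun_prop) (by norm_num),
    hx.eventually_ne (p := fun x => 1 + 5 * x) (by fun_prop) (by norm_num),
    hx.eventually_ne (p := fun x => 16 - 49 * x) (by fun_prop) (by norm_num),
    hx.eventually_ne (p := fun x => 25 + x) (by fun_prop) (by norm_num),
    hx.eventually_ne (p := fun x => 1 - 40 * x - 5 * x ^ 2) (by fun_prop) (by norm_num),
    hx.eventually_ne (p := fun x => 1 - 15 * x - 5 * x ^ 2) (by fun_prop) (by norm_num),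
    hx.eventually_ne (p := fun x => 1 + 5 * x - 5 * x ^ 2) (by fun_prop) (by norm_num),
    hx.eventually_ne (p := fun x => 1 + 30 * x + 245 * x ^ 2) (by fun_prop) (by norm_num),
    hx.eventually_ne (p := fun x => 1 - 500 * x - 2490 * x ^ 2 + 2500 * x ^ 3 + 25 * x ^ 4) (by fun_prop)
      (by norm_num)]
    with t h0 h1 h2 h3 h4 h5 h6 h7 h8 h9 h10 h11 h12 h13 h14 h15
  exact ⟨by linear_combination h0, h1, h2, h3, h4, h5, h6, h7, h8, h9, h10, h11, h12, h13, h14, h15⟩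

theorem nearUnit_S (hx : IsLocalParametrization (-5) 5 x κ) :
    NearUnit κ (fun t => 1 + 50 * x t - 125 * t ^ 2 - 450 * x t * t - 500 * x t ^ 2)
    (fun t => dlogS (x t) t) :=
  hx.nearUnit 0 50 (-450) (-500) (-125) (fun t => by ring)
    ((eventually_isPoint hx).mono fun t h => by linear_combination mul_dlogS h)

theorem nearUnit_SBar (hx : IsLocalParametrization (-5) 5 x κ) :
    NearUnit κ (fun t => 1 + 50 * x t - 125 * t ^ 2 + 450 * x t * t - 500 * x t ^ 2)
    (fun t => dlogSBar (x t) t) :=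
  hx.nearUnit 0 50 450 (-500) (-125) (fun t => by ring)
    ((eventually_isPoint hx).mono fun t h => by linear_combination mul_dlogSBar h)

theorem nearUnit_T (hx : IsLocalParametrization (-5) 5 x κ) :
    NearUnit κ (fun t => 1 + 3 * t - 20 * x t) (fun t => dlogT (x t) t) :=
  hx.nearUnit 3 (-20) 0 0 0 (fun t => by ring)
    ((eventually_isPoint hx).mono fun t h => by linear_combination mul_dlogT h)

theorem nearUnit_G (hx : IsLocalParametrization (-5) 5 x κ) :
    NearUnit κ (fun t => 1 - 3 / 5 * t - 34 / 5 * x t) (fun t => dlogG (x t) t) :=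
  hx.nearUnit (-3 / 5) (-34 / 5) 0 0 0 (fun t => by ring)
    ((eventually_isPoint hx).mono fun t h => by linear_combination mul_dlogG h)

theorem nearUnit_K (hx : IsLocalParametrization (-5) 5 x κ) :
    NearUnit κ (fun t => 1 - 95 / 4 * t + 83 / 4 * x t + 21 / 4 * t ^ 2 + 475 / 4 * x t * t
    + 10 * x t ^ 2) (fun t => dlogK (x t) t) :=
  hx.nearUnit (-95 / 4) (83 / 4) (475 / 4) 10 (21 / 4) (fun t => by ring)
    ((eventually_isPoint hx).mono fun t h => by linear_combination mul_dlogK h)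

theorem nearUnit_U (hx : IsLocalParametrization (-5) 5 x κ) :
    NearUnit κ (fun t => 1 - 7 / 5 * t - 9 * x t - x t ^ 2) (fun t => dlogU (x t) t) :=
  hx.nearUnit (-7 / 5) (-9) 0 (-1) 0 (fun t => by ring)
    ((eventually_isPoint hx).mono fun t h => by linear_combination mul_dlogU h)

theorem nearUnit_V (hx : IsLocalParametrization (-5) 5 x κ) :
    NearUnit κ (fun t => 1 + 18 / 5 * t - 16 * x t + x t ^ 2) (fun t => dlogV (x t) t) :=
  hx.nearUnit (18 / 5) (-16) 0 1 0 (fun t => by ring)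
    ((eventually_isPoint hx).mono fun t h => by linear_combination mul_dlogV h)

theorem nearUnit_A (hx : IsLocalParametrization (-5) 5 x κ) :
    NearUnit κ (fun t => 1 - 35 / 4 * t - 101 / 4 * x t) (fun t => dlogA (x t) t) :=
  hx.nearUnit (-35 / 4) (-101 / 4) 0 0 0 (fun t => by ring)
    ((eventually_isPoint hx).mono fun t h => by linear_combination mul_dlogA h)

theorem nearUnit_B (hx : IsLocalParametrization (-5) 5 x κ) :
    NearUnit κ (fun t => 1 + 21 / 4 * t + 41 / 4 * x t) (fun t => dlogB (x t) t) :=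
  hx.nearUnit (21 / 4) (41 / 4) 0 0 0 (fun t => by ring)
    ((eventually_isPoint hx).mono fun t h => by linear_combination mul_dlogB h)

theorem nearUnit_C (hx : IsLocalParametrization (-5) 5 x κ) : NearUnit κ (fun t => 1 - 9 * x t)
    (fun t => dlogC (x t) t) :=
  hx.nearUnit 0 (-9) 0 0 0 (fun t => by ring)
    ((eventually_isPoint hx).mono fun t h => by linear_combination mul_dlogC h)

theorem nearUnit_L (hx : IsLocalParametrization (-5) 5 x κ) :
    NearUnit κ (fun t => 1 - 7 / 4 * t - 15 / 2 * x t) (fun t => dlogL (x t) t) :=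
  hx.nearUnit (-7 / 4) (-15 / 2) 0 0 0 (fun t => by ring)
    ((eventually_isPoint hx).mono fun t h => by linear_combination mul_dlogL h)

theorem nearUnit_M (hx : IsLocalParametrization (-5) 5 x κ) :
    NearUnit κ (fun t => 1 + 5 * t + 10 * x t) (fun t => dlogM (x t) t) :=
  hx.nearUnit 5 10 0 0 0 (fun t => by ring)
    ((eventually_isPoint hx).mono fun t h => by linear_combination mul_dlogM h)

theorem nearUnit_N (hx : IsLocalParametrization (-5) 5 x κ) :
    NearUnit κ (fun t => 1 - 3 * t + 2 * x t) (fun t => dlogN (x t) t) :=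
  hx.nearUnit (-3) 2 0 0 0 (fun t => by ring)
    ((eventually_isPoint hx).mono fun t h => by linear_combination mul_dlogN h)

theorem nearUnit_P (hx : IsLocalParametrization (-5) 5 x κ) :
    NearUnit κ (fun t => 1 - 7 / 4 * t + 25 / 2 * x t - 245 / 4 * x t ^ 2)
    (fun t => dlogP (x t) t) :=
  hx.nearUnit (-7 / 4) (25 / 2) 0 (-245 / 4) 0 (fun t => by ring)
    ((eventually_isPoint hx).mono fun t h => by linear_combination mul_dlogP h)

theorem nearUnit_Q (hx : IsLocalParametrization (-5) 5 x κ) :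
    NearUnit κ (fun t => 1 - 7 / 20 * t - 79 / 20 * x t) (fun t => dlogQ (x t) t) :=
  hx.nearUnit (-7 / 20) (-79 / 20) 0 0 0 (fun t => by ring)
    ((eventually_isPoint hx).mono fun t h => by linear_combination mul_dlogQ h)

theorem nearUnit_R (hx : IsLocalParametrization (-5) 5 x κ) : NearUnit κ (fun t => 1 - 5 * x t)
    (fun t => dlogR (x t) t) :=
  hx.nearUnit 0 (-5) 0 0 0 (fun t => by ring)
    ((eventually_isPoint hx).mono fun t h => by linear_combination mul_dlogR h)

theorem nearUnit_W (hx : IsLocalParametrization (-5) 5 x κ) :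
    NearUnit κ (fun t => 1 + 1 / 25 * x t) (fun t => dlogW (x t) t) :=
  hx.nearUnit 0 (1 / 25) 0 0 0 (fun t => by ring)
    ((eventually_isPoint hx).mono fun t h => by linear_combination mul_dlogW h)

theorem nearUnit_H (hx : IsLocalParametrization (-5) 5 x κ) :
    NearUnit κ (fun t => 1 - 27 / 5 * t + 58 / 5 * x t - 2 * x t ^ 2) (fun t => dlogH (x t) t) :=
  hx.nearUnit (-27 / 5) (58 / 5) 0 (-2) 0 (fun t => by ring)
    ((eventually_isPoint hx).mono fun t h => by linear_combination mul_dlogH h)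

theorem nearUnit_Z (hx : IsLocalParametrization (-5) 5 x κ) :
    NearUnit κ (fun t => (5 * t + 57 * x t) / (5 * t)) (fun t => dlogZ (x t) t - dlogXi
    (x t) t) := by
  refine hx.nearUnit_div (57 / 5) 0 ?_ ?_
  · filter_upwards [self_mem_nhdsWithin] with t (ht : t ≠ 0)
    field_simp
    ring
  · filter_upwards [eventually_isPoint hx, self_mem_nhdsWithin] with t h (ht : t ≠ 0)
    have h1 := mul_dlogZ h
    have h2 := mul_dlogXi h
    field_simp
    linear_combination t * h1 - (5 * t + 57 * x t) * h2

theorem nearUnit_X (hx : IsLocalParametrization (-5) 5 x κ) : NearUnit κ (fun t => x t / t ^ 2)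
    (fun t => dlogX (x t) t - 2 * dlogXi (x t) t) := by
  refine hx.nearUnit_div_sq ?_
  filter_upwards [eventually_isPoint hx] with t h
  linear_combination t * mul_dlogX h - 2 * x t * mul_dlogXi h

theorem nearZero_phi (hx : IsLocalParametrization (-5) 5 x κ) :
    NearZero κ (fun t => phi4 (x t) t) (fun t => theta (x t) t) := by
  have hX := nearUnit_X hx
  have hU := nearUnit_U hx
  have hSBar := nearUnit_SBar hx
  have hZ := nearUnit_Z hx
  have hV := nearUnit_V hx
  have hS := nearUnit_S hx
  refine hx.nearZero (r := 432 / 5) (by norm_num) (((hX.mul (hU.pow 5)).mul hSBar).div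
    ((hZ.mul (hV.pow 5)).mul hS)) ?_ ?_
  · filter_upwards [self_mem_nhdsWithin] with t (ht : t ≠ 0)
    unfold phi4
    generalize x t = y
    field_simp
  · filter_upwards [eventually_isPoint hx] with t h
    rw [theta_eq h]
    push_cast
    linear_combination mul_dlogXi h

theorem eventually_eqA (hx : IsLocalParametrization (-5) 5 x κ) : ∀ᶠ t in 𝓝[≠] 0, ₂F₁ (1 / 6 : ℂ)
    (-1 / 30) (4 / 5) (phi4 (x t) t) = (1 - 3 / 5 * t - 34 / 5 * x t) ^ (1 / 6 : ℂ) / ((1 + 3 * t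
    - 20 * x t) ^ (1 / 6 : ℂ) * (1 + 50 * x t - 125 * t ^ 2 - 450 * x t * t
    - 500 * x t ^ 2) ^ (1 / 30 : ℂ)) ∧ ₂F₁ (1 / 6 : ℂ) (29 / 30) (4 / 5) (phi4 (x t) t) = ₂F₁
    (1 / 6 : ℂ) (-1 / 30) (4 / 5) (phi4 (x t) t) * ratioA (x t) t := by
  have hG := nearUnit_G hx
  have hT := nearUnit_T hx
  have hS := nearUnit_S hx
  have hA := nearUnit_A hx
  have hK := nearUnit_K hx
  have hr := ((hG.cpow (1 / 6)).div ((hT.cpow (1 / 6)).mul (hS.cpow (1 / 30))))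
  have hw : NearUnit κ (fun t => ratioA (x t) t) (fun t => dlogT (x t) t + dlogA (x t) t - dlogK
      (x t) t) := by
    refine ((hT.mul hA).div hK).congr ?_
    filter_upwards [self_mem_nhdsWithin] with t (ht : t ≠ 0)
    refine ⟨by simp only [ratioA], by ring⟩
  have h1 := NearUnit.eventually_eq_contiguous_b (a := 1 / 6) (b := -1 / 30) (c := 4 / 5)
    (by norm_num) hr hw (nearZero_phi hx) ((eventually_isPoint hx).mono fun t h =>
      ⟨rho_mul h, contiguousA h (by ring) rfl⟩)
  filter_upwards [h1] with t ht
  refine ⟨ht.1, ?_⟩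
  rw [ht.1, ← ht.2]
  norm_num

theorem eventually_eqB (hx : IsLocalParametrization (-5) 5 x κ) : ∀ᶠ t in 𝓝[≠] 0, ₂F₁ (1 / 6 : ℂ)
    (11 / 30) (1 / 5) (phi4 (x t) t) = (1 + 50 * x t - 125 * t ^ 2 - 450 * x t * t
    - 500 * x t ^ 2) ^ (11 / 30 : ℂ) * ((1 + 3 * t - 20 * x t) ^ (5 / 6 : ℂ) * (1 - 3 / 5 * t
    - 34 / 5 * x t) ^ (1 / 6 : ℂ) * (1 + 21 / 4 * t + 41 / 4 * x t)) / ((1 - 95 / 4 * t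
    + 83 / 4 * x t + 21 / 4 * t ^ 2 + 475 / 4 * x t * t + 10 * x t ^ 2) * (1 + 5 * t + 10 * x t))
    ∧ ₂F₁ (1 / 6 : ℂ) (11 / 30) (6 / 5) (phi4 (x t) t) = ₂F₁ (1 / 6 : ℂ) (11 / 30) (1 / 5)
    (phi4 (x t) t) * ratioB (x t) t := by
  have hS := nearUnit_S hx
  have hT := nearUnit_T hx
  have hG := nearUnit_G hx
  have hB := nearUnit_B hx
  have hK := nearUnit_K hx
  have hM := nearUnit_M hx
  have hC := nearUnit_C hx
  have hL := nearUnit_L hx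
  have hr := (((hS.cpow (11 / 30)).mul (((hT.cpow (5 / 6)).mul (hG.cpow (1 / 6))).mul hB)).div
      (hK.mul hM))
  have hw : NearUnit κ (fun t => ratioB (x t) t) (fun t => dlogK (x t) t - dlogC (x t) t - dlogL
      (x t) t) := by
    refine (hK.div (hC.mul hL)).congr ?_
    filter_upwards [self_mem_nhdsWithin] with t (ht : t ≠ 0)
    refine ⟨by simp only [ratioB], by ring⟩
  have h1 := NearUnit.eventually_eq_contiguous_c (a := 1 / 6) (b := 11 / 30) (c := 1 / 5)
    (by norm_num) hr hw (nearZero_phi hx) ((eventually_isPoint hx).mono fun t h =>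
      ⟨rho_mul h, contiguousB h (by ring) rfl⟩)
  filter_upwards [h1] with t ht
  refine ⟨ht.1, ?_⟩
  rw [ht.1, ← ht.2]
  norm_num

theorem eventually_eqC (hx : IsLocalParametrization (-5) 5 x κ) : ∀ᶠ t in 𝓝[≠] 0, ₂F₁ (13 / 30 : ℂ)
    (-1 / 6) (3 / 5) (phi4 (x t) t) = (1 + 50 * x t - 125 * t ^ 2 - 450 * x t * t
    - 500 * x t ^ 2) ^ (13 / 30 : ℂ) * (1 - 3 * t
    + 2 * x t) / ((1 + 3 * t - 20 * x t) ^ (5 / 6 : ℂ) * (1 - 3 / 5 * t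
    - 34 / 5 * x t) ^ (1 / 6 : ℂ) * (1 + 5 * t + 10 * x t)) ∧ ₂F₁ (13 / 30 : ℂ) (5 / 6) (3 / 5)
    (phi4 (x t) t) = ₂F₁ (13 / 30 : ℂ) (-1 / 6) (3 / 5) (phi4 (x t) t) * ratioC (x t) t := by
  have hS := nearUnit_S hx
  have hN := nearUnit_N hx
  have hT := nearUnit_T hx
  have hG := nearUnit_G hx
  have hM := nearUnit_M hx
  have hP := nearUnit_P hx
  have hQ := nearUnit_Q hx
  have hK := nearUnit_K hx
  have hR := nearUnit_R hx
  have hr := (((hS.cpow (13 / 30)).mul hN).div (((hT.cpow (5 / 6)).mul (hG.cpow (1 / 6))).mul hM))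
  have hw : NearUnit κ (fun t => ratioC (x t) t) (fun t => 3 * dlogT (x t) t + dlogP (x t) t
      + dlogQ (x t) t + dlogM (x t) t - dlogN (x t) t - 2 * dlogK (x t) t - 2 * dlogR
      (x t) t) := by
    refine (((((hT.pow 3).mul hP).mul hQ).mul hM).div ((hN.mul (hK.pow 2)).mul (hR.pow 2))).congr
      ?_
    filter_upwards [self_mem_nhdsWithin] with t (ht : t ≠ 0)
    refine ⟨by simp only [ratioC], by push_cast; ring⟩
  have h1 := NearUnit.eventually_eq_contiguous_b (a := 13 / 30) (b := -1 / 6) (c := 3 / 5)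
    (by norm_num) hr hw (nearZero_phi hx) ((eventually_isPoint hx).mono fun t h =>
      ⟨rho_mul h, contiguousC h (by ring) rfl⟩)
  filter_upwards [h1] with t ht
  refine ⟨ht.1, ?_⟩
  rw [ht.1, ← ht.2]
  norm_num

theorem eventually_eqD (hx : IsLocalParametrization (-5) 5 x κ) : ∀ᶠ t in 𝓝[≠] 0, ₂F₁ (7 / 30 : ℂ)
    (-1 / 6) (2 / 5) (phi4 (x t) t) = (1 + 50 * x t - 125 * t ^ 2 - 450 * x t * t
    - 500 * x t ^ 2) ^ (7 / 30 : ℂ) * (1 - 27 / 5 * t + 58 / 5 * x t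
    - 2 * x t ^ 2) / ((1 + 18 / 5 * t - 16 * x t + x t ^ 2) ^ (5 / 6 : ℂ) * (1
    + 1 / 25 * x t) ^ (1 / 6 : ℂ) * (1 - 5 * x t) ^ (7 / 6 : ℂ))
    ∧ ₂F₁ (7 / 30 : ℂ) (5 / 6) (7 / 5) (phi4 (x t) t) = ₂F₁ (7 / 30 : ℂ) (-1 / 6) (2 / 5)
    (phi4 (x t) t) * ratioD (x t) t := by
  have hS := nearUnit_S hx
  have hH := nearUnit_H hx
  have hV := nearUnit_V hx
  have hW := nearUnit_W hx
  have hR := nearUnit_R hx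
  have hM := nearUnit_M hx
  have hU := nearUnit_U hx
  have hr :=
      (((hS.cpow (7 / 30)).mul hH).div (((hV.cpow (5 / 6)).mul (hW.cpow (1 / 6))).mul
      (hR.cpow (7 / 6))))
  have hw : NearUnit κ (fun t => ratioD (x t) t) (fun t => 2 * dlogV (x t) t + dlogW (x t) t
      + dlogM (x t) t - 2 * dlogU (x t) t - dlogH (x t) t) := by
    refine ((((hV.pow 2).mul hW).mul hM).div ((hU.pow 2).mul hH)).congr ?_
    filter_upwards [self_mem_nhdsWithin] with t (ht : t ≠ 0)
    refine ⟨by simp only [ratioD], by push_cast; ring⟩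
  have h1 := NearUnit.eventually_eq_contiguous_bc (a := 7 / 30) (b := -1 / 6) (c := 2 / 5)
    (by norm_num) hr hw (nearZero_phi hx) ((eventually_isPoint hx).mono fun t h =>
      ⟨rho_mul h, contiguousD h (by ring) rfl⟩)
  filter_upwards [h1] with t ht
  refine ⟨ht.1, ?_⟩
  rw [ht.1, ← ht.2]
  norm_num

end Local

/-- Hypergeometric functions of the type with exponent differences `2/3, 1/5, 1/5`. -/
theorem nearOrigin_typeA : NearOrigin (fun x => x * (1 + 5 * x - 5 * x ^ 2)) (fun x ξ =>
      ₂F₁ (1 / 6 : ℂ) (-1 / 30) (4 / 5) (phi4 x ξ)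
        = (1 - 3 / 5 * ξ - 34 / 5 * x) ^ (1 / 6 : ℂ)
          / ((1 + 3 * ξ - 20 * x) ^ (1 / 6 : ℂ)
            * (1 + 50 * x - 125 * ξ ^ 2 - 450 * x * ξ - 500 * x ^ 2) ^ (1 / 30 : ℂ)) ∧
      ₂F₁ (1 / 6 : ℂ) (29 / 30) (4 / 5) (phi4 x ξ)
        = (1 + 3 * ξ - 20 * x) ^ (5 / 6 : ℂ) * (1 - 3 / 5 * ξ - 34 / 5 * x) ^ (1 / 6 : ℂ)
            * (1 - 35 / 4 * ξ - 101 / 4 * x)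
          / ((1 + 50 * x - 125 * ξ ^ 2 - 450 * x * ξ - 500 * x ^ 2) ^ (1 / 30 : ℂ)
            * (1 - 95 / 4 * ξ + 83 / 4 * x + 21 / 4 * ξ ^ 2 + 475 / 4 * x * ξ
              + 10 * x ^ 2)) ∧
      ₂F₁ (1 / 6 : ℂ) (11 / 30) (6 / 5) (phi4 x ξ)
        = (1 + 50 * x - 125 * ξ ^ 2 - 450 * x * ξ - 500 * x ^ 2) ^ (11 / 30 : ℂ)
            * ((1 + 3 * ξ - 20 * x) ^ (5 / 6 : ℂ)
              * (1 - 3 / 5 * ξ - 34 / 5 * x) ^ (1 / 6 : ℂ)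
              * (1 + 21 / 4 * ξ + 41 / 4 * x))
          / ((1 - 9 * x) * (1 - 7 / 4 * ξ - 15 / 2 * x) * (1 + 5 * ξ + 10 * x)) ∧
      ₂F₁ (1 / 6 : ℂ) (11 / 30) (1 / 5) (phi4 x ξ)
        = (1 + 50 * x - 125 * ξ ^ 2 - 450 * x * ξ - 500 * x ^ 2) ^ (11 / 30 : ℂ)
            * ((1 + 3 * ξ - 20 * x) ^ (5 / 6 : ℂ)
              * (1 - 3 / 5 * ξ - 34 / 5 * x) ^ (1 / 6 : ℂ)
              * (1 + 21 / 4 * ξ + 41 / 4 * x))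
          / ((1 - 95 / 4 * ξ + 83 / 4 * x + 21 / 4 * ξ ^ 2 + 475 / 4 * x * ξ
              + 10 * x ^ 2) * (1 + 5 * ξ + 10 * x))) := by
  obtain ⟨x, κ, hx⟩ := exists_isLocalParametrization (-5) 5
  refine hx.nearOrigin (fun y => by ring) ?_
  filter_upwards [self_mem_nhdsWithin, eventually_eqA hx, eventually_eqB hx,
    (nearUnit_G hx).eventually_ne_zero, (nearUnit_T hx).eventually_ne_zero,
    (nearUnit_S hx).eventually_ne_zero, (nearUnit_A hx).eventually_ne_zero,
    (nearUnit_K hx).eventually_ne_zero, (nearUnit_B hx).eventually_ne_zero,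
    (nearUnit_M hx).eventually_ne_zero, (nearUnit_C hx).eventually_ne_zero,
    (nearUnit_L hx).eventually_ne_zero]
    with t (ht : t ≠ 0) eA eB hG hT hS hA hK hB hM hC hL
  refine ⟨?_, ?_, ?_, ?_⟩
  · exact eA.1
  · refine eA.2.trans ?_
    obtain ⟨yG, nG, cG⟩ := exists_cpow_eq hG (1 / 6)
    obtain ⟨yT, nT, cT, dT⟩ := exists_cpow_eq_div (e := 1 / 6) (e' := 5 / 6) hT 1 (by norm_num)
    obtain ⟨yS, nS, cS⟩ := exists_cpow_eq hS (1 / 30)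
    rw [eA.1, ratioA, cG, cT, dT, cS]
    generalize 1 - 95 / 4 * t + 83 / 4 * x t + 21 / 4 * t ^ 2 + 475 / 4 * x t * t
      + 10 * x t ^ 2 = zK at *
    generalize 1 + 50 * x t - 125 * t ^ 2 - 450 * x t * t - 500 * x t ^ 2 = zS at *
    generalize 1 - 35 / 4 * t - 101 / 4 * x t = zA at *
    generalize 1 - 3 / 5 * t - 34 / 5 * x t = zG at *
    generalize 1 + 3 * t - 20 * x t = zT at *
    field_simp
  · refine eB.2.trans ?_
    obtain ⟨yS, nS, cS⟩ := exists_cpow_eq hS (11 / 30)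
    obtain ⟨yT, nT, cT⟩ := exists_cpow_eq hT (5 / 6)
    obtain ⟨yG, nG, cG⟩ := exists_cpow_eq hG (1 / 6)
    rw [eB.1, ratioB, cS, cT, cG]
    generalize 1 - 95 / 4 * t + 83 / 4 * x t + 21 / 4 * t ^ 2 + 475 / 4 * x t * t
      + 10 * x t ^ 2 = zK at *
    generalize 1 + 50 * x t - 125 * t ^ 2 - 450 * x t * t - 500 * x t ^ 2 = zS at *
    generalize 1 + 21 / 4 * t + 41 / 4 * x t = zB at *
    generalize 1 - 3 / 5 * t - 34 / 5 * x t = zG at *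
    generalize 1 - 7 / 4 * t - 15 / 2 * x t = zL at *
    generalize 1 + 3 * t - 20 * x t = zT at *
    generalize 1 + 5 * t + 10 * x t = zM at *
    generalize 1 - 9 * x t = zC at *
    field_simp
  · exact eB.1

/-- Hypergeometric functions of the type with exponent differences `1/3, 2/5, 3/5`. -/
theorem nearOrigin_typeB : NearOrigin (fun x => x * (1 + 5 * x - 5 * x ^ 2)) (fun x ξ =>
      ₂F₁ (-1 / 6 : ℂ) (13 / 30) (3 / 5) (phi4 x ξ)
        = (1 + 50 * x - 125 * ξ ^ 2 - 450 * x * ξ - 500 * x ^ 2) ^ (13 / 30 : ℂ)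
            * (1 - 3 * ξ + 2 * x)
          / ((1 + 3 * ξ - 20 * x) ^ (5 / 6 : ℂ)
            * (1 - 3 / 5 * ξ - 34 / 5 * x) ^ (1 / 6 : ℂ) * (1 + 5 * ξ + 10 * x)) ∧
      ₂F₁ (5 / 6 : ℂ) (13 / 30) (3 / 5) (phi4 x ξ)
        = (1 + 50 * x - 125 * ξ ^ 2 - 450 * x * ξ - 500 * x ^ 2) ^ (13 / 30 : ℂ)
            * ((1 + 3 * ξ - 20 * x) ^ (13 / 6 : ℂ)
              * (1 - 7 / 4 * ξ + 25 / 2 * x - 245 / 4 * x ^ 2)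
              * (1 - 7 / 20 * ξ - 79 / 20 * x))
          / ((1 - 3 / 5 * ξ - 34 / 5 * x) ^ (1 / 6 : ℂ)
            * (1 - 95 / 4 * ξ + 83 / 4 * x + 21 / 4 * ξ ^ 2 + 475 / 4 * x * ξ
              + 10 * x ^ 2) ^ 2 * (1 - 5 * x) ^ 2) ∧
      ₂F₁ (5 / 6 : ℂ) (7 / 30) (7 / 5) (phi4 x ξ)
        = (1 + 50 * x - 125 * ξ ^ 2 - 450 * x * ξ - 500 * x ^ 2) ^ (7 / 30 : ℂ)
            * ((1 + 18 / 5 * ξ - 16 * x + x ^ 2) ^ (7 / 6 : ℂ)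
              * (1 + 1 / 25 * x) ^ (5 / 6 : ℂ) * (1 + 5 * ξ + 10 * x))
          / ((1 - 7 / 5 * ξ - 9 * x - x ^ 2) ^ 2 * (1 - 5 * x) ^ (7 / 6 : ℂ)) ∧
      ₂F₁ (-1 / 6 : ℂ) (7 / 30) (2 / 5) (phi4 x ξ)
        = (1 + 50 * x - 125 * ξ ^ 2 - 450 * x * ξ - 500 * x ^ 2) ^ (7 / 30 : ℂ)
            * (1 - 27 / 5 * ξ + 58 / 5 * x - 2 * x ^ 2)
          / ((1 + 18 / 5 * ξ - 16 * x + x ^ 2) ^ (5 / 6 : ℂ)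
            * (1 + 1 / 25 * x) ^ (1 / 6 : ℂ) * (1 - 5 * x) ^ (7 / 6 : ℂ))) := by
  obtain ⟨x, κ, hx⟩ := exists_isLocalParametrization (-5) 5
  refine hx.nearOrigin (fun y => by ring) ?_
  filter_upwards [self_mem_nhdsWithin, eventually_eqC hx, eventually_eqD hx,
    (nearUnit_S hx).eventually_ne_zero, (nearUnit_N hx).eventually_ne_zero,
    (nearUnit_T hx).eventually_ne_zero, (nearUnit_G hx).eventually_ne_zero,
    (nearUnit_M hx).eventually_ne_zero, (nearUnit_P hx).eventually_ne_zero,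
    (nearUnit_Q hx).eventually_ne_zero, (nearUnit_K hx).eventually_ne_zero,
    (nearUnit_R hx).eventually_ne_zero, (nearUnit_H hx).eventually_ne_zero,
    (nearUnit_V hx).eventually_ne_zero, (nearUnit_W hx).eventually_ne_zero,
    (nearUnit_U hx).eventually_ne_zero]
    with t (ht : t ≠ 0) eC eD hS hN hT hG hM hP hQ hK hR hH hV hW hU
  refine ⟨?_, ?_, ?_, ?_⟩
  · exact (ordinaryHypergeometric_comm _ _ _ _).trans eC.1
  · refine (ordinaryHypergeometric_comm _ _ _ _).trans <| eC.2.trans ?_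
    obtain ⟨yS, nS, cS⟩ := exists_cpow_eq hS (13 / 30)
    obtain ⟨yT, nT, cT, dT⟩ := exists_cpow_eq_div (e := 5 / 6) (e' := 13 / 6) hT 3 (by norm_num)
    obtain ⟨yG, nG, cG⟩ := exists_cpow_eq hG (1 / 6)
    rw [eC.1, ratioC, cS, cT, dT, cG]
    generalize 1 - 95 / 4 * t + 83 / 4 * x t + 21 / 4 * t ^ 2 + 475 / 4 * x t * t
      + 10 * x t ^ 2 = zK at *
    generalize 1 + 50 * x t - 125 * t ^ 2 - 450 * x t * t - 500 * x t ^ 2 = zS at *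
    generalize 1 - 7 / 4 * t + 25 / 2 * x t - 245 / 4 * x t ^ 2 = zP at *
    generalize 1 - 7 / 20 * t - 79 / 20 * x t = zQ at *
    generalize 1 - 3 / 5 * t - 34 / 5 * x t = zG at *
    generalize 1 + 3 * t - 20 * x t = zT at *
    generalize 1 + 5 * t + 10 * x t = zM at *
    generalize 1 - 3 * t + 2 * x t = zN at *
    generalize 1 - 5 * x t = zR at *
    field_simp
  · refine (ordinaryHypergeometric_comm _ _ _ _).trans <| eD.2.trans ?_
    obtain ⟨yS, nS, cS⟩ := exists_cpow_eq hS (7 / 30)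
    obtain ⟨yV, nV, cV, dV⟩ := exists_cpow_eq_div (e := 5 / 6) (e' := 7 / 6) hV 2 (by norm_num)
    obtain ⟨yW, nW, cW, dW⟩ := exists_cpow_eq_div (e := 1 / 6) (e' := 5 / 6) hW 1 (by norm_num)
    obtain ⟨yR, nR, cR⟩ := exists_cpow_eq hR (7 / 6)
    rw [eD.1, ratioD, cS, cV, dV, cW, dW, cR]
    generalize 1 + 50 * x t - 125 * t ^ 2 - 450 * x t * t - 500 * x t ^ 2 = zS at *
    generalize 1 - 27 / 5 * t + 58 / 5 * x t - 2 * x t ^ 2 = zH at *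
    generalize 1 + 18 / 5 * t - 16 * x t + x t ^ 2 = zV at *
    generalize 1 - 7 / 5 * t - 9 * x t - x t ^ 2 = zU at *
    generalize 1 + 5 * t + 10 * x t = zM at *
    generalize 1 + 1 / 25 * x t = zW at *
    generalize 1 - 5 * x t = zR at *
    field_simp
  · exact (ordinaryHypergeometric_comm _ _ _ _).trans eD.1

end E4

/-! ### The curve `ξ² = x (1 + 17 x + 16 x²)` -/

namespace E5

set_option linter.unusedSectionVars false
set_option linter.unusedVariables false

/-- A point of the curve, over any field, outside a finite set of points. -/
structure IsPoint {F : Type*} [Field F] (x ξ : F) : Prop where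
  sq : ξ ^ 2 = x * (1 + 17 * x + 16 * x ^ 2)
  ne₀ : x ≠ 0
  ne₁ : 1 - 4 * x ≠ 0
  ne₂ : 1 + x ≠ 0
  ne₃ : 1 + 4 * x ≠ 0
  ne₄ : 1 + 16 * x ≠ 0
  ne₅ : 1 - 28 * x + 16 * x ^ 2 ≠ 0
  ne₆ : 1 - 8 * x - 144 * x ^ 2 ≠ 0
  ne₇ : 1 + 12 * x + 16 * x ^ 2 ≠ 0
  ne₈ : 9 + 8 * x - 16 * x ^ 2 ≠ 0
  ne₉ : 1 - 116 * x - 1104 * x ^ 2 - 1856 * x ^ 3 + 256 * x ^ 4 ≠ 0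

variable {F : Type*} [Field F]

/-- The logarithmic derivative of `1 + 4 * x`. -/
def dlogA (x ξ : F) : F := (8 * ξ) / (1 + 4 * x)

/-- The logarithmic derivative of `1 - 16 * x ^ 2`. -/
def dlogF (x ξ : F) : F := (-64 * x * ξ) / ((1 - 4 * x) * (1 + 4 * x))

/-- The logarithmic derivative of `ξ + 5 * x`. -/
def dlogP (x ξ : F) : F := (5 * x + 20 * x ^ 2 + ξ - 12 * x * ξ) / (x * (1 - 4 * x))

/-- The logarithmic derivative of `ξ - 5 * x`. -/
def dlogM (x ξ : F) : F := (-5 * x - 20 * x ^ 2 + ξ - 12 * x * ξ) / (x * (1 - 4 * x))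

/-- The logarithmic derivative of `ξ - 3 * x`. -/
def dlogN (x ξ : F) : F := (-3 * x + 12 * x ^ 2 + ξ + 12 * x * ξ) / (x * (1 + 4 * x))

/-- The logarithmic derivative of `1 - 2 * ξ - 14 * x`. -/
def dlogT (x ξ : F) : F := (-2 - 96 * x - 96 * x ^ 2 + 448 * x ^ 3 - 32 * ξ + 256 * x * ξ
    - 192 * x ^ 2 * ξ) / ((1 - 4 * x) * (1 - 28 * x + 16 * x ^ 2))

/-- The logarithmic derivative of `1 - 2 * ξ + 6 * x`. -/
def dlogS (x ξ : F) : F := (-2 - 56 * x - 96 * x ^ 2 - 192 * x ^ 3 + 8 * ξ - 64 * x * ξ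
    - 192 * x ^ 2 * ξ) / ((1 - 4 * x) * (1 + 12 * x + 16 * x ^ 2))

/-- The logarithmic derivative of `1 + 2 / 3 * ξ + 2 / 3 * x - 16 / 3 * x ^ 2`. -/
def dlogQ (x ξ : F) : F := (6 + 200 * x + 384 * x ^ 2 + 1152 * x ^ 3 + 512 * x ^ 4 + 8 * ξ
    - 320 * x * ξ - 384 * x ^ 2 * ξ + 1024 * x ^ 3 * ξ) / ((1 - 4 * x) * (1 + 4 * x) * (9 + 8 * x
    - 16 * x ^ 2))

/-- The logarithmic derivative of `1 - ξ + x`. -/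
def dlogB (x ξ : F) : F := (-1 - 33 * x - 48 * x ^ 2 - 16 * x ^ 3 + ξ - 32 * x * ξ
    - 48 * x ^ 2 * ξ) / ((1 - 4 * x) * (1 + x) * (1 + 4 * x))

/-- The logarithmic derivative of `1 + ξ + x`. -/
def dlogC (x ξ : F) : F :=
    (1 + 33 * x + 48 * x ^ 2 + 16 * x ^ 3 + ξ - 32 * x * ξ - 48 * x ^ 2 * ξ) / ((1 - 4 * x) * (1
    + x) * (1 + 4 * x))

/-- The logarithmic derivative of `1 + 3 * ξ + x`. -/
def dlogD (x ξ : F) : F := (3 + 99 * x + 144 * x ^ 2 + 48 * x ^ 3 - 7 * ξ - 304 * x * ξ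
    - 432 * x ^ 2 * ξ) / ((1 + x) * (1 - 8 * x - 144 * x ^ 2))

/-- The logarithmic derivative of `x`. -/
def dlogX (x ξ : F) : F := (2 * ξ) / x

/-- The logarithmic derivative of `ξ`. -/
def dlogXi (x ξ : F) : F := (ξ + 34 * x * ξ + 48 * x ^ 2 * ξ) / (x * (1 + x) * (1 + 16 * x))

/-- The logarithmic derivative `θ` of the covering `φ`. -/
def theta (x ξ : F) : F := (25 * x + 500 * x ^ 2 + 7600 * x ^ 3 + 30400 * x ^ 4 + 32000 * x ^ 5
    + 25600 * x ^ 6 + ξ + 180 * x * ξ + 560 * x ^ 2 * ξ - 2240 * x ^ 3 * ξ - 11520 * x ^ 4 * ξ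
    - 1024 * x ^ 5 * ξ) / (x * (1 + 4 * x) * (1 - 28 * x + 16 * x ^ 2) * (1 + 12 * x + 16 * x ^ 2))

/-- The function `ρ = θ φ / (1 - φ)`. -/
def rho (x ξ : F) : F := (-54 + 2160 * x + 87264 * x ^ 2 + 699840 * x ^ 3 + 2799360 * x ^ 4
    + 5584896 * x ^ 5 + 2211840 * x ^ 6 - 884736 * x ^ 7 + 216 * ξ + 12960 * x * ξ
    + 43200 * x ^ 2 * ξ - 172800 * x ^ 3 * ξ - 829440 * x ^ 4 * ξ - 221184 * x ^ 5 * ξ) / ((1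
    + 4 * x) * (1 - 28 * x + 16 * x ^ 2) * (1 - 116 * x - 1104 * x ^ 2 - 1856 * x ^ 3
    + 256 * x ^ 4))

/-- The quotient of the hypergeometric functions with parameters
`(8/15, -1/15; 4/5)` and `(8/15, 14/15; 9/5)`. -/
def ratioA (x ξ : F) : F :=
    (1 - 2 * ξ - 14 * x) ^ 3 * (1 + 2 / 3 * ξ + 2 / 3 * x - 16 / 3 * x ^ 2) * (ξ
    - 5 * x) ^ 2 / ((1 - 2 * ξ + 6 * x) ^ 4 * (ξ + 5 * x) ^ 2)

/-- The quotient of the hypergeometric functions with parameters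
`(2/15, -4/15; 1/5)` and `(2/15, 11/15; 6/5)`. -/
def ratioB (x ξ : F) : F :=
    (1 - ξ + x) * (1 - 2 * ξ - 14 * x) ^ 2 * (ξ - 3 * x) / ((1 - 2 * ξ + 6 * x) * (1 + 4 * x) * (ξ
    + 5 * x) * (1 + 3 * ξ + x))

variable [CharZero F] {x ξ : F}

theorem rep_dlogA (h : IsPoint x ξ) : IsRep ξ (1 + 4 * x) (dlogA x ξ) 0 8 := .of_div h.ne₃

theorem mul_dlogA (h : IsPoint x ξ) : (1 + 4 * x) * dlogA x ξ = 2 * ξ * 4 :=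
  (rep_dlogA h).mul_eq h.sq 0

theorem rep_dlogF (h : IsPoint x ξ) : IsRep ξ ((1 - 4 * x) * (1 + 4 * x)) (dlogF x ξ) 0
    (-64 * x) := .of_div (mul_ne_zero h.ne₁ h.ne₃)

theorem mul_dlogF (h : IsPoint x ξ) : (1 - 16 * x ^ 2) * dlogF x ξ = 2 * ξ * (-32 * x) :=
  (rep_dlogF h).mul_eq h.sq 0

theorem rep_dlogP (h : IsPoint x ξ) : IsRep ξ (x * (1 - 4 * x)) (dlogP x ξ) (5 * x + 20 * x ^ 2)
    (1 - 12 * x) := .of_div (mul_ne_zero h.ne₀ h.ne₁)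

theorem mul_dlogP (h : IsPoint x ξ) : (ξ + 5 * x) * dlogP x ξ = 2 * ξ * 5
    + (1 + 34 * x + 48 * x ^ 2) := (rep_dlogP h).mul_eq h.sq (1 - 12 * x)

theorem rep_dlogM (h : IsPoint x ξ) : IsRep ξ (x * (1 - 4 * x)) (dlogM x ξ) (-5 * x - 20 * x ^ 2)
    (1 - 12 * x) := .of_div (mul_ne_zero h.ne₀ h.ne₁)

theorem mul_dlogM (h : IsPoint x ξ) : (ξ - 5 * x) * dlogM x ξ = 2 * ξ * (-5)
    + (1 + 34 * x + 48 * x ^ 2) := (rep_dlogM h).mul_eq h.sq (1 - 12 * x)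

theorem rep_dlogN (h : IsPoint x ξ) : IsRep ξ (x * (1 + 4 * x)) (dlogN x ξ) (-3 * x + 12 * x ^ 2)
    (1 + 12 * x) := .of_div (mul_ne_zero h.ne₀ h.ne₃)

theorem mul_dlogN (h : IsPoint x ξ) : (ξ - 3 * x) * dlogN x ξ = 2 * ξ * (-3)
    + (1 + 34 * x + 48 * x ^ 2) := (rep_dlogN h).mul_eq h.sq (1 + 12 * x)

theorem rep_dlogT (h : IsPoint x ξ) : IsRep ξ ((1 - 4 * x) * (1 - 28 * x + 16 * x ^ 2)) (dlogT x ξ)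
    (-2 - 96 * x - 96 * x ^ 2 + 448 * x ^ 3) (-32 + 256 * x - 192 * x ^ 2) :=
  .of_div (mul_ne_zero h.ne₁ h.ne₅)

theorem mul_dlogT (h : IsPoint x ξ) : (1 - 2 * ξ - 14 * x) * dlogT x ξ = 2 * ξ * (-14)
    + (1 + 34 * x + 48 * x ^ 2) * (-2) := (rep_dlogT h).mul_eq h.sq (64 - 512 * x + 384 * x ^ 2)

theorem rep_dlogS (h : IsPoint x ξ) : IsRep ξ ((1 - 4 * x) * (1 + 12 * x + 16 * x ^ 2)) (dlogS x ξ)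
    (-2 - 56 * x - 96 * x ^ 2 - 192 * x ^ 3) (8 - 64 * x - 192 * x ^ 2) :=
  .of_div (mul_ne_zero h.ne₁ h.ne₇)

theorem mul_dlogS (h : IsPoint x ξ) : (1 - 2 * ξ + 6 * x) * dlogS x ξ = 2 * ξ * 6
    + (1 + 34 * x + 48 * x ^ 2) * (-2) := (rep_dlogS h).mul_eq h.sq (-16 + 128 * x + 384 * x ^ 2)

theorem rep_dlogQ (h : IsPoint x ξ) :
    IsRep ξ ((1 - 4 * x) * (1 + 4 * x) * (9 + 8 * x - 16 * x ^ 2)) (dlogQ x ξ)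
    (6 + 200 * x + 384 * x ^ 2 + 1152 * x ^ 3 + 512 * x ^ 4) (8 - 320 * x - 384 * x ^ 2
    + 1024 * x ^ 3) := .of_div (mul_ne_zero (mul_ne_zero h.ne₁ h.ne₃) h.ne₈)

theorem mul_dlogQ (h : IsPoint x ξ) : (1 + 2 / 3 * ξ + 2 / 3 * x - 16 / 3 * x ^ 2) * dlogQ x ξ =
    2 * ξ * (2 / 3 - 32 / 3 * x) + (1 + 34 * x + 48 * x ^ 2) * (2 / 3) :=
  (rep_dlogQ h).mul_eq h.sq (16 / 3 - 640 / 3 * x - 256 * x ^ 2 + 2048 / 3 * x ^ 3)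

theorem rep_dlogB (h : IsPoint x ξ) : IsRep ξ ((1 - 4 * x) * (1 + x) * (1 + 4 * x)) (dlogB x ξ)
    (-1 - 33 * x - 48 * x ^ 2 - 16 * x ^ 3) (1 - 32 * x - 48 * x ^ 2) :=
  .of_div (mul_ne_zero (mul_ne_zero h.ne₁ h.ne₂) h.ne₃)

theorem mul_dlogB (h : IsPoint x ξ) : (1 - ξ + x) * dlogB x ξ = 2 * ξ
    + (1 + 34 * x + 48 * x ^ 2) * (-1) := (rep_dlogB h).mul_eq h.sq (-1 + 32 * x + 48 * x ^ 2)

theorem rep_dlogC (h : IsPoint x ξ) : IsRep ξ ((1 - 4 * x) * (1 + x) * (1 + 4 * x)) (dlogC x ξ)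
    (1 + 33 * x + 48 * x ^ 2 + 16 * x ^ 3) (1 - 32 * x - 48 * x ^ 2) :=
  .of_div (mul_ne_zero (mul_ne_zero h.ne₁ h.ne₂) h.ne₃)

theorem mul_dlogC (h : IsPoint x ξ) : (1 + ξ + x) * dlogC x ξ = 2 * ξ
    + (1 + 34 * x + 48 * x ^ 2) := (rep_dlogC h).mul_eq h.sq (1 - 32 * x - 48 * x ^ 2)

theorem rep_dlogD (h : IsPoint x ξ) : IsRep ξ ((1 + x) * (1 - 8 * x - 144 * x ^ 2)) (dlogD x ξ)
    (3 + 99 * x + 144 * x ^ 2 + 48 * x ^ 3) (-7 - 304 * x - 432 * x ^ 2) :=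
  .of_div (mul_ne_zero h.ne₂ h.ne₆)

theorem mul_dlogD (h : IsPoint x ξ) : (1 + 3 * ξ + x) * dlogD x ξ = 2 * ξ
    + (1 + 34 * x + 48 * x ^ 2) * 3 := (rep_dlogD h).mul_eq h.sq (-21 - 912 * x - 1296 * x ^ 2)

theorem rep_dlogX (h : IsPoint x ξ) : IsRep ξ x (dlogX x ξ) 0 2 := .of_div h.ne₀

theorem mul_dlogX (h : IsPoint x ξ) : x * dlogX x ξ = 2 * ξ := (rep_dlogX h).mul_eq h.sq 0

theorem rep_dlogXi (h : IsPoint x ξ) : IsRep ξ (x * (1 + x) * (1 + 16 * x)) (dlogXi x ξ) 0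
    (1 + 34 * x + 48 * x ^ 2) := .of_div (mul_ne_zero (mul_ne_zero h.ne₀ h.ne₂) h.ne₄)

theorem mul_dlogXi (h : IsPoint x ξ) : ξ * dlogXi x ξ = (1 + 34 * x + 48 * x ^ 2) :=
  (rep_dlogXi h).mul_eq h.sq (1 + 34 * x + 48 * x ^ 2)

theorem rep_theta (h : IsPoint x ξ) :
    IsRep ξ (x * (1 + 4 * x) * (1 - 28 * x + 16 * x ^ 2) * (1 + 12 * x + 16 * x ^ 2)) (theta x ξ)
    (25 * x + 500 * x ^ 2 + 7600 * x ^ 3 + 30400 * x ^ 4 + 32000 * x ^ 5 + 25600 * x ^ 6)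
    (1 + 180 * x + 560 * x ^ 2 - 2240 * x ^ 3 - 11520 * x ^ 4 - 1024 * x ^ 5) :=
  .of_div (mul_ne_zero (mul_ne_zero (mul_ne_zero h.ne₀ h.ne₃) h.ne₅) h.ne₇)

theorem rep_rho (h : IsPoint x ξ) :
    IsRep ξ ((1 + 4 * x) * (1 - 28 * x + 16 * x ^ 2) * (1 - 116 * x - 1104 * x ^ 2 - 1856 * x ^ 3
    + 256 * x ^ 4)) (rho x ξ) (-54 + 2160 * x + 87264 * x ^ 2 + 699840 * x ^ 3 + 2799360 * x ^ 4
    + 5584896 * x ^ 5 + 2211840 * x ^ 6 - 884736 * x ^ 7) (216 + 12960 * x + 43200 * x ^ 2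
    - 172800 * x ^ 3 - 829440 * x ^ 4 - 221184 * x ^ 5) :=
  .of_div (mul_ne_zero (mul_ne_zero h.ne₃ h.ne₅) h.ne₉)

theorem theta_eq (h : IsPoint x ξ) : theta x ξ = 3 * dlogP x ξ + 5 * dlogS x ξ - dlogF x ξ
    - 2 * dlogM x ξ - 5 * dlogT x ξ := by
  refine mul_left_cancel₀
    ((mul_ne_zero (mul_ne_zero (mul_ne_zero (mul_ne_zero h.ne₀ h.ne₁) h.ne₃) h.ne₅)
    h.ne₇) : (x * (1 - 4 * x) * (1 + 4 * x) * (1 - 28 * x + 16 * x ^ 2) * (1 + 12 * x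
    + 16 * x ^ 2) : F) ≠ 0) ?_
  linear_combination (1 - 4 * x) * (rep_theta h).eq
    - ((3 - 36 * x - 1104 * x ^ 2 - 4416 * x ^ 3 - 2304 * x ^ 4 + 3072 * x ^ 5) * (rep_dlogP h).eq
    + (5 * x - 120 * x ^ 2 - 480 * x ^ 3 + 320 * x ^ 4) * (rep_dlogS h).eq
    + (-x + 16 * x ^ 2 + 304 * x ^ 3 + 256 * x ^ 4 - 256 * x ^ 5) * (rep_dlogF h).eq
    + (-2 + 24 * x + 736 * x ^ 2 + 2944 * x ^ 3 + 1536 * x ^ 4 - 2048 * x ^ 5) * (rep_dlogM h).eq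
    + (-5 * x - 80 * x ^ 2 - 320 * x ^ 3 - 320 * x ^ 4) * (rep_dlogT h).eq)

theorem theta_ne_zero (h : IsPoint x ξ) : theta x ξ ≠ 0 :=
  (rep_theta h).ne_zero_of_norm h.sq (n :=
    (-1) * x * (1 - 28 * x + 16 * x ^ 2) * (1 + 12 * x + 16 * x ^ 2) * (1 - 116 * x - 1104 * x ^ 2
    - 1856 * x ^ 3 + 256 * x ^ 4) ^ 2) (by ring)
    (mul_ne_zero (mul_ne_zero (mul_ne_zero (mul_ne_zero (by norm_num) h.ne₀) h.ne₅) h.ne₇)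
    (pow_ne_zero 2 h.ne₉))

theorem rep_tau (h : IsPoint x ξ) :
    IsRep ξ (x * (1 + 12 * x + 16 * x ^ 2) * (1 - 116 * x - 1104 * x ^ 2 - 1856 * x ^ 3
    + 256 * x ^ 4)) (theta x ξ + rho x ξ) (-29 * x - 1584 * x ^ 2 - 6480 * x ^ 3 + 26240 * x ^ 4
    - 103680 * x ^ 5 - 405504 * x ^ 6 - 118784 * x ^ 7) (1 + 304 * x + 1520 * x ^ 2 - 24320 * x ^ 4
    - 77824 * x ^ 5 - 4096 * x ^ 6) := by
  refine ⟨(mul_ne_zero (mul_ne_zero h.ne₀ h.ne₇) h.ne₉), mul_left_cancel₀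
    ((mul_ne_zero h.ne₃ h.ne₅) : ((1 + 4 * x) * (1 - 28 * x + 16 * x ^ 2) : F) ≠ 0) ?_⟩
  linear_combination (1 - 116 * x - 1104 * x ^ 2 - 1856 * x ^ 3 + 256 * x ^ 4) * (rep_theta h).eq
    + (x + 12 * x ^ 2 + 16 * x ^ 3) * (rep_rho h).eq

theorem rep_P (h : IsPoint x ξ) : IsRep ξ 1 (ξ + 5 * x) (5 * x) 1 := .of_eq

theorem rep_P_sq (h : IsPoint x ξ) : IsRep ξ 1 ((ξ + 5 * x) ^ 2) (x + 42 * x ^ 2 + 16 * x ^ 3)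
    (10 * x) := (rep_P h).sq h.sq

theorem rep_M (h : IsPoint x ξ) : IsRep ξ 1 (ξ - 5 * x) (-5 * x) 1 := .of_eq

theorem rep_M_sq (h : IsPoint x ξ) : IsRep ξ 1 ((ξ - 5 * x) ^ 2) (x + 42 * x ^ 2 + 16 * x ^ 3)
    (-10 * x) := (rep_M h).sq h.sq

theorem rep_T (h : IsPoint x ξ) : IsRep ξ 1 (1 - 2 * ξ - 14 * x) (1 - 14 * x) (-2) := .of_eq

theorem rep_T_sq (h : IsPoint x ξ) : IsRep ξ 1 ((1 - 2 * ξ - 14 * x) ^ 2) (1 - 24 * x + 264 * x ^ 2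
    + 64 * x ^ 3) (-4 + 56 * x) := (rep_T h).sq h.sq

theorem rep_T_pow_3 (h : IsPoint x ξ) : IsRep ξ 1 ((1 - 2 * ξ - 14 * x) ^ 3)
    (1 - 30 * x + 624 * x ^ 2 - 5408 * x ^ 3 - 2688 * x ^ 4) (-6 + 160 * x - 1312 * x ^ 2
    - 128 * x ^ 3) := (rep_T_sq h).pow_succ h.sq (rep_T h)

theorem rep_S (h : IsPoint x ξ) : IsRep ξ 1 (1 - 2 * ξ + 6 * x) (1 + 6 * x) (-2) := .of_eq

theorem rep_S_sq (h : IsPoint x ξ) : IsRep ξ 1 ((1 - 2 * ξ + 6 * x) ^ 2) (1 + 16 * x + 104 * x ^ 2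
    + 64 * x ^ 3) (-4 - 24 * x) := (rep_S h).sq h.sq

theorem rep_S_pow_3 (h : IsPoint x ξ) : IsRep ξ 1 ((1 - 2 * ξ + 6 * x) ^ 3)
    (1 + 30 * x + 384 * x ^ 2 + 1632 * x ^ 3 + 1152 * x ^ 4) (-6 - 80 * x - 352 * x ^ 2
    - 128 * x ^ 3) := (rep_S_sq h).pow_succ h.sq (rep_S h)

theorem rep_S_pow_4 (h : IsPoint x ξ) : IsRep ξ 1 ((1 - 2 * ξ + 6 * x) ^ 4)
    (1 + 48 * x + 928 * x ^ 2 + 7552 * x ^ 3 + 25728 * x ^ 4 + 22528 * x ^ 5 + 4096 * x ^ 6)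
    (-8 - 176 * x - 1600 * x ^ 2 - 5504 * x ^ 3 - 3072 * x ^ 4) :=
  (rep_S_pow_3 h).pow_succ h.sq (rep_S h)

theorem rep_phi (h : IsPoint x ξ) : IsRep ξ ((1 + 4 * x) * (1 - 28 * x + 16 * x ^ 2) ^ 5)
    (phi5 x ξ) (-1350 * x - 97200 * x ^ 2 - 1512000 * x ^ 3 - 4060800 * x ^ 4 + 3801600 * x ^ 5
    + 15206400 * x ^ 6 - 259891200 * x ^ 7 - 1548288000 * x ^ 8 - 1592524800 * x ^ 9
    - 353894400 * x ^ 10) (-54 - 14256 * x - 333504 * x ^ 2 - 832896 * x ^ 3 - 13824 * x ^ 4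
    + 55296 * x ^ 5 + 53305344 * x ^ 6 + 341508096 * x ^ 7 + 233570304 * x ^ 8 + 14155776 * x ^ 9)
    ∧ phi5 x ξ ≠ 0 := by
  have nc : IsRep ξ 1 (54 : F) 54 0 := .of_eq
  have nP3 : IsRep ξ 1 ((ξ + 5 * x) ^ 3) (15 * x ^ 2 + 380 * x ^ 3 + 240 * x ^ 4)
      (x + 92 * x ^ 2 + 16 * x ^ 3) := (rep_P_sq h).pow_succ h.sq (rep_P h)
  have nm1 : IsRep ξ 1 (54 * (ξ + 5 * x) ^ 3) (810 * x ^ 2 + 20520 * x ^ 3 + 12960 * x ^ 4)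
      (54 * x + 4968 * x ^ 2 + 864 * x ^ 3) := nc.mul h.sq nP3
  have nS5 : IsRep ξ 1 ((1 - 2 * ξ + 6 * x) ^ 5) (1 + 70 * x + 1840 * x ^ 2 + 22560 * x ^ 3
      + 142080 * x ^ 4 + 421376 * x ^ 5 + 419840 * x ^ 6 + 122880 * x ^ 7)
      (-10 - 320 * x - 4512 * x ^ 2 - 30208 * x ^ 3 - 87552 * x ^ 4 - 63488 * x ^ 5
      - 8192 * x ^ 6) := (rep_S_pow_4 h).pow_succ h.sq (rep_S h)
  have nm2 : IsRep ξ 1 (54 * (ξ + 5 * x) ^ 3 * (1 - 2 * ξ + 6 * x) ^ 5) (270 * x ^ 2 + 1080 * x ^ 3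
      - 49248 * x ^ 4 + 228096 * x ^ 5 + 193536 * x ^ 6 - 2377728 * x ^ 7 + 1105920 * x ^ 8
      - 7077888 * x ^ 9 + 67239936 * x ^ 10 - 56623104 * x ^ 11 - 113246208 * x ^ 12)
      (54 * x + 648 * x ^ 2 - 16416 * x ^ 3 + 69120 * x ^ 4 + 138240 * x ^ 5 - 1161216 * x ^ 6
      - 663552 * x ^ 7 + 12386304 * x ^ 8 - 17694720 * x ^ 9) := nm1.mul h.sq nS5
  have rF : IsRep ξ 1 (1 - 16 * x ^ 2) (1 - 16 * x ^ 2) 0 := .of_eq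
  have rm1 : IsRep ξ 1 ((1 - 16 * x ^ 2) * (ξ - 5 * x) ^ 2) (x + 42 * x ^ 2 - 672 * x ^ 4
      - 256 * x ^ 5) (-10 * x + 160 * x ^ 3) := rF.mul h.sq (rep_M_sq h)
  have rT4 : IsRep ξ 1 ((1 - 2 * ξ - 14 * x) ^ 4) (1 - 32 * x + 928 * x ^ 2 - 16768 * x ^ 3
      + 112768 * x ^ 4 + 83968 * x ^ 5 + 4096 * x ^ 6) (-8 + 304 * x - 4800 * x ^ 2 + 29056 * x ^ 3
      + 7168 * x ^ 4) := (rep_T_pow_3 h).pow_succ h.sq (rep_T h)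
  have rT5 : IsRep ξ 1 ((1 - 2 * ξ - 14 * x) ^ 5) (1 - 30 * x + 1040 * x ^ 2 - 30240 * x ^ 3
      + 442880 * x ^ 4 - 2343424 * x ^ 5 - 2344960 * x ^ 6 - 286720 * x ^ 7)
      (-10 + 480 * x - 10912 * x ^ 2 + 129792 * x ^ 3 - 625152 * x ^ 4 - 268288 * x ^ 5
      - 8192 * x ^ 6) := rT4.pow_succ h.sq (rep_T h)
  have rm2 : IsRep ξ 1 ((1 - 16 * x ^ 2) * (ξ - 5 * x) ^ 2 * (1 - 2 * ξ - 14 * x) ^ 5)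
      (x + 112 * x ^ 2 - 3320 * x ^ 3 + 40288 * x ^ 4 - 277376 * x ^ 5 + 1033216 * x ^ 6
      - 206848 * x ^ 7 - 17858560 * x ^ 8 + 82608128 * x ^ 9 - 154402816 * x ^ 10
      + 83886080 * x ^ 11 + 52428800 * x ^ 12) (-20 * x + 360 * x ^ 2 - 992 * x ^ 3 - 24192 * x ^ 4
      + 243712 * x ^ 5 - 718848 * x ^ 6 - 1392640 * x ^ 7 + 14450688 * x ^ 8 - 34865152 * x ^ 9
      + 28311552 * x ^ 10 + 2097152 * x ^ 11) := rm1.mul h.sq rT5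
  have hr := rm2.ne_zero_of_norm h.sq (n :=
      x ^ 2 * (1 - 4 * x) ^ 11 * (1 + 4 * x) ^ 2 * (1 - 28 * x + 16 * x ^ 2) ^ 5) (by ring)
      (mul_ne_zero (mul_ne_zero (mul_ne_zero (pow_ne_zero 2 h.ne₀) (pow_ne_zero 11 h.ne₁))
      (pow_ne_zero 2 h.ne₃)) (pow_ne_zero 5 h.ne₅))
  have hn := nm2.ne_zero_of_norm h.sq (n :=
      (-2916) * x ^ 3 * (1 - 4 * x) ^ 11 * (1 + 12 * x + 16 * x ^ 2) ^ 5) (by ring)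
      (mul_ne_zero (mul_ne_zero (mul_ne_zero (by norm_num) (pow_ne_zero 3 h.ne₀))
      (pow_ne_zero 11 h.ne₁)) (pow_ne_zero 5 h.ne₇))
  have hq : IsRep ξ ((1 + 4 * x) * (1 - 28 * x + 16 * x ^ 2) ^ 5) _ (1350 * x + 97200 * x ^ 2
      + 1512000 * x ^ 3 + 4060800 * x ^ 4 - 3801600 * x ^ 5 - 15206400 * x ^ 6 + 259891200 * x ^ 7
      + 1548288000 * x ^ 8 + 1592524800 * x ^ 9 + 353894400 * x ^ 10)
      (54 + 14256 * x + 333504 * x ^ 2 + 832896 * x ^ 3 + 13824 * x ^ 4 - 55296 * x ^ 5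
      - 53305344 * x ^ 6 - 341508096 * x ^ 7 - 233570304 * x ^ 8 - 14155776 * x ^ 9) :=
      nm2.div h.sq rm2 hr (mul_ne_zero h.ne₃ (pow_ne_zero 5 h.ne₅))
  refine ⟨⟨hq.ne_zero, ?_⟩, neg_ne_zero.mpr (div_ne_zero hn hr)⟩
  have h1 := hq.eq
  unfold phi5
  linear_combination -h1

theorem rho_mul (h : IsPoint x ξ) :
    rho x ξ * (1 - phi5 x ξ) = theta x ξ * phi5 x ξ :=
  (rep_rho h).mul_one_sub_eq h.sq (rep_theta h) (rep_phi h).1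

theorem rep_ratioA (h : IsPoint x ξ) : IsRep ξ (3 * (1 + 12 * x + 16 * x ^ 2) ^ 4) (ratioA x ξ)
    (3 + 404 * x + 7984 * x ^ 2 + 33888 * x ^ 3 + 21760 * x ^ 4 - 197632 * x ^ 5 - 423936 * x ^ 6
    + 180224 * x ^ 7 + 360448 * x ^ 8) (-52 - 1664 * x - 7072 * x ^ 2 - 11520 * x ^ 3
    - 30720 * x ^ 4 - 59392 * x ^ 5 + 65536 * x ^ 6 + 32768 * x ^ 7) := by
  have nQ : IsRep ξ 1 (1 + 2 / 3 * ξ + 2 / 3 * x - 16 / 3 * x ^ 2) (1 + 2 / 3 * x - 16 / 3 * x ^ 2)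
      (2 / 3) := .of_eq
  have nm1 : IsRep ξ 1 ((1 - 2 * ξ - 14 * x) ^ 3 * (1 + 2 / 3 * ξ + 2 / 3 * x - 16 / 3 * x ^ 2))
      (1 - 100 / 3 * x + 1912 / 3 * x ^ 2 - 11872 / 3 * x ^ 3 - 68608 / 3 * x ^ 4
      + 34816 / 3 * x ^ 5 + 38912 / 3 * x ^ 6) (-16 / 3 + 136 * x - 2272 / 3 * x ^ 2
      - 16384 / 3 * x ^ 3 + 5120 * x ^ 4 + 2048 / 3 * x ^ 5) := (rep_T_pow_3 h).mul h.sq nQ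
  have nm2 :
      IsRep ξ 1 ((1 - 2 * ξ - 14 * x) ^ 3 * (1 + 2 / 3 * ξ + 2 / 3 * x - 16 / 3 * x ^ 2) * (ξ
      - 5 * x) ^ 2) (x + 62 * x ^ 2 - 1200 * x ^ 3 + 7584 * x ^ 4 - 17280 * x ^ 5 - 13824 * x ^ 6
      + 131072 * x ^ 7 - 204800 * x ^ 8 + 98304 * x ^ 9) (-46 / 3 * x + 736 / 3 * x ^ 2
      - 1504 * x ^ 3 + 4480 * x ^ 4 - 7680 * x ^ 5 + 12288 * x ^ 6 - 57344 / 3 * x ^ 7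
      + 32768 / 3 * x ^ 8) := nm1.mul h.sq (rep_M_sq h)
  have rm1 : IsRep ξ 1 ((1 - 2 * ξ + 6 * x) ^ 4 * (ξ + 5 * x) ^ 2) (x + 10 * x ^ 2 - 160 * x ^ 3
      + 96 * x ^ 4 + 2560 * x ^ 5 + 1536 * x ^ 6 - 40960 * x ^ 7 + 40960 * x ^ 8 + 65536 * x ^ 9)
      (2 * x - 32 * x ^ 2 + 160 * x ^ 3 - 2560 * x ^ 5 + 8192 * x ^ 6 - 8192 * x ^ 7) :=
      (rep_S_pow_4 h).mul h.sq (rep_P_sq h)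
  have hr := rm1.ne_zero_of_norm h.sq (n :=
      x ^ 2 * (1 - 4 * x) ^ 8 * (1 + 12 * x + 16 * x ^ 2) ^ 4) (by ring)
      (mul_ne_zero (mul_ne_zero (pow_ne_zero 2 h.ne₀) (pow_ne_zero 8 h.ne₁)) (pow_ne_zero 4 h.ne₇))
  exact nm2.div h.sq rm1 hr (mul_ne_zero (by norm_num) (pow_ne_zero 4 h.ne₇))

theorem contiguousA (h : IsPoint x ξ) {v l : F} (hv : v = 8 / 15 * dlogA x ξ + 1 / 6 * dlogP x ξ
    + 1 / 15 * dlogX x ξ - 1 / 3 * dlogT x ξ - 3 / 10 * dlogN x ξ) (hl : l = 3 * dlogT x ξ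
    + dlogQ x ξ + 2 * dlogM x ξ - 4 * dlogS x ξ - 2 * dlogP x ξ) :
    v = rho x ξ * ((-1 / 15) - (-1 / 15) * ((4 / 5) - (8 / 15)) / (4 / 5) * ratioA x ξ)
      ∧ (l + v) * ratioA x ξ = (theta x ξ + rho x ξ) * (4 / 5) * (1 - ratioA x ξ)
      + (8 / 15) * rho x ξ * ratioA x ξ := by
  have h1 : IsRep ξ (5 * (1 + 4 * x) * (1 - 28 * x + 16 * x ^ 2)) v (12 - 24 * x + 1056 * x ^ 2
      + 192 * x ^ 3) (56 - 128 * x - 64 * x ^ 2) := by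
    refine ⟨(mul_ne_zero (mul_ne_zero (by norm_num) h.ne₃) h.ne₅), mul_left_cancel₀
      ((mul_ne_zero (mul_ne_zero (by norm_num) h.ne₀) h.ne₁) : (6 * x * (1 - 4 * x) : F) ≠ 0) ?_⟩
    rw [hv]
    linear_combination (16 * x - 512 * x ^ 2 + 2048 * x ^ 3 - 1024 * x ^ 4) * (rep_dlogA
      h).eq + (5 - 120 * x - 480 * x ^ 2 + 320 * x ^ 3) * (rep_dlogP h).eq
      + (2 - 56 * x + 896 * x ^ 3 - 512 * x ^ 4) * (rep_dlogX h).eq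
      + (-10 * x - 40 * x ^ 2) * (rep_dlogT h).eq + (-9 + 288 * x - 1152 * x ^ 2
      + 576 * x ^ 3) * (rep_dlogN h).eq
  have h2 : IsRep ξ (5 * (1 + 4 * x) * (1 + 12 * x + 16 * x ^ 2) * (9 + 8 * x - 16 * x ^ 2) * (1
      - 116 * x - 1104 * x ^ 2 - 1856 * x ^ 3 + 256 * x ^ 4)) (l + v - (8 / 15) * rho x ξ)
      (624 + 49504 * x + 448448 * x ^ 2 + 1120000 * x ^ 3 + 8763392 * x ^ 4 + 70979584 * x ^ 5
      + 180076544 * x ^ 6 + 119799808 * x ^ 7 - 49807360 * x ^ 8 - 24117248 * x ^ 9)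
      (-10400 - 77376 * x + 236288 * x ^ 2 + 4143104 * x ^ 3 + 17264640 * x ^ 4 + 30883840 * x ^ 5
      + 14024704 * x ^ 6 - 12582912 * x ^ 7 - 1048576 * x ^ 8) := by
    refine ⟨(mul_ne_zero (mul_ne_zero (mul_ne_zero (mul_ne_zero (by norm_num) h.ne₃) h.ne₇) h.ne₈)
      h.ne₉), mul_left_cancel₀ ((mul_ne_zero (mul_ne_zero (mul_ne_zero (by norm_num) h.ne₀) h.ne₁)
      h.ne₅) : (6 * x * (1 - 4 * x) * (1 - 28 * x + 16 * x ^ 2) : F) ≠ 0) ?_⟩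
    rw [hv, hl]
    linear_combination (144 * x - 19456 * x ^ 2 + 122880 * x ^ 3 + 7219200 * x ^ 4
      + 33710080 * x ^ 5 - 98680832 * x ^ 6 - 599457792 * x ^ 7 - 348651520 * x ^ 8
      + 996147200 * x ^ 9 + 503316480 * x ^ 10 - 603979776 * x ^ 11
      + 67108864 * x ^ 12) * (rep_dlogA h).eq + (-495 + 62920 * x + 96800 * x ^ 2
      - 26118400 * x ^ 3 - 319616000 * x ^ 4 - 1402762240 * x ^ 5 - 2193551360 * x ^ 6
      + 666828800 * x ^ 7 + 4037017600 * x ^ 8 + 720896000 * x ^ 9 - 1960837120 * x ^ 10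
      + 230686720 * x ^ 11) * (rep_dlogP h).eq + (18 - 2360 * x + 5632 * x ^ 2 + 963840 * x ^ 3
      + 7823360 * x ^ 4 + 4519936 * x ^ 5 - 124272640 * x ^ 6 - 343310336 * x ^ 7
      - 49807360 * x ^ 8 + 560988160 * x ^ 9 + 176160768 * x ^ 10 - 293601280 * x ^ 11
      + 33554432 * x ^ 12) * (rep_dlogX h).eq + (720 * x - 71360 * x ^ 2 - 2150400 * x ^ 3
      - 21079040 * x ^ 4 - 90910720 * x ^ 5 - 167854080 * x ^ 6 - 54722560 * x ^ 7
      + 183500800 * x ^ 8 + 141557760 * x ^ 9 - 20971520 * x ^ 10) * (rep_dlogT h).eq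
      + (-81 + 10944 * x - 69120 * x ^ 2 - 4060800 * x ^ 3 - 18961920 * x ^ 4 + 55507968 * x ^ 5
      + 337195008 * x ^ 6 + 196116480 * x ^ 7 - 560332800 * x ^ 8 - 283115520 * x ^ 9
      + 339738624 * x ^ 10 - 37748736 * x ^ 11) * (rep_dlogN h).eq
      + (30 * x - 3960 * x ^ 2 + 13440 * x ^ 3 + 1524480 * x ^ 4 + 11865600 * x ^ 5
      + 24391680 * x ^ 6 + 3440640 * x ^ 7 - 16220160 * x ^ 8 + 1966080 * x ^ 9) * (rep_dlogQ h).eq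
      + (540 - 68640 * x - 105600 * x ^ 2 + 28492800 * x ^ 3 + 348672000 * x ^ 4
      + 1530286080 * x ^ 5 + 2392965120 * x ^ 6 - 727449600 * x ^ 7 - 4404019200 * x ^ 8
      - 786432000 * x ^ 9 + 2139095040 * x ^ 10 - 251658240 * x ^ 11) * (rep_dlogM h).eq
      + (-1080 * x + 150240 * x ^ 2 - 1574400 * x ^ 3 - 40496640 * x ^ 4 - 186193920 * x ^ 5
      - 178298880 * x ^ 6 + 332759040 * x ^ 7 + 314572800 * x ^ 8 - 290979840 * x ^ 9
      + 31457280 * x ^ 10) * (rep_dlogS h).eq + (-144 * x - 1280 * x ^ 2 + 3840 * x ^ 3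
      + 15360 * x ^ 4 - 16384 * x ^ 6) * (rep_rho h).eq
  have h3 := h1.eq_mul_add h.sq (rep_rho h) (rep_ratioA h) (-1 / 15) (1 / 45)
  have h4 := h2.mul_eq_mul_one_sub h.sq (rep_tau h) (rep_ratioA h) (4 / 5)
  exact ⟨by linear_combination h3, by linear_combination h4⟩

theorem rep_ratioB (h : IsPoint x ξ) :
    IsRep ξ ((1 - 8 * x - 144 * x ^ 2) * (1 + 12 * x + 16 * x ^ 2)) (ratioB x ξ)
    (1 + 74 * x + 576 * x ^ 2 - 416 * x ^ 3 - 2944 * x ^ 4) (-14 - 112 * x - 32 * x ^ 2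
    - 384 * x ^ 3) := by
  have nB : IsRep ξ 1 (1 - ξ + x) (1 + x) (-1) := .of_eq
  have nm1 : IsRep ξ 1 ((1 - ξ + x) * (1 - 2 * ξ - 14 * x) ^ 2) (1 - 19 * x + 252 * x ^ 2
      - 560 * x ^ 3 - 832 * x ^ 4) (-5 + 76 * x - 208 * x ^ 2 - 64 * x ^ 3) :=
      nB.mul h.sq (rep_T_sq h)
  have nN : IsRep ξ 1 (ξ - 3 * x) (-3 * x) 1 := .of_eq
  have nm2 : IsRep ξ 1 ((1 - ξ + x) * (1 - 2 * ξ - 14 * x) ^ 2 * (ξ - 3 * x)) (-8 * x + 48 * x ^ 2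
      + 248 * x ^ 3 - 704 * x ^ 4 - 1920 * x ^ 5 - 1024 * x ^ 6) (1 - 4 * x + 24 * x ^ 2
      + 64 * x ^ 3 - 640 * x ^ 4) := nm1.mul h.sq nN
  have rA : IsRep ξ 1 (1 + 4 * x) (1 + 4 * x) 0 := .of_eq
  have rm1 : IsRep ξ 1 ((1 - 2 * ξ + 6 * x) * (1 + 4 * x)) (1 + 10 * x + 24 * x ^ 2)
      (-2 - 8 * x) := (rep_S h).mul h.sq rA
  have rm2 : IsRep ξ 1 ((1 - 2 * ξ + 6 * x) * (1 + 4 * x) * (ξ + 5 * x))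
      (3 * x + 8 * x ^ 2 - 48 * x ^ 3 - 128 * x ^ 4) (1 - 16 * x ^ 2) := rm1.mul h.sq (rep_P h)
  have rD : IsRep ξ 1 (1 + 3 * ξ + x) (1 + x) 3 := .of_eq
  have rm3 : IsRep ξ 1 ((1 - 2 * ξ + 6 * x) * (1 + 4 * x) * (ξ + 5 * x) * (1 + 3 * ξ + x))
      (6 * x + 62 * x ^ 2 - 40 * x ^ 3 - 992 * x ^ 4 - 896 * x ^ 5) (1 + 10 * x + 8 * x ^ 2
      - 160 * x ^ 3 - 384 * x ^ 4) := rm2.mul h.sq rD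
  have hr := rm3.ne_zero_of_norm h.sq (n :=
      (-1) * x * (1 - 4 * x) ^ 3 * (1 + x) * (1 + 4 * x) ^ 2 * (1 - 8 * x - 144 * x ^ 2) * (1
      + 12 * x + 16 * x ^ 2)) (by ring)
      (mul_ne_zero (mul_ne_zero
      (mul_ne_zero (mul_ne_zero (mul_ne_zero (mul_ne_zero (by norm_num) h.ne₀)
      (pow_ne_zero 3 h.ne₁)) h.ne₂) (pow_ne_zero 2 h.ne₃)) h.ne₆) h.ne₇)
  exact nm2.div h.sq rm3 hr (mul_ne_zero h.ne₆ h.ne₇)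

theorem contiguousB (h : IsPoint x ξ) {v l : F} (hv : v = dlogD x ξ + 2 / 15 * dlogA x ξ
    + 7 / 6 * dlogP x ξ + 3 / 10 * dlogN x ξ - dlogC x ξ - 4 / 3 * dlogT x ξ - 11 / 15 * dlogX x ξ)
    (hl : l = dlogB x ξ + 2 * dlogT x ξ + dlogN x ξ - dlogS x ξ - dlogA x ξ - dlogP x ξ
    - dlogD x ξ) :
    v = rho x ξ * ((-4 / 15) - (-4 / 15) * ((1 / 5) - (2 / 15)) / (1 / 5) * ratioB x ξ)
      ∧ (l + v) * ratioB x ξ = (theta x ξ + rho x ξ) * (1 / 5) * (1 - ratioB x ξ)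
      + (2 / 15) * rho x ξ * ratioB x ξ := by
  have h1 : IsRep ξ (5 * (1 + 4 * x) * (1 - 28 * x + 16 * x ^ 2) * (1 - 8 * x - 144 * x ^ 2)) v
      (48 + 240 * x - 18240 * x ^ 2 - 122880 * x ^ 3 - 337920 * x ^ 4 - 233472 * x ^ 5)
      (144 - 1344 * x + 6144 * x ^ 2 + 55296 * x ^ 3 + 36864 * x ^ 4) := by
    refine ⟨(mul_ne_zero (mul_ne_zero (mul_ne_zero (by norm_num) h.ne₃) h.ne₅) h.ne₆),
      mul_left_cancel₀ ((mul_ne_zero (mul_ne_zero (mul_ne_zero (by norm_num) h.ne₀) h.ne₁)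
      h.ne₂) : (6 * x * (1 - 4 * x) * (1 + x) : F) ≠ 0) ?_⟩
    rw [hv]
    linear_combination (30 * x - 840 * x ^ 2 + 13440 * x ^ 4 - 7680 * x ^ 5) * (rep_dlogD
      h).eq + (4 * x - 156 * x ^ 2 + 800 * x ^ 3 + 15040 * x ^ 4 - 57600 * x ^ 5 - 34816 * x ^ 6
      + 36864 * x ^ 7) * (rep_dlogA h).eq + (35 - 1085 * x - 2800 * x ^ 2 + 148400 * x ^ 3
      + 616000 * x ^ 4 + 143360 * x ^ 5 - 322560 * x ^ 6) * (rep_dlogP h).eq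
      + (9 - 351 * x + 1800 * x ^ 2 + 33840 * x ^ 3 - 129600 * x ^ 4 - 78336 * x ^ 5
      + 82944 * x ^ 6) * (rep_dlogN h).eq + (-30 * x + 1080 * x ^ 2 - 2880 * x ^ 3 - 117120 * x ^ 4
      + 69120 * x ^ 5) * (rep_dlogC h).eq + (-40 * x + 120 * x ^ 2 + 7200 * x ^ 3 + 30080 * x ^ 4
      + 23040 * x ^ 5) * (rep_dlogT h).eq + (-22 + 770 * x - 968 * x ^ 2 - 100320 * x ^ 3
      - 14080 * x ^ 4 + 1458688 * x ^ 5 + 563200 * x ^ 6 - 811008 * x ^ 7) * (rep_dlogX h).eq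
  have h2 : IsRep ξ (5 * (1 + 4 * x) * (1 + 12 * x + 16 * x ^ 2) * (1 - 116 * x - 1104 * x ^ 2
      - 1856 * x ^ 3 + 256 * x ^ 4)) (l + v - (2 / 15) * rho x ξ) (14 + 1736 * x + 16512 * x ^ 2
      + 1600 * x ^ 3 - 247040 * x ^ 4 - 132096 * x ^ 5 + 782336 * x ^ 6 + 376832 * x ^ 7)
      (-280 - 2816 * x - 14400 * x ^ 2 - 49920 * x ^ 3 - 5120 * x ^ 4 + 184320 * x ^ 5
      + 16384 * x ^ 6) := by
    refine ⟨(mul_ne_zero (mul_ne_zero (mul_ne_zero (by norm_num) h.ne₃) h.ne₇) h.ne₉),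
      mul_left_cancel₀ ((mul_ne_zero (mul_ne_zero (mul_ne_zero (mul_ne_zero (by norm_num) h.ne₀)
      h.ne₁) h.ne₂) h.ne₅) : (6 * x * (1 - 4 * x) * (1 + x) * (1 - 28 * x + 16 * x ^ 2) : F) ≠ 0)
      ?_⟩
    rw [hv, hl]
    linear_combination (-26 * x + 3510 * x ^ 2 - 21840 * x ^ 3 - 1300000 * x ^ 4
      - 6273280 * x ^ 5 + 14995968 * x ^ 6 + 101570560 * x ^ 7 + 107560960 * x ^ 8
      - 31948800 * x ^ 9 - 51118080 * x ^ 10 + 6815744 * x ^ 11) * (rep_dlogA h).eq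
      + (5 - 635 * x - 1040 * x ^ 2 + 262640 * x ^ 3 + 3256960 * x ^ 4 + 14969600 * x ^ 5
      + 28810240 * x ^ 6 + 16424960 * x ^ 7 - 10895360 * x ^ 8 - 9175040 * x ^ 9
      + 1310720 * x ^ 10) * (rep_dlogP h).eq + (39 - 5265 * x + 32760 * x ^ 2 + 1950000 * x ^ 3
      + 9409920 * x ^ 4 - 22493952 * x ^ 5 - 152355840 * x ^ 6 - 161341440 * x ^ 7
      + 47923200 * x ^ 8 + 76677120 * x ^ 9 - 10223616 * x ^ 10) * (rep_dlogN h).eq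
      + (-30 * x + 3960 * x ^ 2 - 13440 * x ^ 3 - 1524480 * x ^ 4 - 11865600 * x ^ 5
      - 24391680 * x ^ 6 - 3440640 * x ^ 7 + 16220160 * x ^ 8 - 1966080 * x ^ 9) * (rep_dlogC h).eq
      + (20 * x - 1980 * x ^ 2 - 59920 * x ^ 3 - 595520 * x ^ 4 - 2688000 * x ^ 5 - 5857280 * x ^ 6
      - 5754880 * x ^ 7 - 1720320 * x ^ 8 + 327680 * x ^ 9) * (rep_dlogT h).eq
      + (-22 + 2882 * x - 6600 * x ^ 2 - 1173920 * x ^ 3 - 9708160 * x ^ 4 - 8543744 * x ^ 5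
      + 136699904 * x ^ 6 + 434790400 * x ^ 7 + 337018880 * x ^ 8 - 151388160 * x ^ 9
      - 167247872 * x ^ 10 + 23068672 * x ^ 11) * (rep_dlogX h).eq
      + (30 * x - 3960 * x ^ 2 + 13440 * x ^ 3 + 1524480 * x ^ 4 + 11865600 * x ^ 5
      + 24391680 * x ^ 6 + 3440640 * x ^ 7 - 16220160 * x ^ 8 + 1966080 * x ^ 9) * (rep_dlogB h).eq
      + (-30 * x + 4170 * x ^ 2 - 43320 * x ^ 3 - 1122720 * x ^ 4 - 5376000 * x ^ 5
      - 7342080 * x ^ 6 + 1259520 * x ^ 7 + 3809280 * x ^ 8 - 491520 * x ^ 9) * (rep_dlogS h).eq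
      + (-4 * x - 36 * x ^ 2 + 96 * x ^ 3 + 384 * x ^ 4 + 256 * x ^ 5) * (rep_rho h).eq
  have h3 := h1.eq_mul_add h.sq (rep_rho h) (rep_ratioB h) (-4 / 15) (4 / 45)
  have h4 := h2.mul_eq_mul_one_sub h.sq (rep_tau h) (rep_ratioB h) (1 / 5)
  exact ⟨by linear_combination h3, by linear_combination h4⟩

end E5

namespace E5

section Local

variable {x κ : ℂ → ℂ}

theorem eventually_isPoint (hx : IsLocalParametrization 16 17 x κ) :
    ∀ᶠ t in 𝓝[≠] 0, IsPoint (x t) t := by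
  filter_upwards [hx.sq, hx.eventually_ne_zero,
    hx.eventually_ne (p := fun x => 1 - 4 * x) (by fun_prop) (by norm_num),
    hx.eventually_ne (p := fun x => 1 + x) (by fun_prop) (by norm_num),
    hx.eventually_ne (p := fun x => 1 + 4 * x) (by fun_prop) (by norm_num),
    hx.eventually_ne (p := fun x => 1 + 16 * x) (by fun_prop) (by norm_num),
    hx.eventually_ne (p := fun x => 1 - 28 * x + 16 * x ^ 2) (by fun_prop) (by norm_num),
    hx.eventually_ne (p := fun x => 1 - 8 * x - 144 * x ^ 2) (by fun_prop) (by norm_num),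
    hx.eventually_ne (p := fun x => 1 + 12 * x + 16 * x ^ 2) (by fun_prop) (by norm_num),
    hx.eventually_ne (p := fun x => 9 + 8 * x - 16 * x ^ 2) (by fun_prop) (by norm_num),
    hx.eventually_ne (p := fun x => 1 - 116 * x - 1104 * x ^ 2 - 1856 * x ^ 3 + 256 * x ^ 4) (by fun_prop)
      (by norm_num)]
    with t h0 h1 h2 h3 h4 h5 h6 h7 h8 h9 h10
  exact ⟨by linear_combination h0, h1, h2, h3, h4, h5, h6, h7, h8, h9, h10⟩

theorem nearUnit_A (hx : IsLocalParametrization 16 17 x κ) : NearUnit κ (fun t => 1 + 4 * x t)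
    (fun t => dlogA (x t) t) :=
  hx.nearUnit 0 4 0 0 0 (fun t => by ring)
    ((eventually_isPoint hx).mono fun t h => by linear_combination mul_dlogA h)

theorem nearUnit_F (hx : IsLocalParametrization 16 17 x κ) : NearUnit κ (fun t => 1 - 16 * x t ^ 2)
    (fun t => dlogF (x t) t) :=
  hx.nearUnit 0 0 0 (-16) 0 (fun t => by ring)
    ((eventually_isPoint hx).mono fun t h => by linear_combination mul_dlogF h)

theorem nearUnit_P (hx : IsLocalParametrization 16 17 x κ) :
    NearUnit κ (fun t => (t + 5 * x t) / t) (fun t => dlogP (x t) t - dlogXi (x t) t) := by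
  refine hx.nearUnit_div 5 0 ?_ ?_
  · filter_upwards [self_mem_nhdsWithin] with t (ht : t ≠ 0)
    field_simp
    ring
  · filter_upwards [eventually_isPoint hx, self_mem_nhdsWithin] with t h (ht : t ≠ 0)
    have h1 := mul_dlogP h
    have h2 := mul_dlogXi h
    field_simp
    linear_combination t * h1 - (t + 5 * x t) * h2

theorem nearUnit_M (hx : IsLocalParametrization 16 17 x κ) :
    NearUnit κ (fun t => (t - 5 * x t) / t) (fun t => dlogM (x t) t - dlogXi (x t) t) := by
  refine hx.nearUnit_div (-5) 0 ?_ ?_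
  · filter_upwards [self_mem_nhdsWithin] with t (ht : t ≠ 0)
    field_simp
    ring
  · filter_upwards [eventually_isPoint hx, self_mem_nhdsWithin] with t h (ht : t ≠ 0)
    have h1 := mul_dlogM h
    have h2 := mul_dlogXi h
    field_simp
    linear_combination t * h1 - (t - 5 * x t) * h2

theorem nearUnit_N (hx : IsLocalParametrization 16 17 x κ) :
    NearUnit κ (fun t => (t - 3 * x t) / t) (fun t => dlogN (x t) t - dlogXi (x t) t) := by
  refine hx.nearUnit_div (-3) 0 ?_ ?_
  · filter_upwards [self_mem_nhdsWithin] with t (ht : t ≠ 0)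
    field_simp
    ring
  · filter_upwards [eventually_isPoint hx, self_mem_nhdsWithin] with t h (ht : t ≠ 0)
    have h1 := mul_dlogN h
    have h2 := mul_dlogXi h
    field_simp
    linear_combination t * h1 - (t - 3 * x t) * h2

theorem nearUnit_T (hx : IsLocalParametrization 16 17 x κ) :
    NearUnit κ (fun t => 1 - 2 * t - 14 * x t) (fun t => dlogT (x t) t) :=
  hx.nearUnit (-2) (-14) 0 0 0 (fun t => by ring)
    ((eventually_isPoint hx).mono fun t h => by linear_combination mul_dlogT h)

theorem nearUnit_S (hx : IsLocalParametrization 16 17 x κ) :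
    NearUnit κ (fun t => 1 - 2 * t + 6 * x t) (fun t => dlogS (x t) t) :=
  hx.nearUnit (-2) 6 0 0 0 (fun t => by ring)
    ((eventually_isPoint hx).mono fun t h => by linear_combination mul_dlogS h)

theorem nearUnit_Q (hx : IsLocalParametrization 16 17 x κ) :
    NearUnit κ (fun t => 1 + 2 / 3 * t + 2 / 3 * x t - 16 / 3 * x t ^ 2)
    (fun t => dlogQ (x t) t) :=
  hx.nearUnit (2 / 3) (2 / 3) 0 (-16 / 3) 0 (fun t => by ring)
    ((eventually_isPoint hx).mono fun t h => by linear_combination mul_dlogQ h)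

theorem nearUnit_B (hx : IsLocalParametrization 16 17 x κ) : NearUnit κ (fun t => 1 - t + x t)
    (fun t => dlogB (x t) t) :=
  hx.nearUnit (-1) 1 0 0 0 (fun t => by ring)
    ((eventually_isPoint hx).mono fun t h => by linear_combination mul_dlogB h)

theorem nearUnit_C (hx : IsLocalParametrization 16 17 x κ) : NearUnit κ (fun t => 1 + t + x t)
    (fun t => dlogC (x t) t) :=
  hx.nearUnit 1 1 0 0 0 (fun t => by ring)
    ((eventually_isPoint hx).mono fun t h => by linear_combination mul_dlogC h)

theorem nearUnit_D (hx : IsLocalParametrization 16 17 x κ) : NearUnit κ (fun t => 1 + 3 * t + x t)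
    (fun t => dlogD (x t) t) :=
  hx.nearUnit 3 1 0 0 0 (fun t => by ring)
    ((eventually_isPoint hx).mono fun t h => by linear_combination mul_dlogD h)

theorem nearUnit_X (hx : IsLocalParametrization 16 17 x κ) : NearUnit κ (fun t => x t / t ^ 2)
    (fun t => dlogX (x t) t - 2 * dlogXi (x t) t) := by
  refine hx.nearUnit_div_sq ?_
  filter_upwards [eventually_isPoint hx] with t h
  linear_combination t * mul_dlogX h - 2 * x t * mul_dlogXi h

theorem nearZero_phi (hx : IsLocalParametrization 16 17 x κ) :
    NearZero κ (fun t => phi5 (x t) t) (fun t => theta (x t) t) := by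
  have hP := nearUnit_P hx
  have hS := nearUnit_S hx
  have hF := nearUnit_F hx
  have hM := nearUnit_M hx
  have hT := nearUnit_T hx
  refine hx.nearZero (r := -54) (by norm_num) (((hP.pow 3).mul (hS.pow 5)).div
    ((hF.mul (hM.pow 2)).mul (hT.pow 5))) ?_ ?_
  · filter_upwards [self_mem_nhdsWithin] with t (ht : t ≠ 0)
    unfold phi5
    field_simp
  · filter_upwards [eventually_isPoint hx] with t h
    rw [theta_eq h]
    push_cast
    linear_combination mul_dlogXi h

theorem eventually_eqA (hx : IsLocalParametrization 16 17 x κ) : ∀ᶠ t in 𝓝[≠] 0, ₂F₁ (8 / 15 : ℂ)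
    (-1 / 15) (4 / 5) (phi5 (x t) t) =
    (1 + 4 * x t) ^ (8 / 15 : ℂ) * ((t + 5 * x t) / t) ^ (1 / 6 : ℂ) * (x
    t / t ^ 2) ^ (1 / 15 : ℂ) / ((1 - 2 * t - 14 * x t) ^ (1 / 3 : ℂ) * ((t
    - 3 * x t) / t) ^ (3 / 10 : ℂ)) ∧ ₂F₁ (8 / 15 : ℂ) (14 / 15) (9 / 5) (phi5 (x t) t) = ₂F₁
    (8 / 15 : ℂ) (-1 / 15) (4 / 5) (phi5 (x t) t) * ratioA (x t) t := by
  have hA := nearUnit_A hx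
  have hP := nearUnit_P hx
  have hX := nearUnit_X hx
  have hT := nearUnit_T hx
  have hN := nearUnit_N hx
  have hQ := nearUnit_Q hx
  have hM := nearUnit_M hx
  have hS := nearUnit_S hx
  have hr := ((((hA.cpow (8 / 15)).mul (hP.cpow (1 / 6))).mul (hX.cpow (1 / 15))).div
      ((hT.cpow (1 / 3)).mul (hN.cpow (3 / 10))))
  have hw : NearUnit κ (fun t => ratioA (x t) t) (fun t => 3 * dlogT (x t) t + dlogQ (x t) t
      + 2 * dlogM (x t) t - 4 * dlogS (x t) t - 2 * dlogP (x t) t) := by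
    refine ((((hT.pow 3).mul hQ).mul (hM.pow 2)).div ((hS.pow 4).mul (hP.pow 2))).congr ?_
    filter_upwards [self_mem_nhdsWithin] with t (ht : t ≠ 0)
    refine ⟨by simp only [ratioA]; field_simp, by push_cast; ring⟩
  have h1 := NearUnit.eventually_eq_contiguous_bc (a := 8 / 15) (b := -1 / 15) (c := 4 / 5)
    (by norm_num) hr hw (nearZero_phi hx) ((eventually_isPoint hx).mono fun t h =>
      ⟨rho_mul h, contiguousA h (by ring) rfl⟩)
  filter_upwards [h1] with t ht
  refine ⟨ht.1, ?_⟩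
  rw [ht.1, ← ht.2]
  norm_num

theorem eventually_eqB (hx : IsLocalParametrization 16 17 x κ) : ∀ᶠ t in 𝓝[≠] 0, ₂F₁ (2 / 15 : ℂ)
    (-4 / 15) (1 / 5) (phi5 (x t) t) = (1 + 3 * t + x t) * (1 + 4 * x t) ^ (2 / 15 : ℂ) * ((t
    + 5 * x t) / t) ^ (7 / 6 : ℂ) * ((t - 3 * x t) / t) ^ (3 / 10 : ℂ) / ((1 + t + x t) * (1
    - 2 * t - 14 * x t) ^ (4 / 3 : ℂ) * (x t / t ^ 2) ^ (11 / 15 : ℂ))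
    ∧ ₂F₁ (2 / 15 : ℂ) (11 / 15) (6 / 5) (phi5 (x t) t) = ₂F₁ (2 / 15 : ℂ) (-4 / 15) (1 / 5)
    (phi5 (x t) t) * ratioB (x t) t := by
  have hD := nearUnit_D hx
  have hA := nearUnit_A hx
  have hP := nearUnit_P hx
  have hN := nearUnit_N hx
  have hC := nearUnit_C hx
  have hT := nearUnit_T hx
  have hX := nearUnit_X hx
  have hB := nearUnit_B hx
  have hS := nearUnit_S hx
  have hr := ((((hD.mul (hA.cpow (2 / 15))).mul (hP.cpow (7 / 6))).mul (hN.cpow (3 / 10))).div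
      ((hC.mul (hT.cpow (4 / 3))).mul (hX.cpow (11 / 15))))
  have hw : NearUnit κ (fun t => ratioB (x t) t) (fun t => dlogB (x t) t + 2 * dlogT (x t) t
      + dlogN (x t) t - dlogS (x t) t - dlogA (x t) t - dlogP (x t) t - dlogD (x t) t) := by
    refine (((hB.mul (hT.pow 2)).mul hN).div (((hS.mul hA).mul hP).mul hD)).congr ?_
    filter_upwards [self_mem_nhdsWithin] with t (ht : t ≠ 0)
    refine ⟨by simp only [ratioB]; field_simp, by push_cast; ring⟩
  have h1 := NearUnit.eventually_eq_contiguous_bc (a := 2 / 15) (b := -4 / 15) (c := 1 / 5)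
    (by norm_num) hr hw (nearZero_phi hx) ((eventually_isPoint hx).mono fun t h =>
      ⟨rho_mul h, contiguousB h (by ring) rfl⟩)
  filter_upwards [h1] with t ht
  refine ⟨ht.1, ?_⟩
  rw [ht.1, ← ht.2]
  norm_num

end Local

/-- Hypergeometric functions of the type with exponent differences `1/3, 1/5, 3/5`. -/
theorem nearOrigin_typeA : NearOrigin (fun x => x * (1 + x) * (1 + 16 * x)) (fun x ξ =>
      ₂F₁ (-1 / 15 : ℂ) (8 / 15) (4 / 5) (phi5 x ξ)
        = (1 + 4 * x) ^ (8 / 15 : ℂ) * ((ξ + 5 * x) / ξ) ^ (1 / 6 : ℂ)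
            * (x / ξ ^ 2) ^ (1 / 15 : ℂ)
          / ((1 - 2 * ξ - 14 * x) ^ (1 / 3 : ℂ) * ((ξ - 3 * x) / ξ) ^ (3 / 10 : ℂ)) ∧
      ₂F₁ (14 / 15 : ℂ) (8 / 15) (9 / 5) (phi5 x ξ)
        = (1 - 2 * ξ - 14 * x) ^ (8 / 3 : ℂ)
            * (1 + 2 / 3 * ξ + 2 / 3 * x - 16 / 3 * x ^ 2) * (1 + 4 * x) ^ (8 / 15 : ℂ)
            * ((ξ - 5 * x) / ξ) ^ 2 * (x / ξ ^ 2) ^ (1 / 15 : ℂ)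
          / ((1 - 2 * ξ + 6 * x) ^ 4 * ((ξ + 5 * x) / ξ) ^ (11 / 6 : ℂ)
            * ((ξ - 3 * x) / ξ) ^ (3 / 10 : ℂ)) ∧
      ₂F₁ (2 / 15 : ℂ) (11 / 15) (6 / 5) (phi5 x ξ)
        = (1 - ξ + x) * (1 - 2 * ξ - 14 * x) ^ (2 / 3 : ℂ)
            * ((ξ + 5 * x) / ξ) ^ (1 / 6 : ℂ) * ((ξ - 3 * x) / ξ) ^ (13 / 10 : ℂ)
          / ((1 + ξ + x) * (1 - 2 * ξ + 6 * x) * (1 + 4 * x) ^ (13 / 15 : ℂ)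
            * (x / ξ ^ 2) ^ (11 / 15 : ℂ)) ∧
      ₂F₁ (2 / 15 : ℂ) (-4 / 15) (1 / 5) (phi5 x ξ)
        = (1 + 3 * ξ + x) * (1 + 4 * x) ^ (2 / 15 : ℂ) * ((ξ + 5 * x) / ξ) ^ (7 / 6 : ℂ)
            * ((ξ - 3 * x) / ξ) ^ (3 / 10 : ℂ)
          / ((1 + ξ + x) * (1 - 2 * ξ - 14 * x) ^ (4 / 3 : ℂ)
            * (x / ξ ^ 2) ^ (11 / 15 : ℂ))) := by
  obtain ⟨x, κ, hx⟩ := exists_isLocalParametrization 16 17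
  refine hx.nearOrigin (fun y => by ring) ?_
  filter_upwards [self_mem_nhdsWithin, eventually_eqA hx, eventually_eqB hx,
    (nearUnit_A hx).eventually_ne_zero, (nearUnit_P hx).eventually_ne_zero,
    (nearUnit_X hx).eventually_ne_zero, (nearUnit_T hx).eventually_ne_zero,
    (nearUnit_N hx).eventually_ne_zero, (nearUnit_Q hx).eventually_ne_zero,
    (nearUnit_M hx).eventually_ne_zero, (nearUnit_S hx).eventually_ne_zero,
    (nearUnit_D hx).eventually_ne_zero, (nearUnit_C hx).eventually_ne_zero,
    (nearUnit_B hx).eventually_ne_zero]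
    with t (ht : t ≠ 0) eA eB hA hP hX hT hN hQ hM hS hD hC hB
  have hP0 : t + 5 * x t ≠ 0 := (div_ne_zero_iff.mp hP).1
  have hX0 : x t ≠ 0 := (div_ne_zero_iff.mp hX).1
  have hN0 : t - 3 * x t ≠ 0 := (div_ne_zero_iff.mp hN).1
  have hM0 : t - 5 * x t ≠ 0 := (div_ne_zero_iff.mp hM).1
  refine ⟨?_, ?_, ?_, ?_⟩
  · exact (ordinaryHypergeometric_comm _ _ _ _).trans eA.1
  · refine (ordinaryHypergeometric_comm _ _ _ _).trans <| eA.2.trans ?_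
    obtain ⟨yA, nA, cA⟩ := exists_cpow_eq hA (8 / 15)
    obtain ⟨yP, nP, cP, dP⟩ := exists_cpow_eq_div (e := 1 / 6) (e' := 11 / 6) hP 2 (by norm_num)
    obtain ⟨yX, nX, cX⟩ := exists_cpow_eq hX (1 / 15)
    obtain ⟨yT, nT, cT, dT⟩ := exists_cpow_eq_div (e := 1 / 3) (e' := 8 / 3) hT 3 (by norm_num)
    obtain ⟨yN, nN, cN⟩ := exists_cpow_eq hN (3 / 10)
    rw [eA.1, ratioA, cA, cP, dP, cX, cT, dT, cN]
    generalize 1 + 2 / 3 * t + 2 / 3 * x t - 16 / 3 * x t ^ 2 = zQ at *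
    generalize 1 - 2 * t - 14 * x t = zT at *
    generalize 1 - 2 * t + 6 * x t = zS at *
    generalize 1 + 4 * x t = zA at *
    generalize t + 5 * x t = zP at *
    generalize t - 3 * x t = zN at *
    generalize t - 5 * x t = zM at *
    generalize x t = zX at *
    field_simp
  · refine eB.2.trans ?_
    obtain ⟨yA, nA, cA, dA⟩ := exists_cpow_eq_div (e := 2 / 15) (e' := 13 / 15) hA 1 (by norm_num)
    obtain ⟨yP, nP, cP, dP⟩ := exists_cpow_eq_mul (e := 1 / 6) (e' := 7 / 6) hP 1 (by norm_num)
    obtain ⟨yN, nN, cN, dN⟩ := exists_cpow_eq_mul (e := 3 / 10) (e' := 13 / 10) hN 1 (by norm_num)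
    obtain ⟨yT, nT, cT, dT⟩ := exists_cpow_eq_div (e := 4 / 3) (e' := 2 / 3) hT 2 (by norm_num)
    obtain ⟨yX, nX, cX⟩ := exists_cpow_eq hX (11 / 15)
    rw [eB.1, ratioB, cA, dA, cP, dP, cN, dN, cT, dT, cX]
    generalize 1 - 2 * t - 14 * x t = zT at *
    generalize 1 - 2 * t + 6 * x t = zS at *
    generalize 1 + 3 * t + x t = zD at *
    generalize 1 + 4 * x t = zA at *
    generalize t + 5 * x t = zP at *
    generalize t - 3 * x t = zN at *
    generalize 1 + t + x t = zC at *
    generalize 1 - t + x t = zB at *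
    generalize x t = zX at *
    field_simp
  · exact eB.1

end E5

namespace E5

theorem mul_cpow_of_re_pos {z t : ℂ} (hz : 0 < z.re) (ht : 0 < t.re) (s : ℂ) :
    (z * t) ^ s = z ^ s * t ^ s := by
  have hz0 : z ≠ 0 := by
    rintro rfl
    simp at hz
  have ht0 : t ≠ 0 := by
    rintro rfl
    simp at ht
  have h1 := Complex.abs_arg_lt_pi_div_two_iff.mpr (Or.inl hz)
  have h2 := Complex.abs_arg_lt_pi_div_two_iff.mpr (Or.inl ht)
  rw [abs_lt] at h1 h2
  rw [Complex.cpow_def_of_ne_zero (mul_ne_zero hz0 ht0), Complex.cpow_def_of_ne_zero hz0,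
    Complex.cpow_def_of_ne_zero ht0, Complex.log_mul hz0 ht0 ⟨by linarith, by linarith⟩,
    ← Complex.exp_add, add_mul]

/-- The argument of `x` does not jump if `x` and `t ^ 2` are on the same side of the real axis. -/
theorem cpow_eq_of_im {x t c : ℂ} {r : ℝ} (hr : 0 < r) (hx : x = c * t ^ 2) (hc : 0 < c.re)
    (ht : 0 < t.re) (him : (t ^ 2).im = x.im * r) (s : ℂ) : x ^ s = c ^ s * (t ^ s) ^ 2 := by
  have hc0 : c ≠ 0 := by
    rintro rfl
    simp at hc
  have ht0 : t ≠ 0 := by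
    rintro rfl
    simp at ht
  have hx0 : x ≠ 0 := by
    rw [hx]
    exact mul_ne_zero hc0 (pow_ne_zero 2 ht0)
  have h1 := Complex.abs_arg_lt_pi_div_two_iff.mpr (Or.inl hc)
  have h2 := Complex.abs_arg_lt_pi_div_two_iff.mpr (Or.inl ht)
  rw [abs_lt] at h1 h2
  have hexp : Complex.exp (Complex.log c + 2 * Complex.log t) = x := by
    rw [Complex.exp_add, Complex.exp_log hc0, two_mul, Complex.exp_add, Complex.exp_log ht0, hx]
    ring
  have hexp2 : Complex.exp (2 * Complex.log t) = t ^ 2 := by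
    rw [two_mul, Complex.exp_add, Complex.exp_log ht0]
    ring
  have him1 : x.im = Real.exp (Complex.log c + 2 * Complex.log t).re
      * Real.sin (c.arg + 2 * t.arg) := by
    rw [← hexp, Complex.exp_im]
    simp [Complex.log_im]
  have him2 : (t ^ 2).im = Real.exp (2 * Complex.log t).re * Real.sin (2 * t.arg) := by
    rw [← hexp2, Complex.exp_im]
    simp [Complex.log_im]
  have e1 := Real.exp_pos (Complex.log c + 2 * Complex.log t).re
  have e2 := Real.exp_pos (2 * Complex.log t).re
  have hpi := Real.pi_pos
  have hlog : Complex.log x = Complex.log c + 2 * Complex.log t := by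
    rw [← hexp, Complex.log_exp]
    · by_contra! h
      simp [Complex.log_im] at h
      have s1 : 0 ≤ Real.sin (c.arg + 2 * t.arg) := by
        rw [← Real.sin_add_two_pi]
        exact Real.sin_nonneg_of_nonneg_of_le_pi (by linarith) (by linarith)
      have s2 : Real.sin (2 * t.arg) < 0 :=
        Real.sin_neg_of_neg_of_neg_pi_lt (by linarith) (by linarith)
      have := mul_nonneg (mul_nonneg e1.le s1) hr.le
      have := mul_neg_of_pos_of_neg e2 s2
      rw [him1] at him
      linarith
    · by_contra! h
      simp [Complex.log_im] at h
      have s1 : Real.sin (c.arg + 2 * t.arg) < 0 := by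
        rw [← Real.sin_sub_two_pi]
        exact Real.sin_neg_of_neg_of_neg_pi_lt (by linarith) (by linarith)
      have s2 : 0 < Real.sin (2 * t.arg) :=
        Real.sin_pos_of_pos_of_lt_pi (by linarith) (by linarith)
      have := mul_neg_of_neg_of_pos (mul_neg_of_pos_of_neg e1 s1) hr
      have := mul_pos e2 s2
      rw [him1] at him
      linarith
  rw [Complex.cpow_def_of_ne_zero hx0, Complex.cpow_def_of_ne_zero hc0,
    Complex.cpow_def_of_ne_zero ht0, hlog, ← Complex.exp_nat_mul, ← Complex.exp_add]
  congr 1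
  push_cast
  ring

theorem nearOrigin_cpow : NearOrigin (fun x => x * (1 + x) * (1 + 16 * x)) (fun x ξ => 0 < ξ.re →
    ∀ s : ℂ, (ξ + 5 * x) ^ s = ((ξ + 5 * x) / ξ) ^ s * ξ ^ s ∧
      (ξ - 3 * x) ^ s = ((ξ - 3 * x) / ξ) ^ s * ξ ^ s ∧
      x ^ s = (x / ξ ^ 2) ^ s * (ξ ^ s) ^ 2) := by
  obtain ⟨x, κ, hx⟩ := exists_isLocalParametrization 16 17
  refine hx.nearOrigin (fun y => by ring) ?_
  have hre : ∀ {f : ℂ → ℂ} {v : ℂ → ℂ}, NearUnit κ f v → ∀ᶠ t in 𝓝[≠] 0, 0 < (f t).re :=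
    fun h => (Complex.continuous_re.continuousAt.tendsto.comp h.tendsto).eventually_const_lt
      (by simp)
  have hr : ∀ᶠ z : ℂ in 𝓝 0, 0 < 1 + 34 * z.re + 48 * z.re ^ 2 - 16 * z.im ^ 2 := by
    have : ContinuousAt (fun z : ℂ => 1 + 34 * z.re + 48 * z.re ^ 2 - 16 * z.im ^ 2) 0 := by
      fun_prop
    exact this.tendsto.eventually_const_lt (by simp)
  filter_upwards [hre (nearUnit_P hx), hre (nearUnit_N hx), hre (nearUnit_X hx),
    hx.tendsto.eventually hr, hx.sq, self_mem_nhdsWithin]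
    with t h1 h2 h3 h4 h5 (ht : t ≠ 0) ht' s
  refine ⟨?_, ?_, cpow_eq_of_im h4 (by field_simp) h3 ht' ?_ s⟩
  · rw [← mul_cpow_of_re_pos h1 ht', div_mul_cancel₀ _ ht]
  · rw [← mul_cpow_of_re_pos h2 ht', div_mul_cancel₀ _ ht]
  · rw [h5]
    simp [pow_two]
    ring

theorem nearOrigin_typeA_of_re_pos :
    NearOrigin (fun x => x * (1 + x) * (1 + 16 * x)) (fun x ξ => 0 < ξ.re →
      ₂F₁ (-1 / 15 : ℂ) (8 / 15) (4 / 5) (phi5 x ξ)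
        = (1 + 4 * x) ^ (8 / 15 : ℂ) * (ξ + 5 * x) ^ (1 / 6 : ℂ) * x ^ (1 / 15 : ℂ)
          / ((1 - 2 * ξ - 14 * x) ^ (1 / 3 : ℂ) * (ξ - 3 * x) ^ (3 / 10 : ℂ)) ∧
      ₂F₁ (14 / 15 : ℂ) (8 / 15) (9 / 5) (phi5 x ξ)
        = (1 - 2 * ξ - 14 * x) ^ (8 / 3 : ℂ)
            * (1 + 2 / 3 * ξ + 2 / 3 * x - 16 / 3 * x ^ 2) * (1 + 4 * x) ^ (8 / 15 : ℂ)
            * (ξ - 5 * x) ^ 2 * x ^ (1 / 15 : ℂ)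
          / ((1 - 2 * ξ + 6 * x) ^ 4 * (ξ + 5 * x) ^ (11 / 6 : ℂ)
            * (ξ - 3 * x) ^ (3 / 10 : ℂ)) ∧
      ₂F₁ (2 / 15 : ℂ) (11 / 15) (6 / 5) (phi5 x ξ)
        = (1 - ξ + x) * (1 - 2 * ξ - 14 * x) ^ (2 / 3 : ℂ) * (ξ + 5 * x) ^ (1 / 6 : ℂ)
            * (ξ - 3 * x) ^ (13 / 10 : ℂ)
          / ((1 + ξ + x) * (1 - 2 * ξ + 6 * x) * (1 + 4 * x) ^ (13 / 15 : ℂ)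
            * x ^ (11 / 15 : ℂ)) ∧
      ₂F₁ (2 / 15 : ℂ) (-4 / 15) (1 / 5) (phi5 x ξ)
        = (1 + 3 * ξ + x) * (1 + 4 * x) ^ (2 / 15 : ℂ) * (ξ + 5 * x) ^ (7 / 6 : ℂ)
            * (ξ - 3 * x) ^ (3 / 10 : ℂ)
          / ((1 + ξ + x) * (1 - 2 * ξ - 14 * x) ^ (4 / 3 : ℂ) * x ^ (11 / 15 : ℂ))) := by
  filter_upwards [nearOrigin_typeA, nearOrigin_cpow] with ⟨x, t⟩ ⟨e1, e2, e3, e4⟩ h ht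
  have ht0 : t ≠ 0 := by
    rintro rfl
    simp at ht
  obtain ⟨y, hy⟩ : ∃ y, t ^ (1 / 30 : ℂ) = y := ⟨_, rfl⟩
  have hk : ∀ k : ℕ, t ^ (k * (1 / 30) : ℂ) = y ^ k := fun k => by
    rw [Complex.cpow_nat_mul, hy]
  have hy0 : y ≠ 0 := by
    rw [← hy]
    simp [Complex.cpow_eq_zero_iff, ht0]
  have hty : t = y ^ 30 := by
    rw [← hk]
    norm_num
  have hP : ∀ {s : ℂ} (k : ℕ), s = k * (1 / 30) →
      (t + 5 * x) ^ s = ((t + 5 * x) / t) ^ s * y ^ k := fun k hs => by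
    rw [(h ht _).1, ← hk, hs]
  have hN : ∀ {s : ℂ} (k : ℕ), s = k * (1 / 30) →
      (t - 3 * x) ^ s = ((t - 3 * x) / t) ^ s * y ^ k := fun k hs => by
    rw [(h ht _).2.1, ← hk, hs]
  have hX : ∀ {s : ℂ} (k : ℕ), s = k * (1 / 30) →
      x ^ s = (x / t ^ 2) ^ s * (y ^ k) ^ 2 := fun k hs => by
    rw [(h ht _).2.2, ← hk, hs]
  have hM : (t - 5 * x) = ((t - 5 * x) / t) * y ^ 30 := by
    rw [← hty, div_mul_cancel₀ _ ht0]
  refine ⟨e1.trans ?_, e2.trans ?_, e3.trans ?_, e4.trans ?_⟩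
  · rw [hP (s := 1 / 6) 5 (by norm_num), hX (s := 1 / 15) 2 (by norm_num),
      hN (s := 3 / 10) 9 (by norm_num)]
    generalize ((t + 5 * x) / t) ^ (1 / 6 : ℂ) = p
    generalize ((t - 3 * x) / t) ^ (3 / 10 : ℂ) = n
    generalize (x / t ^ 2) ^ (1 / 15 : ℂ) = z
    field_simp
  · rw [hP (s := 11 / 6) 55 (by norm_num), hX (s := 1 / 15) 2 (by norm_num),
      hN (s := 3 / 10) 9 (by norm_num)]
    conv_rhs => rw [hM]
    generalize ((t + 5 * x) / t) ^ (11 / 6 : ℂ) = p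
    generalize ((t - 3 * x) / t) ^ (3 / 10 : ℂ) = n
    generalize (x / t ^ 2) ^ (1 / 15 : ℂ) = z
    generalize (t - 5 * x) / t = m
    field_simp
  · rw [hP (s := 1 / 6) 5 (by norm_num), hX (s := 11 / 15) 22 (by norm_num),
      hN (s := 13 / 10) 39 (by norm_num)]
    generalize ((t + 5 * x) / t) ^ (1 / 6 : ℂ) = p
    generalize ((t - 3 * x) / t) ^ (13 / 10 : ℂ) = n
    generalize (x / t ^ 2) ^ (11 / 15 : ℂ) = z
    field_simp
  · rw [hP (s := 7 / 6) 35 (by norm_num), hX (s := 11 / 15) 22 (by norm_num),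
      hN (s := 3 / 10) 9 (by norm_num)]
    generalize ((t + 5 * x) / t) ^ (7 / 6 : ℂ) = p
    generalize ((t - 3 * x) / t) ^ (3 / 10 : ℂ) = n
    generalize (x / t ^ 2) ^ (11 / 15 : ℂ) = z
    field_simp

end E5

/-! ### The curve `ξ² = x (1 + x - x²)` -/

namespace E6

set_option linter.unusedSectionVars false
set_option linter.unusedVariables false

/-- A point of the curve, over any field, outside a finite set of points. -/
structure IsPoint {F : Type*} [Field F] (x ξ : F) : Prop where
  sq : ξ ^ 2 = x * (1 + x - x ^ 2)
  ne₀ : x ≠ 0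
  ne₁ : 1 - x ≠ 0
  ne₂ : 1 + x ≠ 0
  ne₃ : 1 - 4 * x - x ^ 2 ≠ 0
  ne₄ : 1 + x - x ^ 2 ≠ 0
  ne₅ : 1 + x + 4 * x ^ 2 ≠ 0
  ne₆ : 4 - x + x ^ 2 ≠ 0

variable {F : Type*} [Field F]

/-- The logarithmic derivative of `1 - ξ + 2 * x`. -/
def dlogA (x ξ : F) : F := (-1 + 2 * x + 3 * ξ) / (1 + x)

/-- The logarithmic derivative of `1 + ξ + 2 * x`. -/
def dlogB (x ξ : F) : F := (1 - 2 * x + 3 * ξ) / (1 + x)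

/-- The logarithmic derivative of `1 + ξ - 2 * x`. -/
def dlogC (x ξ : F) : F :=
    (1 + 4 * x - 3 * x ^ 2 + 2 * x ^ 3 - 5 * ξ + 6 * x * ξ + 3 * x ^ 2 * ξ) / ((1 - x) * (1 - 4 * x
    - x ^ 2))

/-- The logarithmic derivative of `1 - ξ`. -/
def dlogD (x ξ : F) : F := (-1 - 3 * x - ξ - 3 * x * ξ) / ((1 - x) * (1 + x))

/-- The logarithmic derivative of `1 + ξ`. -/
def dlogE (x ξ : F) : F := (1 + 3 * x - ξ - 3 * x * ξ) / ((1 - x) * (1 + x))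

/-- The logarithmic derivative of `1 + x - x ^ 2`. -/
def dlogF (x ξ : F) : F := (2 * ξ - 4 * x * ξ) / (1 + x - x ^ 2)

/-- The logarithmic derivative of `ξ + 2 * x + x ^ 2`. -/
def dlogG (x ξ : F) : F := (2 * x + 3 * x ^ 2 + 4 * x ^ 3 - x ^ 4 + ξ - 6 * x * ξ - 15 * x ^ 2 * ξ
    - 4 * x ^ 3 * ξ) / (x * (1 + x) * (1 - 4 * x - x ^ 2))

/-- The logarithmic derivative of `1 + 1 / 2 * ξ + 1 / 2 * x`. -/
def dlogH (x ξ : F) : F :=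
  (2 + 3 * x - 6 * x ^ 2 - x ^ 3 + 3 * ξ + 3 * x ^ 2 * ξ) / ((1 + x) * (4 - x + x ^ 2))

/-- The logarithmic derivative of `1 - ξ + x - x ^ 2`. -/
def dlogI (x ξ : F) : F := (-1 - x - x ^ 3 + x ^ 4 + ξ - 4 * x * ξ - 3 * x ^ 2 * ξ
    + 4 * x ^ 3 * ξ) / ((1 - x) * (1 + x) * (1 + x - x ^ 2))

/-- The logarithmic derivative of `1 - 3 * ξ + 4 * x - 2 * x ^ 2`. -/
def dlogJ (x ξ : F) : F :=
    (-3 + 3 * x - 6 * x ^ 2 - 6 * x ^ 3 - ξ + 5 * x * ξ - 16 * x ^ 2 * ξ) / ((1 - x) * (1 + x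
    + 4 * x ^ 2))

/-- The logarithmic derivative of `ξ`. -/
def dlogXi (x ξ : F) : F := (ξ + 2 * x * ξ - 3 * x ^ 2 * ξ) / (x * (1 + x - x ^ 2))

/-- The logarithmic derivative `θ` of the covering `φ`. -/
def theta (x ξ : F) : F := (-8 * x - 24 * x ^ 2 + 40 * x ^ 4 - 24 * x ^ 6 + 8 * x ^ 7 + ξ
    + 22 * x * ξ - 5 * x ^ 2 * ξ - 5 * x ^ 4 * ξ - 22 * x ^ 5 * ξ + x ^ 6 * ξ) / (x * (1 - x) * (1
    + x) * (1 - 4 * x - x ^ 2) * (1 + x - x ^ 2))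

/-- The function `ρ = θ φ / (1 - φ)`. -/
def rho (x ξ : F) : F :=
    (16 + 32 * x - 16 * x ^ 2 - 32 * x ^ 3 + 16 * x ^ 4) / ((1 - x) * (1 + x) * (1 - 4 * x
    - x ^ 2))

/-- The quotient of the hypergeometric functions with parameters
`(7/10, -1/10; 4/5)` and `(7/10, 9/10; 9/5)`. -/
def ratioA (x ξ : F) : F :=
  (1 + ξ + 2 * x) * (1 + ξ - 2 * x) ^ 4 / ((1 - ξ) ^ 2 * (1 + x - x ^ 2) ^ 2)

/-- The quotient of the hypergeometric functions with parameters
`(1/10, -1/10; 1/5)` and `(1/10, 9/10; 6/5)`. -/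
def ratioB (x ξ : F) : F := (ξ + 2 * x + x ^ 2) / ξ

/-- The quotient of the hypergeometric functions with parameters
`(3/10, -1/10; 3/5)` and `(3/10, 9/10; 8/5)`. -/
def ratioC (x ξ : F) : F :=
  (1 + ξ - 2 * x) ^ 2 * (1 + 1 / 2 * ξ + 1 / 2 * x) / ((1 + x - x ^ 2) * (1 - ξ + x - x ^ 2))

/-- The quotient of the hypergeometric functions with parameters
`(3/10, -3/10; 2/5)` and `(3/10, 7/10; 7/5)`. -/
def ratioD (x ξ : F) : F :=
  (1 + ξ - 2 * x) ^ 3 / ((1 + x - x ^ 2) * (1 - 3 * ξ + 4 * x - 2 * x ^ 2))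

variable [CharZero F] {x ξ : F}

theorem rep_dlogA (h : IsPoint x ξ) : IsRep ξ (1 + x) (dlogA x ξ) (-1 + 2 * x) 3 :=
  .of_div h.ne₂

theorem mul_dlogA (h : IsPoint x ξ) : (1 - ξ + 2 * x) * dlogA x ξ = 2 * ξ * 2
    + (1 + 2 * x - 3 * x ^ 2) * (-1) := (rep_dlogA h).mul_eq h.sq (-3)

theorem rep_dlogB (h : IsPoint x ξ) : IsRep ξ (1 + x) (dlogB x ξ) (1 - 2 * x) 3 :=
  .of_div h.ne₂

theorem mul_dlogB (h : IsPoint x ξ) : (1 + ξ + 2 * x) * dlogB x ξ = 2 * ξ * 2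
    + (1 + 2 * x - 3 * x ^ 2) := (rep_dlogB h).mul_eq h.sq 3

theorem rep_dlogC (h : IsPoint x ξ) : IsRep ξ ((1 - x) * (1 - 4 * x - x ^ 2)) (dlogC x ξ)
    (1 + 4 * x - 3 * x ^ 2 + 2 * x ^ 3) (-5 + 6 * x + 3 * x ^ 2) :=
  .of_div (mul_ne_zero h.ne₁ h.ne₃)

theorem mul_dlogC (h : IsPoint x ξ) : (1 + ξ - 2 * x) * dlogC x ξ = 2 * ξ * (-2)
    + (1 + 2 * x - 3 * x ^ 2) := (rep_dlogC h).mul_eq h.sq (-5 + 6 * x + 3 * x ^ 2)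

theorem rep_dlogD (h : IsPoint x ξ) : IsRep ξ ((1 - x) * (1 + x)) (dlogD x ξ) (-1 - 3 * x)
    (-1 - 3 * x) := .of_div (mul_ne_zero h.ne₁ h.ne₂)

theorem mul_dlogD (h : IsPoint x ξ) : (1 - ξ) * dlogD x ξ = (1 + 2 * x - 3 * x ^ 2) * (-1) :=
  (rep_dlogD h).mul_eq h.sq (1 + 3 * x)

theorem rep_dlogE (h : IsPoint x ξ) : IsRep ξ ((1 - x) * (1 + x)) (dlogE x ξ) (1 + 3 * x)
    (-1 - 3 * x) := .of_div (mul_ne_zero h.ne₁ h.ne₂)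

theorem mul_dlogE (h : IsPoint x ξ) : (1 + ξ) * dlogE x ξ = (1 + 2 * x - 3 * x ^ 2) :=
  (rep_dlogE h).mul_eq h.sq (-1 - 3 * x)

theorem rep_dlogF (h : IsPoint x ξ) : IsRep ξ (1 + x - x ^ 2) (dlogF x ξ) 0 (2 - 4 * x) :=
  .of_div h.ne₄

theorem mul_dlogF (h : IsPoint x ξ) : (1 + x - x ^ 2) * dlogF x ξ = 2 * ξ * (1 - 2 * x) :=
  (rep_dlogF h).mul_eq h.sq 0

theorem rep_dlogG (h : IsPoint x ξ) : IsRep ξ (x * (1 + x) * (1 - 4 * x - x ^ 2)) (dlogG x ξ)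
    (2 * x + 3 * x ^ 2 + 4 * x ^ 3 - x ^ 4) (1 - 6 * x - 15 * x ^ 2 - 4 * x ^ 3) :=
  .of_div (mul_ne_zero (mul_ne_zero h.ne₀ h.ne₂) h.ne₃)

theorem mul_dlogG (h : IsPoint x ξ) : (ξ + 2 * x + x ^ 2) * dlogG x ξ = 2 * ξ * (2 + 2 * x)
    + (1 + 2 * x - 3 * x ^ 2) := (rep_dlogG h).mul_eq h.sq (1 - 6 * x - 15 * x ^ 2 - 4 * x ^ 3)

theorem rep_dlogH (h : IsPoint x ξ) : IsRep ξ ((1 + x) * (4 - x + x ^ 2)) (dlogH x ξ)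
    (2 + 3 * x - 6 * x ^ 2 - x ^ 3) (3 + 3 * x ^ 2) := .of_div (mul_ne_zero h.ne₂ h.ne₆)

theorem mul_dlogH (h : IsPoint x ξ) : (1 + 1 / 2 * ξ + 1 / 2 * x) * dlogH x ξ = 2 * ξ * (1 / 2)
    + (1 + 2 * x - 3 * x ^ 2) * (1 / 2) := (rep_dlogH h).mul_eq h.sq (3 / 2 + 3 / 2 * x ^ 2)

theorem rep_dlogI (h : IsPoint x ξ) : IsRep ξ ((1 - x) * (1 + x) * (1 + x - x ^ 2)) (dlogI x ξ)
    (-1 - x - x ^ 3 + x ^ 4) (1 - 4 * x - 3 * x ^ 2 + 4 * x ^ 3) :=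
  .of_div (mul_ne_zero (mul_ne_zero h.ne₁ h.ne₂) h.ne₄)

theorem mul_dlogI (h : IsPoint x ξ) : (1 - ξ + x - x ^ 2) * dlogI x ξ = 2 * ξ * (1 - 2 * x)
    + (1 + 2 * x - 3 * x ^ 2) * (-1) :=
  (rep_dlogI h).mul_eq h.sq (-1 + 4 * x + 3 * x ^ 2 - 4 * x ^ 3)

theorem rep_dlogJ (h : IsPoint x ξ) : IsRep ξ ((1 - x) * (1 + x + 4 * x ^ 2)) (dlogJ x ξ)
    (-3 + 3 * x - 6 * x ^ 2 - 6 * x ^ 3) (-1 + 5 * x - 16 * x ^ 2) :=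
  .of_div (mul_ne_zero h.ne₁ h.ne₅)

theorem mul_dlogJ (h : IsPoint x ξ) : (1 - 3 * ξ + 4 * x - 2 * x ^ 2) * dlogJ x ξ = 2 * ξ * (4
    - 4 * x) + (1 + 2 * x - 3 * x ^ 2) * (-3) :=
  (rep_dlogJ h).mul_eq h.sq (3 - 15 * x + 48 * x ^ 2)

theorem rep_dlogXi (h : IsPoint x ξ) : IsRep ξ (x * (1 + x - x ^ 2)) (dlogXi x ξ) 0
    (1 + 2 * x - 3 * x ^ 2) := .of_div (mul_ne_zero h.ne₀ h.ne₄)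

theorem mul_dlogXi (h : IsPoint x ξ) : ξ * dlogXi x ξ = (1 + 2 * x - 3 * x ^ 2) :=
  (rep_dlogXi h).mul_eq h.sq (1 + 2 * x - 3 * x ^ 2)

theorem rep_theta (h : IsPoint x ξ) :
    IsRep ξ (x * (1 - x) * (1 + x) * (1 - 4 * x - x ^ 2) * (1 + x - x ^ 2)) (theta x ξ)
    (-8 * x - 24 * x ^ 2 + 40 * x ^ 4 - 24 * x ^ 6 + 8 * x ^ 7) (1 + 22 * x - 5 * x ^ 2 - 5 * x ^ 4
    - 22 * x ^ 5 + x ^ 6) :=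
  .of_div (mul_ne_zero (mul_ne_zero (mul_ne_zero (mul_ne_zero h.ne₀ h.ne₁) h.ne₂) h.ne₃) h.ne₄)

theorem rep_rho (h : IsPoint x ξ) : IsRep ξ ((1 - x) * (1 + x) * (1 - 4 * x - x ^ 2)) (rho x ξ)
    (16 + 32 * x - 16 * x ^ 2 - 32 * x ^ 3 + 16 * x ^ 4) 0 :=
  .of_div (mul_ne_zero (mul_ne_zero h.ne₁ h.ne₂) h.ne₃)

theorem theta_eq (h : IsPoint x ξ) : theta x ξ = dlogXi x ξ + 2 * dlogF x ξ + 2 * dlogD x ξ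
    - dlogB x ξ - 5 * dlogC x ξ := by
  refine mul_left_cancel₀
    ((mul_ne_zero (mul_ne_zero (mul_ne_zero (mul_ne_zero h.ne₀ h.ne₁) h.ne₂) h.ne₃)
    h.ne₄) : (x * (1 - x) * (1 + x) * (1 - 4 * x - x ^ 2) * (1 + x - x ^ 2) : F) ≠ 0) ?_
  linear_combination (rep_theta h).eq
    - ((1 - 4 * x - 2 * x ^ 2 + 4 * x ^ 3 + x ^ 4) * (rep_dlogXi h).eq
    + (2 * x - 8 * x ^ 2 - 4 * x ^ 3 + 8 * x ^ 4 + 2 * x ^ 5) * (rep_dlogF h).eq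
    + (2 * x - 6 * x ^ 2 - 12 * x ^ 3 + 6 * x ^ 4 + 2 * x ^ 5) * (rep_dlogD h).eq
    + (-x + 4 * x ^ 2 + 3 * x ^ 3 - 9 * x ^ 4 + 2 * x ^ 5 + x ^ 6) * (rep_dlogB h).eq
    + (-5 * x - 10 * x ^ 2 + 5 * x ^ 4) * (rep_dlogC h).eq)

theorem theta_ne_zero (h : IsPoint x ξ) : theta x ξ ≠ 0 :=
  (rep_theta h).ne_zero_of_norm h.sq (n :=
    (-1) * x * (1 - x) * (1 + x) * (1 - 4 * x - x ^ 2) ^ 5 * (1 + x - x ^ 2)) (by ring)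
    (mul_ne_zero (mul_ne_zero (mul_ne_zero (mul_ne_zero (mul_ne_zero (by norm_num) h.ne₀) h.ne₁)
    h.ne₂) (pow_ne_zero 5 h.ne₃)) h.ne₄)

theorem rep_tau (h : IsPoint x ξ) :
    IsRep ξ (x * (1 - x) * (1 + x) * (1 - 4 * x - x ^ 2) * (1 + x - x ^ 2)) (theta x ξ + rho x ξ)
    (8 * x + 24 * x ^ 2 - 40 * x ^ 4 + 24 * x ^ 6 - 8 * x ^ 7) (1 + 22 * x - 5 * x ^ 2 - 5 * x ^ 4
    - 22 * x ^ 5 + x ^ 6) := by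
  refine ⟨(mul_ne_zero (mul_ne_zero (mul_ne_zero (mul_ne_zero h.ne₀ h.ne₁) h.ne₂) h.ne₃) h.ne₄),
    mul_left_cancel₀ (one_ne_zero : (1 : F) ≠ 0) ?_⟩
  linear_combination (rep_theta h).eq + (x + x ^ 2 - x ^ 3) * (rep_rho h).eq

theorem rep_B (h : IsPoint x ξ) : IsRep ξ 1 (1 + ξ + 2 * x) (1 + 2 * x) 1 := .of_eq

theorem rep_C (h : IsPoint x ξ) : IsRep ξ 1 (1 + ξ - 2 * x) (1 - 2 * x) 1 := .of_eq

theorem rep_C_sq (h : IsPoint x ξ) : IsRep ξ 1 ((1 + ξ - 2 * x) ^ 2) (1 - 3 * x + 5 * x ^ 2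
    - x ^ 3) (2 - 4 * x) := (rep_C h).sq h.sq

theorem rep_C_pow_3 (h : IsPoint x ξ) : IsRep ξ 1 ((1 + ξ - 2 * x) ^ 3) (1 - 3 * x + 9 * x ^ 2
    - 17 * x ^ 3 + 6 * x ^ 4) (3 - 11 * x + 13 * x ^ 2 - x ^ 3) :=
  (rep_C_sq h).pow_succ h.sq (rep_C h)

theorem rep_C_pow_4 (h : IsPoint x ξ) : IsRep ξ 1 ((1 + ξ - 2 * x) ^ 4) (1 - 2 * x + 7 * x ^ 2
    - 36 * x ^ 3 + 63 * x ^ 4 - 26 * x ^ 5 + x ^ 6) (4 - 20 * x + 44 * x ^ 2 - 44 * x ^ 3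
    + 8 * x ^ 4) := (rep_C_pow_3 h).pow_succ h.sq (rep_C h)

theorem rep_D (h : IsPoint x ξ) : IsRep ξ 1 (1 - ξ) 1 (-1) := .of_eq

theorem rep_D_sq (h : IsPoint x ξ) : IsRep ξ 1 ((1 - ξ) ^ 2) (1 + x + x ^ 2 - x ^ 3) (-2) :=
  (rep_D h).sq h.sq

theorem rep_F (h : IsPoint x ξ) : IsRep ξ 1 (1 + x - x ^ 2) (1 + x - x ^ 2) 0 := .of_eq

theorem rep_F_sq (h : IsPoint x ξ) : IsRep ξ 1 ((1 + x - x ^ 2) ^ 2) (1 + 2 * x - x ^ 2 - 2 * x ^ 3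
    + x ^ 4) 0 := (rep_F h).sq h.sq

theorem rep_Xi (h : IsPoint x ξ) : IsRep ξ 1 ξ 0 1 := .of_eq

theorem rep_phi (h : IsPoint x ξ) : IsRep ξ ((1 - x) * (1 + x) * (1 - 4 * x - x ^ 2) ^ 5)
    (phi6 x ξ) (-128 * x - 640 * x ^ 2 - 640 * x ^ 3 + 1280 * x ^ 4 + 1920 * x ^ 5 - 1408 * x ^ 6
    - 1920 * x ^ 7 + 1280 * x ^ 8 + 640 * x ^ 9 - 640 * x ^ 10 + 128 * x ^ 11)
    (16 + 384 * x + 608 * x ^ 2 - 544 * x ^ 3 - 688 * x ^ 4 - 688 * x ^ 6 + 544 * x ^ 7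
    + 608 * x ^ 8 - 384 * x ^ 9 + 16 * x ^ 10) ∧ phi6 x ξ ≠ 0 := by
  have nc : IsRep ξ 1 (16 : F) 16 0 := .of_eq
  have nm1 : IsRep ξ 1 (16 * ξ) 0 16 := nc.mul h.sq (rep_Xi h)
  have nm2 : IsRep ξ 1 (16 * ξ * (1 + x - x ^ 2) ^ 2) 0 (16 + 32 * x - 16 * x ^ 2 - 32 * x ^ 3
      + 16 * x ^ 4) := nm1.mul h.sq (rep_F_sq h)
  have nm3 : IsRep ξ 1 (16 * ξ * (1 + x - x ^ 2) ^ 2 * (1 - ξ) ^ 2) (-32 * x - 96 * x ^ 2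
      + 160 * x ^ 4 - 96 * x ^ 6 + 32 * x ^ 7) (16 + 48 * x + 32 * x ^ 2 - 32 * x ^ 3 - 64 * x ^ 4
      + 48 * x ^ 6 - 16 * x ^ 7) := nm2.mul h.sq (rep_D_sq h)
  have rC5 : IsRep ξ 1 ((1 + ξ - 2 * x) ^ 5) (1 - 5 * x ^ 2 - 30 * x ^ 3 + 155 * x ^ 4
      - 232 * x ^ 5 + 105 * x ^ 6 - 10 * x ^ 7) (5 - 30 * x + 91 * x ^ 2 - 168 * x ^ 3
      + 159 * x ^ 4 - 42 * x ^ 5 + x ^ 6) := (rep_C_pow_4 h).pow_succ h.sq (rep_C h)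
  have rm1 : IsRep ξ 1 ((1 + ξ + 2 * x) * (1 + ξ - 2 * x) ^ 5) (1 + 7 * x - 30 * x ^ 2 + 16 * x ^ 3
      + 48 * x ^ 4 - 22 * x ^ 5 - 74 * x ^ 6 + 23 * x ^ 8 - x ^ 9) (6 - 20 * x + 26 * x ^ 2
      - 16 * x ^ 3 - 22 * x ^ 4 + 44 * x ^ 5 + 22 * x ^ 6 - 8 * x ^ 7) := (rep_B h).mul h.sq rC5
  have hr := rm1.ne_zero_of_norm h.sq (n := (1 - x) ^ 5 * (1 + x) ^ 3 * (1 - 4 * x - x ^ 2) ^ 5)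
      (by ring) (mul_ne_zero (mul_ne_zero (pow_ne_zero 5 h.ne₁) (pow_ne_zero 3 h.ne₂))
      (pow_ne_zero 5 h.ne₃))
  have hn := nm3.ne_zero_of_norm h.sq (n :=
      (-256) * x * (1 - x) ^ 4 * (1 + x) ^ 2 * (1 + x - x ^ 2) ^ 5) (by ring)
      (mul_ne_zero (mul_ne_zero (mul_ne_zero (mul_ne_zero (by norm_num) h.ne₀)
      (pow_ne_zero 4 h.ne₁)) (pow_ne_zero 2 h.ne₂)) (pow_ne_zero 5 h.ne₄))
  unfold phi6
  exact ⟨nm3.div h.sq rm1 hr (mul_ne_zero (mul_ne_zero h.ne₁ h.ne₂) (pow_ne_zero 5 h.ne₃)),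
    div_ne_zero hn hr⟩

theorem rho_mul (h : IsPoint x ξ) :
    rho x ξ * (1 - phi6 x ξ) = theta x ξ * phi6 x ξ :=
  (rep_rho h).mul_one_sub_eq h.sq (rep_theta h) (rep_phi h).1

theorem rep_ratioA (h : IsPoint x ξ) : IsRep ξ ((1 + x - x ^ 2) ^ 2) (ratioA x ξ)
    (1 + 17 * x + 9 * x ^ 2 + 3 * x ^ 3 + 6 * x ^ 4) (7 + 13 * x + 9 * x ^ 2 - x ^ 3) := by
  have nm1 : IsRep ξ 1 ((1 + ξ + 2 * x) * (1 + ξ - 2 * x) ^ 4) (1 + 4 * x - 13 * x ^ 2 - 2 * x ^ 3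
      + 11 * x ^ 4 + 20 * x ^ 5 + x ^ 6 - 6 * x ^ 7) (5 - 14 * x + 11 * x ^ 2 + 8 * x ^ 3
      - 17 * x ^ 4 - 10 * x ^ 5 + x ^ 6) := (rep_B h).mul h.sq (rep_C_pow_4 h)
  have rm1 : IsRep ξ 1 ((1 - ξ) ^ 2 * (1 + x - x ^ 2) ^ 2) (1 + 3 * x + 2 * x ^ 2 - 2 * x ^ 3
      - 4 * x ^ 4 + 3 * x ^ 6 - x ^ 7) (-2 - 4 * x + 2 * x ^ 2 + 4 * x ^ 3 - 2 * x ^ 4) :=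
      (rep_D_sq h).mul h.sq (rep_F_sq h)
  have hr := rm1.ne_zero_of_norm h.sq (n := (1 - x) ^ 4 * (1 + x) ^ 2 * (1 + x - x ^ 2) ^ 4)
      (by ring) (mul_ne_zero (mul_ne_zero (pow_ne_zero 4 h.ne₁) (pow_ne_zero 2 h.ne₂))
      (pow_ne_zero 4 h.ne₄))
  exact nm1.div h.sq rm1 hr (pow_ne_zero 2 h.ne₄)

theorem contiguousA (h : IsPoint x ξ) {v l : F} (hv : v = 1 / 15 * dlogA x ξ + 3 / 5 * dlogD x ξ
    - 7 / 30 * dlogB x ξ - 1 / 2 * dlogC x ξ) (hl : l = dlogB x ξ + 4 * dlogC x ξ - 2 * dlogD x ξ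
    - 2 * dlogF x ξ) :
    v = rho x ξ * ((-1 / 10) - (-1 / 10) * ((4 / 5) - (7 / 10)) / (4 / 5) * ratioA x ξ)
      ∧ (l + v) * ratioA x ξ = (theta x ξ + rho x ξ) * (4 / 5) * (1 - ratioA x ξ)
      + (7 / 10) * rho x ξ * ratioA x ξ := by
  have h1 : IsRep ξ (5 * (1 - x) * (1 + x) * (1 - 4 * x - x ^ 2)) v (-7 + x + 17 * x ^ 2
      + 19 * x ^ 3 - 2 * x ^ 4) (7 + 13 * x + 9 * x ^ 2 - x ^ 3) := by
    refine ⟨(mul_ne_zero (mul_ne_zero (mul_ne_zero (by norm_num) h.ne₁) h.ne₂) h.ne₃),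
      mul_left_cancel₀ ((by norm_num) : (6 : F) ≠ 0) ?_⟩
    rw [hv]
    linear_combination (2 - 10 * x + 6 * x ^ 2 + 2 * x ^ 3) * (rep_dlogA h).eq
      + (18 - 72 * x - 18 * x ^ 2) * (rep_dlogD h).eq + (-7 + 35 * x - 21 * x ^ 2
      - 7 * x ^ 3) * (rep_dlogB h).eq + (-15 - 15 * x) * (rep_dlogC h).eq
  have h2 : IsRep ξ (5 * (1 - x) * (1 + x) * (1 - 4 * x - x ^ 2) * (1 + x - x ^ 2))
      (l + v - (7 / 10) * rho x ξ) (-28 - 84 * x + 140 * x ^ 3 - 84 * x ^ 5 + 28 * x ^ 6)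
      (-88 + 40 * x ^ 3 + 80 * x ^ 4 - 4 * x ^ 5) := by
    refine ⟨(mul_ne_zero (mul_ne_zero (mul_ne_zero (mul_ne_zero (by norm_num) h.ne₁) h.ne₂) h.ne₃)
      h.ne₄), mul_left_cancel₀ ((by norm_num) : (6 : F) ≠ 0) ?_⟩
    rw [hv, hl]
    linear_combination (2 - 8 * x - 6 * x ^ 2 + 18 * x ^ 3 - 4 * x ^ 4
      - 2 * x ^ 5) * (rep_dlogA h).eq + (-42 + 126 * x + 252 * x ^ 2 - 126 * x ^ 3
      - 42 * x ^ 4) * (rep_dlogD h).eq + (23 - 92 * x - 69 * x ^ 2 + 207 * x ^ 3 - 46 * x ^ 4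
      - 23 * x ^ 5) * (rep_dlogB h).eq + (105 + 210 * x - 105 * x ^ 3) * (rep_dlogC h).eq
      + (-60 + 240 * x + 120 * x ^ 2 - 240 * x ^ 3 - 60 * x ^ 4) * (rep_dlogF h).eq
      + (-21 - 21 * x + 21 * x ^ 2) * (rep_rho h).eq
  have h3 := h1.eq_mul_add h.sq (rep_rho h) (rep_ratioA h) (-1 / 10) (1 / 80)
  have h4 := h2.mul_eq_mul_one_sub h.sq (rep_tau h) (rep_ratioA h) (4 / 5)
  exact ⟨by linear_combination h3, by linear_combination h4⟩

theorem rep_ratioB (h : IsPoint x ξ) : IsRep ξ (1 + x - x ^ 2) (ratioB x ξ) (1 + x - x ^ 2)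
    (2 + x) := by
  have nG : IsRep ξ 1 (ξ + 2 * x + x ^ 2) (2 * x + x ^ 2) 1 := .of_eq
  have hr := (rep_Xi h).ne_zero_of_norm h.sq (n := (-1) * x * (1 + x - x ^ 2)) (by ring)
      (mul_ne_zero (mul_ne_zero (by norm_num) h.ne₀) h.ne₄)
  exact nG.div h.sq (rep_Xi h) hr h.ne₄

theorem contiguousB (h : IsPoint x ξ) {v l : F} (hv : v = 1 / 10 * dlogE x ξ + 3 / 10 * dlogD x ξ
    - 1 / 30 * dlogA x ξ - 2 / 15 * dlogB x ξ - 1 / 2 * dlogC x ξ) (hl : l = dlogG x ξ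
    - dlogXi x ξ) :
    v = rho x ξ * ((-1 / 10) - (-1 / 10) * ((1 / 5) - (1 / 10)) / (1 / 5) * ratioB x ξ)
      ∧ (l + v) * ratioB x ξ = (theta x ξ + rho x ξ) * (1 / 5) * (1 - ratioB x ξ)
      + (1 / 10) * rho x ξ * ratioB x ξ := by
  have h1 : IsRep ξ (5 * (1 - x) * (1 + x) * (1 - 4 * x - x ^ 2)) v (-4 - 8 * x + 4 * x ^ 2
      + 8 * x ^ 3 - 4 * x ^ 4) (8 + 12 * x - 4 * x ^ 2 - 4 * x ^ 3) := by
    refine ⟨(mul_ne_zero (mul_ne_zero (mul_ne_zero (by norm_num) h.ne₁) h.ne₂) h.ne₃),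
      mul_left_cancel₀ ((by norm_num) : (6 : F) ≠ 0) ?_⟩
    rw [hv]
    linear_combination (3 - 12 * x - 3 * x ^ 2) * (rep_dlogE h).eq
      + (9 - 36 * x - 9 * x ^ 2) * (rep_dlogD h).eq
      + (-1 + 5 * x - 3 * x ^ 2 - x ^ 3) * (rep_dlogA h).eq + (-4 + 20 * x - 12 * x ^ 2
      - 4 * x ^ 3) * (rep_dlogB h).eq + (-15 - 15 * x) * (rep_dlogC h).eq
  have h2 : IsRep ξ (5 * (1 - x) * (1 + x) * (1 - 4 * x - x ^ 2) * (1 + x - x ^ 2))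
      (l + v - (1 / 10) * rho x ξ) (-2 - 21 * x + 35 * x ^ 3 - 25 * x ^ 4 - 6 * x ^ 5 + 7 * x ^ 6)
      (-12 - 15 * x ^ 2 + 25 * x ^ 3 + 15 * x ^ 4 - x ^ 5) := by
    refine ⟨(mul_ne_zero (mul_ne_zero (mul_ne_zero (mul_ne_zero (by norm_num) h.ne₁) h.ne₂) h.ne₃)
      h.ne₄), mul_left_cancel₀ ((mul_ne_zero (by norm_num) h.ne₀) : (6 * x : F) ≠ 0) ?_⟩
    rw [hv, hl]
    linear_combination (3 * x - 9 * x ^ 2 - 18 * x ^ 3 + 9 * x ^ 4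
      + 3 * x ^ 5) * (rep_dlogE h).eq + (9 * x - 27 * x ^ 2 - 54 * x ^ 3 + 27 * x ^ 4
      + 9 * x ^ 5) * (rep_dlogD h).eq + (-x + 4 * x ^ 2 + 3 * x ^ 3 - 9 * x ^ 4 + 2 * x ^ 5
      + x ^ 6) * (rep_dlogA h).eq + (-4 * x + 16 * x ^ 2 + 12 * x ^ 3 - 36 * x ^ 4 + 8 * x ^ 5
      + 4 * x ^ 6) * (rep_dlogB h).eq + (-15 * x - 30 * x ^ 2 + 15 * x ^ 4) * (rep_dlogC h).eq
      + (30 - 60 * x ^ 2 + 30 * x ^ 3) * (rep_dlogG h).eq + (-30 + 120 * x + 60 * x ^ 2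
      - 120 * x ^ 3 - 30 * x ^ 4) * (rep_dlogXi h).eq
      + (-3 * x - 3 * x ^ 2 + 3 * x ^ 3) * (rep_rho h).eq
  have h3 := h1.eq_mul_add h.sq (rep_rho h) (rep_ratioB h) (-1 / 10) (1 / 20)
  have h4 := h2.mul_eq_mul_one_sub h.sq (rep_tau h) (rep_ratioB h) (1 / 5)
  exact ⟨by linear_combination h3, by linear_combination h4⟩

theorem rep_ratioC (h : IsPoint x ξ) : IsRep ξ (2 * (1 + x - x ^ 2) ^ 2) (ratioC x ξ)
    (2 + 4 * x - 2 * x ^ 2 - 4 * x ^ 3 + 2 * x ^ 4) (7 - 7 * x - x ^ 2 - x ^ 3) := by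
  have nH : IsRep ξ 1 (1 + 1 / 2 * ξ + 1 / 2 * x) (1 + 1 / 2 * x) (1 / 2) := .of_eq
  have nm1 : IsRep ξ 1 ((1 + ξ - 2 * x) ^ 2 * (1 + 1 / 2 * ξ + 1 / 2 * x))
      (1 - 3 / 2 * x + 5 / 2 * x ^ 2 - 3 / 2 * x ^ 3 + 3 / 2 * x ^ 4)
      (5 / 2 - 9 / 2 * x + 1 / 2 * x ^ 2 - 1 / 2 * x ^ 3) := (rep_C_sq h).mul h.sq nH
  have rI : IsRep ξ 1 (1 - ξ + x - x ^ 2) (1 + x - x ^ 2) (-1) := .of_eq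
  have rm1 : IsRep ξ 1 ((1 + x - x ^ 2) * (1 - ξ + x - x ^ 2)) (1 + 2 * x - x ^ 2 - 2 * x ^ 3
      + x ^ 4) (-1 - x + x ^ 2) := (rep_F h).mul h.sq rI
  have hr := rm1.ne_zero_of_norm h.sq (n := (1 - x) * (1 + x) * (1 + x - x ^ 2) ^ 3) (by ring)
      (mul_ne_zero (mul_ne_zero h.ne₁ h.ne₂) (pow_ne_zero 3 h.ne₄))
  exact nm1.div h.sq rm1 hr (mul_ne_zero (by norm_num) (pow_ne_zero 2 h.ne₄))

theorem contiguousC (h : IsPoint x ξ) {v l : F} (hv : v = 2 / 15 * dlogA x ξ + 1 / 30 * dlogB x ξ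
    + 1 / 5 * dlogD x ξ - 1 / 2 * dlogC x ξ) (hl : l = 2 * dlogC x ξ + dlogH x ξ - dlogF x ξ
    - dlogI x ξ) :
    v = rho x ξ * ((-1 / 10) - (-1 / 10) * ((3 / 5) - (3 / 10)) / (3 / 5) * ratioC x ξ)
      ∧ (l + v) * ratioC x ξ = (theta x ξ + rho x ξ) * (3 / 5) * (1 - ratioC x ξ)
      + (3 / 10) * rho x ξ * ratioC x ξ := by
  have h1 : IsRep ξ (5 * (1 - x) * (1 + x) * (1 - 4 * x - x ^ 2)) v (-4 - 8 * x + 4 * x ^ 2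
      + 8 * x ^ 3 - 4 * x ^ 4) (14 - 14 * x - 2 * x ^ 2 - 2 * x ^ 3) := by
    refine ⟨(mul_ne_zero (mul_ne_zero (mul_ne_zero (by norm_num) h.ne₁) h.ne₂) h.ne₃),
      mul_left_cancel₀ ((by norm_num) : (6 : F) ≠ 0) ?_⟩
    rw [hv]
    linear_combination (4 - 20 * x + 12 * x ^ 2 + 4 * x ^ 3) * (rep_dlogA h).eq
      + (1 - 5 * x + 3 * x ^ 2 + x ^ 3) * (rep_dlogB h).eq
      + (6 - 24 * x - 6 * x ^ 2) * (rep_dlogD h).eq + (-15 - 15 * x) * (rep_dlogC h).eq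
  have h2 : IsRep ξ (5 * (1 - x) * (1 + x) * (1 - 4 * x - x ^ 2) * (1 + x - x ^ 2) * (4 - x
      + x ^ 2)) (l + v - (3 / 10) * rho x ξ) (-42 - 168 * x + 6 * x ^ 2 + 456 * x ^ 3 + 60 * x ^ 4
      - 336 * x ^ 5 + 66 * x ^ 6 - 12 * x ^ 7 + 18 * x ^ 8) (-189 + 231 * x - 141 * x ^ 2
      - 105 * x ^ 3 + 285 * x ^ 4 + 33 * x ^ 5 + 33 * x ^ 6 - 3 * x ^ 7) := by
    refine
      ⟨(mul_ne_zero (mul_ne_zero (mul_ne_zero (mul_ne_zero (mul_ne_zero (by norm_num) h.ne₁) h.ne₂)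
      h.ne₃) h.ne₄) h.ne₆), mul_left_cancel₀ ((by norm_num) : (6 : F) ≠ 0) ?_⟩
    rw [hv, hl]
    linear_combination (16 - 68 * x - 28 * x ^ 2 + 140 * x ^ 3 - 80 * x ^ 4
      + 28 * x ^ 5 - 4 * x ^ 6 - 4 * x ^ 7) * (rep_dlogA h).eq
      + (4 - 17 * x - 7 * x ^ 2 + 35 * x ^ 3 - 20 * x ^ 4 + 7 * x ^ 5 - x ^ 6
      - x ^ 7) * (rep_dlogB h).eq + (24 - 78 * x - 120 * x ^ 2 + 90 * x ^ 3 - 30 * x ^ 4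
      + 12 * x ^ 5 + 6 * x ^ 6) * (rep_dlogD h).eq + (180 + 315 * x - 45 * x ^ 2 - 90 * x ^ 3
      + 45 * x ^ 4 - 45 * x ^ 5) * (rep_dlogC h).eq + (30 - 120 * x - 90 * x ^ 2 + 270 * x ^ 3
      - 60 * x ^ 4 - 30 * x ^ 5) * (rep_dlogH h).eq + (-120 + 510 * x + 90 * x ^ 2 - 420 * x ^ 3
      + 60 * x ^ 4 - 90 * x ^ 5 - 30 * x ^ 6) * (rep_dlogF h).eq + (-120 + 510 * x - 30 * x ^ 2
      + 90 * x ^ 3 + 30 * x ^ 4) * (rep_dlogI h).eq + (-36 - 27 * x + 36 * x ^ 2 - 18 * x ^ 3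
      + 9 * x ^ 4) * (rep_rho h).eq
  have h3 := h1.eq_mul_add h.sq (rep_rho h) (rep_ratioC h) (-1 / 10) (1 / 20)
  have h4 := h2.mul_eq_mul_one_sub h.sq (rep_tau h) (rep_ratioC h) (3 / 5)
  exact ⟨by linear_combination h3, by linear_combination h4⟩

theorem rep_ratioD (h : IsPoint x ξ) : IsRep ξ ((1 + x - x ^ 2) * (1 + x + 4 * x ^ 2)) (ratioD x ξ)
    (1 + 12 * x - 6 * x ^ 2 - 2 * x ^ 3 - 9 * x ^ 4) (6 + 4 * x - 8 * x ^ 2 + 2 * x ^ 3) := by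
  have rJ : IsRep ξ 1 (1 - 3 * ξ + 4 * x - 2 * x ^ 2) (1 + 4 * x - 2 * x ^ 2) (-3) := .of_eq
  have rm1 : IsRep ξ 1 ((1 + x - x ^ 2) * (1 - 3 * ξ + 4 * x - 2 * x ^ 2))
      (1 + 5 * x + x ^ 2 - 6 * x ^ 3 + 2 * x ^ 4) (-3 - 3 * x + 3 * x ^ 2) := (rep_F h).mul h.sq rJ
  have hr := rm1.ne_zero_of_norm h.sq (n :=
      (1 - x) ^ 2 * (1 + x - x ^ 2) ^ 2 * (1 + x + 4 * x ^ 2)) (by ring)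
      (mul_ne_zero (mul_ne_zero (pow_ne_zero 2 h.ne₁) (pow_ne_zero 2 h.ne₄)) h.ne₅)
  exact (rep_C_pow_3 h).div h.sq rm1 hr (mul_ne_zero h.ne₄ h.ne₅)

theorem contiguousD (h : IsPoint x ξ) {v l : F} (hv : v = 7 / 30 * dlogB x ξ + 1 / 5 * dlogE x ξ
    + dlogJ x ξ - 1 / 15 * dlogA x ξ - 2 / 5 * dlogD x ξ - 3 / 2 * dlogC x ξ)
    (hl : l = 3 * dlogC x ξ - dlogF x ξ - dlogJ x ξ) :
    v = rho x ξ * ((-3 / 10) - (-3 / 10) * ((2 / 5) - (3 / 10)) / (2 / 5) * ratioD x ξ)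
      ∧ (l + v) * ratioD x ξ = (theta x ξ + rho x ξ) * (2 / 5) * (1 - ratioD x ξ)
      + (3 / 10) * rho x ξ * ratioD x ξ := by
  have h1 : IsRep ξ (5 * (1 - x) * (1 + x) * (1 - 4 * x - x ^ 2) * (1 + x + 4 * x ^ 2)) v
      (-18 + 6 * x - 90 * x ^ 2 - 240 * x ^ 3 + 90 * x ^ 4 + 126 * x ^ 5 - 42 * x ^ 6)
      (36 + 60 * x - 60 * x ^ 2 - 60 * x ^ 3 + 60 * x ^ 4 - 12 * x ^ 5) := by
    refine ⟨(mul_ne_zero (mul_ne_zero (mul_ne_zero (mul_ne_zero (by norm_num) h.ne₁) h.ne₂) h.ne₃)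
      h.ne₅), mul_left_cancel₀ ((by norm_num) : (6 : F) ≠ 0) ?_⟩
    rw [hv]
    linear_combination (7 - 28 * x + 14 * x ^ 2 - 112 * x ^ 3 + 91 * x ^ 4
      + 28 * x ^ 5) * (rep_dlogB h).eq + (6 - 18 * x - 6 * x ^ 2 - 102 * x ^ 3
      - 24 * x ^ 4) * (rep_dlogE h).eq + (30 - 90 * x - 150 * x ^ 2 - 30 * x ^ 3) * (rep_dlogJ
      h).eq + (-2 + 8 * x - 4 * x ^ 2 + 32 * x ^ 3 - 26 * x ^ 4 - 8 * x ^ 5) * (rep_dlogA h).eq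
      + (-12 + 36 * x + 12 * x ^ 2 + 204 * x ^ 3 + 48 * x ^ 4) * (rep_dlogD h).eq
      + (-45 - 90 * x - 225 * x ^ 2 - 180 * x ^ 3) * (rep_dlogC h).eq
  have h2 : IsRep ξ (5 * (1 - x) * (1 + x) * (1 - 4 * x - x ^ 2) * (1 + x - x ^ 2))
      (l + v - (3 / 10) * rho x ξ) (-12 - 36 * x + 60 * x ^ 3 - 36 * x ^ 5 + 12 * x ^ 6)
      (-44 + 20 * x + 30 * x ^ 2 + 10 * x ^ 3 + 30 * x ^ 4 - 2 * x ^ 5) := by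
    refine ⟨(mul_ne_zero (mul_ne_zero (mul_ne_zero (mul_ne_zero (by norm_num) h.ne₁) h.ne₂) h.ne₃)
      h.ne₄), mul_left_cancel₀ ((by norm_num) : (6 : F) ≠ 0) ?_⟩
    rw [hv, hl]
    linear_combination (7 - 28 * x - 21 * x ^ 2 + 63 * x ^ 3 - 14 * x ^ 4
      - 7 * x ^ 5) * (rep_dlogB h).eq + (6 - 18 * x - 36 * x ^ 2 + 18 * x ^ 3
      + 6 * x ^ 4) * (rep_dlogE h).eq + (-2 + 8 * x + 6 * x ^ 2 - 18 * x ^ 3 + 4 * x ^ 4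
      + 2 * x ^ 5) * (rep_dlogA h).eq + (-12 + 36 * x + 72 * x ^ 2 - 36 * x ^ 3
      - 12 * x ^ 4) * (rep_dlogD h).eq + (45 + 90 * x - 45 * x ^ 3) * (rep_dlogC h).eq
      + (-30 + 120 * x + 60 * x ^ 2 - 120 * x ^ 3 - 30 * x ^ 4) * (rep_dlogF h).eq
      + (-9 - 9 * x + 9 * x ^ 2) * (rep_rho h).eq
  have h3 := h1.eq_mul_add h.sq (rep_rho h) (rep_ratioD h) (-3 / 10) (3 / 40)
  have h4 := h2.mul_eq_mul_one_sub h.sq (rep_tau h) (rep_ratioD h) (2 / 5)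
  exact ⟨by linear_combination h3, by linear_combination h4⟩

end E6

namespace E6

section Local

variable {x κ : ℂ → ℂ}

theorem eventually_isPoint (hx : IsLocalParametrization (-1) 1 x κ) :
    ∀ᶠ t in 𝓝[≠] 0, IsPoint (x t) t := by
  filter_upwards [hx.sq, hx.eventually_ne_zero,
    hx.eventually_ne (p := fun x => 1 - x) (by fun_prop) (by norm_num),
    hx.eventually_ne (p := fun x => 1 + x) (by fun_prop) (by norm_num),
    hx.eventually_ne (p := fun x => 1 - 4 * x - x ^ 2) (by fun_prop) (by norm_num),
    hx.eventually_ne (p := fun x => 1 + x - x ^ 2) (by fun_prop) (by norm_num),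
    hx.eventually_ne (p := fun x => 1 + x + 4 * x ^ 2) (by fun_prop) (by norm_num),
    hx.eventually_ne (p := fun x => 4 - x + x ^ 2) (by fun_prop) (by norm_num)]
    with t h0 h1 h2 h3 h4 h5 h6 h7
  exact ⟨by linear_combination h0, h1, h2, h3, h4, h5, h6, h7⟩

theorem nearUnit_A (hx : IsLocalParametrization (-1) 1 x κ) : NearUnit κ (fun t => 1 - t + 2 * x t)
    (fun t => dlogA (x t) t) :=
  hx.nearUnit (-1) 2 0 0 0 (fun t => by ring)
    ((eventually_isPoint hx).mono fun t h => by linear_combination mul_dlogA h)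

theorem nearUnit_B (hx : IsLocalParametrization (-1) 1 x κ) : NearUnit κ (fun t => 1 + t + 2 * x t)
    (fun t => dlogB (x t) t) :=
  hx.nearUnit 1 2 0 0 0 (fun t => by ring)
    ((eventually_isPoint hx).mono fun t h => by linear_combination mul_dlogB h)

theorem nearUnit_C (hx : IsLocalParametrization (-1) 1 x κ) : NearUnit κ (fun t => 1 + t - 2 * x t)
    (fun t => dlogC (x t) t) :=
  hx.nearUnit 1 (-2) 0 0 0 (fun t => by ring)
    ((eventually_isPoint hx).mono fun t h => by linear_combination mul_dlogC h)

theorem nearUnit_D (hx : IsLocalParametrization (-1) 1 x κ) : NearUnit κ (fun t => 1 - t)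
    (fun t => dlogD (x t) t) :=
  hx.nearUnit (-1) 0 0 0 0 (fun t => by ring)
    ((eventually_isPoint hx).mono fun t h => by linear_combination mul_dlogD h)

theorem nearUnit_E (hx : IsLocalParametrization (-1) 1 x κ) : NearUnit κ (fun t => 1 + t)
    (fun t => dlogE (x t) t) :=
  hx.nearUnit 1 0 0 0 0 (fun t => by ring)
    ((eventually_isPoint hx).mono fun t h => by linear_combination mul_dlogE h)

theorem nearUnit_F (hx : IsLocalParametrization (-1) 1 x κ) :
    NearUnit κ (fun t => 1 + x t - x t ^ 2) (fun t => dlogF (x t) t) :=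
  hx.nearUnit 0 1 0 (-1) 0 (fun t => by ring)
    ((eventually_isPoint hx).mono fun t h => by linear_combination mul_dlogF h)

theorem nearUnit_G (hx : IsLocalParametrization (-1) 1 x κ) :
    NearUnit κ (fun t => (t + 2 * x t + x t ^ 2) / t) (fun t => dlogG (x t) t - dlogXi
    (x t) t) := by
  refine hx.nearUnit_div 2 1 ?_ ?_
  · filter_upwards [self_mem_nhdsWithin] with t (ht : t ≠ 0)
    field_simp
  · filter_upwards [eventually_isPoint hx, self_mem_nhdsWithin] with t h (ht : t ≠ 0)
    have h1 := mul_dlogG h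
    have h2 := mul_dlogXi h
    field_simp
    linear_combination t * h1 - (t + 2 * x t + x t ^ 2) * h2

theorem nearUnit_H (hx : IsLocalParametrization (-1) 1 x κ) :
    NearUnit κ (fun t => 1 + 1 / 2 * t + 1 / 2 * x t) (fun t => dlogH (x t) t) :=
  hx.nearUnit (1 / 2) (1 / 2) 0 0 0 (fun t => by ring)
    ((eventually_isPoint hx).mono fun t h => by linear_combination mul_dlogH h)

theorem nearUnit_I (hx : IsLocalParametrization (-1) 1 x κ) :
    NearUnit κ (fun t => 1 - t + x t - x t ^ 2) (fun t => dlogI (x t) t) :=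
  hx.nearUnit (-1) 1 0 (-1) 0 (fun t => by ring)
    ((eventually_isPoint hx).mono fun t h => by linear_combination mul_dlogI h)

theorem nearUnit_J (hx : IsLocalParametrization (-1) 1 x κ) :
    NearUnit κ (fun t => 1 - 3 * t + 4 * x t - 2 * x t ^ 2) (fun t => dlogJ (x t) t) :=
  hx.nearUnit (-3) 4 0 (-2) 0 (fun t => by ring)
    ((eventually_isPoint hx).mono fun t h => by linear_combination mul_dlogJ h)

theorem nearZero_phi (hx : IsLocalParametrization (-1) 1 x κ) :
    NearZero κ (fun t => phi6 (x t) t) (fun t => theta (x t) t) := by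
  have hF := nearUnit_F hx
  have hD := nearUnit_D hx
  have hB := nearUnit_B hx
  have hC := nearUnit_C hx
  refine hx.nearZero (r := 16) (by norm_num) (((hF.pow 2).mul (hD.pow 2)).div (hB.mul (hC.pow 5)))
    ?_ ?_
  · filter_upwards [self_mem_nhdsWithin] with t (ht : t ≠ 0)
    unfold phi6
    rw [← mul_div_assoc]
    congr 1
    ring
  · filter_upwards [eventually_isPoint hx] with t h
    rw [theta_eq h]
    push_cast
    linear_combination mul_dlogXi h

theorem eventually_eqA (hx : IsLocalParametrization (-1) 1 x κ) : ∀ᶠ t in 𝓝[≠] 0, ₂F₁ (7 / 10 : ℂ)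
    (-1 / 10) (4 / 5) (phi6 (x t) t) = (1 - t + 2 * x t) ^ (1 / 15 : ℂ) * (1
    - t) ^ (3 / 5 : ℂ) / ((1 + t + 2 * x t) ^ (7 / 30 : ℂ) * (1 + t - 2 * x t) ^ (1 / 2 : ℂ))
    ∧ ₂F₁ (7 / 10 : ℂ) (9 / 10) (9 / 5) (phi6 (x t) t) = ₂F₁ (7 / 10 : ℂ) (-1 / 10) (4 / 5)
    (phi6 (x t) t) * ratioA (x t) t := by
  have hA := nearUnit_A hx
  have hD := nearUnit_D hx
  have hB := nearUnit_B hx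
  have hC := nearUnit_C hx
  have hF := nearUnit_F hx
  have hr :=
      (((hA.cpow (1 / 15)).mul (hD.cpow (3 / 5))).div ((hB.cpow (7 / 30)).mul (hC.cpow (1 / 2))))
  have hw : NearUnit κ (fun t => ratioA (x t) t) (fun t => dlogB (x t) t + 4 * dlogC (x t) t
      - 2 * dlogD (x t) t - 2 * dlogF (x t) t) := by
    refine ((hB.mul (hC.pow 4)).div ((hD.pow 2).mul (hF.pow 2))).congr ?_
    filter_upwards [self_mem_nhdsWithin] with t (ht : t ≠ 0)
    refine ⟨by simp only [ratioA], by push_cast; ring⟩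
  have h1 := NearUnit.eventually_eq_contiguous_bc (a := 7 / 10) (b := -1 / 10) (c := 4 / 5)
    (by norm_num) hr hw (nearZero_phi hx) ((eventually_isPoint hx).mono fun t h =>
      ⟨rho_mul h, contiguousA h (by ring) rfl⟩)
  filter_upwards [h1] with t ht
  refine ⟨ht.1, ?_⟩
  rw [ht.1, ← ht.2]
  norm_num

theorem eventually_eqB (hx : IsLocalParametrization (-1) 1 x κ) : ∀ᶠ t in 𝓝[≠] 0, ₂F₁ (1 / 10 : ℂ)
    (-1 / 10) (1 / 5) (phi6 (x t) t) = (1 + t) ^ (1 / 10 : ℂ) * (1 - t) ^ (3 / 10 : ℂ) / ((1 - t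
    + 2 * x t) ^ (1 / 30 : ℂ) * (1 + t + 2 * x t) ^ (2 / 15 : ℂ) * (1 + t - 2 * x t) ^ (1 / 2 : ℂ))
    ∧ ₂F₁ (1 / 10 : ℂ) (9 / 10) (6 / 5) (phi6 (x t) t) = ₂F₁ (1 / 10 : ℂ) (-1 / 10) (1 / 5)
    (phi6 (x t) t) * ratioB (x t) t := by
  have hE := nearUnit_E hx
  have hD := nearUnit_D hx
  have hA := nearUnit_A hx
  have hB := nearUnit_B hx
  have hC := nearUnit_C hx
  have hG := nearUnit_G hx
  have hr :=
      (((hE.cpow (1 / 10)).mul (hD.cpow (3 / 10))).div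
      (((hA.cpow (1 / 30)).mul (hB.cpow (2 / 15))).mul (hC.cpow (1 / 2))))
  have hw : NearUnit κ (fun t => ratioB (x t) t) (fun t => dlogG (x t) t - dlogXi (x t) t) := by
    refine hG.congr ?_
    filter_upwards [self_mem_nhdsWithin] with t (ht : t ≠ 0)
    refine ⟨by simp only [ratioB], by ring⟩
  have h1 := NearUnit.eventually_eq_contiguous_bc (a := 1 / 10) (b := -1 / 10) (c := 1 / 5)
    (by norm_num) hr hw (nearZero_phi hx) ((eventually_isPoint hx).mono fun t h =>
      ⟨rho_mul h, contiguousB h (by ring) rfl⟩)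
  filter_upwards [h1] with t ht
  refine ⟨ht.1, ?_⟩
  rw [ht.1, ← ht.2]
  norm_num

theorem eventually_eqC (hx : IsLocalParametrization (-1) 1 x κ) : ∀ᶠ t in 𝓝[≠] 0, ₂F₁ (3 / 10 : ℂ)
    (-1 / 10) (3 / 5) (phi6 (x t) t) = (1 - t + 2 * x t) ^ (2 / 15 : ℂ) * (1 + t
    + 2 * x t) ^ (1 / 30 : ℂ) * (1 - t) ^ (1 / 5 : ℂ) / (1 + t - 2 * x t) ^ (1 / 2 : ℂ)
    ∧ ₂F₁ (3 / 10 : ℂ) (9 / 10) (8 / 5) (phi6 (x t) t) = ₂F₁ (3 / 10 : ℂ) (-1 / 10) (3 / 5)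
    (phi6 (x t) t) * ratioC (x t) t := by
  have hA := nearUnit_A hx
  have hB := nearUnit_B hx
  have hD := nearUnit_D hx
  have hC := nearUnit_C hx
  have hH := nearUnit_H hx
  have hF := nearUnit_F hx
  have hI := nearUnit_I hx
  have hr := ((((hA.cpow (2 / 15)).mul (hB.cpow (1 / 30))).mul (hD.cpow (1 / 5))).div
      (hC.cpow (1 / 2)))
  have hw : NearUnit κ (fun t => ratioC (x t) t) (fun t => 2 * dlogC (x t) t + dlogH (x t) t
      - dlogF (x t) t - dlogI (x t) t) := by
    refine (((hC.pow 2).mul hH).div (hF.mul hI)).congr ?_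
    filter_upwards [self_mem_nhdsWithin] with t (ht : t ≠ 0)
    refine ⟨by simp only [ratioC], by push_cast; ring⟩
  have h1 := NearUnit.eventually_eq_contiguous_bc (a := 3 / 10) (b := -1 / 10) (c := 3 / 5)
    (by norm_num) hr hw (nearZero_phi hx) ((eventually_isPoint hx).mono fun t h =>
      ⟨rho_mul h, contiguousC h (by ring) rfl⟩)
  filter_upwards [h1] with t ht
  refine ⟨ht.1, ?_⟩
  rw [ht.1, ← ht.2]
  norm_num

theorem eventually_eqD (hx : IsLocalParametrization (-1) 1 x κ) : ∀ᶠ t in 𝓝[≠] 0, ₂F₁ (3 / 10 : ℂ)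
    (-3 / 10) (2 / 5) (phi6 (x t) t) = (1 + t + 2 * x t) ^ (7 / 30 : ℂ) * (1
    + t) ^ (1 / 5 : ℂ) * (1 - 3 * t + 4 * x t
    - 2 * x t ^ 2) / ((1 - t + 2 * x t) ^ (1 / 15 : ℂ) * (1 - t) ^ (2 / 5 : ℂ) * (1 + t
    - 2 * x t) ^ (3 / 2 : ℂ)) ∧ ₂F₁ (3 / 10 : ℂ) (7 / 10) (7 / 5) (phi6 (x t) t) = ₂F₁ (3 / 10 : ℂ)
    (-3 / 10) (2 / 5) (phi6 (x t) t) * ratioD (x t) t := by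
  have hB := nearUnit_B hx
  have hE := nearUnit_E hx
  have hJ := nearUnit_J hx
  have hA := nearUnit_A hx
  have hD := nearUnit_D hx
  have hC := nearUnit_C hx
  have hF := nearUnit_F hx
  have hr :=
      ((((hB.cpow (7 / 30)).mul (hE.cpow (1 / 5))).mul hJ).div
      (((hA.cpow (1 / 15)).mul (hD.cpow (2 / 5))).mul (hC.cpow (3 / 2))))
  have hw : NearUnit κ (fun t => ratioD (x t) t) (fun t => 3 * dlogC (x t) t - dlogF (x t) t
      - dlogJ (x t) t) := by
    refine ((hC.pow 3).div (hF.mul hJ)).congr ?_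
    filter_upwards [self_mem_nhdsWithin] with t (ht : t ≠ 0)
    refine ⟨by simp only [ratioD], by push_cast; ring⟩
  have h1 := NearUnit.eventually_eq_contiguous_bc (a := 3 / 10) (b := -3 / 10) (c := 2 / 5)
    (by norm_num) hr hw (nearZero_phi hx) ((eventually_isPoint hx).mono fun t h =>
      ⟨rho_mul h, contiguousD h (by ring) rfl⟩)
  filter_upwards [h1] with t ht
  refine ⟨ht.1, ?_⟩
  rw [ht.1, ← ht.2]
  norm_num

end Local

/-- Hypergeometric functions of the type with exponent differences `1/5, 1/5, 4/5`. -/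
theorem nearOrigin_typeA : NearOrigin (fun x => x * (1 + x - x ^ 2)) (fun x ξ =>
      ₂F₁ (7 / 10 : ℂ) (-1 / 10) (4 / 5) (phi6 x ξ)
        = (1 - ξ + 2 * x) ^ (1 / 15 : ℂ) * (1 - ξ) ^ (3 / 5 : ℂ)
          / ((1 + ξ + 2 * x) ^ (7 / 30 : ℂ) * (1 + ξ - 2 * x) ^ (1 / 2 : ℂ)) ∧
      ₂F₁ (7 / 10 : ℂ) (9 / 10) (9 / 5) (phi6 x ξ)
        = (1 - ξ + 2 * x) ^ (1 / 15 : ℂ) * (1 + ξ + 2 * x) ^ (23 / 30 : ℂ)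
            * (1 + ξ - 2 * x) ^ (7 / 2 : ℂ)
          / ((1 - ξ) ^ (7 / 5 : ℂ) * (1 + x - x ^ 2) ^ 2) ∧
      ₂F₁ (1 / 10 : ℂ) (9 / 10) (6 / 5) (phi6 x ξ)
        = (ξ + 2 * x + x ^ 2) * (1 + ξ) ^ (1 / 10 : ℂ) * (1 - ξ) ^ (3 / 10 : ℂ)
          / (ξ * (1 - ξ + 2 * x) ^ (1 / 30 : ℂ) * (1 + ξ + 2 * x) ^ (2 / 15 : ℂ)
            * (1 + ξ - 2 * x) ^ (1 / 2 : ℂ)) ∧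
      ₂F₁ (1 / 10 : ℂ) (-1 / 10) (1 / 5) (phi6 x ξ)
        = (1 + ξ) ^ (1 / 10 : ℂ) * (1 - ξ) ^ (3 / 10 : ℂ)
          / ((1 - ξ + 2 * x) ^ (1 / 30 : ℂ) * (1 + ξ + 2 * x) ^ (2 / 15 : ℂ)
            * (1 + ξ - 2 * x) ^ (1 / 2 : ℂ))) := by
  obtain ⟨x, κ, hx⟩ := exists_isLocalParametrization (-1) 1
  refine hx.nearOrigin (fun y => by ring) ?_
  filter_upwards [self_mem_nhdsWithin, eventually_eqA hx, eventually_eqB hx,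
    (nearUnit_A hx).eventually_ne_zero, (nearUnit_D hx).eventually_ne_zero,
    (nearUnit_B hx).eventually_ne_zero, (nearUnit_C hx).eventually_ne_zero,
    (nearUnit_F hx).eventually_ne_zero, (nearUnit_E hx).eventually_ne_zero,
    (nearUnit_G hx).eventually_ne_zero]
    with t (ht : t ≠ 0) eA eB hA hD hB hC hF hE hG
  have hG0 : t + 2 * x t + x t ^ 2 ≠ 0 := (div_ne_zero_iff.mp hG).1
  refine ⟨?_, ?_, ?_, ?_⟩
  · exact eA.1
  · refine eA.2.trans ?_
    obtain ⟨yA, nA, cA⟩ := exists_cpow_eq hA (1 / 15)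
    obtain ⟨yD, nD, cD, dD⟩ := exists_cpow_eq_div (e := 3 / 5) (e' := 7 / 5) hD 2 (by norm_num)
    obtain ⟨yB, nB, cB, dB⟩ := exists_cpow_eq_div (e := 7 / 30) (e' := 23 / 30) hB 1 (by norm_num)
    obtain ⟨yC, nC, cC, dC⟩ := exists_cpow_eq_div (e := 1 / 2) (e' := 7 / 2) hC 4 (by norm_num)
    rw [eA.1, ratioA, cA, cD, dD, cB, dB, cC, dC]
    generalize 1 - t + 2 * x t = zA at *
    generalize 1 + t + 2 * x t = zB at *
    generalize 1 + t - 2 * x t = zC at *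
    generalize 1 + x t - x t ^ 2 = zF at *
    generalize 1 - t = zD at *
    field_simp
  · refine eB.2.trans ?_
    obtain ⟨yE, nE, cE⟩ := exists_cpow_eq hE (1 / 10)
    obtain ⟨yD, nD, cD⟩ := exists_cpow_eq hD (3 / 10)
    obtain ⟨yA, nA, cA⟩ := exists_cpow_eq hA (1 / 30)
    obtain ⟨yB, nB, cB⟩ := exists_cpow_eq hB (2 / 15)
    obtain ⟨yC, nC, cC⟩ := exists_cpow_eq hC (1 / 2)
    rw [eB.1, ratioB, cE, cD, cA, cB, cC]
    generalize t + 2 * x t + x t ^ 2 = zG at *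
    generalize 1 - t + 2 * x t = zA at *
    generalize 1 + t + 2 * x t = zB at *
    generalize 1 + t - 2 * x t = zC at *
    generalize 1 - t = zD at *
    generalize 1 + t = zE at *
    field_simp
  · exact eB.1

/-- Hypergeometric functions of the type with exponent differences `2/5, 2/5, 2/5`. -/
theorem nearOrigin_typeB : NearOrigin (fun x => x * (1 + x - x ^ 2)) (fun x ξ =>
      ₂F₁ (3 / 10 : ℂ) (-1 / 10) (3 / 5) (phi6 x ξ)
        = (1 - ξ + 2 * x) ^ (2 / 15 : ℂ) * (1 + ξ + 2 * x) ^ (1 / 30 : ℂ)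
            * (1 - ξ) ^ (1 / 5 : ℂ)
          / (1 + ξ - 2 * x) ^ (1 / 2 : ℂ) ∧
      ₂F₁ (3 / 10 : ℂ) (9 / 10) (8 / 5) (phi6 x ξ)
        = (1 - ξ + 2 * x) ^ (2 / 15 : ℂ) * (1 + ξ + 2 * x) ^ (1 / 30 : ℂ)
            * (1 - ξ) ^ (1 / 5 : ℂ) * (1 + ξ - 2 * x) ^ (3 / 2 : ℂ)
            * (1 + 1 / 2 * ξ + 1 / 2 * x)
          / ((1 + x - x ^ 2) * (1 - ξ + x - x ^ 2)) ∧
      ₂F₁ (3 / 10 : ℂ) (7 / 10) (7 / 5) (phi6 x ξ)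
        = (1 + ξ + 2 * x) ^ (7 / 30 : ℂ) * (1 + ξ) ^ (1 / 5 : ℂ)
            * (1 + ξ - 2 * x) ^ (3 / 2 : ℂ)
          / ((1 - ξ + 2 * x) ^ (1 / 15 : ℂ) * (1 - ξ) ^ (2 / 5 : ℂ)
            * (1 + x - x ^ 2)) ∧
      ₂F₁ (3 / 10 : ℂ) (-3 / 10) (2 / 5) (phi6 x ξ)
        = (1 + ξ + 2 * x) ^ (7 / 30 : ℂ) * (1 + ξ) ^ (1 / 5 : ℂ)
            * (1 - 3 * ξ + 4 * x - 2 * x ^ 2)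
          / ((1 - ξ + 2 * x) ^ (1 / 15 : ℂ) * (1 - ξ) ^ (2 / 5 : ℂ)
            * (1 + ξ - 2 * x) ^ (3 / 2 : ℂ))) := by
  obtain ⟨x, κ, hx⟩ := exists_isLocalParametrization (-1) 1
  refine hx.nearOrigin (fun y => by ring) ?_
  filter_upwards [self_mem_nhdsWithin, eventually_eqC hx, eventually_eqD hx,
    (nearUnit_A hx).eventually_ne_zero, (nearUnit_B hx).eventually_ne_zero,
    (nearUnit_D hx).eventually_ne_zero, (nearUnit_C hx).eventually_ne_zero,
    (nearUnit_H hx).eventually_ne_zero, (nearUnit_F hx).eventually_ne_zero,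
    (nearUnit_I hx).eventually_ne_zero, (nearUnit_E hx).eventually_ne_zero,
    (nearUnit_J hx).eventually_ne_zero]
    with t (ht : t ≠ 0) eC eD hA hB hD hC hH hF hI hE hJ
  refine ⟨?_, ?_, ?_, ?_⟩
  · exact eC.1
  · refine eC.2.trans ?_
    obtain ⟨yA, nA, cA⟩ := exists_cpow_eq hA (2 / 15)
    obtain ⟨yB, nB, cB⟩ := exists_cpow_eq hB (1 / 30)
    obtain ⟨yD, nD, cD⟩ := exists_cpow_eq hD (1 / 5)
    obtain ⟨yC, nC, cC, dC⟩ := exists_cpow_eq_div (e := 1 / 2) (e' := 3 / 2) hC 2 (by norm_num)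
    rw [eC.1, ratioC, cA, cB, cD, cC, dC]
    generalize 1 + 1 / 2 * t + 1 / 2 * x t = zH at *
    generalize 1 - t + x t - x t ^ 2 = zI at *
    generalize 1 - t + 2 * x t = zA at *
    generalize 1 + t + 2 * x t = zB at *
    generalize 1 + t - 2 * x t = zC at *
    generalize 1 + x t - x t ^ 2 = zF at *
    generalize 1 - t = zD at *
    field_simp
  · refine eD.2.trans ?_
    obtain ⟨yB, nB, cB⟩ := exists_cpow_eq hB (7 / 30)
    obtain ⟨yE, nE, cE⟩ := exists_cpow_eq hE (1 / 5)
    obtain ⟨yA, nA, cA⟩ := exists_cpow_eq hA (1 / 15)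
    obtain ⟨yD, nD, cD⟩ := exists_cpow_eq hD (2 / 5)
    obtain ⟨yC, nC, cC, dC⟩ := exists_cpow_eq_div (e := 3 / 2) (e' := 3 / 2) hC 3 (by norm_num)
    rw [cC, eq_div_iff nC] at dC
    rw [eD.1, ratioD, cB, cE, cA, cD, cC]
    generalize 1 - 3 * t + 4 * x t - 2 * x t ^ 2 = zJ at *
    generalize 1 - t + 2 * x t = zA at *
    generalize 1 + t + 2 * x t = zB at *
    generalize 1 + t - 2 * x t = zC at *
    generalize 1 + x t - x t ^ 2 = zF at *
    generalize 1 - t = zD at *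
    generalize 1 + t = zE at *
    field_simp
    linear_combination -dC
  · exact eD.1

end E6

/-! ### Logarithmic derivatives -/

section LogDeriv

variable {K : Type} [Field K] [Algebra ℂ K] {D : Derivation ℂ K K} {f g l m : K}

/-- The function `l` is a logarithmic derivative of `f`. -/
def IsLogDeriv (D : Derivation ℂ K K) (f l : K) : Prop := D f = f * l

namespace IsLogDeriv

theorem congr (hf : IsLogDeriv D f l) (h : l = m) : IsLogDeriv D f m := h ▸ hf

theorem mul (hf : IsLogDeriv D f l) (hg : IsLogDeriv D g m) : IsLogDeriv D (f * g) (l + m) := by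
  unfold IsLogDeriv at *
  rw [D.leibniz, hf, hg, smul_eq_mul, smul_eq_mul]
  ring

theorem div (hf : IsLogDeriv D f l) (hg : IsLogDeriv D g m) : IsLogDeriv D (f / g) (l - m) := by
  unfold IsLogDeriv at *
  rw [D.leibniz_div, hf, hg]
  simp only [smul_eq_mul]
  rcases eq_or_ne g 0 with rfl | h
  · simp
  · field_simp

theorem pow (hf : IsLogDeriv D f l) (n : ℕ) : IsLogDeriv D (f ^ n) (n * l) := by
  induction n with
  | zero => simp [IsLogDeriv]
  | succ n ih =>
    rw [pow_succ]
    exact (ih.mul hf).congr (by push_cast; ring)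

theorem neg (hf : IsLogDeriv D f l) : IsLogDeriv D (-f) l := by
  unfold IsLogDeriv at *
  rw [map_neg, hf, neg_mul]

theorem ofNat (n : ℕ) [n.AtLeastTwo] : IsLogDeriv D (ofNat(n) : K) 0 := by
  have : D (ofNat(n) : K) = 0 := D.map_natCast n
  rw [IsLogDeriv, this, mul_zero]

end IsLogDeriv

end LogDeriv

/-! ### Polynomials given by lists of integers -/

/-- The polynomial whose list of coefficients is `l`, the constant one first. -/
noncomputable def intPoly (l : List ℤ) : ℂ[X] := l.foldr (fun c P => C (c : ℂ) + X * P) 0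

/-- The list of coefficients of a sum. -/
def listAdd : List ℤ → List ℤ → List ℤ
  | [], m => m
  | l, [] => l
  | c :: l, d :: m => (c + d) :: listAdd l m

/-- The list of coefficients of a product. -/
def listMul : List ℤ → List ℤ → List ℤ
  | [], _ => []
  | c :: l, m => listAdd (m.map (c * ·)) (0 :: listMul l m)

theorem intPoly_nil : intPoly [] = 0 := rfl

theorem intPoly_cons (c : ℤ) (l : List ℤ) : intPoly (c :: l) = C (c : ℂ) + X * intPoly l := rfl

theorem intPoly_listAdd (l m : List ℤ) : intPoly (listAdd l m) = intPoly l + intPoly m := by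
  induction l generalizing m with
  | nil => simp [listAdd, intPoly_nil]
  | cons c l ih =>
    cases m with
    | nil => simp [listAdd, intPoly_nil]
    | cons d m =>
      simp only [listAdd, intPoly_cons, ih, Int.cast_add, C_add]
      ring

theorem intPoly_map_mul (c : ℤ) (l : List ℤ) :
    intPoly (l.map (c * ·)) = C (c : ℂ) * intPoly l := by
  induction l with
  | nil => simp [intPoly_nil]
  | cons d l ih =>
    simp only [List.map_cons, intPoly_cons, ih, Int.cast_mul, C_mul]
    ring

theorem intPoly_listMul (l m : List ℤ) : intPoly (listMul l m) = intPoly l * intPoly m := by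
  induction l with
  | nil => simp [listMul, intPoly_nil]
  | cons c l ih =>
    simp only [listMul, intPoly_listAdd, intPoly_map_mul, intPoly_cons, ih, Int.cast_zero, C_0]
    ring

theorem intPoly_eq_zero {l : List ℤ} (h : l.all (· == 0) = true) : intPoly l = 0 := by
  induction l with
  | nil => rfl
  | cons c l ih =>
    simp only [List.all_cons, Bool.and_eq_true, beq_iff_eq] at h
    simp [intPoly_cons, h.1, ih h.2]

theorem coeff_intPoly (l : List ℤ) (n : ℕ) : (intPoly l).coeff n = (l.getD n 0 : ℂ) := by
  induction l generalizing n with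
  | nil => simp [intPoly_nil]
  | cons c l ih =>
    cases n with
    | zero => simp [intPoly_cons]
    | succ n => rw [intPoly_cons, coeff_add, coeff_C_succ, coeff_X_mul, ih, zero_add,
        List.getD_cons_succ]

theorem natDegree_intPoly_le {l : List ℤ} {n : ℕ} (h : l.length ≤ n + 1) :
    (intPoly l).natDegree ≤ n := by
  refine natDegree_le_iff_coeff_eq_zero.mpr fun k hk => ?_
  rw [coeff_intPoly, List.getD_eq_default _ _ (by lia), Int.cast_zero]

theorem le_natDegree_intPoly {l : List ℤ} {n : ℕ} (h : l.getD n 0 ≠ 0) :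
    n ≤ (intPoly l).natDegree := by
  refine le_natDegree_of_ne_zero ?_
  rw [coeff_intPoly]
  exact Int.cast_ne_zero.mpr h

theorem intPoly_ne_zero {l : List ℤ} (h : l.getD 0 0 ≠ 0) : intPoly l ≠ 0 := by
  intro h0
  apply h
  have := coeff_intPoly l 0
  rw [h0, coeff_zero] at this
  exact_mod_cast this.symm

theorem aeval_intPoly {K : Type*} [Field K] [Algebra ℂ K] (x : K) (l : List ℤ) :
    aeval x (intPoly l) = l.foldr (fun (c : ℤ) y => (c : K) + x * y) 0 := by
  induction l with
  | nil => simp [intPoly_nil]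
  | cons c l ih => simp [intPoly_cons, ih]

namespace IsCurveField

variable {K : Type} [Field K] [Algebra ℂ K] {a b : ℂ} {x ξ : K} {D : Derivation ℂ K K}

theorem isLogDeriv_quadratic (h : IsCurveField a b x ξ D) (c₀ c₁ c₂ c₃ c₄ c₅ : ℂ) {f l m : K}
    (hl : f * l = m)
    (hf : f = algebraMap ℂ K c₀ + algebraMap ℂ K c₁ * ξ + algebraMap ℂ K c₂ * x
      + algebraMap ℂ K c₃ * (x * ξ) + algebraMap ℂ K c₄ * x ^ 2 + algebraMap ℂ K c₅ * ξ ^ 2 := by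
        simp only [map_div₀, map_neg, map_one, map_ofNat, map_zero] <;> ring)
    (hm : m = 2 * ξ * (algebraMap ℂ K c₂ + algebraMap ℂ K c₃ * ξ
        + 2 * algebraMap ℂ K c₄ * x)
      + (1 + 2 * algebraMap ℂ K b * x + 3 * algebraMap ℂ K a * x ^ 2)
        * (algebraMap ℂ K c₁ + algebraMap ℂ K c₃ * x + 2 * algebraMap ℂ K c₅ * ξ) := by
        simp only [map_div₀, map_neg, map_one, map_ofNat, map_zero] <;> ring) :
    IsLogDeriv D f l := by
  rw [IsLogDeriv, hl, hm, hf]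
  simp only [map_add, Derivation.leibniz, Derivation.leibniz_pow, D.map_algebraMap, h.deriv_x,
    h.deriv_xi, smul_eq_mul, nsmul_eq_mul]
  push_cast
  ring

/-- The function `ψ = (α + β ξ) / p` has degree `n`, provided that the numbers in `hn` are as
stated: then the norm of `α + β ξ` is `p r` with `r` prime to `p`. -/
theorem finrank_adjoin_intPoly (h : IsCurveField a b x ξ D) (k m : ℤ) (α β p r u v : List ℤ)
    (c : ℤ) {n : ℕ} {ψ : K}
    (hψ : aeval x (intPoly p) * ψ = aeval x (intPoly α) + aeval x (intPoly β) * ξ)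
    (hn : (α.length ≤ n + 1 ∧ p.length ≤ n + 1 ∧ r.length ≤ n + 1) ∧
      (p.getD n 0 ≠ 0 ∨ r.getD n 0 ≠ 0) ∧ (β.getD 0 0 ≠ 0 ∧ p.getD 0 0 ≠ 0 ∧ c ≠ 0) ∧
      (listAdd (listAdd (listMul u p) (listMul v r)) [-c]).all (· == 0) = true ∧
      (listAdd (listAdd (listMul α α) (listMul [-1] (listMul p r)))
        (listMul (listMul β β) [0, -1, -m, -k])).all (· == 0) = true := by decide)
    (hk : (k : ℂ) = a := by norm_num) (hm : (m : ℂ) = b := by norm_num) :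
    Module.finrank ℂ⟮ψ⟯ K = n := by
  subst hk hm
  obtain ⟨⟨hα, hpn, hrn⟩, hd, ⟨hβ, hp, hc⟩, hcop, hpr⟩ := hn
  have hα' := natDegree_intPoly_le hα
  have hp' := natDegree_intPoly_le hpn
  have hr' := natDegree_intPoly_le hrn
  have hmax : max (intPoly p).natDegree (intPoly r).natDegree = n := by
    refine le_antisymm (max_le hp' hr') ?_
    rcases hd with hd | hd
    · exact (le_natDegree_intPoly hd).trans (le_max_left _ _)
    · exact (le_natDegree_intPoly hd).trans (le_max_right _ _)
  replace hcop := intPoly_eq_zero hcop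
  replace hpr := intPoly_eq_zero hpr
  simp only [intPoly_listAdd, intPoly_listMul, intPoly_cons, intPoly_nil] at hcop hpr
  have hc' : (c : ℂ) ≠ 0 := Int.cast_ne_zero.mpr hc
  rw [← hmax] at hα' ⊢
  refine h.finrank_adjoin (intPoly_ne_zero hβ) (intPoly_ne_zero hp) hα'
    ⟨C (c : ℂ)⁻¹ * intPoly u, C (c : ℂ)⁻¹ * intPoly v, ?_⟩ ?_ hψ
  · have h1 : C (c : ℂ)⁻¹ * C (c : ℂ) = 1 := by
      rw [← C_mul, inv_mul_cancel₀ hc', C_1]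
    push_cast at hcop
    simp only [map_neg] at hcop
    linear_combination C (c : ℂ)⁻¹ * hcop + h1
  · push_cast at hpr
    simp only [map_neg, map_one, map_zero] at hpr
    linear_combination hpr

end IsCurveField

namespace E3

section CurveField

variable {K : Type} [Field K] [Algebra ℂ K] {x ξ : K} {D : Derivation ℂ K K}

theorem isPoint (h : IsCurveField (-9) 33 x ξ D) : IsPoint x ξ := by
  have hC : x * (1 + algebraMap ℂ K 33 * x + algebraMap ℂ K (-9) * x ^ 2)
      = x * (1 + 33 * x - 9 * x ^ 2) := by
    simp only [map_neg, map_ofNat]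
    ring
  refine ⟨h.sq.trans hC, ?_,
    h.ne_zero_of_eval (1 - 21 * X) 0 ?_ (by simp),
    h.ne_zero_of_eval (1 - X) 0 ?_ (by simp),
    h.ne_zero_of_eval (1 + 9 * X) 0 ?_ (by simp),
    h.ne_zero_of_eval (7 + 3 * X) 0 ?_ (by simp),
    h.ne_zero_of_eval (1 + 33 * X - 9 * X ^ 2) 0 ?_ (by simp),
    h.ne_zero_of_eval (1 + 198 * X - 99 * X ^ 2) 0 ?_ (by simp),
    h.ne_zero_of_eval (1 - 378 * X + 1053 * X ^ 2 + 324 * X ^ 3) 0 ?_ (by simp),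
    h.ne_zero_of_eval (1 - 684 * X + 4446 * X ^ 2 + 6156 * X ^ 3 + 81 * X ^ 4) 0 ?_ (by simp)⟩
  · rw [← aeval_X (R := ℂ) x]
    exact h.aeval_ne_zero X_ne_zero
  all_goals
    simp only [map_add, map_sub, map_mul, map_pow, map_one, map_ofNat, map_zero, aeval_X]
    ring

variable [CharZero K]

theorem isLogDeriv_A (h : IsCurveField (-9) 33 x ξ D) : IsLogDeriv D (1 - 9 * ξ + 54 * x)
    (dlogA x ξ) := h.isLogDeriv_quadratic 1 (-9) 54 0 0 0 (mul_dlogA (isPoint h))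

theorem isLogDeriv_B (h : IsCurveField (-9) 33 x ξ D) :
    IsLogDeriv D (1 + 21 * ξ - 117 * x + 9 * x * ξ - 234 * x ^ 2) (dlogB x ξ) :=
  h.isLogDeriv_quadratic 1 21 (-117) 9 (-234) 0 (mul_dlogB (isPoint h))

theorem isLogDeriv_BBar (h : IsCurveField (-9) 33 x ξ D) :
    IsLogDeriv D (1 - 21 * ξ - 117 * x - 9 * x * ξ - 234 * x ^ 2) (dlogBBar x ξ) :=
  h.isLogDeriv_quadratic 1 (-21) (-117) (-9) (-234) 0 (mul_dlogBBar (isPoint h))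

theorem isLogDeriv_C (h : IsCurveField (-9) 33 x ξ D) : IsLogDeriv D (1 + 9 * x) (dlogC x ξ) :=
  h.isLogDeriv_quadratic 1 0 9 0 0 0 (mul_dlogC (isPoint h))

theorem isLogDeriv_P (h : IsCurveField (-9) 33 x ξ D) : IsLogDeriv D (1 + 198 * x - 99 * x ^ 2)
    (dlogP x ξ) := h.isLogDeriv_quadratic 1 0 198 0 (-99) 0 (mul_dlogP (isPoint h))

theorem isLogDeriv_F (h : IsCurveField (-9) 33 x ξ D) : IsLogDeriv D (1 + 33 * x - 9 * x ^ 2)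
    (dlogF x ξ) := h.isLogDeriv_quadratic 1 0 33 0 (-9) 0 (mul_dlogF (isPoint h))

theorem isLogDeriv_R (h : IsCurveField (-9) 33 x ξ D) : IsLogDeriv D (1 + 3 / 7 * x) (dlogR x ξ) :=
  h.isLogDeriv_quadratic 1 0 (3 / 7) 0 0 0 (mul_dlogR (isPoint h))

theorem isLogDeriv_Xi (h : IsCurveField (-9) 33 x ξ D) : IsLogDeriv D ξ (dlogXi x ξ) :=
  h.isLogDeriv_quadratic 0 1 0 0 0 0 (mul_dlogXi (isPoint h))

theorem isLogDeriv_phi (h : IsCurveField (-9) 33 x ξ D) : IsLogDeriv D (phi3 x ξ) (theta x ξ) := by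
  refine (((((IsLogDeriv.ofNat 144).mul (isLogDeriv_Xi h)).mul ((isLogDeriv_F h).pow 2)).mul
    (isLogDeriv_A h)).div ((isLogDeriv_B h).pow 3)).congr ?_
  rw [theta_eq (isPoint h)]
  push_cast
  ring

theorem isLogDeriv_ratioA (h : IsCurveField (-9) 33 x ξ D) : IsLogDeriv D (ratioA x ξ)
    (dlogB x ξ + 2 * dlogC x ξ + dlogP x ξ - dlogA x ξ - 2 * dlogBBar x ξ) := by
  refine ((((isLogDeriv_B h).mul ((isLogDeriv_C h).pow 2)).mul (isLogDeriv_P h)).div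
    ((isLogDeriv_A h).mul ((isLogDeriv_BBar h).pow 2))).congr ?_
  push_cast
  ring

theorem finrank_adjoin_ratioA (h : IsCurveField (-9) 33 x ξ D) : Module.finrank ℂ⟮ratioA x ξ
    - 1⟯ K = 8 := by
  have h0 := isPoint h
  refine h.finrank_adjoin_intPoly (-9) 33 [0, 3132, -256824, -11914128, -3241620, -215215380,
    16498728, 11704824, -78732] [72, 19008, 1010880, 14754960, -16096320, 5388768, -577368] [1,
    -1368, 476748, -6069816, 11345670, 54628344, 38616588, 997272, 6561] [0, -5184, -190512,
    4945536, 197821440, 434950560, -266219136, 32752512, 944784] [28125000000000000,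
    1030738683059846208, -26761069201600073808, -1069069704126467006880, -2350301913080825344560,
    1438571270979236149920, -176986155700489696848, -5105364134181124032] [-7223044235520863,
    2574807584060586606, -32797929034690082613, 61320080352818011680, 295205320920566277495,
    208674090367999412598, 5388996857252835069, 35453917598480028] 28125000000000000 ?_
  simp only [aeval_intPoly, List.foldr]
  push_cast
  linear_combination (rep_ratioA h0).sub_one.eq

theorem finrank_adjoin_ratioA_div (h : IsCurveField (-9) 33 x ξ D) :
    Module.finrank ℂ⟮(1 - (1 - phi3 x ξ) * ratioA x ξ) / phi3 x ξ⟯ K = 7 := by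
  have h0 := isPoint h
  have h1 : IsRep ξ ((1 - 684 * x + 4446 * x ^ 2 + 6156 * x ^ 3 + 81 * x ^ 4) ^ 2)
      ((1 - phi3 x ξ) * ratioA x ξ) (1 + 1764 * x + 219924 * x ^ 2 - 17983944 * x ^ 3
      + 8104050 * x ^ 4 - 160587036 * x ^ 5 + 55115316 * x ^ 6 + 12702096 * x ^ 7 - 72171 * x ^ 8)
      (-72 - 19008 * x - 1010880 * x ^ 2 - 14754960 * x ^ 3 + 16096320 * x ^ 4 - 5388768 * x ^ 5
      + 577368 * x ^ 6) := (rep_phi h0).1.one_sub.mul h0.sq (rep_ratioA h0) (pow_ne_zero 2 h0.ne₈)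
  have h2 : IsRep ξ (4 * (1 + 33 * x - 9 * x ^ 2) ^ 2) ((1 - (1 - phi3 x ξ) * ratioA x ξ) / phi3 x
      ξ) (2 + 132 * x + 2142 * x ^ 2 - 1188 * x ^ 3 + 162 * x ^ 4) (57 - 741 * x - 1539 * x ^ 2
      - 27 * x ^ 3) := h1.one_sub.div h0.sq (rep_phi h0).1 (rep_phi h0).2
      (mul_ne_zero (by norm_num) (pow_ne_zero 2 h0.ne₅))
  refine h.finrank_adjoin_intPoly (-9) 33 [-8, -792, -25920, -273240, 233280, -64152, 5832] [-228,
    -4560, 106020, 176580, -51840, -972] [-16, -1584, -51840, -546480, 466560, -128304, 11664] [-4,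
    2853, -97434, 237015, 2394360, 2376459, 86022, 729] [-27716932217, 853864656606,
    -1962916749315, -20620356404760, -20545491641760, -743779649043, -6303432636] [-11202583632,
    -429796244016, -4741333130736, 4038652702224, -1109810576016, 100854922176] 488281250000 ?_
  simp only [aeval_intPoly, List.foldr]
  push_cast
  linear_combination (-4 - 132 * x + 36 * x ^ 2) * h2.eq

theorem isDarbouxCovering_A (h : IsCurveField (-9) 33 x ξ D) :
    IsDarbouxCovering (hypergeometricODE (2 / 5) (1 / 3) (1 / 3)) K (phi3 x ξ) := by
  have h0 := isPoint h
  obtain ⟨e₁, e₂⟩ := contiguousA h0 rfl rfl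
  rw [e₁] at e₂
  refine h.isDarbouxCovering_of_contiguous_b (α := 3 / 10) (β := -1 / 30) (γ := 3 / 5)
    (by norm_num) (by norm_num) (by norm_num) ?_ ?_ ?_ (by norm_num) (isLogDeriv_phi h)
    (isLogDeriv_ratioA h) (rho_mul h0) e₂ (rep_phi h0).2 (theta_ne_zero h0)
    (fun M h1 h2 => ⟨sub_mem h2 (one_mem M), div_mem
    (sub_mem (one_mem M) (mul_mem (sub_mem (one_mem M) h1) h2)) h1⟩) ?_
  iterate 3 simp only [map_div₀, map_neg, map_one, map_ofNat]
  rw [finrank_adjoin_ratioA h, finrank_adjoin_ratioA_div h]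
  norm_num

theorem isLogDeriv_ratioC (h : IsCurveField (-9) 33 x ξ D) : IsLogDeriv D (ratioC x ξ)
    (2 * dlogB x ξ + dlogR x ξ - dlogA x ξ - 2 * dlogF x ξ) := by
  refine ((((isLogDeriv_B h).pow 2).mul (isLogDeriv_R h)).div
    ((isLogDeriv_A h).mul ((isLogDeriv_F h).pow 2))).congr ?_
  push_cast
  ring

theorem rep_mul_ratioC {F : Type*} [Field F] [CharZero F] {x ξ : F} (h : IsPoint x ξ) :
    IsRep ξ (7 * (1 + 9 * x) * (1 - 684 * x + 4446 * x ^ 2 + 6156 * x ^ 3 + 81 * x ^ 4))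
    (phi3 x ξ * ratioC x ξ) (-21168 * x - 716688 * x ^ 2 - 412128 * x ^ 3 + 34992 * x ^ 4
    + 34992 * x ^ 5) (1008 - 117504 * x - 286416 * x ^ 2 - 101088 * x ^ 3) :=
    (rep_phi h).1.mul h.sq (rep_ratioC h) (mul_ne_zero (mul_ne_zero (by norm_num) h.ne₃)
    h.ne₈)

theorem finrank_adjoin_ratioC_mul (h : IsCurveField (-9) 33 x ξ D) :
    Module.finrank ℂ⟮phi3 x ξ * ratioC x ξ⟯ K = 5 := by
  have h0 := isPoint h
  refine h.finrank_adjoin_intPoly (-9) 33 [0, -148176, -5016816, -2884896, 244944, 244944] [7056,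
    -822528, -2004912, -707616] [49, -33075, -83790, 2262330, 2718765, 35721] [0, -1016064,
    -34401024, -19782144, 1679616, 1679616] [1152000000000, 36898373760768, 21193841051136,
    -1802879410176, -1799735977728] [-35720564537, -85700601532, 2429209764618, 2913267956508,
    38275634943] 56448000000000 ?_
  simp only [aeval_intPoly, List.foldr]
  push_cast
  linear_combination (7) * (rep_mul_ratioC h0).eq

theorem finrank_adjoin_ratioC_sq_mul (h : IsCurveField (-9) 33 x ξ D) :
    Module.finrank ℂ⟮phi3 x ξ * ratioC x ξ * ratioC x ξ⟯ K = 9 := by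
  have h0 := isPoint h
  have h2 : IsRep ξ (49 * (1 + 9 * x) ^ 2 * (1 + 33 * x - 9 * x ^ 2) ^ 2)
      (phi3 x ξ * ratioC x ξ * ratioC x ξ) (211680 * x + 5896800 * x ^ 2 - 38880000 * x ^ 3
      - 25077600 * x ^ 4 + 1749600 * x ^ 5 + 2099520 * x ^ 6) (7056 + 831600 * x - 8372160 * x ^ 2
      - 8203680 * x ^ 3 - 2157840 * x ^ 4 - 104976 * x ^ 5) :=
      (rep_mul_ratioC h0).mul h0.sq (rep_ratioC h0)
      (mul_ne_zero (mul_ne_zero (by norm_num) (pow_ne_zero 2 h0.ne₃)) (pow_ne_zero 2 h0.ne₅))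
  refine h.finrank_adjoin_intPoly (-9) 33 [0, -10372320, -631229760, -7536654720, 66698251200,
    23318668800, -13991201280, -2623350240, 925888320] [-345744, -52157952, -931349664,
    14306498640, 9678962160, -123451776, -781861248, -46294416] [-2401, -280917, -12252303,
    -241286094, -2036216070, -5401515294, 5326251147, -1528037217, 141776649] [0, 49787136,
    -33969051648, 163029500928, 648439271424, 762663237120, 413225846784, 108415853568,
    11609505792, 136048896] [-1800000000000000000000, 190899058778911376614656,
    -851095642835876017911552, -3467683773238009040849664, -4100479028201774106351360,
    -2226957851598331584579840, -585038426577217051090176, -62697923546341331259648,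
    -734813572955204572416] [-950083970924412779, -55120395391327573622, -1210570625125455862359,
    -10753234220515414073985, -29415503822692028952015, 28836878230425812374359,
    -8259508163711473625628, 765749734663822126029] 4321800000000000000000000 ?_
  simp only [aeval_intPoly, List.foldr]
  push_cast
  linear_combination (-49 - 1617 * x + 441 * x ^ 2) * h2.eq

theorem isDarbouxCovering_C (h : IsCurveField (-9) 33 x ξ D) :
    IsDarbouxCovering (hypergeometricODE (1 / 5) (1 / 3) (2 / 3)) K (phi3 x ξ) := by
  have h0 := isPoint h
  obtain ⟨e₁, e₂⟩ := contiguousC h0 rfl rfl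
  rw [e₁] at e₂
  refine h.isDarbouxCovering_of_contiguous_bc (α := 17 / 30) (β := -1 / 10) (γ := 4 / 5)
    (by norm_num) (by norm_num) (by norm_num) ?_ ?_ ?_ (by norm_num) (by norm_num) (by norm_num)
    (isLogDeriv_phi h) (isLogDeriv_ratioC h) (rho_mul h0) e₂ (rep_phi h0).2 (theta_ne_zero h0)
    (fun M h1 h2 => ⟨mul_mem h1 h2, mul_mem (mul_mem h1 h2) h2⟩) ?_
  iterate 3 simp only [map_div₀, map_neg, map_one, map_ofNat]
  rw [finrank_adjoin_ratioC_mul h, finrank_adjoin_ratioC_sq_mul h]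
  norm_num

end CurveField

end E3

namespace E4

section CurveField

variable {K : Type} [Field K] [Algebra ℂ K] {x ξ : K} {D : Derivation ℂ K K}

theorem isPoint (h : IsCurveField (-5) 5 x ξ D) : IsPoint x ξ := by
  have hC : x * (1 + algebraMap ℂ K 5 * x + algebraMap ℂ K (-5) * x ^ 2)
      = x * (1 + 5 * x - 5 * x ^ 2) := by
    simp only [map_neg, map_ofNat]
    ring
  refine ⟨h.sq.trans hC, ?_,
    h.ne_zero_of_eval (1 - 125 * X) 0 ?_ (by simp),
    h.ne_zero_of_eval (1 - 9 * X) 0 ?_ (by simp),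
    h.ne_zero_of_eval (1 - 5 * X) 0 ?_ (by simp),
    h.ne_zero_of_eval (1 - X) 0 ?_ (by simp),
    h.ne_zero_of_eval (1 + X) 0 ?_ (by simp),
    h.ne_zero_of_eval (1 + 4 * X) 0 ?_ (by simp),
    h.ne_zero_of_eval (1 + 5 * X) 0 ?_ (by simp),
    h.ne_zero_of_eval (16 - 49 * X) 0 ?_ (by simp),
    h.ne_zero_of_eval (25 + X) 0 ?_ (by simp),
    h.ne_zero_of_eval (1 - 40 * X - 5 * X ^ 2) 0 ?_ (by simp),
    h.ne_zero_of_eval (1 - 15 * X - 5 * X ^ 2) 0 ?_ (by simp),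
    h.ne_zero_of_eval (1 + 5 * X - 5 * X ^ 2) 0 ?_ (by simp),
    h.ne_zero_of_eval (1 + 30 * X + 245 * X ^ 2) 0 ?_ (by simp),
    h.ne_zero_of_eval (1 - 500 * X - 2490 * X ^ 2 + 2500 * X ^ 3 + 25 * X ^ 4) 0 ?_ (by simp)⟩
  · rw [← aeval_X (R := ℂ) x]
    exact h.aeval_ne_zero X_ne_zero
  all_goals
    simp only [map_add, map_sub, map_mul, map_pow, map_one, map_ofNat, map_zero, aeval_X]
    ring

variable [CharZero K]

theorem isLogDeriv_S (h : IsCurveField (-5) 5 x ξ D) :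
    IsLogDeriv D (1 + 50 * x - 125 * ξ ^ 2 - 450 * x * ξ - 500 * x ^ 2) (dlogS x ξ) :=
  h.isLogDeriv_quadratic 1 0 50 (-450) (-500) (-125) (mul_dlogS (isPoint h))

theorem isLogDeriv_SBar (h : IsCurveField (-5) 5 x ξ D) :
    IsLogDeriv D (1 + 50 * x - 125 * ξ ^ 2 + 450 * x * ξ - 500 * x ^ 2) (dlogSBar x ξ) :=
  h.isLogDeriv_quadratic 1 0 50 450 (-500) (-125) (mul_dlogSBar (isPoint h))

theorem isLogDeriv_T (h : IsCurveField (-5) 5 x ξ D) : IsLogDeriv D (1 + 3 * ξ - 20 * x)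
    (dlogT x ξ) := h.isLogDeriv_quadratic 1 3 (-20) 0 0 0 (mul_dlogT (isPoint h))

theorem isLogDeriv_K (h : IsCurveField (-5) 5 x ξ D) :
    IsLogDeriv D (1 - 95 / 4 * ξ + 83 / 4 * x + 21 / 4 * ξ ^ 2 + 475 / 4 * x * ξ + 10 * x ^ 2)
    (dlogK x ξ) := h.isLogDeriv_quadratic 1 (-95 / 4) (83 / 4) (475 / 4) 10 (21 / 4)
    (mul_dlogK (isPoint h))

theorem isLogDeriv_U (h : IsCurveField (-5) 5 x ξ D) : IsLogDeriv D (1 - 7 / 5 * ξ - 9 * x - x ^ 2)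
    (dlogU x ξ) := h.isLogDeriv_quadratic 1 (-7 / 5) (-9) 0 (-1) 0 (mul_dlogU (isPoint h))

theorem isLogDeriv_V (h : IsCurveField (-5) 5 x ξ D) :
    IsLogDeriv D (1 + 18 / 5 * ξ - 16 * x + x ^ 2) (dlogV x ξ) :=
  h.isLogDeriv_quadratic 1 (18 / 5) (-16) 0 1 0 (mul_dlogV (isPoint h))

theorem isLogDeriv_A (h : IsCurveField (-5) 5 x ξ D) : IsLogDeriv D (1 - 35 / 4 * ξ - 101 / 4 * x)
    (dlogA x ξ) := h.isLogDeriv_quadratic 1 (-35 / 4) (-101 / 4) 0 0 0 (mul_dlogA (isPoint h))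

theorem isLogDeriv_M (h : IsCurveField (-5) 5 x ξ D) : IsLogDeriv D (1 + 5 * ξ + 10 * x)
    (dlogM x ξ) := h.isLogDeriv_quadratic 1 5 10 0 0 0 (mul_dlogM (isPoint h))

theorem isLogDeriv_N (h : IsCurveField (-5) 5 x ξ D) : IsLogDeriv D (1 - 3 * ξ + 2 * x)
    (dlogN x ξ) := h.isLogDeriv_quadratic 1 (-3) 2 0 0 0 (mul_dlogN (isPoint h))

theorem isLogDeriv_P (h : IsCurveField (-5) 5 x ξ D) :
    IsLogDeriv D (1 - 7 / 4 * ξ + 25 / 2 * x - 245 / 4 * x ^ 2) (dlogP x ξ) :=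
  h.isLogDeriv_quadratic 1 (-7 / 4) (25 / 2) 0 (-245 / 4) 0 (mul_dlogP (isPoint h))

theorem isLogDeriv_Q (h : IsCurveField (-5) 5 x ξ D) : IsLogDeriv D (1 - 7 / 20 * ξ - 79 / 20 * x)
    (dlogQ x ξ) := h.isLogDeriv_quadratic 1 (-7 / 20) (-79 / 20) 0 0 0 (mul_dlogQ (isPoint h))

theorem isLogDeriv_R (h : IsCurveField (-5) 5 x ξ D) : IsLogDeriv D (1 - 5 * x) (dlogR x ξ) :=
  h.isLogDeriv_quadratic 1 0 (-5) 0 0 0 (mul_dlogR (isPoint h))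

theorem isLogDeriv_Z (h : IsCurveField (-5) 5 x ξ D) : IsLogDeriv D (5 * ξ + 57 * x) (dlogZ x ξ) :=
  h.isLogDeriv_quadratic 0 5 57 0 0 0 (mul_dlogZ (isPoint h))

theorem isLogDeriv_X (h : IsCurveField (-5) 5 x ξ D) : IsLogDeriv D x (dlogX x ξ) :=
  h.isLogDeriv_quadratic 0 0 1 0 0 0 (mul_dlogX (isPoint h))

theorem isLogDeriv_phi (h : IsCurveField (-5) 5 x ξ D) : IsLogDeriv D (phi4 x ξ) (theta x ξ) := by
  refine (((((IsLogDeriv.ofNat 432).mul (isLogDeriv_X h)).mul ((isLogDeriv_U h).pow 5)).mul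
    (isLogDeriv_SBar h)).div (((isLogDeriv_Z h).mul ((isLogDeriv_V h).pow 5)).mul
    (isLogDeriv_S h))).congr ?_
  rw [theta_eq (isPoint h)]
  push_cast
  ring

theorem isLogDeriv_ratioA (h : IsCurveField (-5) 5 x ξ D) : IsLogDeriv D (ratioA x ξ)
    (dlogT x ξ + dlogA x ξ - dlogK x ξ) := by
  refine (((isLogDeriv_T h).mul (isLogDeriv_A h)).div (isLogDeriv_K h)).congr ?_
  ring

theorem finrank_adjoin_ratioA (h : IsCurveField (-5) 5 x ξ D) :
    Module.finrank ℂ⟮ratioA x ξ⟯ K = 4 := by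
  have h0 := isPoint h
  refine h.finrank_adjoin_intPoly (-5) 5 [1, -170, -1170, 1900, -125] [18, -1650, -660] [1, -500,
    -2490, 2500, 25] [1, -164, 4830, 5620, 625] [-70987614789, 2267909183780, 2631410665315,
    292551132500] [237341940645, 1162361687500, -1170236165275, -11702045300] 166354325856 ?_
  simp only [aeval_intPoly, List.foldr]
  push_cast
  linear_combination (rep_ratioA h0).eq

theorem rep_mul_ratioA {F : Type*} [Field F] [CharZero F] {x ξ : F} (h : IsPoint x ξ) :
    IsRep ξ ((25 + x) * (1 - 40 * x - 5 * x ^ 2) ^ 4) (ratioA x ξ * (1 - phi4 x ξ))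
    (25 + 43995 * x + 3397350 * x ^ 2 + 18048000 * x ^ 3 + 28135500 * x ^ 4 + 157130250 * x ^ 5
    - 180858750 * x ^ 6 + 12450000 * x ^ 7 + 721875 * x ^ 8 - 3125 * x ^ 9) (-1710 - 535800 * x
    - 9481050 * x ^ 2 - 9796500 * x ^ 3 + 77022750 * x ^ 4 - 34830000 * x ^ 5 - 573750 * x ^ 6
    + 37500 * x ^ 7) := (rep_ratioA h).mul h.sq (rep_phi h).1.one_sub
    (mul_ne_zero h.ne₉ (pow_ne_zero 4 h.ne₁₀))

theorem finrank_adjoin_ratioA_sq_mul (h : IsCurveField (-5) 5 x ξ D) :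
    Module.finrank ℂ⟮ratioA x ξ * (1 - phi4 x ξ) * ratioA x ξ⟯ K = 7 := by
  have h0 := isPoint h
  have h2 : IsRep ξ ((25 + x) * (1 - 40 * x - 5 * x ^ 2) ^ 3)
      (ratioA x ξ * (1 - phi4 x ξ) * ratioA x ξ) (25 + 22465 * x + 605625 * x ^ 2 + 823625 * x ^ 3
      - 7859125 * x ^ 4 + 4675875 * x ^ 5 + 116875 * x ^ 6 - 3125 * x ^ 7) (-1260 - 174840 * x
      - 207600 * x ^ 2 - 3915000 * x ^ 3 + 358500 * x ^ 4 + 21000 * x ^ 5) :=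
      (rep_mul_ratioA h0).mul h0.sq (rep_ratioA h0) (mul_ne_zero h0.ne₉ (pow_ne_zero 3 h0.ne₁₀))
  refine h.finrank_adjoin_intPoly (-5) 5 [-25, -22465, -605625, -823625, 7859125, -4675875,
    -116875, 3125] [1260, 174840, 207600, 3915000, -358500, -21000] [-25, 2999, -119505, 1565215,
    660925, 98925, 6125, 125] [-25, 15575, -1469025, -10828625, -9375875, 7858125, 7968125,
    78125] [-8916995716432702290547525675, -3839122198526791401491430221400,
    -26199582021700608808490807344875, -22212729758410322080740484874000,
    19048419807865737615937107414375, 19078812273240819595319131065000,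
    187039236111705271599700859375] [-4060537364314460635178514389, 239724614415615459001134577080,
    -3766823144471231883714354249765, -1585244194445335899769802234800,
    -237017424793029295050466019175, -14667566517134934148332453000, -299262777778728434559521375]
    324438327018679073143151001600 ?_
  simp only [aeval_intPoly, List.foldr]
  push_cast
  linear_combination (-1) * h2.eq

theorem isDarbouxCovering_A (h : IsCurveField (-5) 5 x ξ D) :
    IsDarbouxCovering (hypergeometricODE (1 / 5) (2 / 3) (1 / 5)) K (phi4 x ξ) := by
  have h0 := isPoint h
  obtain ⟨e₁, e₂⟩ := contiguousA h0 rfl rfl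
  rw [e₁] at e₂
  refine h.isDarbouxCovering_of_contiguous_b (α := 1 / 6) (β := -1 / 30) (γ := 4 / 5) (by norm_num)
    (by norm_num) (by norm_num) ?_ ?_ ?_ (by norm_num) (isLogDeriv_phi h) (isLogDeriv_ratioA h)
    (rho_mul h0) e₂ (rep_phi h0).2 (theta_ne_zero h0)
    (fun M h1 h2 => ⟨h2, mul_mem (mul_mem h2 (sub_mem (one_mem M) h1)) h2⟩) ?_
  iterate 3 simp only [map_div₀, map_neg, map_one, map_ofNat]
  rw [finrank_adjoin_ratioA h, finrank_adjoin_ratioA_sq_mul h]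
  norm_num

theorem isLogDeriv_ratioC (h : IsCurveField (-5) 5 x ξ D) : IsLogDeriv D (ratioC x ξ)
    (3 * dlogT x ξ + dlogP x ξ + dlogQ x ξ + dlogM x ξ - dlogN x ξ - 2 * dlogK x ξ
    - 2 * dlogR x ξ) := by
  refine ((((((isLogDeriv_T h).pow 3).mul (isLogDeriv_P h)).mul (isLogDeriv_Q h)).mul
    (isLogDeriv_M h)).div (((isLogDeriv_N h).mul ((isLogDeriv_K h).pow 2)).mul
    ((isLogDeriv_R h).pow 2))).congr ?_
  push_cast
  ring

theorem rep_mul_ratioC {F : Type*} [Field F] [CharZero F] {x ξ : F} (h : IsPoint x ξ) :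
    IsRep ξ ((1 - 125 * x) * (1 - x) * (1 - 40 * x - 5 * x ^ 2) ^ 2) (ratioC x ξ * (1 - phi4 x ξ))
    (1 - 50 * x - 11725 * x ^ 2 - 129600 * x ^ 3 - 227525 * x ^ 4 + 283250 * x ^ 5 - 4375 * x ^ 6)
    (-24 + 2400 * x + 39000 * x ^ 2 - 162000 * x ^ 3 + 30600 * x ^ 4) :=
    (rep_ratioC h).mul h.sq (rep_phi h).1.one_sub (mul_ne_zero (mul_ne_zero h.ne₁ h.ne₄)
    (pow_ne_zero 2 h.ne₁₀))

theorem finrank_adjoin_ratioC_mul (h : IsCurveField (-5) 5 x ξ D) :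
    Module.finrank ℂ⟮ratioC x ξ * (1 - phi4 x ξ)⟯ K = 6 := by
  have h0 := isPoint h
  refine h.finrank_adjoin_intPoly (-5) 5 [1, -50, -11725, -129600, -227525, 283250, -4375] [-24,
    2400, 39000, -162000, 30600] [1, -206, 11795, -209940, 148375, 46850, 3125] [1, -470, -17245,
    -194700, -535025, 613250, 6125] [14974770310183595884783, 516682631815867342750641,
    5694376575863572420530230, 15465282785554778969721010, -17788082051560724133461925,
    -177657954101697032865475] [-4775274644663831902447, 323740969089952415364567,
    -6076526005360559211265694, 4307744614848454227689630, 1359173803105886018542845,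
    90641813317192363706875] 10199495665519763982336 ?_
  simp only [aeval_intPoly, List.foldr]
  push_cast
  linear_combination (rep_mul_ratioC h0).eq

theorem finrank_adjoin_ratioC_sq_mul (h : IsCurveField (-5) 5 x ξ D) :
    Module.finrank ℂ⟮ratioC x ξ * (1 - phi4 x ξ) * ratioC x ξ⟯ K = 7 := by
  have h0 := isPoint h
  have h2 : IsRep ξ (5 * (1 - 125 * x) * (1 - x) ^ 2 * (1 - 500 * x - 2490 * x ^ 2 + 2500 * x ^ 3
      + 25 * x ^ 4)) (ratioC x ξ * (1 - phi4 x ξ) * ratioC x ξ) (5 + 2169 * x + 61625 * x ^ 2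
      + 524525 * x ^ 3 + 1646975 * x ^ 4 - 506725 * x ^ 5 - 1180125 * x ^ 6 - 30625 * x ^ 7)
      (192 + 10272 * x + 252960 * x ^ 2 + 1939200 * x ^ 3 - 1584000 * x ^ 4 - 100800 * x ^ 5) :=
      (rep_mul_ratioC h0).mul h0.sq (rep_ratioC h0)
      (mul_ne_zero (mul_ne_zero (mul_ne_zero (by norm_num) h0.ne₁) (pow_ne_zero 2 h0.ne₄)) h0.ne₁₄)
  refine h.finrank_adjoin_intPoly (-5) 5 [-25, -10845, -308125, -2622625, -8234875, 2533625,
    5900625, 153125] [-960, -51360, -1264800, -9696000, 7920000, 504000] [-25, 15675, -1531525,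
    -4827625, 21999125, -23389375, 7655625, 78125] [-25, -501, 25355, 1031015, 13414325, 62397425,
    9977625, 300125] [-467006279829633681444891757427959565276411,
    -10483044237123840496115912039175978084145945, -54438436435340404355554336616908775762279185,
    630556765506320482982092906054295808877025450, 6026852575701820240970601790588848995165657675,
    977998004718937520756091782387914057596071375, 29517449991473395267738854806976750516027625]
    [-19094905600120150611622384644729691509681925, 100332015010351340487081368412228348509862025,
    714134567952583758617858310181892212143942625, -2420326744106281640320024586572817493110932250,
    2384712673691500747940161860079955473846133125, -752073966915232833102273128163332685166049375,
    -7683634420937472737333104645714481079765625] 489047796998744607326681910053941276873958400 ?_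
  simp only [aeval_intPoly, List.foldr]
  push_cast
  linear_combination (-5) * h2.eq

theorem isDarbouxCovering_C (h : IsCurveField (-5) 5 x ξ D) :
    IsDarbouxCovering (hypergeometricODE (2 / 5) (1 / 3) (3 / 5)) K (phi4 x ξ) := by
  have h0 := isPoint h
  obtain ⟨e₁, e₂⟩ := contiguousC h0 rfl rfl
  rw [e₁] at e₂
  refine h.isDarbouxCovering_of_contiguous_b (α := 13 / 30) (β := -1 / 6) (γ := 3 / 5)
    (by norm_num) (by norm_num) (by norm_num) ?_ ?_ ?_ (by norm_num) (isLogDeriv_phi h)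
    (isLogDeriv_ratioC h) (rho_mul h0) e₂ (rep_phi h0).2 (theta_ne_zero h0)
    (fun M h1 h2 => ⟨mul_mem h2 (sub_mem (one_mem M) h1), mul_mem
    (mul_mem h2 (sub_mem (one_mem M) h1)) h2⟩) ?_
  iterate 3 simp only [map_div₀, map_neg, map_one, map_ofNat]
  rw [finrank_adjoin_ratioC_mul h, finrank_adjoin_ratioC_sq_mul h]
  norm_num

end CurveField

end E4

namespace E5

section CurveField

variable {K : Type} [Field K] [Algebra ℂ K] {x ξ : K} {D : Derivation ℂ K K}

theorem isPoint (h : IsCurveField 16 17 x ξ D) : IsPoint x ξ := by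
  have hC : x * (1 + algebraMap ℂ K 17 * x + algebraMap ℂ K 16 * x ^ 2)
      = x * (1 + 17 * x + 16 * x ^ 2) := by
    simp only [map_ofNat]
  refine ⟨h.sq.trans hC, ?_,
    h.ne_zero_of_eval (1 - 4 * X) 0 ?_ (by simp),
    h.ne_zero_of_eval (1 + X) 0 ?_ (by simp),
    h.ne_zero_of_eval (1 + 4 * X) 0 ?_ (by simp),
    h.ne_zero_of_eval (1 + 16 * X) 0 ?_ (by simp),
    h.ne_zero_of_eval (1 - 28 * X + 16 * X ^ 2) 0 ?_ (by simp),
    h.ne_zero_of_eval (1 - 8 * X - 144 * X ^ 2) 0 ?_ (by simp),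
    h.ne_zero_of_eval (1 + 12 * X + 16 * X ^ 2) 0 ?_ (by simp),
    h.ne_zero_of_eval (9 + 8 * X - 16 * X ^ 2) 0 ?_ (by simp),
    h.ne_zero_of_eval (1 - 116 * X - 1104 * X ^ 2 - 1856 * X ^ 3 + 256 * X ^ 4) 0 ?_ (by simp)⟩
  · rw [← aeval_X (R := ℂ) x]
    exact h.aeval_ne_zero X_ne_zero
  all_goals
    simp only [map_add, map_sub, map_mul, map_pow, map_one, map_ofNat, map_zero, aeval_X]
    ring

variable [CharZero K]

theorem isLogDeriv_F (h : IsCurveField 16 17 x ξ D) : IsLogDeriv D (1 - 16 * x ^ 2) (dlogF x ξ) :=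
  h.isLogDeriv_quadratic 1 0 0 0 (-16) 0 (mul_dlogF (isPoint h))

theorem isLogDeriv_P (h : IsCurveField 16 17 x ξ D) : IsLogDeriv D (ξ + 5 * x) (dlogP x ξ) :=
  h.isLogDeriv_quadratic 0 1 5 0 0 0 (mul_dlogP (isPoint h))

theorem isLogDeriv_M (h : IsCurveField 16 17 x ξ D) : IsLogDeriv D (ξ - 5 * x) (dlogM x ξ) :=
  h.isLogDeriv_quadratic 0 1 (-5) 0 0 0 (mul_dlogM (isPoint h))

theorem isLogDeriv_T (h : IsCurveField 16 17 x ξ D) : IsLogDeriv D (1 - 2 * ξ - 14 * x)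
    (dlogT x ξ) := h.isLogDeriv_quadratic 1 (-2) (-14) 0 0 0 (mul_dlogT (isPoint h))

theorem isLogDeriv_S (h : IsCurveField 16 17 x ξ D) : IsLogDeriv D (1 - 2 * ξ + 6 * x)
    (dlogS x ξ) := h.isLogDeriv_quadratic 1 (-2) 6 0 0 0 (mul_dlogS (isPoint h))

theorem isLogDeriv_Q (h : IsCurveField 16 17 x ξ D) :
    IsLogDeriv D (1 + 2 / 3 * ξ + 2 / 3 * x - 16 / 3 * x ^ 2) (dlogQ x ξ) :=
  h.isLogDeriv_quadratic 1 (2 / 3) (2 / 3) 0 (-16 / 3) 0 (mul_dlogQ (isPoint h))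

theorem isLogDeriv_phi (h : IsCurveField 16 17 x ξ D) : IsLogDeriv D (phi5 x ξ) (theta x ξ) := by
  refine ((((IsLogDeriv.ofNat 54).mul ((isLogDeriv_P h).pow 3)).mul ((isLogDeriv_S h).pow 5)).div
    (((isLogDeriv_F h).mul ((isLogDeriv_M h).pow 2)).mul ((isLogDeriv_T h).pow 5))).neg.congr ?_
  rw [theta_eq (isPoint h)]
  push_cast
  ring

theorem isLogDeriv_ratioA (h : IsCurveField 16 17 x ξ D) : IsLogDeriv D (ratioA x ξ)
    (3 * dlogT x ξ + dlogQ x ξ + 2 * dlogM x ξ - 4 * dlogS x ξ - 2 * dlogP x ξ) := by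
  refine (((((isLogDeriv_T h).pow 3).mul (isLogDeriv_Q h)).mul ((isLogDeriv_M h).pow 2)).div
    (((isLogDeriv_S h).pow 4).mul ((isLogDeriv_P h).pow 2))).congr ?_
  push_cast
  ring

theorem rep_mul_ratioA {F : Type*} [Field F] [CharZero F] {x ξ : F} (h : IsPoint x ξ) :
    IsRep ξ ((1 + 4 * x) * (1 - 28 * x + 16 * x ^ 2) ^ 2) (phi5 x ξ * ratioA x ξ)
    (-414 * x - 936 * x ^ 2 + 20736 * x ^ 3 + 42624 * x ^ 4 + 9216 * x ^ 5)
    (-54 - 72 * x - 4032 * x ^ 2 - 8064 * x ^ 3) := (rep_phi h).1.mul h.sq (rep_ratioA h)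
    (mul_ne_zero h.ne₃ (pow_ne_zero 2 h.ne₅))

theorem finrank_adjoin_ratioA_mul (h : IsCurveField 16 17 x ξ D) :
    Module.finrank ℂ⟮phi5 x ξ * ratioA x ξ⟯ K = 5 := by
  have h0 := isPoint h
  refine h.finrank_adjoin_intPoly 16 17 [0, -414, -936, 20736, 42624, 9216] [-54, -72, -4032,
    -8064] [1, -52, 592, 2368, -3328, 1024] [0, -2916, -37584, -72576, 20736, 82944] [9841500,
    111936492, 208720800, -63809856, -239169024] [-137113, 1840688, 6661344, -9546688,
    2952704] 9841500 ?_
  simp only [aeval_intPoly, List.foldr]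
  push_cast
  linear_combination (rep_mul_ratioA h0).eq

theorem finrank_adjoin_ratioA_sq_mul (h : IsCurveField 16 17 x ξ D) :
    Module.finrank ℂ⟮phi5 x ξ * ratioA x ξ * ratioA x ξ - 1⟯ K = 8 := by
  have h0 := isPoint h
  have h2 : IsRep ξ ((1 + 4 * x) * (1 + 12 * x + 16 * x ^ 2) ^ 3)
      (phi5 x ξ * ratioA x ξ * ratioA x ξ) (522 * x + 13392 * x ^ 2 + 81120 * x ^ 3
      + 201600 * x ^ 4 + 184320 * x ^ 5 - 43008 * x ^ 6 - 73728 * x ^ 7)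
      (-54 - 2544 * x - 14880 * x ^ 2 - 32640 * x ^ 3 - 30720 * x ^ 4 - 6144 * x ^ 5
      + 24576 * x ^ 6) := (rep_mul_ratioA h0).mul h0.sq (rep_ratioA h0)
      (mul_ne_zero h0.ne₃ (pow_ne_zero 3 h0.ne₇))
  refine h.finrank_adjoin_intPoly 16 17 [-1, 482, 12768, 76320, 182400, 144384, -83968,
    -90112] [-54, -2544, -14880, -32640, -30720, -6144, 24576] [1, 40, 624, 4800, 19200, 39936,
    40960, 16384] [1, -3920, 38640, 254976, -257280, -1665024, -20480, 1638400,
    -589824] [1698161065, 80025926472, -1435170665184, -528322398144, 9722648968704, 2310336454656,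
    -10695900053504, 3584362217472] [38023310, 1099006128, 13364425104, 75715906176, 195019413504,
    228376866816, 99565617152] 1736184375 ?_
  simp only [aeval_intPoly, List.foldr]
  push_cast
  linear_combination h2.sub_one.eq

theorem isDarbouxCovering_A (h : IsCurveField 16 17 x ξ D) :
    IsDarbouxCovering (hypergeometricODE (1 / 5) (1 / 3) (3 / 5)) K (phi5 x ξ) := by
  have h0 := isPoint h
  obtain ⟨e₁, e₂⟩ := contiguousA h0 rfl rfl
  rw [e₁] at e₂
  refine h.isDarbouxCovering_of_contiguous_bc (α := 8 / 15) (β := -1 / 15) (γ := 4 / 5)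
    (by norm_num) (by norm_num) (by norm_num) ?_ ?_ ?_ (by norm_num) (by norm_num) (by norm_num)
    (isLogDeriv_phi h) (isLogDeriv_ratioA h) (rho_mul h0) e₂ (rep_phi h0).2 (theta_ne_zero h0)
    (fun M h1 h2 => ⟨mul_mem h1 h2, sub_mem (mul_mem (mul_mem h1 h2) h2) (one_mem M)⟩) ?_
  iterate 3 simp only [map_div₀, map_neg, map_one, map_ofNat]
  rw [finrank_adjoin_ratioA_mul h, finrank_adjoin_ratioA_sq_mul h]
  norm_num

end CurveField

end E5

namespace E6

section CurveField

variable {K : Type} [Field K] [Algebra ℂ K] {x ξ : K} {D : Derivation ℂ K K}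

theorem isPoint (h : IsCurveField (-1) 1 x ξ D) : IsPoint x ξ := by
  have hC : x * (1 + algebraMap ℂ K 1 * x + algebraMap ℂ K (-1) * x ^ 2)
      = x * (1 + x - x ^ 2) := by
    simp only [map_neg, map_one]
    ring
  refine ⟨h.sq.trans hC, ?_,
    h.ne_zero_of_eval (1 - X) 0 ?_ (by simp),
    h.ne_zero_of_eval (1 + X) 0 ?_ (by simp),
    h.ne_zero_of_eval (1 - 4 * X - X ^ 2) 0 ?_ (by simp),
    h.ne_zero_of_eval (1 + X - X ^ 2) 0 ?_ (by simp),
    h.ne_zero_of_eval (1 + X + 4 * X ^ 2) 0 ?_ (by simp),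
    h.ne_zero_of_eval (4 - X + X ^ 2) 0 ?_ (by simp)⟩
  · rw [← aeval_X (R := ℂ) x]
    exact h.aeval_ne_zero X_ne_zero
  all_goals
    simp only [map_add, map_sub, map_mul, map_pow, map_one, map_ofNat, map_zero, aeval_X]
    ring

variable [CharZero K]

theorem isLogDeriv_B (h : IsCurveField (-1) 1 x ξ D) : IsLogDeriv D (1 + ξ + 2 * x) (dlogB x ξ) :=
  h.isLogDeriv_quadratic 1 1 2 0 0 0 (mul_dlogB (isPoint h))

theorem isLogDeriv_C (h : IsCurveField (-1) 1 x ξ D) : IsLogDeriv D (1 + ξ - 2 * x) (dlogC x ξ) :=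
  h.isLogDeriv_quadratic 1 1 (-2) 0 0 0 (mul_dlogC (isPoint h))

theorem isLogDeriv_D (h : IsCurveField (-1) 1 x ξ D) : IsLogDeriv D (1 - ξ) (dlogD x ξ) :=
  h.isLogDeriv_quadratic 1 (-1) 0 0 0 0 (mul_dlogD (isPoint h))

theorem isLogDeriv_F (h : IsCurveField (-1) 1 x ξ D) : IsLogDeriv D (1 + x - x ^ 2) (dlogF x ξ) :=
  h.isLogDeriv_quadratic 1 0 1 0 (-1) 0 (mul_dlogF (isPoint h))

theorem isLogDeriv_H (h : IsCurveField (-1) 1 x ξ D) : IsLogDeriv D (1 + 1 / 2 * ξ + 1 / 2 * x)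
    (dlogH x ξ) := h.isLogDeriv_quadratic 1 (1 / 2) (1 / 2) 0 0 0 (mul_dlogH (isPoint h))

theorem isLogDeriv_I (h : IsCurveField (-1) 1 x ξ D) : IsLogDeriv D (1 - ξ + x - x ^ 2)
    (dlogI x ξ) := h.isLogDeriv_quadratic 1 (-1) 1 0 (-1) 0 (mul_dlogI (isPoint h))

theorem isLogDeriv_Xi (h : IsCurveField (-1) 1 x ξ D) : IsLogDeriv D ξ (dlogXi x ξ) :=
  h.isLogDeriv_quadratic 0 1 0 0 0 0 (mul_dlogXi (isPoint h))

theorem isLogDeriv_phi (h : IsCurveField (-1) 1 x ξ D) : IsLogDeriv D (phi6 x ξ) (theta x ξ) := by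
  refine (((((IsLogDeriv.ofNat 16).mul (isLogDeriv_Xi h)).mul ((isLogDeriv_F h).pow 2)).mul
    ((isLogDeriv_D h).pow 2)).div ((isLogDeriv_B h).mul ((isLogDeriv_C h).pow 5))).congr ?_
  rw [theta_eq (isPoint h)]
  push_cast
  ring

theorem isLogDeriv_ratioA (h : IsCurveField (-1) 1 x ξ D) : IsLogDeriv D (ratioA x ξ)
    (dlogB x ξ + 4 * dlogC x ξ - 2 * dlogD x ξ - 2 * dlogF x ξ) := by
  refine (((isLogDeriv_B h).mul ((isLogDeriv_C h).pow 4)).div (((isLogDeriv_D h).pow 2).mul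
    ((isLogDeriv_F h).pow 2))).congr ?_
  push_cast
  ring

theorem rep_mul_ratioA {F : Type*} [Field F] [CharZero F] {x ξ : F} (h : IsPoint x ξ) :
    IsRep ξ ((1 - x) * (1 - 4 * x - x ^ 2)) (phi6 x ξ * ratioA x ξ) (-16 * x - 16 * x ^ 2
    + 16 * x ^ 3) (16 - 32 * x) := (rep_phi h).1.mul h.sq (rep_ratioA h)
    (mul_ne_zero h.ne₁ h.ne₃)

theorem finrank_adjoin_ratioA_mul (h : IsCurveField (-1) 1 x ξ D) :
    Module.finrank ℂ⟮phi6 x ξ * ratioA x ξ⟯ K = 3 := by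
  have h0 := isPoint h
  refine h.finrank_adjoin_intPoly (-1) 1 [0, -16, -16, 16] [16, -32] [1, -5, 3, 1] [0, -256, -256,
    256] [1280, 1024, -1024] [-21, 12, 4] 1280 ?_
  simp only [aeval_intPoly, List.foldr]
  push_cast
  linear_combination (rep_mul_ratioA h0).eq

theorem finrank_adjoin_ratioA_sq_mul (h : IsCurveField (-1) 1 x ξ D) :
    Module.finrank ℂ⟮phi6 x ξ * ratioA x ξ * ratioA x ξ⟯ K = 8 := by
  have h0 := isPoint h
  have h2 : IsRep ξ ((1 - x) * (1 + x - x ^ 2) ^ 2) (phi6 x ξ * ratioA x ξ * ratioA x ξ)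
      (96 * x + 192 * x ^ 2 + 64 * x ^ 3 - 32 * x ^ 4 - 64 * x ^ 5) (16 + 192 * x + 64 * x ^ 2
      - 32 * x ^ 3 + 16 * x ^ 4) := (rep_mul_ratioA h0).mul h0.sq (rep_ratioA h0)
      (mul_ne_zero h0.ne₁ (pow_ne_zero 2 h0.ne₄))
  refine h.finrank_adjoin_intPoly (-1) 1 [0, 96, 288, 160, -160, -160, -32, 64] [16, 208, 240,
    -160, -80, 48, -16] [1, 2, -3, -5, 5, 3, -4, 1] [0, -256, 2816, -8448, -1280, 21760, 14592,
    3328, 256] [102400000, -174476032, 312307200, 408896256, -661009408, -554061056, -135305728,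
    -10767104] [118453, -40161, -268928, 135159, 203008, -186465, 42059] 102400000 ?_
  simp only [aeval_intPoly, List.foldr]
  push_cast
  linear_combination (1 + x - x ^ 2) * h2.eq

theorem isDarbouxCovering_A (h : IsCurveField (-1) 1 x ξ D) :
    IsDarbouxCovering (hypergeometricODE (1 / 5) (1 / 5) (4 / 5)) K (phi6 x ξ) := by
  have h0 := isPoint h
  obtain ⟨e₁, e₂⟩ := contiguousA h0 rfl rfl
  rw [e₁] at e₂
  refine h.isDarbouxCovering_of_contiguous_bc (α := 7 / 10) (β := -1 / 10) (γ := 4 / 5)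
    (by norm_num) (by norm_num) (by norm_num) ?_ ?_ ?_ (by norm_num) (by norm_num) (by norm_num)
    (isLogDeriv_phi h) (isLogDeriv_ratioA h) (rho_mul h0) e₂ (rep_phi h0).2 (theta_ne_zero h0)
    (fun M h1 h2 => ⟨mul_mem h1 h2, mul_mem (mul_mem h1 h2) h2⟩) ?_
  iterate 3 simp only [map_div₀, map_neg, map_one, map_ofNat]
  rw [finrank_adjoin_ratioA_mul h, finrank_adjoin_ratioA_sq_mul h]
  norm_num

theorem isLogDeriv_ratioC (h : IsCurveField (-1) 1 x ξ D) : IsLogDeriv D (ratioC x ξ)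
    (2 * dlogC x ξ + dlogH x ξ - dlogF x ξ - dlogI x ξ) := by
  refine ((((isLogDeriv_C h).pow 2).mul (isLogDeriv_H h)).div
    ((isLogDeriv_F h).mul (isLogDeriv_I h))).congr ?_
  push_cast
  ring

theorem finrank_adjoin_ratioC (h : IsCurveField (-1) 1 x ξ D) :
    Module.finrank ℂ⟮ratioC x ξ⟯ K = 7 := by
  have h0 := isPoint h
  refine h.finrank_adjoin_intPoly (-1) 1 [-4, -12, 0, 20, 0, -12, 4] [-14, 0, 30, -10, 0, -2] [-4,
    -12, 0, 20, 0, -12, 4] [-4, 37, -98, 55, 0, 3, 6, 1] [-2721, 4374, -3707, -304, -328, -379,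
    -60] [-404, 52, 964, -92, -644, 240] 12500 ?_
  simp only [aeval_intPoly, List.foldr]
  push_cast
  linear_combination (-2 - 2 * x + 2 * x ^ 2) * (rep_ratioC h0).eq

theorem rep_mul_ratioC {F : Type*} [Field F] [CharZero F] {x ξ : F} (h : IsPoint x ξ) :
    IsRep ξ ((1 + x) * (1 - 4 * x - x ^ 2) ^ 3) (phi6 x ξ * ratioC x ξ) (-72 * x - 56 * x ^ 2
    + 40 * x ^ 3 - 160 * x ^ 4 - 40 * x ^ 5 + 104 * x ^ 6 - 8 * x ^ 7) (16 + 80 * x + 80 * x ^ 2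
    - 80 * x ^ 3 - 80 * x ^ 4 + 48 * x ^ 5) := (rep_phi h).1.mul h.sq (rep_ratioC h)
    (mul_ne_zero h.ne₂ (pow_ne_zero 3 h.ne₃))

theorem finrank_adjoin_ratioC_sq_mul (h : IsCurveField (-1) 1 x ξ D) :
    Module.finrank ℂ⟮phi6 x ξ * ratioC x ξ * ratioC x ξ⟯ K = 6 := by
  have h0 := isPoint h
  have h2 : IsRep ξ ((1 + x) * (1 - 4 * x - x ^ 2) * (1 + x - x ^ 2))
      (phi6 x ξ * ratioC x ξ * ratioC x ξ) (-16 * x - 32 * x ^ 2 + 16 * x ^ 3 + 32 * x ^ 4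
      - 16 * x ^ 5) (16 - 28 * x + 4 * x ^ 2 + 28 * x ^ 3 - 4 * x ^ 4) :=
      (rep_mul_ratioC h0).mul h0.sq (rep_ratioC h0)
      (mul_ne_zero (mul_ne_zero h0.ne₂ h0.ne₃) h0.ne₄)
  refine h.finrank_adjoin_intPoly (-1) 1 [0, -16, -32, 16, 32, -16] [16, -28, 4, 28, -4] [1, -2,
    -9, -3, 4, 1] [0, -256, 384, -272, 176, -48, 16] [144000, -233216, 161408, -109248, 29248,
    -10192] [-2036, -5664, -1509, 2631, 637] 144000 ?_
  simp only [aeval_intPoly, List.foldr]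
  push_cast
  linear_combination h2.eq

theorem isDarbouxCovering_C (h : IsCurveField (-1) 1 x ξ D) :
    IsDarbouxCovering (hypergeometricODE (2 / 5) (2 / 5) (2 / 5)) K (phi6 x ξ) := by
  have h0 := isPoint h
  obtain ⟨e₁, e₂⟩ := contiguousC h0 rfl rfl
  rw [e₁] at e₂
  refine h.isDarbouxCovering_of_contiguous_bc (α := 3 / 10) (β := -1 / 10) (γ := 3 / 5)
    (by norm_num) (by norm_num) (by norm_num) ?_ ?_ ?_ (by norm_num) (by norm_num) (by norm_num)
    (isLogDeriv_phi h) (isLogDeriv_ratioC h) (rho_mul h0) e₂ (rep_phi h0).2 (theta_ne_zero h0)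
    (fun M h1 h2 => ⟨h2, mul_mem (mul_mem h1 h2) h2⟩) ?_
  iterate 3 simp only [map_div₀, map_neg, map_one, map_ofNat]
  rw [finrank_adjoin_ratioC h, finrank_adjoin_ratioC_sq_mul h]
  norm_num

end CurveField

end E6

theorem isElliptic_darbouxCurve {a b : ℂ} (ha : a ≠ 0) (hab : b ^ 2 - 4 * a ≠ 0) :
    (darbouxCurve a b).IsElliptic := by
  refine ⟨isUnit_iff_ne_zero.mpr ?_⟩
  have : (darbouxCurve a b).Δ = 16 * a ^ 2 * (b ^ 2 - 4 * a) := by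
    simp only [darbouxCurve, WeierstrassCurve.Δ, WeierstrassCurve.b₂, WeierstrassCurve.b₄,
      WeierstrassCurve.b₆, WeierstrassCurve.b₈]
    ring
  rw [this]
  exact mul_ne_zero (mul_ne_zero (by norm_num) (pow_ne_zero 2 ha)) hab

instance {a b : ℂ} : CharZero (DarbouxField a b) :=
  charZero_of_injective_algebraMap (algebraMap ℂ (DarbouxField a b)).injective

theorem mainTheorem3 :
    -- the curve `E₃` and its covering
    ((darbouxCurve (-9) 33).IsElliptic ∧
      coordXi (-9) 33 ^ 2
        = coordX (-9) 33 * (1 + 33 * coordX (-9) 33 - 9 * coordX (-9) 33 ^ 2) ∧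
      IsDarbouxCovering (hypergeometricODE (2 / 5) (1 / 3) (1 / 3)) (DarbouxField (-9) 33)
        (phi3 (coordX (-9) 33) (coordXi (-9) 33)) ∧
      IsDarbouxCovering (hypergeometricODE (1 / 5) (1 / 3) (2 / 3)) (DarbouxField (-9) 33)
        (phi3 (coordX (-9) 33) (coordXi (-9) 33))) ∧
    -- the curve `E₄` and its covering
    ((darbouxCurve (-5) 5).IsElliptic ∧
      coordXi (-5) 5 ^ 2
        = coordX (-5) 5 * (1 + 5 * coordX (-5) 5 - 5 * coordX (-5) 5 ^ 2) ∧
      IsDarbouxCovering (hypergeometricODE (1 / 5) (2 / 3) (1 / 5)) (DarbouxField (-5) 5)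
        (phi4 (coordX (-5) 5) (coordXi (-5) 5)) ∧
      IsDarbouxCovering (hypergeometricODE (2 / 5) (1 / 3) (3 / 5)) (DarbouxField (-5) 5)
        (phi4 (coordX (-5) 5) (coordXi (-5) 5))) ∧
    -- the curve `E₅` and its covering
    ((darbouxCurve 16 17).IsElliptic ∧
      coordXi 16 17 ^ 2
        = coordX 16 17 * (1 + coordX 16 17) * (1 + 16 * coordX 16 17) ∧
      IsDarbouxCovering (hypergeometricODE (1 / 5) (1 / 3) (3 / 5)) (DarbouxField 16 17)
        (phi5 (coordX 16 17) (coordXi 16 17))) ∧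
    -- the curve `E₆` and its covering
    ((darbouxCurve (-1) 1).IsElliptic ∧
      coordXi (-1) 1 ^ 2
        = coordX (-1) 1 * (1 + coordX (-1) 1 - coordX (-1) 1 ^ 2) ∧
      IsDarbouxCovering (hypergeometricODE (1 / 5) (1 / 5) (4 / 5)) (DarbouxField (-1) 1)
        (phi6 (coordX (-1) 1) (coordXi (-1) 1)) ∧
      IsDarbouxCovering (hypergeometricODE (2 / 5) (2 / 5) (2 / 5)) (DarbouxField (-1) 1)
        (phi6 (coordX (-1) 1) (coordXi (-1) 1))) ∧
    -- type `(1/3, 1/3, 2/5)`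
    NearOrigin (fun x => x * (1 + 33 * x - 9 * x ^ 2)) (fun x ξ =>
      ₂F₁ (3 / 10 : ℂ) (-1 / 30) (3 / 5) (phi3 x ξ)
        = (1 - 9 * ξ + 54 * x) ^ (1 / 30 : ℂ)
          / (1 + 21 * ξ - 117 * x + 9 * x * ξ - 234 * x ^ 2) ^ (1 / 10 : ℂ) ∧
      ₂F₁ (3 / 10 : ℂ) (29 / 30) (3 / 5) (phi3 x ξ)
        = (1 + 21 * ξ - 117 * x + 9 * x * ξ - 234 * x ^ 2) ^ (9 / 10 : ℂ)
            * (1 + 9 * x) ^ 2 * (1 + 198 * x - 99 * x ^ 2)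
          / ((1 - 9 * ξ + 54 * x) ^ (29 / 30 : ℂ)
            * (1 - 21 * ξ - 117 * x - 9 * x * ξ - 234 * x ^ 2) ^ 2) ∧
      ₂F₁ (7 / 10 : ℂ) (11 / 30) (7 / 5) (phi3 x ξ)
        = (1 + 21 * ξ - 117 * x + 9 * x * ξ - 234 * x ^ 2) ^ (11 / 10 : ℂ)
          / ((1 - 9 * ξ + 54 * x) ^ (11 / 30 : ℂ) * (1 + 33 * x - 9 * x ^ 2)) ∧
      ₂F₁ (-3 / 10 : ℂ) (11 / 30) (2 / 5) (phi3 x ξ)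
        = (1 - 9 * ξ + 54 * x) ^ (19 / 30 : ℂ) * (1 - 15 * ξ - 72 * x - 54 * x ^ 2)
          / ((1 + 21 * ξ - 117 * x + 9 * x * ξ - 234 * x ^ 2) ^ (9 / 10 : ℂ)
            * (1 + 9 * x))) ∧
    -- type `(1/3, 2/3, 1/5)`
    NearOrigin (fun x => x * (1 + 33 * x - 9 * x ^ 2)) (fun x ξ =>
      ₂F₁ (-1 / 10 : ℂ) (17 / 30) (4 / 5) (phi3 x ξ)
        = (1 - 9 * ξ + 54 * x) ^ (13 / 30 : ℂ)
          / (1 + 21 * ξ - 117 * x + 9 * x * ξ - 234 * x ^ 2) ^ (3 / 10 : ℂ) ∧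
      ₂F₁ (9 / 10 : ℂ) (17 / 30) (9 / 5) (phi3 x ξ)
        = (1 + 21 * ξ - 117 * x + 9 * x * ξ - 234 * x ^ 2) ^ (17 / 10 : ℂ)
            * (1 + 3 / 7 * x)
          / ((1 - 9 * ξ + 54 * x) ^ (17 / 30 : ℂ) * (1 + 33 * x - 9 * x ^ 2) ^ 2) ∧
      ₂F₁ (1 / 10 : ℂ) (23 / 30) (6 / 5) (phi3 x ξ)
        = (1 + 21 * ξ - 117 * x + 9 * x * ξ - 234 * x ^ 2) ^ (3 / 10 : ℂ)
            * (1 - 9 * ξ + 54 * x) ^ (7 / 30 : ℂ) * (ξ + 5 * x)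
          / (ξ * (1 + 9 * x)) ∧
      ₂F₁ (1 / 10 : ℂ) (-7 / 30) (1 / 5) (phi3 x ξ)
        = (1 - 9 * ξ + 54 * x) ^ (7 / 30 : ℂ) * (1 - 21 * x)
          / (1 + 21 * ξ - 117 * x + 9 * x * ξ - 234 * x ^ 2) ^ (7 / 10 : ℂ)) ∧
    -- type `(2/3, 1/5, 1/5)`
    NearOrigin (fun x => x * (1 + 5 * x - 5 * x ^ 2)) (fun x ξ =>
      ₂F₁ (1 / 6 : ℂ) (-1 / 30) (4 / 5) (phi4 x ξ)
        = (1 - 3 / 5 * ξ - 34 / 5 * x) ^ (1 / 6 : ℂ)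
          / ((1 + 3 * ξ - 20 * x) ^ (1 / 6 : ℂ)
            * (1 + 50 * x - 125 * ξ ^ 2 - 450 * x * ξ - 500 * x ^ 2) ^ (1 / 30 : ℂ)) ∧
      ₂F₁ (1 / 6 : ℂ) (29 / 30) (4 / 5) (phi4 x ξ)
        = (1 + 3 * ξ - 20 * x) ^ (5 / 6 : ℂ) * (1 - 3 / 5 * ξ - 34 / 5 * x) ^ (1 / 6 : ℂ)
            * (1 - 35 / 4 * ξ - 101 / 4 * x)
          / ((1 + 50 * x - 125 * ξ ^ 2 - 450 * x * ξ - 500 * x ^ 2) ^ (1 / 30 : ℂ)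
            * (1 - 95 / 4 * ξ + 83 / 4 * x + 21 / 4 * ξ ^ 2 + 475 / 4 * x * ξ
              + 10 * x ^ 2)) ∧
      ₂F₁ (1 / 6 : ℂ) (11 / 30) (6 / 5) (phi4 x ξ)
        = (1 + 50 * x - 125 * ξ ^ 2 - 450 * x * ξ - 500 * x ^ 2) ^ (11 / 30 : ℂ)
            * ((1 + 3 * ξ - 20 * x) ^ (5 / 6 : ℂ)
              * (1 - 3 / 5 * ξ - 34 / 5 * x) ^ (1 / 6 : ℂ)
              * (1 + 21 / 4 * ξ + 41 / 4 * x))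
          / ((1 - 9 * x) * (1 - 7 / 4 * ξ - 15 / 2 * x) * (1 + 5 * ξ + 10 * x)) ∧
      ₂F₁ (1 / 6 : ℂ) (11 / 30) (1 / 5) (phi4 x ξ)
        = (1 + 50 * x - 125 * ξ ^ 2 - 450 * x * ξ - 500 * x ^ 2) ^ (11 / 30 : ℂ)
            * ((1 + 3 * ξ - 20 * x) ^ (5 / 6 : ℂ)
              * (1 - 3 / 5 * ξ - 34 / 5 * x) ^ (1 / 6 : ℂ)
              * (1 + 21 / 4 * ξ + 41 / 4 * x))
          / ((1 - 95 / 4 * ξ + 83 / 4 * x + 21 / 4 * ξ ^ 2 + 475 / 4 * x * ξ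
              + 10 * x ^ 2) * (1 + 5 * ξ + 10 * x))) ∧
    -- type `(1/3, 2/5, 3/5)`
    NearOrigin (fun x => x * (1 + 5 * x - 5 * x ^ 2)) (fun x ξ =>
      ₂F₁ (-1 / 6 : ℂ) (13 / 30) (3 / 5) (phi4 x ξ)
        = (1 + 50 * x - 125 * ξ ^ 2 - 450 * x * ξ - 500 * x ^ 2) ^ (13 / 30 : ℂ)
            * (1 - 3 * ξ + 2 * x)
          / ((1 + 3 * ξ - 20 * x) ^ (5 / 6 : ℂ)
            * (1 - 3 / 5 * ξ - 34 / 5 * x) ^ (1 / 6 : ℂ) * (1 + 5 * ξ + 10 * x)) ∧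
      ₂F₁ (5 / 6 : ℂ) (13 / 30) (3 / 5) (phi4 x ξ)
        = (1 + 50 * x - 125 * ξ ^ 2 - 450 * x * ξ - 500 * x ^ 2) ^ (13 / 30 : ℂ)
            * ((1 + 3 * ξ - 20 * x) ^ (13 / 6 : ℂ)
              * (1 - 7 / 4 * ξ + 25 / 2 * x - 245 / 4 * x ^ 2)
              * (1 - 7 / 20 * ξ - 79 / 20 * x))
          / ((1 - 3 / 5 * ξ - 34 / 5 * x) ^ (1 / 6 : ℂ)
            * (1 - 95 / 4 * ξ + 83 / 4 * x + 21 / 4 * ξ ^ 2 + 475 / 4 * x * ξ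
              + 10 * x ^ 2) ^ 2 * (1 - 5 * x) ^ 2) ∧
      ₂F₁ (5 / 6 : ℂ) (7 / 30) (7 / 5) (phi4 x ξ)
        = (1 + 50 * x - 125 * ξ ^ 2 - 450 * x * ξ - 500 * x ^ 2) ^ (7 / 30 : ℂ)
            * ((1 + 18 / 5 * ξ - 16 * x + x ^ 2) ^ (7 / 6 : ℂ)
              * (1 + 1 / 25 * x) ^ (5 / 6 : ℂ) * (1 + 5 * ξ + 10 * x))
          / ((1 - 7 / 5 * ξ - 9 * x - x ^ 2) ^ 2 * (1 - 5 * x) ^ (7 / 6 : ℂ)) ∧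
      ₂F₁ (-1 / 6 : ℂ) (7 / 30) (2 / 5) (phi4 x ξ)
        = (1 + 50 * x - 125 * ξ ^ 2 - 450 * x * ξ - 500 * x ^ 2) ^ (7 / 30 : ℂ)
            * (1 - 27 / 5 * ξ + 58 / 5 * x - 2 * x ^ 2)
          / ((1 + 18 / 5 * ξ - 16 * x + x ^ 2) ^ (5 / 6 : ℂ)
            * (1 + 1 / 25 * x) ^ (1 / 6 : ℂ) * (1 - 5 * x) ^ (7 / 6 : ℂ))) ∧
    -- type `(1/3, 1/5, 3/5)`, principal powers, on the half `0 < Re ξ` of the neighbourhood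
    NearOrigin (fun x => x * (1 + x) * (1 + 16 * x)) (fun x ξ => 0 < ξ.re →
      ₂F₁ (-1 / 15 : ℂ) (8 / 15) (4 / 5) (phi5 x ξ)
        = (1 + 4 * x) ^ (8 / 15 : ℂ) * (ξ + 5 * x) ^ (1 / 6 : ℂ) * x ^ (1 / 15 : ℂ)
          / ((1 - 2 * ξ - 14 * x) ^ (1 / 3 : ℂ) * (ξ - 3 * x) ^ (3 / 10 : ℂ)) ∧
      ₂F₁ (14 / 15 : ℂ) (8 / 15) (9 / 5) (phi5 x ξ)
        = (1 - 2 * ξ - 14 * x) ^ (8 / 3 : ℂ)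
            * (1 + 2 / 3 * ξ + 2 / 3 * x - 16 / 3 * x ^ 2) * (1 + 4 * x) ^ (8 / 15 : ℂ)
            * (ξ - 5 * x) ^ 2 * x ^ (1 / 15 : ℂ)
          / ((1 - 2 * ξ + 6 * x) ^ 4 * (ξ + 5 * x) ^ (11 / 6 : ℂ)
            * (ξ - 3 * x) ^ (3 / 10 : ℂ)) ∧
      ₂F₁ (2 / 15 : ℂ) (11 / 15) (6 / 5) (phi5 x ξ)
        = (1 - ξ + x) * (1 - 2 * ξ - 14 * x) ^ (2 / 3 : ℂ) * (ξ + 5 * x) ^ (1 / 6 : ℂ)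
            * (ξ - 3 * x) ^ (13 / 10 : ℂ)
          / ((1 + ξ + x) * (1 - 2 * ξ + 6 * x) * (1 + 4 * x) ^ (13 / 15 : ℂ)
            * x ^ (11 / 15 : ℂ)) ∧
      ₂F₁ (2 / 15 : ℂ) (-4 / 15) (1 / 5) (phi5 x ξ)
        = (1 + 3 * ξ + x) * (1 + 4 * x) ^ (2 / 15 : ℂ) * (ξ + 5 * x) ^ (7 / 6 : ℂ)
            * (ξ - 3 * x) ^ (3 / 10 : ℂ)
          / ((1 + ξ + x) * (1 - 2 * ξ - 14 * x) ^ (4 / 3 : ℂ) * x ^ (11 / 15 : ℂ))) ∧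
    -- type `(1/3, 1/5, 3/5)`, on the full neighbourhood; the powers of `ξ` that are divided out
    -- of the factors vanishing at the origin have total exponent zero
    NearOrigin (fun x => x * (1 + x) * (1 + 16 * x)) (fun x ξ =>
      ₂F₁ (-1 / 15 : ℂ) (8 / 15) (4 / 5) (phi5 x ξ)
        = (1 + 4 * x) ^ (8 / 15 : ℂ) * ((ξ + 5 * x) / ξ) ^ (1 / 6 : ℂ)
            * (x / ξ ^ 2) ^ (1 / 15 : ℂ)
          / ((1 - 2 * ξ - 14 * x) ^ (1 / 3 : ℂ) * ((ξ - 3 * x) / ξ) ^ (3 / 10 : ℂ)) ∧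
      ₂F₁ (14 / 15 : ℂ) (8 / 15) (9 / 5) (phi5 x ξ)
        = (1 - 2 * ξ - 14 * x) ^ (8 / 3 : ℂ)
            * (1 + 2 / 3 * ξ + 2 / 3 * x - 16 / 3 * x ^ 2) * (1 + 4 * x) ^ (8 / 15 : ℂ)
            * ((ξ - 5 * x) / ξ) ^ 2 * (x / ξ ^ 2) ^ (1 / 15 : ℂ)
          / ((1 - 2 * ξ + 6 * x) ^ 4 * ((ξ + 5 * x) / ξ) ^ (11 / 6 : ℂ)
            * ((ξ - 3 * x) / ξ) ^ (3 / 10 : ℂ)) ∧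
      ₂F₁ (2 / 15 : ℂ) (11 / 15) (6 / 5) (phi5 x ξ)
        = (1 - ξ + x) * (1 - 2 * ξ - 14 * x) ^ (2 / 3 : ℂ)
            * ((ξ + 5 * x) / ξ) ^ (1 / 6 : ℂ) * ((ξ - 3 * x) / ξ) ^ (13 / 10 : ℂ)
          / ((1 + ξ + x) * (1 - 2 * ξ + 6 * x) * (1 + 4 * x) ^ (13 / 15 : ℂ)
            * (x / ξ ^ 2) ^ (11 / 15 : ℂ)) ∧
      ₂F₁ (2 / 15 : ℂ) (-4 / 15) (1 / 5) (phi5 x ξ)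
        = (1 + 3 * ξ + x) * (1 + 4 * x) ^ (2 / 15 : ℂ) * ((ξ + 5 * x) / ξ) ^ (7 / 6 : ℂ)
            * ((ξ - 3 * x) / ξ) ^ (3 / 10 : ℂ)
          / ((1 + ξ + x) * (1 - 2 * ξ - 14 * x) ^ (4 / 3 : ℂ)
            * (x / ξ ^ 2) ^ (11 / 15 : ℂ))) ∧
    -- type `(1/5, 1/5, 4/5)`
    NearOrigin (fun x => x * (1 + x - x ^ 2)) (fun x ξ =>
      ₂F₁ (7 / 10 : ℂ) (-1 / 10) (4 / 5) (phi6 x ξ)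
        = (1 - ξ + 2 * x) ^ (1 / 15 : ℂ) * (1 - ξ) ^ (3 / 5 : ℂ)
          / ((1 + ξ + 2 * x) ^ (7 / 30 : ℂ) * (1 + ξ - 2 * x) ^ (1 / 2 : ℂ)) ∧
      ₂F₁ (7 / 10 : ℂ) (9 / 10) (9 / 5) (phi6 x ξ)
        = (1 - ξ + 2 * x) ^ (1 / 15 : ℂ) * (1 + ξ + 2 * x) ^ (23 / 30 : ℂ)
            * (1 + ξ - 2 * x) ^ (7 / 2 : ℂ)
          / ((1 - ξ) ^ (7 / 5 : ℂ) * (1 + x - x ^ 2) ^ 2) ∧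
      ₂F₁ (1 / 10 : ℂ) (9 / 10) (6 / 5) (phi6 x ξ)
        = (ξ + 2 * x + x ^ 2) * (1 + ξ) ^ (1 / 10 : ℂ) * (1 - ξ) ^ (3 / 10 : ℂ)
          / (ξ * (1 - ξ + 2 * x) ^ (1 / 30 : ℂ) * (1 + ξ + 2 * x) ^ (2 / 15 : ℂ)
            * (1 + ξ - 2 * x) ^ (1 / 2 : ℂ)) ∧
      ₂F₁ (1 / 10 : ℂ) (-1 / 10) (1 / 5) (phi6 x ξ)
        = (1 + ξ) ^ (1 / 10 : ℂ) * (1 - ξ) ^ (3 / 10 : ℂ)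
          / ((1 - ξ + 2 * x) ^ (1 / 30 : ℂ) * (1 + ξ + 2 * x) ^ (2 / 15 : ℂ)
            * (1 + ξ - 2 * x) ^ (1 / 2 : ℂ))) ∧
    -- type `(2/5, 2/5, 2/5)`
    NearOrigin (fun x => x * (1 + x - x ^ 2)) (fun x ξ =>
      ₂F₁ (3 / 10 : ℂ) (-1 / 10) (3 / 5) (phi6 x ξ)
        = (1 - ξ + 2 * x) ^ (2 / 15 : ℂ) * (1 + ξ + 2 * x) ^ (1 / 30 : ℂ)
            * (1 - ξ) ^ (1 / 5 : ℂ)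
          / (1 + ξ - 2 * x) ^ (1 / 2 : ℂ) ∧
      ₂F₁ (3 / 10 : ℂ) (9 / 10) (8 / 5) (phi6 x ξ)
        = (1 - ξ + 2 * x) ^ (2 / 15 : ℂ) * (1 + ξ + 2 * x) ^ (1 / 30 : ℂ)
            * (1 - ξ) ^ (1 / 5 : ℂ) * (1 + ξ - 2 * x) ^ (3 / 2 : ℂ)
            * (1 + 1 / 2 * ξ + 1 / 2 * x)
          / ((1 + x - x ^ 2) * (1 - ξ + x - x ^ 2)) ∧
      ₂F₁ (3 / 10 : ℂ) (7 / 10) (7 / 5) (phi6 x ξ)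
        = (1 + ξ + 2 * x) ^ (7 / 30 : ℂ) * (1 + ξ) ^ (1 / 5 : ℂ)
            * (1 + ξ - 2 * x) ^ (3 / 2 : ℂ)
          / ((1 - ξ + 2 * x) ^ (1 / 15 : ℂ) * (1 - ξ) ^ (2 / 5 : ℂ)
            * (1 + x - x ^ 2)) ∧
      ₂F₁ (3 / 10 : ℂ) (-3 / 10) (2 / 5) (phi6 x ξ)
        = (1 + ξ + 2 * x) ^ (7 / 30 : ℂ) * (1 + ξ) ^ (1 / 5 : ℂ)
            * (1 - 3 * ξ + 4 * x - 2 * x ^ 2)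
          / ((1 - ξ + 2 * x) ^ (1 / 15 : ℂ) * (1 - ξ) ^ (2 / 5 : ℂ)
            * (1 + ξ - 2 * x) ^ (3 / 2 : ℂ))) := by
  obtain ⟨D₃, h₃⟩ := exists_isCurveField (-9) 33 (by norm_num)
  obtain ⟨D₄, h₄⟩ := exists_isCurveField (-5) 5 (by norm_num)
  obtain ⟨D₅, h₅⟩ := exists_isCurveField 16 17 (by norm_num)
  obtain ⟨D₆, h₆⟩ := exists_isCurveField (-1) 1 (by norm_num)
  refine ⟨⟨?_, ?_, E3.isDarbouxCovering_A h₃, E3.isDarbouxCovering_C h₃⟩,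
    ⟨?_, ?_, E4.isDarbouxCovering_A h₄, E4.isDarbouxCovering_C h₄⟩,
    ⟨?_, ?_, E5.isDarbouxCovering_A h₅⟩,
    ⟨?_, ?_, E6.isDarbouxCovering_A h₆, E6.isDarbouxCovering_C h₆⟩,
    E3.nearOrigin_typeA, E3.nearOrigin_typeB, E4.nearOrigin_typeA, E4.nearOrigin_typeB,
    E5.nearOrigin_typeA_of_re_pos, E5.nearOrigin_typeA, E6.nearOrigin_typeA, E6.nearOrigin_typeB⟩
  · exact isElliptic_darbouxCurve (by norm_num) (by norm_num)
  · exact (E3.isPoint h₃).sq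
  · exact isElliptic_darbouxCurve (by norm_num) (by norm_num)
  · exact (E4.isPoint h₄).sq
  · exact isElliptic_darbouxCurve (by norm_num) (by norm_num)
  · rw [(E5.isPoint h₅).sq]
    ring
  · exact isElliptic_darbouxCurve (by norm_num) (by norm_num)
  · exact (E6.isPoint h₆).sq
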